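/- Let $T>0$, $n\ge 1$, $\mathbb T=\mathbb R/T\mathbb Z$, $\mathbb R^n_+=\{x=(x',x_n)\in\mathbb R^n : x_n>0\}$. The Fourier transform on $\mathbb T\times\mathbb R^n$ has frequencies $(\tau,\xi)\in\frac{2\pi}{T}\mathbb Z\times\mathbb R^n$ (characters $e^{\mathrm i\tau t+\mathrm i\xi\cdot x}$), and $\mathsf{op}[m]=\mathcal F^{-1}m\mathcal F$. For $N\in\{n-1,n\}$ let $L^2_\perp(\mathbb T\times\mathbb R^N)$ be the space of $f\in L^2$ with $\int_{\mathbb T}f(t,x)\,dt=0$ for a.e. $x$. For $s,r\ge 0$ let $H^{(s,r)}_\perp(\mathbb T\times\mathbb R^N)$ be the space of $f\in L^2_\perp(\mathbb T\times\mathbb R^N)$ with $(1+\tau^2)^{s/2}(1+|\xi|^2)^{r/2}\mathcal Ff\in L^2$. Let $L^2_\perp(\mathbb T\times\mathbb R^n_+)$ and $\overline H^{(s,r)}_\perp(\mathbb T\times\mathbb R^n_+)$ be the spaces of restrictions to $\mathbb T\times\mathbb R^n_+$ of elements of $L^2_\perp(\mathbb T\times\mathbb R^n)$ and $H^{(s,r)}_\perp(\mathbb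 T\times\mathbb R^n)$, respectively. Put $$\mathbb E=\overline H^{(1,2)}_\perp(\mathbb T\times\mathbb R^n_+)\cap\overline H^{(0,4)}_\perp(\mathbb T\times\mathbb R^n_+),\qquad \mathbb G=H^{(3/4,0)}_\perp(\mathbb T\times\mathbb R^{n-1})\cap H^{(0,3/2)}_\perp(\mathbb T\times\mathbb R^{n-1}).$$ For $\tau\in\mathbb R\setminus\{0\}$ and $\xi'\in\mathbb R^{n-1}$ let $D(\tau,\xi',z)=\mathrm i\tau+(|\xi'|^2+z^2)(\mathrm i\tau+|\xi'|^2+z^2)$, and let $D^{\pm}(\tau,\xi',z)=\prod(z-\rho)$, the product over the roots $\rho$ of $D(\tau,\xi',\cdot)$, with multiplicity, with $\pm\operatorname{Im}\rho>0$. For $f\in L^2_\perp(\mathbb T\times\mathbb R^n_+)$ let $\mathsf{op}[D^-]^{-1}_+f$ be the restriction to $\mathbb T\times\mathbb R^n_+$ of $\mathsf{op}[1/D^-]F$, where $F\in L^2_\perp(\mathbb T\times\mathbb R^n)$ is any extension of $f$. **Theorem.** (i) Let $f\in L^2_\perp(\mathbb T\times\mathbb R^n_+)$. Then $\mathsf{op}[D^-]^{-1}_+f\in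 L^2(\mathbb T\times\mathbb R^n_+)$ is well defined, independently of the extension $F$, and has a unique trace $(\mathsf{op}[D^-]^{-1}_+f)|_{x_n=0}\in L^2(\mathbb T\times\mathbb R^{n-1})$. The Dirichlet problem $$\begin{cases}\partial_tu-\Delta(\partial_t-\Delta)u=f&\text{in }\mathbb T\times\mathbb R^n_+,\\ u|_{x_n=0}=0&\text{on }\mathbb T\times\mathbb R^{n-1},\\ \partial_nu|_{x_n=0}=0&\text{on }\mathbb T\times\mathbb R^{n-1}\end{cases}$$ (the equation in the sense of distributions) has a solution $u\in\mathbb E$ if and only if $(\mathsf{op}[D^-]^{-1}_+f)|_{x_n=0}\in\mathbb G$. (ii) There is $f\in L^2_\perp(\mathbb T\times\mathbb R^n_+)$ for which the Dirichlet problem has no solution in $\mathbb E$. (iii) The Dirichlet boundary operators nevertheless satisfy the Lopatinskiĭ–Shapiro conditions for $D$: for all $\tau\ne 0$ and $\xi'\in\mathbb R^{n-1}$ the polynomials $1$ and $\mathrm iz$ are linearly independent modulo $D^+(\tau,\xi',z)$. So these conditions are not sufficient for solvability in $\mathbb E$. Here $g\in L^2(\mathbb T\times\mathbb R^{n-1})$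 is the trace of $v\in L^2(\mathbb T\times\mathbb R^n_+)$ if $\frac1\varepsilon\int_0^\varepsilon\|v(\cdot,\cdot,s)-g\|^2_{L^2(\mathbb T\times\mathbb R^{n-1})}\,ds\to 0$ as $\varepsilon\to0^+$. -/

import Mathlib

open MeasureTheory Filter Topology Polynomial
open scoped ContDiff FourierTransform

noncomputable section

namespace CHG

/-! ### The space-time domains

`Space n` is Euclidean `ℝⁿ`, and `Cyl T n` is `𝕋 × ℝⁿ` with `𝕋 = ℝ / Tℤ`. The dimension of the half
space problem is `n = d + 1`, with coordinates `x = (x', xₙ)`, `x' ∈ ℝ^d`, `xₙ = x (Fin.last d)`. -/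

abbrev Space (n : ℕ) : Type := EuclideanSpace ℝ (Fin n)

abbrev Cyl (T : ℝ) (n : ℕ) : Type := AddCircle T × Space n

/-- The tangential part `x'` of `x = (x', xₙ)`. -/
def tang {d : ℕ} (x : Space (d + 1)) : Space d := WithLp.toLp 2 fun j => x j.castSucc

/-- The point `(x', xₙ)`. -/
def glue {d : ℕ} (x' : Space d) (s : ℝ) : Space (d + 1) :=
  WithLp.toLp 2 (Fin.snoc (α := fun _ => ℝ) (fun j => x' j) s)

/-- The half cylinder `𝕋 × ℝⁿ₊`. -/
def Gplus (T : ℝ) (d : ℕ) : Set (Cyl T (d + 1)) := {p | 0 < p.2 (Fin.last d)}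

section Spaces

variable (T : ℝ) [hT : Fact (0 < T)]

/-- `L²(𝕋 × ℝⁿ)`. -/
abbrev L2 (n : ℕ) : Type := Lp ℂ 2 (volume : Measure (Cyl T n))

/-- `L²(𝕋 × ℝⁿ₊)`. -/
abbrev L2plus (d : ℕ) : Type :=
  Lp ℂ 2 ((volume : Measure (Cyl T (d + 1))).restrict (Gplus T d))

end Spaces

variable {T : ℝ} [hT : Fact (0 < T)]

/-- The restriction operator `r⁺ : L²(𝕋 × ℝⁿ) → L²(𝕋 × ℝⁿ₊)`. -/
def restr {d : ℕ} (F : L2 T (d + 1)) : L2plus T d :=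
  LpToLpRestrictCLM (Cyl T (d + 1)) ℂ ℂ (volume : Measure (Cyl T (d + 1))) 2 (Gplus T d) F

/-- The restricted space `r⁺ X` on the half cylinder. -/
def bar {d : ℕ} (X : Set (L2 T (d + 1))) : Set (L2plus T d) := restr '' X

/-! ### The Fourier transform on `𝕋 × ℝⁿ` -/

/-- The `k`-th Fourier coefficient in time, as a function of the space variable. -/
def timeCoeff {n : ℕ} (f : L2 T n) (k : ℤ) (x : Space n) : ℂ :=
  fourierCoeff (fun t : AddCircle T => f (t, x)) k

theorem memLp_timeCoeff {n : ℕ} (f : L2 T n) (k : ℤ) :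
    MemLp (timeCoeff f k) 2 (volume : Measure (Space n)) := by
  have hsm : StronglyMeasurable (f : Cyl T n → ℂ) := Lp.stronglyMeasurable f
  have hm : StronglyMeasurable (timeCoeff f k) := by
    have : StronglyMeasurable (fun p : Space n × AddCircle T =>
        (fourier (-k) p.2 : ℂ) • (f : Cyl T n → ℂ) (p.2, p.1)) := by
      have h1 : StronglyMeasurable fun p : Space n × AddCircle T => (fourier (-k) p.2 : ℂ) :=
        ((map_continuous (fourier (T := T) (-k))).comp continuous_snd).stronglyMeasurable
      have h2 : StronglyMeasurable fun p : Space n × AddCircle T =>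
          (f : Cyl T n → ℂ) (p.2, p.1) := hsm.comp_measurable measurable_swap
      exact h1.mul h2
    exact this.integral_prod_right
  have hb : ∀ x, ‖timeCoeff f k x‖ₑ ^ (2 : ℝ) ≤
      ∫⁻ t, ‖(f : Cyl T n → ℂ) (t, x)‖ₑ ^ (2 : ℝ) ∂(AddCircle.haarAddCircle (T := T)) := by
    intro x
    have hx : AEStronglyMeasurable (fun t : AddCircle T => (f : Cyl T n → ℂ) (t, x))
        AddCircle.haarAddCircle :=
      (hsm.comp_measurable measurable_prodMk_right).aestronglyMeasurable
    have h1 : ‖timeCoeff f k x‖ₑ ≤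
        eLpNorm (fun t : AddCircle T => (f : Cyl T n → ℂ) (t, x)) 1 AddCircle.haarAddCircle := by
      rw [eLpNorm_one_eq_lintegral_enorm]
      refine (enorm_integral_le_lintegral_enorm _).trans (le_of_eq ?_)
      refine lintegral_congr fun t => ?_
      rw [enorm_smul]
      have : ‖(fourier (-k) t : ℂ)‖ₑ = 1 := by
        rw [← ofReal_norm, fourier_apply, Circle.norm_coe, ENNReal.ofReal_one]
      rw [this, one_mul]
    have h2 := h1.trans (eLpNorm_le_eLpNorm_of_exponent_le (p := 1) (q := 2) (by norm_num) hx)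
    have h3 := ENNReal.rpow_le_rpow h2 (by norm_num : (0 : ℝ) ≤ 2)
    refine h3.trans (le_of_eq ?_)
    rw [eLpNorm_eq_lintegral_rpow_enorm_toReal (by norm_num) (by norm_num), ← ENNReal.rpow_mul]
    norm_num
  refine ⟨hm.aestronglyMeasurable, ?_⟩
  rw [eLpNorm_lt_top_iff_lintegral_rpow_enorm_lt_top (by norm_num) (by norm_num)]
  have hf := Lp.memLp f
  have hf2 := (eLpNorm_lt_top_iff_lintegral_rpow_enorm_lt_top (by norm_num) (by norm_num)).1 hf.2
  have hmeas : Measurable fun p : Cyl T n => ‖(f : Cyl T n → ℂ) p‖ₑ ^ (2 : ℝ) :=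
    hsm.measurable.enorm.pow_const _
  have hf2' : ∫⁻ x : Space n, ∫⁻ t : AddCircle T, ‖(f : Cyl T n → ℂ) (t, x)‖ₑ ^ (2 : ℝ) < ⊤ :=
    (lintegral_prod_symm (μ := (volume : Measure (AddCircle T)))
      (ν := (volume : Measure (Space n))) _ hmeas.aemeasurable).symm.trans_lt hf2
  simp only [AddCircle.volume_eq_smul_haarAddCircle, lintegral_smul_measure, smul_eq_mul,
    ENNReal.toReal_ofNat] at hf2' ⊢
  have hT0 : ENNReal.ofReal T ≠ 0 := by simpa using hT.out
  refine (lintegral_mono hb).trans_lt ?_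
  by_contra hcon
  rw [not_lt, top_le_iff] at hcon
  rw [lintegral_const_mul' _ _ ENNReal.ofReal_ne_top, hcon, ENNReal.mul_top hT0] at hf2'
  exact lt_irrefl _ hf2'

/-- The Fourier transform on `𝕋 × ℝⁿ`. The pair `(k, η) ∈ ℤ × ℝⁿ` stands for the angular
frequency `(2πk/T, 2πη)`, so that it belongs to the character `e^{i(2πk/T)t + i(2πη)·x}`. -/
def fourierG {n : ℕ} (f : L2 T n) (k : ℤ) : Lp ℂ 2 (volume : Measure (Space n)) :=
  𝓕 ((memLp_timeCoeff f k).toLp (timeCoeff f k))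

/-- The time frequency `2πk/T`. -/
def tfreq (T : ℝ) (k : ℤ) : ℝ := 2 * Real.pi * k / T

/-- The space frequency `2πη`. -/
def xfreq {n : ℕ} (η : Space n) : Space n := (2 * Real.pi) • η

/-- `V = op[m] F` for the Fourier multiplier operator with symbol `m(τ, ξ)`. -/
def IsOp {n : ℕ} (m : ℝ → Space n → ℂ) (F V : L2 T n) : Prop :=
  ∀ k : ℤ, ∀ᵐ η : Space n, fourierG V k η = m (tfreq T k) (xfreq η) * fourierG F k η

/-! ### Purely oscillatory spaces -/

/-- `L²_⊥`: vanishing mean in time. -/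
def L2perp (T : ℝ) [hT : Fact (0 < T)] (n : ℕ) : Set (L2 T n) :=
  {f | ∀ᵐ x : Space n, ∫ t : AddCircle T, f (t, x) = 0}

/-- The weight `⟨τ⟩^s ⟨ξ⟩^r` of dominating mixed smoothness. -/
def weight {n : ℕ} (s r : ℝ) (τ : ℝ) (ξ : Space n) : ℝ :=
  (1 + τ ^ 2) ^ (s / 2) * (1 + ‖ξ‖ ^ 2) ^ (r / 2)

/-- `H^{(s,r)}_⊥(𝕋 × ℝⁿ)`, for `s, r ≥ 0`. -/
def Hperp (T : ℝ) [hT : Fact (0 < T)] (n : ℕ) (s r : ℝ) : Set (L2 T n) :=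
  {f | f ∈ L2perp T n ∧
    ∑' k : ℤ, ∫⁻ η : Space n,
      (‖weight s r (tfreq T k) (xfreq η)‖ₑ * ‖fourierG f k η‖ₑ) ^ 2 < ⊤}

/-- `L²_⊥(𝕋 × ℝⁿ₊)`. -/
def L2perpPlus (T : ℝ) [hT : Fact (0 < T)] (d : ℕ) : Set (L2plus T d) := bar (L2perp T (d + 1))

/-- The solution space `𝔼`. -/
def solSpace (T : ℝ) [hT : Fact (0 < T)] (d : ℕ) : Set (L2plus T d) :=
  bar (Hperp T (d + 1) 1 2) ∩ bar (Hperp T (d + 1) 0 4)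

/-- The boundary space `𝔾` on `𝕋 × ℝ^{n-1}`. -/
def traceSpace (T : ℝ) [hT : Fact (0 < T)] (d : ℕ) : Set (L2 T d) :=
  Hperp T d (3 / 4) 0 ∩ Hperp T d 0 (3 / 2)

/-! ### Test functions, weak derivatives and traces -/

/-- `C_c^∞(𝕋 × ℝⁿ₊)`; smoothness is that of the lift to `ℝ × ℝⁿ`. -/
structure IsTest {d : ℕ} (φ : Cyl T (d + 1) → ℂ) : Prop where
  smooth : ContDiff ℝ ∞ fun p : ℝ × Space (d + 1) => φ ((p.1 : AddCircle T), p.2)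
  compact : HasCompactSupport φ
  support : tsupport φ ⊆ Gplus T d

/-- The time derivative of a smooth function. -/
def dt {n : ℕ} (φ : Cyl T n → ℂ) : Cyl T n → ℂ :=
  fun p => deriv (fun s : ℝ => φ (p.1 + (s : AddCircle T), p.2)) 0

/-- The `j`-th spatial derivative of a smooth function. -/
def dx {n : ℕ} (j : Fin n) (φ : Cyl T n → ℂ) : Cyl T n → ℂ :=
  fun p => deriv (fun s : ℝ => φ (p.1, p.2 + EuclideanSpace.single j s)) 0

/-- The spatial Laplacian of a smooth function. -/
def lap {n : ℕ} (φ : Cyl T n → ℂ) : Cyl T n → ℂ := fun p => ∑ j, dx j (dx j φ) p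

/-- `∂ₜu - Δ(∂ₜ - Δ)u = f` on `𝕋 × ℝⁿ₊` in the sense of distributions. -/
def WeakEq {d : ℕ} (u f : L2plus T d) : Prop :=
  ∀ φ : Cyl T (d + 1) → ℂ, IsTest φ →
    ∫ p in Gplus T d, u p * (-dt φ p + lap (dt φ) p + lap (lap φ) p) =
      ∫ p in Gplus T d, f p * φ p

/-- `w = ∂ₙu` on `𝕋 × ℝⁿ₊` in the sense of distributions. -/
def IsWeakNormalDeriv {d : ℕ} (u w : L2plus T d) : Prop :=
  ∀ φ : Cyl T (d + 1) → ℂ, IsTest φ →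
    ∫ p in Gplus T d, u p * dx (Fin.last d) φ p = -∫ p in Gplus T d, w p * φ p

/-- `u|_{xₙ = 0} = g`: the mean over `0 < s < ε` of `‖u(·, ·, s) - g‖²_{L²(𝕋 × ℝ^{n-1})}` tends to
`0` as `ε → 0+`. It does not depend on the choice of representatives, and it determines `g`. -/
def HasTrace {d : ℕ} (u : L2plus T d) (g : L2 T d) : Prop :=
  Tendsto (fun ε : ℝ => (ENNReal.ofReal ε)⁻¹ *
      ∫⁻ s in Set.Ioo 0 ε, ∫⁻ y : Cyl T d, ‖u (y.1, glue y.2 s) - g y‖ₑ ^ 2)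
    (𝓝[>] 0) (𝓝 0)

/-- `u` solves the Dirichlet problem with right-hand side `f`: the equation holds, and
`u` and `∂ₙu` vanish on the boundary. -/
structure SolvesDirichlet {d : ℕ} (u f : L2plus T d) : Prop where
  eqn : WeakEq u f
  trace_zero : HasTrace u 0
  trace_one : ∃ w : L2plus T d, IsWeakNormalDeriv u w ∧ HasTrace w 0

/-! ### The symbol and its factors -/

/-- `D(τ, ξ', z) = iτ + (|ξ'|² + z²)(iτ + |ξ'|² + z²)` as a polynomial in `z`. -/
def symbolD {d : ℕ} (τ : ℝ) (ξ' : Space d) : ℂ[X] :=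
  C (Complex.I * τ) + (C ((‖ξ'‖ : ℂ) ^ 2) + X ^ 2) *
    (C (Complex.I * τ) + (C ((‖ξ'‖ : ℂ) ^ 2) + X ^ 2))

open Classical in
/-- `D⁺(τ, ξ', z) = ∏ (z - ρ)` over the roots `ρ` of `D(τ, ξ', ·)` in the upper half plane. -/
def symbolDplus {d : ℕ} (τ : ℝ) (ξ' : Space d) : ℂ[X] :=
  (((symbolD τ ξ').roots.filter fun ρ => 0 < ρ.im).map fun ρ => X - C ρ).prod

open Classical in
/-- `D⁻(τ, ξ', z) = ∏ (z - ρ)` over the roots `ρ` of `D(τ, ξ', ·)` in the lower half plane. -/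
def symbolDminus {d : ℕ} (τ : ℝ) (ξ' : Space d) : ℂ[X] :=
  (((symbolD τ ξ').roots.filter fun ρ => ρ.im < 0).map fun ρ => X - C ρ).prod

/-- The symbol `1 / D⁻(τ, ξ)`. -/
def invDminus {d : ℕ} (τ : ℝ) (ξ : Space (d + 1)) : ℂ :=
  ((symbolDminus τ (tang ξ)).eval (ξ (Fin.last d) : ℂ))⁻¹

/-- `v = op[m]₊ f`: there is an extension `F ∈ L²_⊥(𝕋 × ℝⁿ)` of `f` with `v = r⁺ op[m] F`. -/
def IsOpPlus {d : ℕ} (m : ℝ → Space (d + 1) → ℂ) (f v : L2plus T d) : Prop :=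
  ∃ F V : L2 T (d + 1), F ∈ L2perp T (d + 1) ∧ restr F = f ∧ IsOp m F V ∧ restr V = v

/-- The Lopatinskiĭ–Shapiro conditions for `D` and two boundary operators with symbols
`B 0`, `B 1` (polynomials in `z`): for all `τ ≠ 0` and `ξ'` they are linearly independent
modulo `D⁺(τ, ξ', ·)`. -/
def LopatinskiiShapiro {d : ℕ} (B : Fin 2 → ℝ → Space d → ℂ[X]) : Prop :=
  ∀ τ : ℝ, τ ≠ 0 → ∀ ξ' : Space d, ∀ c : Fin 2 → ℂ,
    symbolDplus τ ξ' ∣ ∑ i, C (c i) * B i τ ξ' → c = 0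

/-- The symbols `1` and `iz` of the Dirichlet conditions `u|_{xₙ=0}` and `∂ₙu|_{xₙ=0}`. -/
def dirichletSymbol {d : ℕ} (i : Fin 2) (_τ : ℝ) (_ξ' : Space d) : ℂ[X] :=
  (C Complex.I * X) ^ (i : ℕ)

end CHG

end

/-!
# Solvability of a mixed order Dirichlet problem in the half space

The symbol factors as `D = (z² + a²)(z² + b²)` with `a² = |ξ'|² + p`, `b² = |ξ'|² + q`, where
`p + q = pq = iτ`, and `Re a, Re b > 0`; hence `D^± = (z ∓ ia)(z ∓ ib)`. For large `|τ|` the number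
`p` stays bounded while `q` grows like `τ`, so that `|a|² ∼ 1 + |ξ'|²` but `|b|² ∼ |τ| + |ξ'|²`
(`exists_rootBounds`). The discrepancy between the two scales is the reason for the extra condition.

Everything is done on the Fourier side. A function on the cylinder vanishes on the half cylinder if
and only if its transform is *anticausal* (`restr_eq_zero_iff_anticausal`), a property that is
preserved by multiplication with `z` and with `1 / (z - ρ)`, `Im ρ < 0`. The trace at `xₙ = 0` is
the integral of the transform over the normal frequency (`hasTrace_restr`), and this integral
vanishes for anticausal functions (`Anticausal.integral_eq_zero`). In particular multiplication with
`1 / D⁻` is well defined on the half cylinder (`restr_eq_of_isOp`), and it gains the normal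
derivative that a trace needs (`exists_trace_transform`).

*Necessity.* If `u`, with extension `U`, solves the problem, then `D Û - F̂` is anticausal
(`WeakEq.anticausal`), and so is `D⁺ Û - F̂ / D⁻`. Since `D⁺` is quadratic in `z` and the boundary
conditions say that `∫ Û = ∫ z Û = 0`, the trace of `op[D⁻]⁻¹₊ f` equals `∫ z² Û`, the trace of
`-∂ₙ²u` (`integral_isOp_eq`). For `u ∈ 𝔼` this trace lies in `𝔾` (`sqSummable_weight_zero`,
`sqSummable_abs_tfreq`); the two memberships in `𝔼` may come from different extensions, and these
are interchanged by a low-pass filter in `z` that is holomorphic in the upper half plane.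

*Sufficiency.* The right-hand side is extended by `F̂ + N` with an anticausal corrector
`N = coefA · corrA + coefB · corrB`, and `Û = (F̂ + N) / D`. The coefficients are determined by
`∫ Û = ∫ (z - ia) Û = 0` (`integral_corrected`), that is, by the boundary conditions, and `U` is in
`𝔼` by ellipticity of `D` (`exists_weight_le_symD`) as soon as `N ∈ L²`. For `corrB` this requires
`|b|^{5/2} coefB ∈ L²`, which follows from the regularity of the trace of `op[D⁻]⁻¹₊ f`, as
that trace is `ib coefB` up to a better term (`trace_eq_coefB`, `sqSummable_coefB`).

*Failure of solvability.* On bounded frequencies `ξ` one has `|D⁻| ≲ |τ|^{1/2}` only, as `a` is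
bounded there. Hence there is `f` with time coefficients of size at most `|k|^{-3/4}` such that the
trace of `op[D⁻]⁻¹₊ f` has coefficients `|k|^{-5/4}` (`exists_trace_eq_rpow`); the weight
`|k|^{3/4}` of `𝔾` turns them into `|k|^{-1/2}`, which is not square summable
(`not_mem_traceSpace_of_eq_rpow`). The Lopatinskiĭ–Shapiro conditions hold nevertheless, because
`D⁺` has degree two.
-/

noncomputable section

namespace CHG

/-! ### Splitting off the normal coordinate -/

@[simp] theorem glue_last {d : ℕ} (x : Space d) (s : ℝ) : glue x s (Fin.last d) = s := by
  simp [glue]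

@[simp] theorem glue_castSucc {d : ℕ} (x : Space d) (s : ℝ) (j : Fin d) :
    glue x s j.castSucc = x j := by
  simp [glue]

@[simp] theorem tang_glue {d : ℕ} (x : Space d) (s : ℝ) : tang (glue x s) = x := by
  ext j; simp [tang]

@[simp] theorem glue_tang {d : ℕ} (x : Space (d + 1)) : glue (tang x) (x (Fin.last d)) = x := by
  ext j
  refine Fin.lastCases ?_ (fun i => ?_) j
  · simp
  · simp [tang]

theorem continuous_glue {d : ℕ} : Continuous fun p : Space d × ℝ => glue p.1 p.2 := by
  refine (PiLp.continuous_toLp 2 _).comp (continuous_pi fun j => ?_)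
  refine Fin.lastCases ?_ (fun i => ?_) j
  · simpa using continuous_snd
  · simp only [Fin.snoc_castSucc]; fun_prop

theorem continuous_tang {d : ℕ} : Continuous (tang : Space (d + 1) → Space d) := by
  refine (PiLp.continuous_toLp 2 _).comp (continuous_pi fun j => ?_)
  fun_prop

/-- The splitting `(x', xₙ) ↦ x` as a measurable equivalence. -/
def glueEquiv (d : ℕ) : Space d × ℝ ≃ᵐ Space (d + 1) where
  toFun p := glue p.1 p.2
  invFun x := (tang x, x (Fin.last d))
  left_inv p := by simp
  right_inv x := by simp
  measurable_toFun := continuous_glue.measurable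
  measurable_invFun := (continuous_tang.prodMk (by fun_prop)).measurable

@[simp] theorem glueEquiv_apply {d : ℕ} (p : Space d × ℝ) : glueEquiv d p = glue p.1 p.2 := rfl

theorem measurePreserving_glue (d : ℕ) : MeasurePreserving (glueEquiv d) := by
  refine MeasurePreserving.symm (glueEquiv d).symm ?_
  have h1 := PiLp.volume_preserving_ofLp (Fin (d + 1))
  have h2 := volume_preserving_piFinSuccAbove (fun _ : Fin (d + 1) => ℝ) (Fin.last d)
  have h3 : MeasurePreserving (Prod.swap : ℝ × (Fin d → ℝ) → (Fin d → ℝ) × ℝ) :=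
    Measure.measurePreserving_swap
  have h4 : MeasurePreserving
      (Prod.map (WithLp.toLp 2) id : (Fin d → ℝ) × ℝ → Space d × ℝ) :=
    (PiLp.volume_preserving_toLp (Fin d)).prod (MeasurePreserving.id volume)
  have := h4.comp (h3.comp (h2.comp h1))
  convert this using 1
  funext x
  refine Prod.ext ?_ ?_
  · ext j
    simp [glueEquiv, tang, MeasurableEquiv.piFinSuccAbove, Fin.insertNthEquiv,
      Fin.init]
  · simp [glueEquiv, MeasurableEquiv.piFinSuccAbove, Fin.insertNthEquiv]

theorem norm_glue_sq {d : ℕ} (x : Space d) (s : ℝ) : ‖glue x s‖ ^ 2 = ‖x‖ ^ 2 + s ^ 2 := by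
  simp [EuclideanSpace.norm_sq_eq, Fin.sum_univ_castSucc]

theorem inner_glue {d : ℕ} (x y : Space d) (s r : ℝ) :
    inner ℝ (glue x s) (glue y r) = inner ℝ x y + s * r := by
  simp [PiLp.inner_apply, Fin.sum_univ_castSucc, mul_comm]

theorem glue_smul {d : ℕ} (c : ℝ) (x : Space d) (s : ℝ) : c • glue x s = glue (c • x) (c * s) := by
  ext j
  refine Fin.lastCases ?_ (fun i => ?_) j <;> simp

theorem lintegral_glue {d : ℕ} {f : Space (d + 1) → ENNReal} (hf : AEMeasurable f) :
    ∫⁻ x, f x = ∫⁻ x' : Space d, ∫⁻ s : ℝ, f (glue x' s) := by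
  rw [← (measurePreserving_glue d).lintegral_comp_emb (glueEquiv d).measurableEmbedding]
  exact lintegral_prod _ (hf.comp_quasiMeasurePreserving
    (measurePreserving_glue d).quasiMeasurePreserving)

theorem lintegral_glue' {d : ℕ} {f : Space (d + 1) → ENNReal} (hf : AEMeasurable f) :
    ∫⁻ x, f x = ∫⁻ s : ℝ, ∫⁻ x' : Space d, f (glue x' s) := by
  rw [← (measurePreserving_glue d).lintegral_comp_emb (glueEquiv d).measurableEmbedding]
  exact lintegral_prod_symm _ (hf.comp_quasiMeasurePreserving
    (measurePreserving_glue d).quasiMeasurePreserving)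

theorem integrable_glue_iff {d : ℕ} {f : Space (d + 1) → ℂ} :
    Integrable (fun p : Space d × ℝ => f (glue p.1 p.2)) (volume.prod volume) ↔ Integrable f :=
  (measurePreserving_glue d).integrable_comp_emb (glueEquiv d).measurableEmbedding

theorem integral_glue {d : ℕ} {f : Space (d + 1) → ℂ} (hf : Integrable f) :
    ∫ x, f x = ∫ x' : Space d, ∫ s : ℝ, f (glue x' s) := by
  rw [← (measurePreserving_glue d).integral_comp']
  exact integral_prod _ (integrable_glue_iff.2 hf)

theorem integral_glue' {d : ℕ} {f : Space (d + 1) → ℂ} (hf : Integrable f) :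
    ∫ x, f x = ∫ s : ℝ, ∫ x' : Space d, f (glue x' s) := by
  rw [← (measurePreserving_glue d).integral_comp']
  exact integral_prod_symm _ (integrable_glue_iff.2 hf)

theorem ae_glue_iff {d : ℕ} {p : Space (d + 1) → Prop} :
    (∀ᵐ q : Space d × ℝ, p (glue q.1 q.2)) ↔ ∀ᵐ x, p x := by
  have h := (measurePreserving_glue d).map_eq
  constructor
  · intro hq
    rw [← h, (glueEquiv d).measurableEmbedding.ae_map_iff]
    exact hq
  · intro hx
    rw [← h, (glueEquiv d).measurableEmbedding.ae_map_iff] at hx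
    exact hx

theorem ae_ae_glue {d : ℕ} {p : Space (d + 1) → Prop} (h : ∀ᵐ x, p x) :
    ∀ᵐ x' : Space d, ∀ᵐ s : ℝ, p (glue x' s) :=
  Measure.ae_ae_of_ae_prod (ae_glue_iff.2 h)

theorem ae_ae_glue' {d : ℕ} {p : Space (d + 1) → Prop} (h : ∀ᵐ x, p x) :
    ∀ᵐ s : ℝ, ∀ᵐ x' : Space d, p (glue x' s) :=
  Measure.ae_ae_of_ae_prod (Measure.measurePreserving_swap (μ := (volume : Measure ℝ))
    (ν := (volume : Measure (Space d))).quasiMeasurePreserving.ae (ae_glue_iff.2 h))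

theorem aestronglyMeasurable_glue {d : ℕ} {f : Space (d + 1) → ℂ}
    (hf : AEStronglyMeasurable f) :
    AEStronglyMeasurable (fun p : Space d × ℝ => f (glue p.1 p.2)) (volume.prod volume) :=
  hf.comp_measurePreserving (measurePreserving_glue d)

/-! ### The Fourier transform on `L²(ℝⁿ)` -/

section Plancherel

variable {E : Type*} [NormedAddCommGroup E] [InnerProductSpace ℝ E] [FiniteDimensional ℝ E]
  [MeasurableSpace E] [BorelSpace E]

theorem integral_mul_eq_inner {α : Type*} [MeasurableSpace α] {μ : Measure α} {g : α → ℂ}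
    (hg : MemLp g 2 μ) (f : Lp ℂ 2 μ) :
    ∫ x, f x * g x ∂μ = inner ℂ (hg.star.toLp (star g)) f := by
  rw [L2.inner_def]
  refine integral_congr_ae ?_
  filter_upwards [hg.star.coeFn_toLp] with x hx
  simp [hx, mul_comm]

theorem continuous_integral_mul {α : Type*} [MeasurableSpace α] {μ : Measure α} {g : α → ℂ}
    (hg : MemLp g 2 μ) : Continuous fun f : Lp ℂ 2 μ => ∫ x, f x * g x ∂μ := by
  simp_rw [integral_mul_eq_inner hg]
  fun_prop

/-- The multiplication formula `∫ f̂ g = ∫ f ĝ` for `f ∈ L²` and `g ∈ L¹ ∩ L²` with `ĝ ∈ L²`. -/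
theorem integral_fourier_mul (f : Lp ℂ 2 (volume : Measure E)) {g : E → ℂ} (hg1 : Integrable g)
    (hg2 : MemLp g 2) (hg : MemLp (𝓕 g) 2) :
    ∫ x, (𝓕 f : Lp ℂ 2 (volume : Measure E)) x * g x = ∫ x, f x * 𝓕 g x := by
  refine DenseRange.induction_on (p := fun f : Lp ℂ 2 (volume : Measure E) =>
    ∫ x, (𝓕 f : Lp ℂ 2 (volume : Measure E)) x * g x = ∫ x, f x * 𝓕 g x)
    (SchwartzMap.denseRange_toLpCLM (p := 2) ENNReal.ofNat_ne_top) f ?_ ?_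
  · exact isClosed_eq ((continuous_integral_mul hg2).comp
      (Lp.fourierTransformₗᵢ E ℂ).continuous) (continuous_integral_mul hg)
  · intro φ
    simp only [SchwartzMap.toLpCLM_apply]
    rw [SchwartzMap.toLp_fourier_eq]
    have h1 : ∫ x, ((𝓕 φ).toLp 2 (volume : Measure E)) x * g x = ∫ x, 𝓕 (φ : E → ℂ) x * g x := by
      refine integral_congr_ae ?_
      filter_upwards [(𝓕 φ).coeFn_toLp 2] with x hx
      rw [hx, SchwartzMap.fourier_coe]
    have h2 : ∫ x, (φ.toLp 2 (volume : Measure E)) x * 𝓕 g x = ∫ x, φ x * 𝓕 g x := by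
      refine integral_congr_ae ?_
      filter_upwards [φ.coeFn_toLp 2] with x hx
      rw [hx]
    rw [h1, h2]
    have := VectorFourier.integral_fourierIntegral_smul_eq_flip (μ := (volume : Measure E))
      (ν := (volume : Measure E)) (L := innerₗ E) (f := (φ : E → ℂ)) (g := g)
      Real.continuous_fourierChar continuous_inner φ.integrable hg1
    simp only [flip_innerₗ, smul_eq_mul] at this
    exact this

theorem integral_fourier_mul_schwartz (f : Lp ℂ 2 (volume : Measure E)) (φ : SchwartzMap E ℂ) :
    ∫ x, (𝓕 f : Lp ℂ 2 (volume : Measure E)) x * φ x = ∫ x, f x * 𝓕 (φ : E → ℂ) x := by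
  refine integral_fourier_mul f φ.integrable (φ.memLp 2) ?_
  rw [← SchwartzMap.fourier_coe]
  exact (𝓕 φ).memLp 2

theorem _root_.MeasureTheory.MemLp.locallyIntegrable_two {f : E → ℂ} (hf : MemLp f 2) :
    LocallyIntegrable f :=
  hf.locallyIntegrable (by norm_num)

/-- On `L¹ ∩ L²` the Fourier transform of `L²` is given by the Fourier integral. -/
theorem fourier_toLp_ae_eq {f : E → ℂ} (hf1 : Integrable f) (hf2 : MemLp f 2) :
    (𝓕 (hf2.toLp f) : Lp ℂ 2 (volume : Measure E)) =ᵐ[volume] 𝓕 f := by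
  refine ae_eq_of_integral_contDiff_smul_eq (μ := (volume : Measure E))
    (Lp.memLp _).locallyIntegrable_two
    (Continuous.locallyIntegrable ?_) ?_
  · exact VectorFourier.fourierIntegral_continuous Real.continuous_fourierChar
      continuous_inner hf1
  · intro g hg hgs
    have hs : HasCompactSupport fun x => (g x : ℂ) :=
      hgs.comp_left (g := fun r : ℝ => (r : ℂ)) (by simp)
    have hd : ContDiff ℝ ∞ fun x => (g x : ℂ) := Complex.ofRealCLM.contDiff.comp hg
    set φ : SchwartzMap E ℂ := hs.toSchwartzMap hd with hφ
    have hφx : ∀ x, φ x = (g x : ℂ) := fun x => rfl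
    have h1 := integral_fourier_mul_schwartz (hf2.toLp f) φ
    have h2 : ∫ x, (hf2.toLp f) x * 𝓕 (φ : E → ℂ) x = ∫ x, f x * 𝓕 (φ : E → ℂ) x := by
      refine integral_congr_ae ?_
      filter_upwards [hf2.coeFn_toLp] with x hx
      rw [hx]
    have h3 := VectorFourier.integral_fourierIntegral_smul_eq_flip (μ := (volume : Measure E))
      (ν := (volume : Measure E)) (L := innerₗ E) (f := f) (g := (φ : E → ℂ))
      Real.continuous_fourierChar continuous_inner hf1 φ.integrable
    simp only [flip_innerₗ, smul_eq_mul] at h3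
    rw [h2] at h1
    simp only [Complex.real_smul]
    simp only [← hφx]
    simp_rw [mul_comm (φ _)]
    rw [h1]
    exact h3.symm

variable (E) in
/-- Countably many Schwartz functions separate the points of `L²`. -/
theorem exists_schwartz_separating :
    ∃ φ : ℕ → SchwartzMap E ℂ, ∀ f : E → ℂ, MemLp f 2 → (∀ j, ∫ x, f x * φ j x = 0) →
      f =ᵐ[volume] 0 := by
  have hd : Dense (Set.range (SchwartzMap.toLpCLM ℂ (E := E) ℂ 2 (volume : Measure E))) :=
    SchwartzMap.denseRange_toLpCLM (p := 2) ENNReal.ofNat_ne_top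
  have : Fact ((2 : ENNReal) ≠ ⊤) := ⟨by norm_num⟩
  obtain ⟨t, hts, htc, htd⟩ := hd.exists_countable_dense_subset
  have hne : t.Nonempty := htd.nonempty
  obtain ⟨e, rfl⟩ := htc.exists_eq_range hne
  choose φ hφ using fun j => hts ⟨j, rfl⟩
  refine ⟨φ, fun f hf h => ?_⟩
  have hz : ∀ g : Lp ℂ 2 (volume : Measure E), ∫ x, g x * f x = 0 := by
    intro g
    refine DenseRange.induction_on (p := fun g : Lp ℂ 2 (volume : Measure E) =>
      ∫ x, g x * f x = 0) htd g (isClosed_eq (continuous_integral_mul hf) continuous_const) ?_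
    intro j
    rw [← h j, ← hφ j]
    refine integral_congr_ae ?_
    filter_upwards [(φ j).coeFn_toLp 2] with x hx
    simp only [SchwartzMap.toLpCLM_apply, hx, mul_comm]
  have h0 := hz (hf.star.toLp (star f))
  rw [integral_mul_eq_inner hf, inner_self_eq_zero] at h0
  have h1 := hf.star.coeFn_toLp
  rw [h0] at h1
  filter_upwards [h1, Lp.coeFn_zero ℂ 2 (volume : Measure E)] with x hx hx0
  rw [hx0] at hx
  simpa using hx.symm

end Plancherel

/-! ### Time coefficients and the Fourier transform on `𝕋 × ℝⁿ` -/

section TimeCoeff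

variable {T : ℝ} [hT : Fact (0 < T)]

theorem ae_volume_addCircle_iff {p : AddCircle T → Prop} :
    (∀ᵐ t, p t) ↔ ∀ᵐ t ∂(AddCircle.haarAddCircle (T := T)), p t := by
  rw [AddCircle.volume_eq_smul_haarAddCircle]
  have h0 : ENNReal.ofReal T ≠ 0 := by simpa using hT.out
  simp only [ae_iff, Measure.smul_apply, smul_eq_mul, mul_eq_zero, h0, false_or]

theorem ae_ae_swap {n : ℕ} {p : Cyl T n → Prop} (h : ∀ᵐ q, p q) :
    ∀ᵐ x : Space n, ∀ᵐ t : AddCircle T, p (t, x) :=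
  Measure.ae_ae_of_ae_prod (Measure.measurePreserving_swap (μ := (volume : Measure (Space n)))
    (ν := (volume : Measure (AddCircle T))).quasiMeasurePreserving.ae h)

theorem ae_of_ae_ae_swap {n : ℕ} {p : Cyl T n → Prop} (hp : MeasurableSet {q | p q})
    (h : ∀ᵐ x : Space n, ∀ᵐ t : AddCircle T, p (t, x)) : ∀ᵐ q, p q := by
  have h1 : ∀ᵐ r : Space n × AddCircle T, p (r.2, r.1) :=
    (Measure.ae_prod_iff_ae_ae (p := fun r : Space n × AddCircle T => p (r.2, r.1))
      (measurable_swap hp)).2 h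
  exact (Measure.measurePreserving_swap (μ := (volume : Measure (AddCircle T)))
    (ν := (volume : Measure (Space n)))).quasiMeasurePreserving.ae h1

theorem lintegral_sq_slice {n : ℕ} {f : Cyl T n → ℂ} (hf : MemLp f 2) :
    ∫⁻ x : Space n, ∫⁻ t : AddCircle T, ‖f (t, x)‖ₑ ^ 2 = ∫⁻ p, ‖f p‖ₑ ^ 2 :=
  (lintegral_prod_symm (μ := (volume : Measure (AddCircle T)))
    (ν := (volume : Measure (Space n))) _
    (hf.1.enorm.pow_const 2)).symm

theorem _root_.MeasureTheory.memLp_two_iff_lintegral {α : Type*} [MeasurableSpace α]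
    {μ : Measure α} {f : α → ℂ} (hf : AEStronglyMeasurable f μ) :
    MemLp f 2 μ ↔ ∫⁻ x, ‖f x‖ₑ ^ 2 ∂μ < ⊤ := by
  unfold MemLp
  rw [eLpNorm_lt_top_iff_lintegral_rpow_enorm_lt_top (by norm_num) (by norm_num)]
  simp [hf]

theorem _root_.MeasureTheory.Lp.enorm_sq_eq_lintegral {α : Type*} [MeasurableSpace α]
    {μ : Measure α} (f : Lp ℂ 2 μ) : ‖f‖ₑ ^ 2 = ∫⁻ x, ‖f x‖ₑ ^ 2 ∂μ := by
  rw [Lp.enorm_def, eLpNorm_eq_lintegral_rpow_enorm_toReal (by norm_num) (by norm_num)]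
  simp only [ENNReal.toReal_ofNat, ENNReal.rpow_ofNat, one_div]
  rw [← ENNReal.rpow_natCast, ← ENNReal.rpow_mul]
  norm_num

theorem ae_memLp_slice {n : ℕ} {f : Cyl T n → ℂ} (hf : MemLp f 2) :
    ∀ᵐ x : Space n, MemLp (fun t : AddCircle T => f (t, x)) 2 (AddCircle.haarAddCircle) := by
  have h1 : ∫⁻ x : Space n, ∫⁻ t : AddCircle T, ‖f (t, x)‖ₑ ^ 2 < ⊤ := by
    rw [lintegral_sq_slice hf]; exact (memLp_two_iff_lintegral hf.1).1 hf
  have hm : AEMeasurable (fun r : Space n × AddCircle T => ‖f (r.2, r.1)‖ₑ ^ 2)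
      (volume.prod volume) :=
    (hf.1.enorm.pow_const 2).comp_quasiMeasurePreserving
      (Measure.measurePreserving_swap (μ := (volume : Measure (Space n)))
        (ν := (volume : Measure (AddCircle T)))).quasiMeasurePreserving
  have h2 := ae_lt_top' hm.lintegral_prod_right' h1.ne
  have hs : AEStronglyMeasurable (fun r : Space n × AddCircle T => f (r.2, r.1))
      (volume.prod volume) := hf.1.prod_swap
  filter_upwards [h2, hs.prodMk_left] with x hx hx2
  have : MemLp (fun t : AddCircle T => f (t, x)) 2 volume := (memLp_two_iff_lintegral hx2).2 hx
  exact memLp_haarAddCircle_iff.2 this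

theorem tsum_enorm_sq_fourierCoeff {g : AddCircle T → ℂ}
    (hg : MemLp g 2 AddCircle.haarAddCircle) :
    ENNReal.ofReal T * ∑' k : ℤ, ‖fourierCoeff g k‖ₑ ^ 2 = ∫⁻ t, ‖g t‖ₑ ^ 2 := by
  have h := hasSum_sq_fourierCoeff (hg.toLp g)
  have hc : ∀ k, fourierCoeff (hg.toLp g) k = fourierCoeff g k := fun k => by
    rw [fourierCoeff_congr_ae hg.coeFn_toLp]
  simp_rw [hc] at h
  rw [AddCircle.volume_eq_smul_haarAddCircle, lintegral_smul_measure, smul_eq_mul]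
  congr 1
  have h2 : ∫⁻ t, ‖g t‖ₑ ^ 2 ∂AddCircle.haarAddCircle
      = ENNReal.ofReal (∫ t, ‖(hg.toLp g) t‖ ^ 2 ∂AddCircle.haarAddCircle) := by
    rw [ofReal_integral_eq_lintegral_ofReal]
    · refine lintegral_congr_ae ?_
      filter_upwards [hg.coeFn_toLp] with t ht
      rw [ht, ENNReal.ofReal_pow (norm_nonneg _), ofReal_norm]
    · exact (Lp.memLp _).integrable_norm_pow (by norm_num)
    · exact Eventually.of_forall fun _ => by positivity
  rw [h2, ← h.tsum_eq, ENNReal.ofReal_tsum_of_nonneg (fun _ => by positivity) h.summable]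
  simp_rw [ENNReal.ofReal_pow (norm_nonneg _), ofReal_norm]

theorem tsum_lintegral_timeCoeff {n : ℕ} (f : L2 T n) :
    ENNReal.ofReal T * ∑' k : ℤ, ∫⁻ x, ‖timeCoeff f k x‖ₑ ^ 2 = ‖f‖ₑ ^ 2 := by
  rw [Lp.enorm_sq_eq_lintegral, ← lintegral_sq_slice (Lp.memLp f), ← lintegral_tsum,
    ← lintegral_const_mul']
  · refine lintegral_congr_ae ?_
    filter_upwards [ae_memLp_slice (Lp.memLp f)] with x hx
    exact tsum_enorm_sq_fourierCoeff hx
  · exact ENNReal.ofReal_ne_top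
  · exact fun k => (memLp_timeCoeff f k).1.enorm.pow_const 2

theorem timeCoeff_congr {n : ℕ} {f : L2 T n} {g : Cyl T n → ℂ} (h : f =ᵐ[volume] g) (k : ℤ) :
    timeCoeff f k =ᵐ[volume] fun x => fourierCoeff (fun t : AddCircle T => g (t, x)) k := by
  filter_upwards [ae_ae_swap h] with x hx
  exact congrFun (fourierCoeff_congr_ae (ae_volume_addCircle_iff.1 hx)) k

theorem timeCoeff_add {n : ℕ} (f g : L2 T n) (k : ℤ) :
    timeCoeff (f + g) k =ᵐ[volume] timeCoeff f k + timeCoeff g k := by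
  filter_upwards [timeCoeff_congr (Lp.coeFn_add f g) k, ae_memLp_slice (Lp.memLp f),
    ae_memLp_slice (Lp.memLp g)] with x hx hf hg
  rw [hx]
  exact congrFun (fourierCoeff.add (hf.integrable (by norm_num)) (hg.integrable (by norm_num))) k

theorem timeCoeff_smul {n : ℕ} (c : ℂ) (f : L2 T n) (k : ℤ) :
    timeCoeff (c • f) k =ᵐ[volume] c • timeCoeff f k := by
  filter_upwards [timeCoeff_congr (Lp.coeFn_smul c f) k] with x hx
  rw [hx]
  exact fourierCoeff.const_smul _ c k

theorem fourierG_add {n : ℕ} (f g : L2 T n) (k : ℤ) :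
    fourierG (f + g) k = fourierG f k + fourierG g k := by
  unfold fourierG
  rw [← FourierTransform.fourier_add, ← MemLp.toLp_add]
  congr 1
  exact MemLp.toLp_congr _ _ (timeCoeff_add f g k)

theorem fourierG_smul {n : ℕ} (c : ℂ) (f : L2 T n) (k : ℤ) :
    fourierG (c • f) k = c • fourierG f k := by
  unfold fourierG
  rw [← FourierTransform.fourier_smul, ← MemLp.toLp_const_smul]
  congr 1
  exact MemLp.toLp_congr _ _ (timeCoeff_smul c f k)

theorem fourierG_sub {n : ℕ} (f g : L2 T n) (k : ℤ) :
    fourierG (f - g) k = fourierG f k - fourierG g k := by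
  rw [sub_eq_add_neg, ← neg_one_smul ℂ g, fourierG_add, fourierG_smul, neg_one_smul,
    ← sub_eq_add_neg]

theorem fourierG_zero {n : ℕ} (k : ℤ) : fourierG (0 : L2 T n) k = 0 := by
  have := fourierG_sub (0 : L2 T n) 0 k
  rwa [sub_self, sub_self] at this

theorem enorm_fourierG {n : ℕ} (f : L2 T n) (k : ℤ) :
    ‖fourierG f k‖ₑ ^ 2 = ∫⁻ x, ‖timeCoeff f k x‖ₑ ^ 2 := by
  have : ‖fourierG f k‖ₑ = ‖(memLp_timeCoeff f k).toLp (timeCoeff f k)‖ₑ := by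
    rw [← ofReal_norm, ← ofReal_norm]
    congr 1
    exact Lp.norm_fourier_eq _
  rw [this, Lp.enorm_sq_eq_lintegral]
  refine lintegral_congr_ae ?_
  filter_upwards [(memLp_timeCoeff f k).coeFn_toLp] with x hx
  rw [hx]

/-- Parseval's identity on `𝕋 × ℝⁿ`. -/
theorem tsum_enorm_fourierG {n : ℕ} (f : L2 T n) :
    ENNReal.ofReal T * ∑' k : ℤ, ‖fourierG f k‖ₑ ^ 2 = ‖f‖ₑ ^ 2 := by
  simp_rw [enorm_fourierG]
  exact tsum_lintegral_timeCoeff f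

theorem tsum_enorm_fourierG_ne_top {n : ℕ} (f : L2 T n) :
    ∑' k : ℤ, ‖fourierG f k‖ₑ ^ 2 ≠ ⊤ := by
  intro h
  have := tsum_enorm_fourierG f
  rw [h, ENNReal.mul_top (by simpa using hT.out)] at this
  exact absurd this.symm (by simp)

theorem hasSum_norm_fourierG {n : ℕ} (f : L2 T n) :
    HasSum (fun k : ℤ => T * ‖fourierG f k‖ ^ 2) (‖f‖ ^ 2) := by
  have h := tsum_enorm_fourierG_ne_top f
  have h2 := ENNReal.hasSum_toReal h
  have h3 := congrArg ENNReal.toReal (tsum_enorm_fourierG f)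
  rw [ENNReal.toReal_mul, ENNReal.toReal_ofReal hT.out.le, ENNReal.tsum_toReal_eq
    (fun k => by simp)] at h3
  simp only [ENNReal.toReal_pow, toReal_enorm] at h2 h3
  rw [← h3]
  exact h2.mul_left T

variable (T) in
/-- The transform `F ↦ (√T F̂(k, ·))ₖ` as an isometry into the Hilbert sum over the time
frequencies. -/
def freqIsometry (n : ℕ) :
    L2 T n →ₗᵢ[ℂ] lp (fun _ : ℤ => Lp ℂ 2 (volume : Measure (Space n))) 2 where
  toFun f := ⟨fun k => (Real.sqrt T : ℂ) • fourierG f k, by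
    refine memℓp_gen ?_
    simp only [ENNReal.toReal_ofNat, Real.rpow_ofNat, norm_smul, mul_pow]
    simpa [Complex.norm_real, Real.sq_sqrt hT.out.le] using (hasSum_norm_fourierG f).summable⟩
  map_add' f g := by
    ext1; funext k
    simp [fourierG_add, smul_add]; rfl
  map_smul' c f := by
    ext1; funext k
    simp only [fourierG_smul]; exact smul_comm _ _ _
  norm_map' f := by
    have h := lp.norm_rpow_eq_tsum (p := 2) (by norm_num) (⟨fun k => (Real.sqrt T : ℂ) •
      fourierG f k, by
        refine memℓp_gen ?_
        simp only [ENNReal.toReal_ofNat, Real.rpow_ofNat, norm_smul, mul_pow]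
        simpa [Complex.norm_real, Real.sq_sqrt hT.out.le] using
          (hasSum_norm_fourierG f).summable⟩ :
        lp (fun _ : ℤ => Lp ℂ 2 (volume : Measure (Space n))) 2)
    simp only [ENNReal.toReal_ofNat, Real.rpow_ofNat, norm_smul, mul_pow, Complex.norm_real,
      Real.norm_eq_abs, sq_abs, Real.sq_sqrt hT.out.le, (hasSum_norm_fourierG f).tsum_eq] at h
    exact (sq_eq_sq₀ (norm_nonneg _) (norm_nonneg _)).1 h

theorem freqIsometry_apply {n : ℕ} (f : L2 T n) (k : ℤ) :
    freqIsometry T n f k = (Real.sqrt T : ℂ) • fourierG f k := rfl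

/-- The polarized form of Parseval's identity on `𝕋 × ℝⁿ`. -/
theorem hasSum_inner_fourierG {n : ℕ} (f g : L2 T n) :
    HasSum (fun k : ℤ => (T : ℂ) * inner ℂ (fourierG f k) (fourierG g k)) (inner ℂ f g) := by
  have h := lp.hasSum_inner (𝕜 := ℂ) (freqIsometry T n f) (freqIsometry T n g)
  rw [LinearIsometry.inner_map_map] at h
  have e : (fun k : ℤ => (T : ℂ) * inner ℂ (fourierG f k) (fourierG g k)) =
      fun k => inner ℂ (freqIsometry T n f k) (freqIsometry T n g k) := by
    funext k
    rw [freqIsometry_apply, freqIsometry_apply, inner_smul_left, inner_smul_right, ← mul_assoc,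
      Complex.conj_ofReal, ← Complex.ofReal_mul, Real.mul_self_sqrt hT.out.le]
  rw [e]
  exact h

theorem memLp_mode {n : ℕ} (k : ℤ) {w : Space n → ℂ} (hw : MemLp w 2) :
    MemLp (fun p : Cyl T n => (fourier k p.1 : ℂ) * w p.2) 2 := by
  have hm : AEStronglyMeasurable (fun p : Cyl T n => (fourier k p.1 : ℂ) * w p.2) :=
    ((map_continuous (fourier (T := T) k)).comp continuous_fst).aestronglyMeasurable.mul
      (hw.1.comp_snd (μ := (volume : Measure (AddCircle T))))
  rw [memLp_two_iff_lintegral hm]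
  have : ∀ p : Cyl T n, ‖(fourier k p.1 : ℂ) * w p.2‖ₑ ^ 2 = ‖w p.2‖ₑ ^ 2 := by
    intro p
    have : ‖(fourier k p.1 : ℂ)‖ₑ = 1 := by
      rw [← ofReal_norm, fourier_apply, Circle.norm_coe, ENNReal.ofReal_one]
    rw [enorm_mul, this, one_mul]
  simp_rw [this]
  have h2 : ∫⁻ p : Cyl T n, ‖w p.2‖ₑ ^ 2
      = ∫⁻ _ : AddCircle T, ∫⁻ x : Space n, ‖w x‖ₑ ^ 2 :=
    lintegral_prod (μ := (volume : Measure (AddCircle T))) (ν := (volume : Measure (Space n)))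
      (fun p => ‖w p.2‖ₑ ^ 2) ((hw.1.enorm.pow_const 2).comp_quasiMeasurePreserving
        Measure.quasiMeasurePreserving_snd)
  rw [h2, lintegral_const]
  exact ENNReal.mul_lt_top ((memLp_two_iff_lintegral hw.1).1 hw) (measure_lt_top _ _)

/-- The element `e^{2πikt/T} w(x)` of `L²(𝕋 × ℝⁿ)`. -/
def mode {n : ℕ} (k : ℤ) (w : Lp ℂ 2 (volume : Measure (Space n))) : L2 T n :=
  (memLp_mode k (Lp.memLp w)).toLp _

theorem timeCoeff_mode {n : ℕ} (k : ℤ) (w : Lp ℂ 2 (volume : Measure (Space n))) (j : ℤ) :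
    timeCoeff (mode (T := T) k w) j =ᵐ[volume] fun x => if j = k then w x else 0 := by
  filter_upwards [timeCoeff_congr (memLp_mode (T := T) k (Lp.memLp w)).coeFn_toLp j] with x hx
  rw [mode, hx]
  have : (fun t : AddCircle T => (fourier k t : ℂ) * w x) =
      fun t : AddCircle T => w x * (fourier k t : ℂ) := by funext t; ring
  simp only [this]
  rw [fourierCoeff.const_mul, fourierCoeff_fourier, Pi.single_apply]
  split_ifs <;> simp

theorem fourierG_mode {n : ℕ} (k : ℤ) (w : Lp ℂ 2 (volume : Measure (Space n))) (j : ℤ) :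
    fourierG (mode (T := T) k w) j = if j = k then 𝓕 w else 0 := by
  unfold fourierG
  split_ifs with h
  · congr 1
    refine Lp.ext ((MemLp.coeFn_toLp _).trans ((timeCoeff_mode k w j).trans ?_))
    simp [h]
  · have : (memLp_timeCoeff (mode (T := T) k w) j).toLp (timeCoeff (mode k w) j) = 0 := by
      refine Lp.ext ((MemLp.coeFn_toLp _).trans ((timeCoeff_mode k w j).trans ?_))
      simp only [h, if_false]
      exact (Lp.coeFn_zero _ _ _).symm
    rw [this]
    exact (Lp.fourierTransformₗᵢ (Space n) ℂ).map_zero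

variable (T) in
/-- The range is closed and contains the families with a single nonzero entry, whose span is dense.
-/
theorem freqIsometry_surjective (n : ℕ) : Function.Surjective (freqIsometry T n) := by
  intro w
  have hcl : IsClosed (Set.range (freqIsometry T n)) :=
    (freqIsometry T n).isometry.isClosedEmbedding.isClosed_range
  refine hcl.mem_of_tendsto (lp.hasSum_single (by norm_num) w) (Eventually.of_forall fun s => ?_)
  have hmem : ∀ k, lp.single 2 k (w k) ∈ LinearMap.range (freqIsometry T n).toLinearMap := by
    intro k
    refine ⟨mode k (𝓕⁻ ((Real.sqrt T : ℂ)⁻¹ • w k)), ?_⟩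
    ext1; funext j
    have hs : (Real.sqrt T : ℂ) ≠ 0 := by
      simpa using (Real.sqrt_pos.2 hT.out).ne'
    simp only [LinearIsometry.coe_toLinearMap, freqIsometry_apply, fourierG_mode]
    split_ifs with h
    · subst h
      rw [FourierTransform.fourier_fourierInv_eq, smul_smul, mul_inv_cancel₀ hs, one_smul,
        lp.single_apply_self]
    · rw [lp.single_apply_ne _ _ _ h, smul_zero]
  exact Submodule.sum_mem _ fun k _ => hmem k

/-- Square summable frequency data: `h k` is measurable for each `k`, and
`∑ₖ ∫ |h k η|² dη < ∞`. -/
def SqSummable {α : Type*} [MeasurableSpace α] (μ : Measure α) (h : ℤ → α → ℂ) : Prop :=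
  (∀ k, AEStronglyMeasurable (h k) μ) ∧ ∑' k, ∫⁻ x, ‖h k x‖ₑ ^ 2 ∂μ < ⊤

theorem sqSummable_fourierG {n : ℕ} (f : L2 T n) :
    SqSummable volume fun k => (fourierG f k : Space n → ℂ) := by
  refine ⟨fun k => (Lp.memLp _).1, ?_⟩
  simp_rw [← Lp.enorm_sq_eq_lintegral]
  exact (tsum_enorm_fourierG_ne_top f).lt_top

theorem SqSummable.memLp {α : Type*} [MeasurableSpace α] {μ : Measure α} {h : ℤ → α → ℂ}
    (hh : SqSummable μ h) (k : ℤ) : MemLp (h k) 2 μ :=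
  (memLp_two_iff_lintegral (hh.1 k)).2 ((ENNReal.le_tsum k).trans_lt hh.2)

variable (T) in
/-- Every square summable family is the Fourier transform of an element of `L²(𝕋 × ℝⁿ)`. -/
theorem SqSummable.exists_fourierG {n : ℕ} {h : ℤ → Space n → ℂ} (hh : SqSummable volume h) :
    ∃ V : L2 T n, ∀ k, fourierG V k =ᵐ[volume] h k := by
  have hs : (Real.sqrt T : ℂ) ≠ 0 := by
    simpa using (Real.sqrt_pos.2 hT.out).ne'
  have hn : ∀ k, ‖(hh.memLp k).toLp (h k)‖ₑ ^ 2 = ∫⁻ x, ‖h k x‖ₑ ^ 2 := by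
    intro k
    rw [Lp.enorm_sq_eq_lintegral]
    refine lintegral_congr_ae ?_
    filter_upwards [(hh.memLp k).coeFn_toLp] with x hx
    rw [hx]
  have hsum : Summable fun k => ‖(hh.memLp k).toLp (h k)‖ ^ 2 := by
    have h1 : ∑' k, ‖(hh.memLp k).toLp (h k)‖ₑ ^ 2 ≠ ⊤ := by
      simp_rw [hn]; exact hh.2.ne
    simpa using ENNReal.summable_toReal h1
  let w : lp (fun _ : ℤ => Lp ℂ 2 (volume : Measure (Space n))) 2 :=
    ⟨fun k => (Real.sqrt T : ℂ) • (hh.memLp k).toLp (h k), by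
      refine memℓp_gen ?_
      simp only [ENNReal.toReal_ofNat, Real.rpow_ofNat, norm_smul, mul_pow]
      exact hsum.mul_left _⟩
  obtain ⟨V, hV⟩ := freqIsometry_surjective T n w
  refine ⟨V, fun k => ?_⟩
  have h1 : (Real.sqrt T : ℂ) • fourierG V k = (Real.sqrt T : ℂ) • (hh.memLp k).toLp (h k) := by
    rw [← freqIsometry_apply, hV]
  rw [smul_right_injective _ hs h1]
  exact (hh.memLp k).coeFn_toLp

theorem fourierG_eq_zero_iff {n : ℕ} (f : L2 T n) (k : ℤ) :
    fourierG f k = 0 ↔ timeCoeff f k =ᵐ[volume] 0 := by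
  have h := enorm_fourierG f k
  rw [← enorm_eq_zero, ← pow_eq_zero_iff (two_ne_zero), h,
    lintegral_eq_zero_iff' ((memLp_timeCoeff f k).1.enorm.pow_const 2)]
  refine ⟨fun h => ?_, fun h => ?_⟩ <;> filter_upwards [h] with x hx <;> simpa using hx

theorem mem_L2perp_iff {n : ℕ} {f : L2 T n} : f ∈ L2perp T n ↔ fourierG f 0 = 0 := by
  rw [fourierG_eq_zero_iff]
  have h : ∀ x, ∫ t : AddCircle T, f (t, x) = T * timeCoeff f 0 x := by
    intro x
    rw [timeCoeff, fourierCoeff, AddCircle.volume_eq_smul_haarAddCircle, integral_smul_measure,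
      ENNReal.toReal_ofReal hT.out.le]
    simp
  have hT0 : (T : ℂ) ≠ 0 := by exact_mod_cast hT.out.ne'
  simp only [L2perp, Set.mem_ofPred_eq, h]
  refine ⟨fun h => ?_, fun h => ?_⟩ <;> filter_upwards [h] with x hx <;> simpa [hT0] using hx

end TimeCoeff

/-! ### Functions supported in the lower half space, on the Fourier side -/

/-- The Cauchy-Schwarz inequality for an integral of a product. -/
theorem enorm_integral_mul_sq_le {α : Type*} [MeasurableSpace α] {μ : Measure α} {f g : α → ℂ}
    (hf : AEStronglyMeasurable f μ) (hg : AEStronglyMeasurable g μ) :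
    ‖∫ x, f x * g x ∂μ‖ₑ ^ 2 ≤ (∫⁻ x, ‖f x‖ₑ ^ 2 ∂μ) * ∫⁻ x, ‖g x‖ₑ ^ 2 ∂μ := by
  have h1 : ‖∫ x, f x * g x ∂μ‖ₑ ≤ ∫⁻ x, ‖f x‖ₑ * ‖g x‖ₑ ∂μ := by
    simpa only [enorm_mul] using enorm_integral_le_lintegral_enorm (μ := μ) fun x => f x * g x
  have h2 := h1.trans (ENNReal.lintegral_mul_le_Lp_mul_Lq μ Real.HolderConjugate.two_two
    hf.enorm hg.enorm)
  have h3 := pow_le_pow_left₀ zero_le h2 2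
  refine h3.trans (le_of_eq ?_)
  rw [mul_pow, ← ENNReal.rpow_natCast, ← ENNReal.rpow_natCast, ← ENNReal.rpow_mul,
    ← ENNReal.rpow_mul]
  simp

theorem memLp_integral_mul_right {α β : Type*} [MeasurableSpace α] [MeasurableSpace β]
    {μ : Measure α} {ν : Measure β} [SFinite μ] [SFinite ν] {F : α × β → ℂ} {χ : β → ℂ}
    (hF : MemLp F 2 (μ.prod ν)) (hχ : MemLp χ 2 ν) :
    MemLp (fun x => ∫ y, F (x, y) * χ y ∂ν) 2 μ := by
  have hm : AEStronglyMeasurable (fun x => ∫ y, F (x, y) * χ y ∂ν) μ :=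
    (hF.1.mul hχ.1.comp_snd).integral_prod_right'
  rw [memLp_two_iff_lintegral hm]
  have h1 : ∀ᵐ x ∂μ, ‖∫ y, F (x, y) * χ y ∂ν‖ₑ ^ 2 ≤
      (∫⁻ y, ‖F (x, y)‖ₑ ^ 2 ∂ν) * ∫⁻ y, ‖χ y‖ₑ ^ 2 ∂ν := by
    filter_upwards [hF.1.prodMk_left] with x hx
    exact enorm_integral_mul_sq_le hx hχ.1
  have hc := (memLp_two_iff_lintegral hχ.1).1 hχ
  refine (lintegral_mono_ae h1).trans_lt ?_
  rw [lintegral_mul_const' _ _ hc.ne, ← lintegral_prod _ (hF.1.enorm.pow_const 2)]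
  exact ENNReal.mul_lt_top ((memLp_two_iff_lintegral hF.1).1 hF) hc

theorem memLp_glue {d : ℕ} {f : Space (d + 1) → ℂ} (hf : MemLp f 2) :
    MemLp (fun p : Space d × ℝ => f (glue p.1 p.2)) 2 (volume.prod volume) :=
  hf.comp_measurePreserving (measurePreserving_glue d)

theorem ae_memLp_glue {d : ℕ} {f : Space (d + 1) → ℂ} (hf : MemLp f 2) :
    ∀ᵐ x' : Space d, MemLp (fun s : ℝ => f (glue x' s)) 2 := by
  have h1 : ∫⁻ x' : Space d, ∫⁻ s : ℝ, ‖f (glue x' s)‖ₑ ^ 2 < ⊤ := by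
    rw [← lintegral_glue (hf.1.enorm.pow_const 2)]
    exact (memLp_two_iff_lintegral hf.1).1 hf
  have hm := aestronglyMeasurable_glue hf.1
  have h2 := ae_lt_top' (hm.enorm.pow_const 2).lintegral_prod_right' h1.ne
  filter_upwards [h2, hm.prodMk_left] with x hx hx2
  exact (memLp_two_iff_lintegral hx2).2 hx

theorem ae_memLp_glue' {d : ℕ} {f : Space (d + 1) → ℂ} (hf : MemLp f 2) :
    ∀ᵐ s : ℝ, MemLp (fun x' : Space d => f (glue x' s)) 2 := by
  have h1 : ∫⁻ s : ℝ, ∫⁻ x' : Space d, ‖f (glue x' s)‖ₑ ^ 2 < ⊤ := by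
    rw [← lintegral_glue' (hf.1.enorm.pow_const 2)]
    exact (memLp_two_iff_lintegral hf.1).1 hf
  have hm := (aestronglyMeasurable_glue hf.1).prod_swap
  have h2 := ae_lt_top' (hm.enorm.pow_const 2).lintegral_prod_right' h1.ne
  filter_upwards [h2, hm.prodMk_left] with x hx hx2
  exact (memLp_two_iff_lintegral hx2).2 hx

/-- The product `φ(x') χ(xₙ)`. -/
def tensor {d : ℕ} (φ : Space d → ℂ) (χ : ℝ → ℂ) (x : Space (d + 1)) : ℂ :=
  φ (tang x) * χ (x (Fin.last d))

@[simp] theorem tensor_glue {d : ℕ} (φ : Space d → ℂ) (χ : ℝ → ℂ) (x : Space d) (s : ℝ) :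
    tensor φ χ (glue x s) = φ x * χ s := by simp [tensor]

theorem integrable_tensor {d : ℕ} {φ : Space d → ℂ} {χ : ℝ → ℂ} (hφ : Integrable φ)
    (hχ : Integrable χ) : Integrable (tensor φ χ) := by
  rw [← integrable_glue_iff]
  simpa using hφ.mul_prod hχ

theorem memLp_tensor {d : ℕ} {φ : Space d → ℂ} {χ : ℝ → ℂ} (hφ : MemLp φ 2)
    (hχ : MemLp χ 2) : MemLp (tensor φ χ) 2 := by
  have hm : AEStronglyMeasurable (tensor φ χ) := by
    have h1 := (hφ.1.comp_fst (ν := (volume : Measure ℝ))).mul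
      (hχ.1.comp_snd (μ := (volume : Measure (Space d))))
    have h2 := h1.comp_measurePreserving (measurePreserving_glue d).symm
    refine h2.congr (Eventually.of_forall fun x => ?_)
    simp only [Function.comp, Pi.mul_apply]
    rfl
  rw [memLp_two_iff_lintegral hm, lintegral_glue (hm.enorm.pow_const 2)]
  simp only [tensor_glue, enorm_mul, mul_pow]
  have h2 := (memLp_two_iff_lintegral hχ.1).1 hχ
  simp_rw [lintegral_const_mul'' _ (hχ.1.enorm.pow_const 2)]
  rw [lintegral_mul_const' _ _ h2.ne]
  exact ENNReal.mul_lt_top ((memLp_two_iff_lintegral hφ.1).1 hφ) h2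

theorem fourier_tensor {d : ℕ} {φ : Space d → ℂ} {χ : ℝ → ℂ} (hφ : Integrable φ)
    (hχ : Integrable χ) : 𝓕 (tensor φ χ) = tensor (𝓕 φ) (𝓕 χ) := by
  funext η
  obtain ⟨⟨ξ, ζ⟩, rfl⟩ := (glueEquiv d).surjective η
  simp only [glueEquiv_apply, tensor_glue, Real.fourier_eq]
  rw [integral_glue ((Real.fourierIntegral_convergent_iff _).2 (integrable_tensor hφ hχ)),
    ← integral_mul_const]
  refine integral_congr_ae (Eventually.of_forall fun x => ?_)
  simp only [tensor_glue, inner_glue]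
  rw [← integral_const_mul]
  refine integral_congr_ae (Eventually.of_forall fun s => ?_)
  simp only [neg_add, AddChar.map_add_eq_mul, Circle.smul_def, smul_eq_mul, Circle.coe_mul,
    RCLike.inner_apply, conj_trivial]
  rw [mul_comm ζ s]
  ring

theorem integral_mul_tensor {d : ℕ} (V : Lp ℂ 2 (volume : Measure (Space (d + 1))))
    (φ : SchwartzMap (Space d) ℂ) (ψ : SchwartzMap ℝ ℂ) :
    ∫ x, V x * tensor φ ψ x =
      ∫ ξ, (𝓕 V : Lp ℂ 2 (volume : Measure (Space (d + 1)))) ξ *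
        tensor (𝓕⁻ (φ : Space d → ℂ)) (𝓕⁻ (ψ : ℝ → ℂ)) ξ := by
  have hφ := (𝓕⁻ φ)
  have h1 : Integrable (tensor (d := d) (𝓕⁻ φ : SchwartzMap (Space d) ℂ)
      (𝓕⁻ ψ : SchwartzMap ℝ ℂ)) := integrable_tensor (𝓕⁻ φ).integrable (𝓕⁻ ψ).integrable
  have h2 : MemLp (tensor (d := d) (𝓕⁻ φ : SchwartzMap (Space d) ℂ)
      (𝓕⁻ ψ : SchwartzMap ℝ ℂ)) 2 := memLp_tensor ((𝓕⁻ φ).memLp 2) ((𝓕⁻ ψ).memLp 2)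
  have h3 : 𝓕 (tensor (d := d) (𝓕⁻ φ : SchwartzMap (Space d) ℂ) (𝓕⁻ ψ : SchwartzMap ℝ ℂ))
      = tensor φ ψ := by
    rw [fourier_tensor (𝓕⁻ φ).integrable (𝓕⁻ ψ).integrable, ← SchwartzMap.fourier_coe,
      ← SchwartzMap.fourier_coe, FourierTransform.fourier_fourierInv_eq,
      FourierTransform.fourier_fourierInv_eq]
  have h4 := integral_fourier_mul V h1 h2 (by
    rw [h3]; exact memLp_tensor (φ.memLp 2) (ψ.memLp 2))
  rw [h3] at h4
  rw [← h4, SchwartzMap.fourierInv_coe, SchwartzMap.fourierInv_coe]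

/-- Smooth functions on the line with compact support in `(0, ∞)`. -/
structure IsHalfLineTest (ψ : ℝ → ℂ) : Prop where
  smooth : ContDiff ℝ ∞ ψ
  compact : HasCompactSupport ψ
  support : tsupport ψ ⊆ Set.Ioi 0

/-- The Schwartz function underlying a test function. -/
def IsHalfLineTest.schwartz {ψ : ℝ → ℂ} (hψ : IsHalfLineTest ψ) : SchwartzMap ℝ ℂ :=
  hψ.compact.toSchwartzMap hψ.smooth

theorem IsHalfLineTest.coe_schwartz {ψ : ℝ → ℂ} (hψ : IsHalfLineTest ψ) :
    (hψ.schwartz : ℝ → ℂ) = ψ := rfl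

theorem IsHalfLineTest.memLp {ψ : ℝ → ℂ} (hψ : IsHalfLineTest ψ) : MemLp ψ 2 := by
  rw [← hψ.coe_schwartz]; exact hψ.schwartz.memLp 2

theorem IsHalfLineTest.fourierInv_eq {ψ : ℝ → ℂ} (hψ : IsHalfLineTest ψ) :
    𝓕⁻ ψ = (𝓕⁻ hψ.schwartz : SchwartzMap ℝ ℂ) := by
  rw [SchwartzMap.fourierInv_coe, hψ.coe_schwartz]

theorem IsHalfLineTest.eq_zero {ψ : ℝ → ℂ} (hψ : IsHalfLineTest ψ) {s : ℝ} (hs : s ≤ 0) :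
    ψ s = 0 := by
  by_contra h
  exact absurd (hψ.support (subset_tsupport ψ h)) (by simpa using hs)

theorem IsHalfLineTest.comp_sub {ψ : ℝ → ℂ} (hψ : IsHalfLineTest ψ) {r : ℝ} (hr : 0 ≤ r) :
    IsHalfLineTest fun s => ψ (s - r) where
  smooth := hψ.smooth.comp (contDiff_id.sub contDiff_const)
  compact := hψ.compact.comp_homeomorph (Homeomorph.subRight r)
  support := by
    intro s hs
    have h1 : s - r ∈ tsupport ψ := by
      have := tsupport_comp_subset_preimage ψ (f := fun s : ℝ => s - r) (by fun_prop) hs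
      exact this
    have := hψ.support h1
    simp only [Set.mem_Ioi] at this ⊢
    linarith

theorem fourierInv_comp_sub (ψ : ℝ → ℂ) (r ζ : ℝ) :
    𝓕⁻ (fun s => ψ (s - r)) ζ = Complex.exp (2 * Real.pi * r * ζ * Complex.I) * 𝓕⁻ ψ ζ := by
  rw [Real.fourierInv_eq', Real.fourierInv_eq', ← integral_const_mul,
    ← integral_add_right_eq_self (μ := (volume : Measure ℝ)) _ r]
  refine integral_congr_ae (Eventually.of_forall fun s => ?_)
  simp only [add_sub_cancel_right, smul_eq_mul, RCLike.inner_apply, conj_trivial, ← mul_assoc,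
    ← Complex.exp_add]
  congr 2
  push_cast
  ring

/-- If `∫ f(ζ) e^{2πirζ} dζ` vanishes for almost all `r > 0`, then so does the integral of `f`
against `1 / (2πζ - ρ)`, `Im ρ < 0`, because the latter is a superposition of the former
exponentials. -/
theorem integral_mul_inv_sub_eq_zero {f : ℝ → ℂ} (hf : Integrable f) {ρ : ℂ} (hρ : ρ.im < 0)
    (h : ∀ᵐ r : ℝ ∂(volume.restrict (Set.Ioi 0)),
      ∫ ζ : ℝ, f ζ * Complex.exp (2 * Real.pi * r * ζ * Complex.I) = 0) :
    ∫ ζ : ℝ, f ζ * (2 * Real.pi * ζ - ρ)⁻¹ = 0 := by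
  have h1 : ∀ ζ : ℝ, (2 * Real.pi * ζ - ρ)⁻¹ = -Complex.I *
      ∫ r in Set.Ioi (0 : ℝ), Complex.exp (Complex.I * (2 * Real.pi * ζ - ρ) * r) := by
    intro ζ
    have hre : (Complex.I * (2 * Real.pi * ζ - ρ)).re < 0 := by simpa using hρ
    have hne : (2 * Real.pi * ζ - ρ : ℂ) ≠ 0 := by
      intro h0; rw [h0] at hre; simp at hre
    rw [integral_exp_mul_complex_Ioi hre]
    simp only [Complex.ofReal_zero, mul_zero, Complex.exp_zero]
    field_simp
  have hnorm : ∀ ζ r : ℝ, ‖Complex.exp (Complex.I * (2 * Real.pi * ζ - ρ) * r)‖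
      = Real.exp (ρ.im * r) := by
    intro ζ r
    rw [Complex.norm_exp]; simp
  have hexp : IntegrableOn (fun r : ℝ => Real.exp (ρ.im * r)) (Set.Ioi 0) :=
    integrableOn_exp_mul_Ioi hρ 0
  have hint : Integrable (fun p : ℝ × ℝ => f p.1 *
      Complex.exp (Complex.I * (2 * Real.pi * p.1 - ρ) * p.2))
      (volume.prod (volume.restrict (Set.Ioi 0))) := by
    refine (hf.mul_prod (hexp.ofReal (𝕜 := ℂ))).mono ?_ (Eventually.of_forall fun p => ?_)
    · exact hf.1.comp_fst.mul (Continuous.aestronglyMeasurable (by fun_prop))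
    · rw [norm_mul, norm_mul, hnorm]
      refine le_of_eq ?_
      congr 1
      change _ = ‖((Real.exp (ρ.im * p.2) : ℝ) : ℂ)‖
      rw [Complex.norm_real, Real.norm_of_nonneg (Real.exp_pos _).le]
  simp_rw [h1]
  have h2 : ∀ ζ : ℝ, f ζ * (-Complex.I * ∫ r in Set.Ioi (0 : ℝ),
      Complex.exp (Complex.I * (2 * Real.pi * ζ - ρ) * r)) = -Complex.I *
      ∫ r in Set.Ioi (0 : ℝ), f ζ * Complex.exp (Complex.I * (2 * Real.pi * ζ - ρ) * r) := by
    intro ζ; rw [integral_const_mul]; ring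
  simp_rw [h2]
  rw [integral_const_mul, integral_integral_swap hint]
  have h3 : ∀ᵐ r : ℝ ∂(volume.restrict (Set.Ioi 0)),
      ∫ ζ : ℝ, f ζ * Complex.exp (Complex.I * (2 * Real.pi * ζ - ρ) * r) = 0 := by
    filter_upwards [h] with r hr
    have : ∀ ζ : ℝ, f ζ * Complex.exp (Complex.I * (2 * Real.pi * ζ - ρ) * r) =
        Complex.exp (-Complex.I * ρ * r) *
          (f ζ * Complex.exp (2 * Real.pi * r * ζ * Complex.I)) := by
      intro ζ
      rw [mul_left_comm, ← Complex.exp_add]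
      congr 2; ring
    simp_rw [this]
    rw [integral_const_mul, hr, mul_zero]
  rw [integral_congr_ae h3]
  simp

theorem norm_inv_sub_le {ρ : ℂ} (hρ : ρ.im < 0) (ζ : ℝ) :
    ‖(2 * Real.pi * ζ - ρ : ℂ)⁻¹‖ ≤ (-ρ.im)⁻¹ := by
  rw [norm_inv]
  refine inv_anti₀ (by linarith) ?_
  refine le_trans ?_ (Complex.abs_im_le_norm _)
  simp
  exact neg_le_abs _

/-- The function with Fourier transform `1 / (z - ρ)^j`, `Im ρ < 0`, is supported in the lower half
line, so that its pairing with a test function on `(0, ∞)` vanishes. The power is raised by one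
factor at a time, as a superposition of translates. -/
theorem integral_inv_pow_mul_fourierInv {ρ : ℂ} (hρ : ρ.im < 0) (j : ℕ) {ψ : ℝ → ℂ}
    (hψ : IsHalfLineTest ψ) :
    Integrable (fun ζ : ℝ => 𝓕⁻ ψ ζ * ((2 * Real.pi * ζ - ρ)⁻¹) ^ j) ∧
    ∫ ζ : ℝ, 𝓕⁻ ψ ζ * ((2 * Real.pi * ζ - ρ)⁻¹) ^ j = 0 := by
  have hI : ∀ (j : ℕ) {ψ : ℝ → ℂ}, IsHalfLineTest ψ →
      Integrable (fun ζ : ℝ => 𝓕⁻ ψ ζ * ((2 * Real.pi * ζ - ρ)⁻¹) ^ j) := by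
    intro j ψ hψ
    rw [hψ.fourierInv_eq]
    refine (𝓕⁻ hψ.schwartz).integrable.mul_bdd (c := ((-ρ.im)⁻¹) ^ j) ?_
      (Eventually.of_forall fun ζ => ?_)
    · exact (Measurable.aestronglyMeasurable (by fun_prop))
    · rw [norm_pow]
      exact pow_le_pow_left₀ (norm_nonneg _) (norm_inv_sub_le hρ ζ) j
  refine ⟨hI j hψ, ?_⟩
  induction j generalizing ψ with
  | zero =>
    simp only [pow_zero, mul_one]
    have h1 : 𝓕 (𝓕⁻ ψ) 0 = ψ 0 := by
      rw [hψ.fourierInv_eq, ← SchwartzMap.fourier_coe, FourierTransform.fourier_fourierInv_eq,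
        hψ.coe_schwartz]
    rw [Real.fourier_eq', hψ.eq_zero le_rfl] at h1
    simpa using h1
  | succ j ih =>
    have := integral_mul_inv_sub_eq_zero (hI j hψ) hρ ?_
    · simpa only [pow_succ, mul_assoc] using this
    · filter_upwards [ae_restrict_mem measurableSet_Ioi] with r hr
      have h2 := ih (hψ.comp_sub (le_of_lt hr))
      simp_rw [fourierInv_comp_sub] at h2
      rw [← h2]
      refine integral_congr_ae (Eventually.of_forall fun ζ => ?_)
      ring

/-- `W` is the Fourier transform of a function that vanishes on the half space `xₙ > 0`: for almost
every tangential frequency, its pairings with the test functions of `xₙ > 0` vanish. For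
square integrable `W` these integrals converge for almost every tangential frequency. -/
def Anticausal {d : ℕ} (W : Space (d + 1) → ℂ) : Prop :=
  ∀ ψ : ℝ → ℂ, IsHalfLineTest ψ → ∀ᵐ ξ : Space d, ∫ ζ : ℝ, W (glue ξ ζ) * 𝓕⁻ ψ ζ = 0

theorem ae_eq_zero_of_forall_halfLineTest {J : ℝ → ℂ} (hJ : MemLp J 2)
    (h : ∀ ψ : ℝ → ℂ, IsHalfLineTest ψ → ∫ s, J s * ψ s = 0) : ∀ᵐ s : ℝ, 0 < s → J s = 0 := by
  refine IsOpen.ae_eq_zero_of_integral_contDiff_smul_eq_zero isOpen_Ioi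
    (hJ.locallyIntegrable_two.locallyIntegrableOn _) fun g hg hgc hgs => ?_
  have hc : tsupport (fun s => (g s : ℂ)) ⊆ tsupport g :=
    closure_mono fun s hs h0 => hs (by simp [h0])
  rw [← h (fun s => (g s : ℂ)) ⟨Complex.ofRealCLM.contDiff.comp hg,
    hgc.comp_left (g := fun r : ℝ => (r : ℂ)) (by simp), hc.trans hgs⟩]
  simp [mul_comm]

theorem IsHalfLineTest.memLp_fourierInv {ψ : ℝ → ℂ} (hψ : IsHalfLineTest ψ) :
    MemLp (𝓕⁻ ψ) 2 := by
  rw [hψ.fourierInv_eq]; exact (𝓕⁻ hψ.schwartz).memLp 2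

/-- The half space support condition is seen by the Fourier transform frequency by frequency in the
tangential variables. Both conditions say that the pairings with the products `φ(x') ψ(xₙ)`, `ψ` a
test function on `(0, ∞)`, vanish; countably many `φ` suffice, which gives exceptional null sets
that do not depend on `φ`. -/
theorem anticausal_fourier_iff {d : ℕ} (V : Lp ℂ 2 (volume : Measure (Space (d + 1)))) :
    Anticausal ((𝓕 V : Lp ℂ 2 (volume : Measure (Space (d + 1)))) : Space (d + 1) → ℂ) ↔
      ∀ᵐ x : Space (d + 1), 0 < x (Fin.last d) → V x = 0 := by
  set W : Lp ℂ 2 (volume : Measure (Space (d + 1))) := 𝓕 V with hW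
  obtain ⟨φ, hφ⟩ := exists_schwartz_separating (Space d)
  have hleft : ∀ (φ : SchwartzMap (Space d) ℂ) {ψ : ℝ → ℂ} (hψ : IsHalfLineTest ψ),
      ∫ ξ, W ξ * tensor (𝓕⁻ (φ : Space d → ℂ)) (𝓕⁻ ψ) ξ =
        ∫ ξ, (∫ ζ, W (glue ξ ζ) * 𝓕⁻ ψ ζ) * 𝓕⁻ (φ : Space d → ℂ) ξ := by
    intro φ ψ hψ
    rw [integral_glue]
    · refine integral_congr_ae (Eventually.of_forall fun ξ => ?_)
      simp only [tensor_glue]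
      rw [← integral_mul_const]
      refine integral_congr_ae (Eventually.of_forall fun ζ => ?_)
      ring
    · refine (Lp.memLp W).integrable_mul (p := 2) (q := 2) (memLp_tensor ?_ hψ.memLp_fourierInv)
      rw [← SchwartzMap.fourierInv_coe]; exact (𝓕⁻ φ).memLp 2
  have hbase : ∀ (φ : SchwartzMap (Space d) ℂ) {ψ : ℝ → ℂ} (hψ : IsHalfLineTest ψ),
      ∫ x, V x * tensor φ ψ x = ∫ ξ, W ξ * tensor (𝓕⁻ (φ : Space d → ℂ)) (𝓕⁻ ψ) ξ :=
    fun φ ψ hψ => integral_mul_tensor V φ hψ.schwartz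
  constructor
  · intro h
    have h1 : ∀ j, ∀ᵐ s : ℝ, 0 < s → ∫ x', V (glue x' s) * φ j x' = 0 := by
      intro j
      have hm : MemLp (fun s : ℝ => ∫ x', V (glue x' s) * φ j x') 2 := by
        have h2 : MemLp (fun p : ℝ × Space d => V (glue p.2 p.1)) 2 (volume.prod volume) :=
          (memLp_glue (Lp.memLp V)).comp_measurePreserving Measure.measurePreserving_swap
        exact memLp_integral_mul_right h2 ((φ j).memLp 2)
      refine ae_eq_zero_of_forall_halfLineTest hm fun ψ hψ => ?_
      have h2 := hbase (φ j) hψ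
      have h5 : ∫ ξ, (∫ ζ, W (glue ξ ζ) * 𝓕⁻ ψ ζ) * 𝓕⁻ (φ j : Space d → ℂ) ξ = 0 := by
        refine integral_eq_zero_of_ae ?_
        filter_upwards [h ψ hψ] with ξ hξ
        simp [hξ]
      rw [hleft (φ j) hψ, h5, integral_glue'] at h2
      · rw [← h2]
        refine integral_congr_ae (Eventually.of_forall fun s => ?_)
        simp only [tensor_glue]
        rw [← integral_mul_const]
        refine integral_congr_ae (Eventually.of_forall fun x => ?_)
        ring
      · exact (Lp.memLp V).integrable_mul (p := 2) (q := 2)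
          (memLp_tensor ((φ j).memLp 2) hψ.memLp)
    have h3 : ∀ᵐ s : ℝ, ∀ᵐ x' : Space d, 0 < s → V (glue x' s) = 0 := by
      filter_upwards [ae_all_iff.2 h1, ae_memLp_glue' (Lp.memLp V)] with s hs hms
      by_cases h0 : 0 < s
      · filter_upwards [hφ _ hms fun j => hs j h0] with x hx _ using hx
      · exact Eventually.of_forall fun x h => absurd h h0
    have hmeas : MeasurableSet {x : Space (d + 1) | 0 < x (Fin.last d) → V x = 0} := by
      have e : {x : Space (d + 1) | 0 < x (Fin.last d) → V x = 0} =
          {x : Space (d + 1) | 0 < x (Fin.last d)}ᶜ ∪ {x | V x = 0} := by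
        ext x; simp [imp_iff_not_or]
      rw [e]
      refine MeasurableSet.union (MeasurableSet.compl ?_) ?_
      · exact measurableSet_lt measurable_const (by fun_prop)
      · exact measurableSet_eq_fun (Lp.stronglyMeasurable V).measurable measurable_const
    rw [← ae_glue_iff]
    have hmeas2 : MeasurableSet {p : Space d × ℝ | 0 < p.2 → V (glue p.1 p.2) = 0} := by
      simpa using (glueEquiv d).measurable hmeas
    have h4 : ∀ᵐ p : Space d × ℝ, 0 < p.2 → V (glue p.1 p.2) = 0 :=
      (Measure.ae_prod_iff_ae_ae hmeas2).2 ((Measure.ae_ae_comm hmeas2).2 h3)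
    simpa using h4
  · intro h ψ hψ
    have hm : MemLp (fun ξ : Space d => ∫ ζ, W (glue ξ ζ) * 𝓕⁻ ψ ζ) 2 :=
      memLp_integral_mul_right (memLp_glue (Lp.memLp W)) hψ.memLp_fourierInv
    refine hφ _ hm fun j => ?_
    have h1 := hleft (𝓕 (φ j)) hψ
    have e : 𝓕⁻ ((𝓕 (φ j) : SchwartzMap (Space d) ℂ) : Space d → ℂ) = φ j := by
      rw [← SchwartzMap.fourierInv_coe, FourierTransform.fourierInv_fourier_eq]
    rw [e] at h1
    rw [← h1, ← e, ← hbase _ hψ]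
    refine integral_eq_zero_of_ae ?_
    filter_upwards [h] with x hx
    by_cases h0 : 0 < x (Fin.last d)
    · simp [hx h0]
    · simp [tensor, hψ.eq_zero (not_lt.1 h0)]

/-- Multiplication by `1 / (z - ρ)` with `Im ρ < 0` preserves the functions supported in the lower
half space: it is a superposition of translations towards it. -/
theorem Anticausal.mul_inv_sub {d : ℕ} {W : Space (d + 1) → ℂ} (hW : StronglyMeasurable W)
    (hW2 : MemLp W 2) (h : Anticausal W) {ρ : Space d → ℂ} (hρ : ∀ ξ, (ρ ξ).im < 0) :
    Anticausal fun η => (2 * Real.pi * η (Fin.last d) - ρ (tang η))⁻¹ * W η := by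
  intro ψ hψ
  have h1 : ∀ᵐ r : ℝ ∂(volume.restrict (Set.Ioi 0)), ∀ᵐ ξ : Space d,
      ∫ ζ : ℝ, W (glue ξ ζ) * 𝓕⁻ ψ ζ * Complex.exp (2 * Real.pi * r * ζ * Complex.I) = 0 := by
    filter_upwards [ae_restrict_mem measurableSet_Ioi] with r hr
    filter_upwards [h _ (hψ.comp_sub (le_of_lt hr))] with ξ hξ
    simp_rw [fourierInv_comp_sub] at hξ
    rw [← hξ]
    refine integral_congr_ae (Eventually.of_forall fun ζ => ?_)
    ring
  have hχ : Continuous (𝓕⁻ ψ) := by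
    rw [hψ.fourierInv_eq]; exact (𝓕⁻ hψ.schwartz).continuous
  have hm : StronglyMeasurable fun p : ℝ × Space d => ∫ ζ : ℝ,
      W (glue p.2 ζ) * 𝓕⁻ ψ ζ * Complex.exp (2 * Real.pi * p.1 * ζ * Complex.I) := by
    have h2 : StronglyMeasurable fun q : (ℝ × Space d) × ℝ =>
        W (glue q.1.2 q.2) * 𝓕⁻ ψ q.2 * Complex.exp (2 * Real.pi * q.1.1 * q.2 * Complex.I) := by
      refine StronglyMeasurable.mul (StronglyMeasurable.mul ?_ ?_) ?_
      · exact hW.comp_measurable (continuous_glue.measurable.comp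
          ((measurable_snd.comp measurable_fst).prodMk measurable_snd))
      · exact (hχ.comp continuous_snd).stronglyMeasurable
      · exact Continuous.stronglyMeasurable (by fun_prop)
    exact h2.integral_prod_right
  have h2 := (Measure.ae_ae_comm (p := fun (r : ℝ) (ξ : Space d) => ∫ ζ : ℝ,
    W (glue ξ ζ) * 𝓕⁻ ψ ζ * Complex.exp (2 * Real.pi * r * ζ * Complex.I) = 0)
    (hm.measurable (measurableSet_singleton 0))).1 h1
  filter_upwards [h2, ae_memLp_glue hW2] with ξ hξ hξ2
  have h3 := integral_mul_inv_sub_eq_zero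
    (hξ2.integrable_mul (p := 2) (q := 2) hψ.memLp_fourierInv) (hρ ξ) hξ
  rw [← h3]
  refine integral_congr_ae (Eventually.of_forall fun ζ => ?_)
  simp only [glue_last, tang_glue, Pi.mul_apply]
  ring

/-! ### Restriction to the half cylinder -/

section Restriction

variable {T : ℝ} [hT : Fact (0 < T)]

theorem measurableSet_Gplus (T : ℝ) (d : ℕ) : MeasurableSet (Gplus T d) := by
  refine measurableSet_lt measurable_const ?_
  have : Measurable fun x : Space (d + 1) => x (Fin.last d) := by fun_prop
  exact this.comp measurable_snd

theorem restr_ae_eq {d : ℕ} (F : L2 T (d + 1)) :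
    restr F =ᵐ[(volume : Measure (Cyl T (d + 1))).restrict (Gplus T d)] F :=
  LpToLpRestrictCLM_coeFn ℂ (Gplus T d) F

theorem restr_sub {d : ℕ} (F G : L2 T (d + 1)) : restr (F - G) = restr F - restr G :=
  map_sub _ F G

theorem restr_eq_zero_iff {d : ℕ} (F : L2 T (d + 1)) :
    restr F = 0 ↔ ∀ᵐ p : Cyl T (d + 1), p ∈ Gplus T d → F p = 0 := by
  rw [← ae_restrict_iff' (measurableSet_Gplus T d)]
  constructor
  · intro h
    have h1 := restr_ae_eq F
    rw [h] at h1
    filter_upwards [h1, Lp.coeFn_zero ℂ 2 ((volume : Measure (Cyl T (d + 1))).restrict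
      (Gplus T d))] with p hp hp0
    rw [← hp, hp0]; rfl
  · intro h
    refine Lp.ext ?_
    filter_upwards [restr_ae_eq F, h, Lp.coeFn_zero ℂ 2
      ((volume : Measure (Cyl T (d + 1))).restrict (Gplus T d))] with p hp h1 hp0
    rw [hp, h1, hp0]; rfl

theorem restr_surjective {d : ℕ} (u : L2plus T d) : ∃ F : L2 T (d + 1), restr F = u := by
  have h : MemLp ((Gplus T d).indicator u) 2 :=
    (memLp_indicator_iff_restrict (measurableSet_Gplus T d)).2 (Lp.memLp u)
  refine ⟨h.toLp _, Lp.ext ((restr_ae_eq _).trans ?_)⟩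
  filter_upwards [ae_restrict_of_ae h.coeFn_toLp, ae_restrict_mem (measurableSet_Gplus T d)]
    with p hp hpm
  rw [hp, Set.indicator_of_mem hpm]

theorem restr_eq_zero_iff_timeCoeff {d : ℕ} (F : L2 T (d + 1)) :
    restr F = 0 ↔ ∀ k, ∀ᵐ x : Space (d + 1), 0 < x (Fin.last d) → timeCoeff F k x = 0 := by
  rw [restr_eq_zero_iff]
  constructor
  · intro h k
    filter_upwards [ae_ae_swap h] with x hx h0
    have : (fun t : AddCircle T => F (t, x)) =ᵐ[AddCircle.haarAddCircle] 0 := by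
      refine ae_volume_addCircle_iff.1 ?_
      filter_upwards [hx] with t ht using ht h0
    rw [timeCoeff, fourierCoeff_congr_ae this]
    simp [fourierCoeff]
  · intro h
    have hm : MeasurableSet {p : Cyl T (d + 1) | p ∈ Gplus T d → F p = 0} := by
      have e : {p : Cyl T (d + 1) | p ∈ Gplus T d → F p = 0} =
          (Gplus T d)ᶜ ∪ {p | F p = 0} := by
        ext p; simp [imp_iff_not_or]
      rw [e]
      exact (measurableSet_Gplus T d).compl.union
        (measurableSet_eq_fun (Lp.stronglyMeasurable F).measurable measurable_const)
    refine ae_of_ae_ae_swap hm ?_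
    filter_upwards [ae_all_iff.2 h, ae_memLp_slice (Lp.memLp F)] with x hx hx2
    by_cases h0 : 0 < x (Fin.last d)
    · have h1 := tsum_enorm_sq_fourierCoeff hx2
      have h2 : ∀ k, fourierCoeff (fun t : AddCircle T => F (t, x)) k = 0 := fun k => hx k h0
      simp only [h2, enorm_zero, ne_eq, OfNat.ofNat_ne_zero, not_false_eq_true, zero_pow,
        tsum_zero, mul_zero] at h1
      rw [eq_comm, lintegral_eq_zero_iff' (((memLp_haarAddCircle_iff.1 hx2).1.enorm.pow_const 2))]
        at h1
      filter_upwards [h1] with t ht _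
      simpa using ht
    · exact Eventually.of_forall fun t ht => absurd ht h0

/-- Whether an element of `L²` vanishes on the half cylinder can be read off its Fourier
transform. -/
theorem restr_eq_zero_iff_anticausal {d : ℕ} (F : L2 T (d + 1)) :
    restr F = 0 ↔ ∀ k, Anticausal (fourierG F k : Space (d + 1) → ℂ) := by
  rw [restr_eq_zero_iff_timeCoeff]
  refine forall_congr' fun k => ?_
  rw [fourierG, anticausal_fourier_iff]
  refine ⟨fun h => ?_, fun h => ?_⟩ <;>
    filter_upwards [h, (memLp_timeCoeff F k).coeFn_toLp] with x hx hx2 h0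
  · rw [hx2, hx h0]
  · rw [← hx2, hx h0]

theorem Anticausal.congr {d : ℕ} {W W' : Space (d + 1) → ℂ} (h : Anticausal W)
    (hW : W =ᵐ[volume] W') : Anticausal W' := by
  intro ψ hψ
  filter_upwards [h ψ hψ, ae_ae_glue hW] with ξ hξ h2
  rw [← hξ]
  refine integral_congr_ae ?_
  filter_upwards [h2] with ζ hζ
  rw [hζ]

theorem anticausal_of_ae_zero {d : ℕ} {W : Space (d + 1) → ℂ} (hW : W =ᵐ[volume] 0) :
    Anticausal W := by
  refine Anticausal.congr (W := 0) (fun ψ hψ => Eventually.of_forall fun ξ => ?_) hW.symm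
  simp

end Restriction

/-! ### Partial Fourier transform and traces -/

/-- The function `1 / (1 + iζ)`. -/
def cauchyKernel (ζ : ℝ) : ℂ := (1 + Complex.I * ζ)⁻¹

theorem one_add_I_mul_ne_zero (ζ : ℝ) : (1 + Complex.I * ζ : ℂ) ≠ 0 := by
  intro h
  have := congrArg Complex.re h
  simp at this

theorem norm_cauchyKernel_sq (ζ : ℝ) : ‖cauchyKernel ζ‖ ^ 2 = (1 + ζ ^ 2)⁻¹ := by
  rw [cauchyKernel, norm_inv, inv_pow, ← Complex.normSq_eq_norm_sq, Complex.normSq_apply]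
  simp [sq]

theorem continuous_cauchyKernel : Continuous cauchyKernel :=
  Continuous.inv₀ (by fun_prop) one_add_I_mul_ne_zero

theorem memLp_cauchyKernel : MemLp cauchyKernel 2 := by
  rw [memLp_two_iff_integrable_sq_norm continuous_cauchyKernel.aestronglyMeasurable]
  simp_rw [norm_cauchyKernel_sq]
  exact integrable_inv_one_add_sq

theorem norm_exp_char (s ζ : ℝ) : ‖Complex.exp (2 * Real.pi * s * ζ * Complex.I)‖ = 1 := by
  have := Complex.norm_exp_ofReal_mul_I (2 * Real.pi * s * ζ)
  push_cast at this; exact this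

theorem memLp_exp_mul_cauchyKernel (s : ℝ) :
    MemLp (fun ζ : ℝ => cauchyKernel ζ * Complex.exp (2 * Real.pi * s * ζ * Complex.I)) 2 := by
  refine memLp_cauchyKernel.of_le ?_ (Eventually.of_forall fun ζ => ?_)
  · exact (continuous_cauchyKernel.mul (by fun_prop)).aestronglyMeasurable
  · rw [norm_mul, norm_exp_char, mul_one]

theorem memLp_one_add_mul {d : ℕ} {W : Space (d + 1) → ℂ} (hW : MemLp W 2)
    (hW' : MemLp (fun η => (η (Fin.last d) : ℂ) * W η) 2) :
    MemLp (fun η => (1 + Complex.I * η (Fin.last d)) * W η) 2 := by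
  have := hW.add (hW'.const_mul Complex.I)
  refine (memLp_congr_ae (Eventually.of_forall fun η => ?_)).1 this
  simp; ring

theorem cauchyKernel_mul {d : ℕ} (W : Space (d + 1) → ℂ) (ξ : Space d) (ζ : ℝ) :
    cauchyKernel ζ * ((1 + Complex.I * (glue ξ ζ) (Fin.last d)) * W (glue ξ ζ)) =
      W (glue ξ ζ) := by
  rw [glue_last, cauchyKernel, ← mul_assoc, inv_mul_cancel₀ (one_add_I_mul_ne_zero ζ), one_mul]

theorem integrable_tensor_mul {d : ℕ} {W : Space (d + 1) → ℂ} (hW : MemLp W 2)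
    (hW' : MemLp (fun η => (η (Fin.last d) : ℂ) * W η) 2) {φ : Space d → ℂ} (hφ : MemLp φ 2) :
    Integrable fun η => φ (tang η) * W η := by
  have h := (memLp_tensor hφ memLp_cauchyKernel).integrable_mul (p := 2) (q := 2)
    (memLp_one_add_mul hW hW')
  refine h.congr (Eventually.of_forall fun η => ?_)
  obtain ⟨⟨ξ, ζ⟩, rfl⟩ := (glueEquiv d).surjective η
  simp only [Pi.mul_apply, glueEquiv_apply, tensor_glue, tang_glue]
  rw [mul_assoc, cauchyKernel_mul]

theorem memLp_partial_fourier {d : ℕ} {W : Space (d + 1) → ℂ} (hW : MemLp W 2)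
    (hW' : MemLp (fun η => (η (Fin.last d) : ℂ) * W η) 2) (s : ℝ) :
    MemLp (fun ξ : Space d => ∫ ζ : ℝ, W (glue ξ ζ) *
      Complex.exp (2 * Real.pi * s * ζ * Complex.I)) 2 := by
  have h := memLp_integral_mul_right (memLp_glue (memLp_one_add_mul hW hW'))
    (memLp_exp_mul_cauchyKernel s)
  refine (memLp_congr_ae (Eventually.of_forall fun ξ => ?_)).1 h
  refine integral_congr_ae (Eventually.of_forall fun ζ => ?_)
  simp only
  conv_rhs => rw [← cauchyKernel_mul W]
  ring

/-- The Fourier transform of a slice `V(·, s)` is the inverse Fourier transform of `V̂` in the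
normal frequency. The integral converges absolutely, since `(1 + iζ) V̂` and `1 / (1 + iζ)` are
square integrable in `ζ`. The identity is tested against countably many Schwartz functions of `x'`,
for each of which both sides agree as functions of `s`. -/
theorem fourier_slice {d : ℕ} (V : Lp ℂ 2 (volume : Measure (Space (d + 1))))
    (hV : MemLp (fun η => (η (Fin.last d) : ℂ) *
      (𝓕 V : Lp ℂ 2 (volume : Measure (Space (d + 1)))) η) 2) :
    ∀ᵐ s : ℝ, ∃ h : MemLp (fun x' : Space d => V (glue x' s)) 2,
      (𝓕 (h.toLp _) : Lp ℂ 2 (volume : Measure (Space d))) =ᵐ[volume] fun ξ =>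
        ∫ ζ : ℝ, (𝓕 V : Lp ℂ 2 (volume : Measure (Space (d + 1)))) (glue ξ ζ) *
          Complex.exp (2 * Real.pi * s * ζ * Complex.I) := by
  set W : Lp ℂ 2 (volume : Measure (Space (d + 1))) := 𝓕 V with hWdef
  have hW := Lp.memLp W
  obtain ⟨φ, hφ⟩ := exists_schwartz_separating (Space d)
  have hint : ∀ j, Integrable fun η => φ j (tang η) * W η := fun j =>
    integrable_tensor_mul hW hV ((φ j).memLp 2)
  have hJ2 : ∀ j, Continuous fun s : ℝ => ∫ η : Space (d + 1), φ j (tang η) * W η *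
      Complex.exp (2 * Real.pi * s * η (Fin.last d) * Complex.I) := by
    intro j
    refine continuous_of_dominated (bound := fun η => ‖φ j (tang η) * W η‖) (fun s => ?_)
      (fun s => Eventually.of_forall fun η => ?_) (hint j).norm
      (Eventually.of_forall fun η => by fun_prop)
    · exact (hint j).1.mul (Continuous.aestronglyMeasurable (by fun_prop))
    · rw [norm_mul, norm_exp_char, mul_one]
  -- for a fixed test function of `x'`, the identity holds as an identity of functions of `s`
  have key : ∀ j, ∀ᵐ s : ℝ, ∫ x', V (glue x' s) * (𝓕 (φ j) : SchwartzMap (Space d) ℂ) x' =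
      ∫ η : Space (d + 1), φ j (tang η) * W η *
        Complex.exp (2 * Real.pi * s * η (Fin.last d) * Complex.I) := by
    intro j
    have hm : MemLp (fun s : ℝ => ∫ x', V (glue x' s) *
        (𝓕 (φ j) : SchwartzMap (Space d) ℂ) x') 2 := by
      have h2 : MemLp (fun p : ℝ × Space d => V (glue p.2 p.1)) 2 (volume.prod volume) :=
        (memLp_glue (Lp.memLp V)).comp_measurePreserving Measure.measurePreserving_swap
      exact memLp_integral_mul_right h2 ((𝓕 (φ j)).memLp 2)
    refine ae_eq_of_integral_contDiff_smul_eq hm.locallyIntegrable_two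
      (hJ2 j).locallyIntegrable fun g hg hgc => ?_
    have hs : HasCompactSupport fun x => (g x : ℂ) :=
      hgc.comp_left (g := fun r : ℝ => (r : ℂ)) (by simp)
    have hd : ContDiff ℝ ∞ fun x => (g x : ℂ) := Complex.ofRealCLM.contDiff.comp hg
    set ψ : SchwartzMap ℝ ℂ := hs.toSchwartzMap hd with hψ
    have hψx : ∀ x, ψ x = (g x : ℂ) := fun x => rfl
    have h1 := integral_mul_tensor V (𝓕 (φ j)) ψ
    have e : 𝓕⁻ ((𝓕 (φ j) : SchwartzMap (Space d) ℂ) : Space d → ℂ) = φ j := by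
      rw [← SchwartzMap.fourierInv_coe, FourierTransform.fourierInv_fourier_eq]
    rw [e, integral_glue'] at h1
    · have hl : ∫ s : ℝ, g s • ∫ x', V (glue x' s) * (𝓕 (φ j) : SchwartzMap (Space d) ℂ) x' =
          ∫ s : ℝ, ∫ x' : Space d, V (glue x' s) *
            tensor (𝓕 (φ j) : SchwartzMap (Space d) ℂ) ψ (glue x' s) := by
        refine integral_congr_ae (Eventually.of_forall fun s => ?_)
        simp only [tensor_glue, Complex.real_smul]
        rw [← integral_const_mul]
        refine integral_congr_ae (Eventually.of_forall fun x => ?_)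
        simp only [hψx]
        ring
      rw [hl, h1]
      have hsw : Integrable (fun p : Space (d + 1) × ℝ => φ j (tang p.1) * W p.1 *
          (Complex.exp (2 * Real.pi * p.2 * p.1 (Fin.last d) * Complex.I) * ψ p.2))
          (volume.prod volume) := by
        refine ((hint j).mul_prod ψ.integrable).mono ?_ (Eventually.of_forall fun p => ?_)
        · refine (hint j).1.comp_fst.mul ((Continuous.aestronglyMeasurable ?_).mul
            ψ.integrable.1.comp_snd)
          have : Continuous fun p : Space (d + 1) × ℝ => p.1 (Fin.last d) := by fun_prop
          fun_prop
        · rw [norm_mul, norm_mul (Complex.exp _), norm_exp_char, one_mul, norm_mul (_ * _)]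
      have hr : ∀ s : ℝ, g s • ∫ η : Space (d + 1), φ j (tang η) * W η *
          Complex.exp (2 * Real.pi * s * η (Fin.last d) * Complex.I) =
          ∫ η : Space (d + 1), φ j (tang η) * W η *
            (Complex.exp (2 * Real.pi * s * η (Fin.last d) * Complex.I) * ψ s) := by
        intro s
        rw [Complex.real_smul, ← integral_const_mul]
        refine integral_congr_ae (Eventually.of_forall fun x => ?_)
        simp only [hψx]
        ring
      simp_rw [hr]
      rw [← integral_integral_swap hsw]
      refine integral_congr_ae (Eventually.of_forall fun η => ?_)
      simp only
      rw [integral_const_mul, tensor, Real.fourierInv_eq']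
      simp only [smul_eq_mul, RCLike.inner_apply, conj_trivial]
      rw [mul_comm (φ j (tang η)) (W η), mul_assoc]
      congr 2
      refine integral_congr_ae (Eventually.of_forall fun s => ?_)
      simp only
      congr 2
      push_cast
      ring
    · exact (Lp.memLp V).integrable_mul (p := 2) (q := 2)
        (memLp_tensor ((𝓕 (φ j)).memLp 2) (ψ.memLp 2))
  filter_upwards [ae_all_iff.2 key, ae_memLp_glue' (Lp.memLp V)] with s hs hms
  refine ⟨hms, ?_⟩
  have hM := memLp_partial_fourier hW hV s
  have hdiff := hφ _ ((Lp.memLp (𝓕 (hms.toLp _) : Lp ℂ 2 (volume : Measure (Space d)))).sub hM)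
    fun j => ?_
  · filter_upwards [hdiff] with ξ hξ
    exact sub_eq_zero.1 hξ
  · simp only [Pi.sub_apply, sub_mul]
    have hI1 : Integrable fun x => (𝓕 (hms.toLp _) : Lp ℂ 2 (volume : Measure (Space d))) x *
        φ j x := (Lp.memLp _).integrable_mul (p := 2) (q := 2) ((φ j).memLp 2)
    have hI2 : Integrable fun ξ => (∫ ζ : ℝ, W (glue ξ ζ) *
        Complex.exp (2 * Real.pi * s * ζ * Complex.I)) * φ j ξ :=
      hM.integrable_mul (p := 2) (q := 2) ((φ j).memLp 2)
    rw [integral_sub hI1 hI2, sub_eq_zero, integral_fourier_mul_schwartz]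
    have h1 : ∫ x, (hms.toLp _) x * 𝓕 (φ j : Space d → ℂ) x =
        ∫ x', V (glue x' s) * (𝓕 (φ j) : SchwartzMap (Space d) ℂ) x' := by
      refine integral_congr_ae ?_
      filter_upwards [hms.coeFn_toLp] with x hx
      rw [hx, SchwartzMap.fourier_coe]
    rw [h1, hs j, integral_glue]
    · refine integral_congr_ae (Eventually.of_forall fun ξ => ?_)
      simp only [tang_glue, glue_last]
      rw [← integral_mul_const]
      refine integral_congr_ae (Eventually.of_forall fun ζ => ?_)
      ring
    · refine (hint j).mono ((hint j).1.mul (Continuous.aestronglyMeasurable (by fun_prop)))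
        (Eventually.of_forall fun η => ?_)
      rw [norm_mul, norm_exp_char, mul_one]

/-! ### Traces on the boundary -/

section Trace

variable (T : ℝ)

/-- The splitting `((t, x'), xₙ) ↦ (t, x)` as a measurable equivalence. -/
def cylGlueEquiv (d : ℕ) : Cyl T d × ℝ ≃ᵐ Cyl T (d + 1) :=
  MeasurableEquiv.prodAssoc.trans
    (MeasurableEquiv.prodCongr (MeasurableEquiv.refl (AddCircle T)) (glueEquiv d))

theorem measurePreserving_cylGlue [Fact (0 < T)] (d : ℕ) :
    MeasurePreserving (cylGlueEquiv T d) ((volume : Measure (Cyl T d)).prod volume) volume := by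
  have h1 := measurePreserving_prodAssoc (volume : Measure (AddCircle T))
    (volume : Measure (Space d)) (volume : Measure ℝ)
  have h2 := (MeasurePreserving.id (volume : Measure (AddCircle T))).prod
    (measurePreserving_glue d)
  exact h2.comp h1

variable {T} [hT : Fact (0 < T)]

theorem ae_ae_cylGlue {d : ℕ} {p : Cyl T (d + 1) → Prop} (h : ∀ᵐ q, p q) :
    ∀ᵐ s : ℝ, ∀ᵐ y : Cyl T d, p (y.1, glue y.2 s) := by
  have h1 := (measurePreserving_cylGlue T d).quasiMeasurePreserving.ae h
  exact Measure.ae_ae_of_ae_prod (Measure.measurePreserving_swap (μ := (volume : Measure ℝ))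
    (ν := (volume : Measure (Cyl T d))).quasiMeasurePreserving.ae h1)

theorem ae_memLp_cylGlue {d : ℕ} {f : Cyl T (d + 1) → ℂ} (hf : MemLp f 2) :
    ∀ᵐ s : ℝ, MemLp (fun y : Cyl T d => f (y.1, glue y.2 s)) 2 := by
  have hg : MemLp (fun p : ℝ × Cyl T d => f (p.2.1, glue p.2.2 p.1)) 2 (volume.prod volume) :=
    (hf.comp_measurePreserving (measurePreserving_cylGlue T d)).comp_measurePreserving
      Measure.measurePreserving_swap
  have h1 := (memLp_two_iff_lintegral hg.1).1 hg
  rw [lintegral_prod _ (hg.1.enorm.pow_const 2)] at h1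
  have h2 := ae_lt_top' (hg.1.enorm.pow_const 2).lintegral_prod_right' h1.ne
  filter_upwards [h2, hg.1.prodMk_left] with x hx hx2
  exact (memLp_two_iff_lintegral hx2).2 hx

theorem measurable_slice_dist {d : ℕ} {u : Cyl T (d + 1) → ℂ} (hu : StronglyMeasurable u)
    (g : L2 T d) : Measurable fun p : ℝ × Cyl T d =>
      ‖u (p.2.1, glue p.2.2 p.1) - g p.2‖ₑ ^ 2 := by
  have h1 : Measurable fun p : ℝ × Cyl T d => ((p.2.1, glue p.2.2 p.1) : Cyl T (d + 1)) :=
    (cylGlueEquiv T d).measurable.comp measurable_swap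
  exact ((hu.measurable.comp h1).sub
    ((Lp.stronglyMeasurable g).measurable.comp measurable_snd)).enorm.pow_const 2

theorem enorm_sub_sq_le (a b c : ℂ) : ‖a - b‖ₑ ^ 2 ≤ 2 * ‖c - a‖ₑ ^ 2 + 2 * ‖c - b‖ₑ ^ 2 := by
  have h : ‖a - b‖ ^ 2 ≤ 2 * ‖c - a‖ ^ 2 + 2 * ‖c - b‖ ^ 2 := by
    have h1 : ‖a - b‖ ≤ ‖c - a‖ + ‖c - b‖ := by
      have : a - b = (c - b) - (c - a) := by ring
      rw [this]; linarith [norm_sub_le (c - b) (c - a)]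
    nlinarith [sq_nonneg (‖c - a‖ - ‖c - b‖), norm_nonneg (a - b)]
  have h2 := ENNReal.ofReal_le_ofReal h
  rw [ENNReal.ofReal_add (by positivity) (by positivity), ENNReal.ofReal_mul (by norm_num),
    ENNReal.ofReal_mul (by norm_num)] at h2
  simpa [ENNReal.ofReal_pow] using h2

/-- The constant `‖g - h‖²` is at most twice the sum of the means of `‖u(·, ·, s) - g‖²` and of
`‖u(·, ·, s) - h‖²` over `0 < s < ε`, which tend to zero. -/
theorem HasTrace.unique {d : ℕ} {u : L2plus T d} {g h : L2 T d} (hg : HasTrace u g)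
    (hh : HasTrace u h) : g = h := by
  have hmg := measurable_slice_dist (Lp.stronglyMeasurable u) g
  have hmh := measurable_slice_dist (Lp.stronglyMeasurable u) h
  have hle : ∀ ε : ℝ, 0 < ε → ∫⁻ y, ‖g y - h y‖ₑ ^ 2 ≤
      2 * ((ENNReal.ofReal ε)⁻¹ * ∫⁻ s in Set.Ioo 0 ε, ∫⁻ y : Cyl T d,
        ‖u (y.1, glue y.2 s) - g y‖ₑ ^ 2) + 2 * ((ENNReal.ofReal ε)⁻¹ *
        ∫⁻ s in Set.Ioo 0 ε, ∫⁻ y : Cyl T d, ‖u (y.1, glue y.2 s) - h y‖ₑ ^ 2) := by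
    intro ε hε
    have h1 : ∀ s : ℝ, ∫⁻ y, ‖g y - h y‖ₑ ^ 2 ≤
        2 * (∫⁻ y : Cyl T d, ‖u (y.1, glue y.2 s) - g y‖ₑ ^ 2) +
        2 * ∫⁻ y : Cyl T d, ‖u (y.1, glue y.2 s) - h y‖ₑ ^ 2 := by
      intro s
      rw [← lintegral_const_mul' _ _ (by norm_num), ← lintegral_const_mul' _ _ (by norm_num),
        ← lintegral_add_left (Measurable.const_mul
          (f := fun y : Cyl T d => ‖u (y.1, glue y.2 s) - g y‖ₑ ^ 2)
          (hmg.comp measurable_prodMk_left) 2)]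
      exact lintegral_mono fun y => enorm_sub_sq_le _ _ _
    have h2 : (ENNReal.ofReal ε) * ∫⁻ y, ‖g y - h y‖ₑ ^ 2 ≤
        2 * (∫⁻ s in Set.Ioo 0 ε, ∫⁻ y : Cyl T d, ‖u (y.1, glue y.2 s) - g y‖ₑ ^ 2) +
        2 * ∫⁻ s in Set.Ioo 0 ε, ∫⁻ y : Cyl T d, ‖u (y.1, glue y.2 s) - h y‖ₑ ^ 2 := by
      have h3 : (ENNReal.ofReal ε) * ∫⁻ y, ‖g y - h y‖ₑ ^ 2 =
          ∫⁻ _ in Set.Ioo 0 ε, ∫⁻ y, ‖g y - h y‖ₑ ^ 2 := by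
        rw [lintegral_const, Measure.restrict_apply_univ, Real.volume_Ioo, sub_zero, mul_comm]
      rw [h3, ← lintegral_const_mul' _ _ (by norm_num), ← lintegral_const_mul' _ _ (by norm_num),
        ← lintegral_add_left ((hmg.lintegral_prod_right').const_mul 2)]
      exact lintegral_mono fun s => h1 s
    have h0 : ENNReal.ofReal ε ≠ 0 := by simpa using hε
    calc ∫⁻ y, ‖g y - h y‖ₑ ^ 2
        = (ENNReal.ofReal ε)⁻¹ * ((ENNReal.ofReal ε) * ∫⁻ y, ‖g y - h y‖ₑ ^ 2) := by
          rw [← mul_assoc, ENNReal.inv_mul_cancel h0 ENNReal.ofReal_ne_top, one_mul]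
      _ ≤ _ := by
          refine (mul_le_mul_right h2 _).trans (le_of_eq ?_)
          rw [mul_add]; ring
  have hz : ∫⁻ y, ‖g y - h y‖ₑ ^ 2 = 0 := by
    have hlim := (ENNReal.Tendsto.const_mul hg (Or.inr (by norm_num : (2 : ENNReal) ≠ ⊤))).add
      (ENNReal.Tendsto.const_mul hh (Or.inr (by norm_num : (2 : ENNReal) ≠ ⊤)))
    simp only [mul_zero, add_zero] at hlim
    refine le_antisymm (ge_of_tendsto hlim ?_) bot_le
    filter_upwards [self_mem_nhdsWithin] with ε hε using hle ε hε
  rw [lintegral_eq_zero_iff' (f := fun y => ‖g y - h y‖ₑ ^ 2)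
    (((Lp.memLp g).1.sub (Lp.memLp h).1).enorm.pow_const 2)] at hz
  refine Lp.ext ?_
  filter_upwards [hz] with y hy
  simpa [sub_eq_zero] using hy

/-- The modulus of continuity `∫ |e^{2πisζ} - 1|² / (1 + ζ²) dζ`. -/
def slabModulus (s : ℝ) : ENNReal :=
  ∫⁻ ζ : ℝ, ‖cauchyKernel ζ * (Complex.exp (2 * Real.pi * s * ζ * Complex.I) - 1)‖ₑ ^ 2

theorem tendsto_slabModulus : Tendsto slabModulus (𝓝 0) (𝓝 0) := by
  have h := tendsto_lintegral_filter_of_dominated_convergence (μ := (volume : Measure ℝ))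
    (l := 𝓝 (0 : ℝ)) (F := fun s ζ =>
      ‖cauchyKernel ζ * (Complex.exp (2 * Real.pi * s * ζ * Complex.I) - 1)‖ₑ ^ 2)
    (f := fun _ => 0) (fun ζ => 4 * ‖cauchyKernel ζ‖ₑ ^ 2) ?_ ?_ ?_ ?_
  · rw [lintegral_zero] at h; exact h
  · exact Eventually.of_forall fun s => ((continuous_cauchyKernel.mul
      (by fun_prop)).measurable).enorm.pow_const 2
  · refine Eventually.of_forall fun s => Eventually.of_forall fun ζ => ?_
    have h1 : ‖Complex.exp (2 * Real.pi * s * ζ * Complex.I) - 1‖ ≤ 2 := by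
      have := norm_sub_le (Complex.exp (2 * Real.pi * s * ζ * Complex.I)) 1
      rw [norm_exp_char, norm_one] at this
      linarith
    have h2 : ‖Complex.exp (2 * Real.pi * s * ζ * Complex.I) - 1‖ₑ ≤ 2 := by
      rw [← ofReal_norm]
      exact (ENNReal.ofReal_le_ofReal h1).trans (by simp)
    rw [enorm_mul, mul_pow, mul_comm]
    gcongr
    exact (pow_le_pow_left₀ zero_le h2 2).trans (by norm_num)
  · rw [lintegral_const_mul' _ _ (by norm_num)]
    exact ENNReal.mul_ne_top (by norm_num)
      ((memLp_two_iff_lintegral memLp_cauchyKernel.1).1 memLp_cauchyKernel).ne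
  · refine Eventually.of_forall fun ζ => ?_
    have hc : Continuous fun s : ℝ =>
        ‖cauchyKernel ζ * (Complex.exp (2 * Real.pi * s * ζ * Complex.I) - 1)‖ₑ ^ 2 := by
      have : Continuous fun s : ℝ =>
        cauchyKernel ζ * (Complex.exp (2 * Real.pi * s * ζ * Complex.I) - 1) := by fun_prop
      exact (ENNReal.continuous_pow 2).comp this.enorm
    have := hc.tendsto 0
    simpa using this

/-- A modulus of continuity at `s = 0` that holds for almost all slices gives the trace in the mean.
-/
theorem hasTrace_of_le {d : ℕ} {u : L2plus T d} {g : L2 T d} {K : ENNReal} (hK : K ≠ ⊤)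
    (h : ∀ᵐ s : ℝ, 0 < s →
      ∫⁻ y : Cyl T d, ‖u (y.1, glue y.2 s) - g y‖ₑ ^ 2 ≤ K * slabModulus s) : HasTrace u g := by
  have hlim : Tendsto (fun s => K * slabModulus s) (𝓝 0) (𝓝 0) := by
    simpa using ENNReal.Tendsto.const_mul tendsto_slabModulus (Or.inr hK)
  unfold HasTrace
  rw [ENNReal.tendsto_nhds_zero]
  intro δ hδ
  obtain ⟨r, hr, hrs⟩ := Metric.eventually_nhds_iff.1 (ENNReal.tendsto_nhds_zero.1 hlim δ hδ)
  filter_upwards [Ioo_mem_nhdsGT hr] with ε hε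
  have h1 : ∫⁻ s in Set.Ioo 0 ε, ∫⁻ y : Cyl T d, ‖u (y.1, glue y.2 s) - g y‖ₑ ^ 2 ≤
      ∫⁻ _ in Set.Ioo 0 ε, δ := by
    refine lintegral_mono_ae ?_
    filter_upwards [ae_restrict_of_ae h, ae_restrict_mem measurableSet_Ioo] with s hs hsm
    refine (hs hsm.1).trans (hrs ?_)
    rw [Real.dist_eq, sub_zero, abs_of_pos hsm.1]
    exact hsm.2.trans hε.2
  rw [lintegral_const, Measure.restrict_apply_univ, Real.volume_Ioo, sub_zero] at h1
  refine (mul_le_mul_right h1 _).trans ?_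
  have h0 : ENNReal.ofReal ε ≠ 0 := by simpa using hε.1
  rw [mul_comm δ, ← mul_assoc, ENNReal.inv_mul_cancel h0 ENNReal.ofReal_ne_top, one_mul]

theorem SqSummable.add {α : Type*} [MeasurableSpace α] {μ : Measure α} {h g : ℤ → α → ℂ}
    (hh : SqSummable μ h) (hg : SqSummable μ g) : SqSummable μ fun k x => h k x + g k x := by
  refine ⟨fun k => (hh.1 k).add (hg.1 k), ?_⟩
  have h1 : ∀ k, ∫⁻ x, ‖h k x + g k x‖ₑ ^ 2 ∂μ ≤
      2 * (∫⁻ x, ‖h k x‖ₑ ^ 2 ∂μ) + 2 * ∫⁻ x, ‖g k x‖ₑ ^ 2 ∂μ := by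
    intro k
    rw [← lintegral_const_mul' _ _ (by norm_num), ← lintegral_const_mul' _ _ (by norm_num),
      ← lintegral_add_left' (((hh.1 k).enorm.pow_const 2).const_mul 2)]
    refine lintegral_mono fun x => ?_
    have := enorm_sub_sq_le (h k x) (-g k x) 0
    simpa using this
  refine (ENNReal.tsum_le_tsum h1).trans_lt ?_
  rw [ENNReal.tsum_add, ENNReal.tsum_mul_left, ENNReal.tsum_mul_left]
  exact ENNReal.add_lt_top.2 ⟨ENNReal.mul_lt_top (by norm_num) hh.2,
    ENNReal.mul_lt_top (by norm_num) hg.2⟩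

theorem SqSummable.mono {α : Type*} [MeasurableSpace α] {μ : Measure α} {h g : ℤ → α → ℂ}
    (hh : SqSummable μ h) (hg : ∀ k, AEStronglyMeasurable (g k) μ) (C : ℝ)
    (hle : ∀ k, ∀ᵐ x ∂μ, ‖g k x‖ ≤ C * ‖h k x‖) : SqSummable μ g := by
  refine ⟨hg, ?_⟩
  have h1 : ∀ k, ∫⁻ x, ‖g k x‖ₑ ^ 2 ∂μ ≤ ENNReal.ofReal C ^ 2 * ∫⁻ x, ‖h k x‖ₑ ^ 2 ∂μ := by
    intro k
    rw [← lintegral_const_mul' _ _ (by simp)]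
    refine lintegral_mono_ae ?_
    filter_upwards [hle k] with x hx
    rw [← mul_pow]
    refine pow_le_pow_left₀ zero_le ?_ 2
    rw [← ofReal_norm, ← ofReal_norm, ← ENNReal.ofReal_mul' (norm_nonneg _)]
    exact ENNReal.ofReal_le_ofReal hx
  refine (ENNReal.tsum_le_tsum h1).trans_lt ?_
  rw [ENNReal.tsum_mul_left]
  exact ENNReal.mul_lt_top (by simp) hh.2

theorem SqSummable.const_mul {α : Type*} [MeasurableSpace α] {μ : Measure α} {h : ℤ → α → ℂ}
    (hh : SqSummable μ h) (c : ℂ) : SqSummable μ fun k x => c * h k x :=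
  hh.mono (fun k => (hh.1 k).const_mul c) ‖c‖ fun k => Eventually.of_forall fun x => by
    rw [norm_mul]

/-- An element of `L²(𝕋 × ℝⁿ)` whose normal derivative is square integrable has a trace, whose
Fourier transform is the integral of `V̂` over the normal frequency. -/
theorem hasTrace_restr {d : ℕ} {V : L2 T (d + 1)} {G : L2 T d}
    (hV : SqSummable volume fun k η => (η (Fin.last d) : ℂ) * fourierG V k η)
    (hG : ∀ k, fourierG G k =ᵐ[volume] fun ξ => ∫ ζ : ℝ, fourierG V k (glue ξ ζ)) :
    HasTrace (restr V) G := by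
  have hW1 : SqSummable volume fun k (η : Space (d + 1)) =>
      (1 + Complex.I * η (Fin.last d)) * fourierG V k η := by
    refine ((sqSummable_fourierG V).add (hV.const_mul Complex.I)).mono (fun k => ?_) 1
      fun k => Eventually.of_forall fun η => ?_
    · exact (Continuous.aestronglyMeasurable (by fun_prop)).mul (Lp.memLp _).1
    · rw [one_mul]; exact le_of_eq (by congr 1; ring)
  set A : ℤ → ENNReal := fun k => ∫⁻ η : Space (d + 1),
    ‖(1 + Complex.I * η (Fin.last d)) * fourierG V k η‖ₑ ^ 2 with hA
  have hK : ENNReal.ofReal T * ∑' k, A k ≠ ⊤ := ENNReal.mul_ne_top ENNReal.ofReal_ne_top hW1.2.ne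
  refine hasTrace_of_le hK ?_
  have hslice : ∀ k, ∀ᵐ s : ℝ, ∃ h : MemLp (fun x' : Space d => timeCoeff V k (glue x' s)) 2,
      (𝓕 (h.toLp _) : Lp ℂ 2 (volume : Measure (Space d))) =ᵐ[volume] fun ξ =>
        ∫ ζ : ℝ, fourierG V k (glue ξ ζ) *
          Complex.exp (2 * Real.pi * s * ζ * Complex.I) := by
    intro k
    have h1 := fourier_slice ((memLp_timeCoeff V k).toLp (timeCoeff V k)) (hV.memLp k)
    filter_upwards [h1, ae_ae_glue' (memLp_timeCoeff V k).coeFn_toLp] with s hs hs2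
    obtain ⟨hm, hs⟩ := hs
    have hm2 : MemLp (fun x' : Space d => timeCoeff V k (glue x' s)) 2 :=
      (memLp_congr_ae hs2).1 hm
    refine ⟨hm2, ?_⟩
    have : hm2.toLp _ = hm.toLp _ := MemLp.toLp_congr _ _ (EventuallyEq.symm hs2)
    rw [this]; exact hs
  have hres : ∀ᵐ s : ℝ, ∀ᵐ y : Cyl T d,
      ((y.1, glue y.2 s) : Cyl T (d + 1)) ∈ Gplus T d →
        restr V (y.1, glue y.2 s) = V (y.1, glue y.2 s) := by
    refine ae_ae_cylGlue (p := fun q => q ∈ Gplus T d → restr V q = V q) ?_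
    exact (ae_restrict_iff' (measurableSet_Gplus T d)).1 (restr_ae_eq V)
  filter_upwards [ae_all_iff.2 hslice, hres, ae_memLp_cylGlue (Lp.memLp V)] with s hs hr hm h0
  set L : L2 T d := hm.toLp _ with hL
  have h1 : ∫⁻ y : Cyl T d, ‖restr V (y.1, glue y.2 s) - G y‖ₑ ^ 2 = ‖L - G‖ₑ ^ 2 := by
    rw [Lp.enorm_sq_eq_lintegral]
    refine lintegral_congr_ae ?_
    filter_upwards [hr, hm.coeFn_toLp, Lp.coeFn_sub L G] with y hy1 hy2 hy3
    rw [hy3, Pi.sub_apply, hy2, hy1 (by simpa [Gplus] using h0)]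
  rw [h1, ← tsum_enorm_fourierG, mul_assoc, ← ENNReal.tsum_mul_right]
  gcongr with k
  obtain ⟨hk, hkM⟩ := hs k
  have h2 : fourierG L k = 𝓕 (hk.toLp _) := by
    rw [fourierG]
    congr 1
    exact MemLp.toLp_congr _ _ (timeCoeff_congr hm.coeFn_toLp k)
  rw [Lp.enorm_sq_eq_lintegral, hA]
  simp only
  rw [lintegral_glue ((hW1.1 k).enorm.pow_const 2),
    ← lintegral_mul_const'' _ ((aestronglyMeasurable_glue
      (hW1.1 k)).enorm.pow_const 2).lintegral_prod_right']
  refine lintegral_mono_ae ?_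
  rw [fourierG_sub, h2]
  filter_upwards [Lp.coeFn_sub (𝓕 (hk.toLp _) : Lp ℂ 2 (volume : Measure (Space d)))
    (fourierG G k), hkM, hG k, ae_memLp_glue (hW1.memLp k)] with ξ hx1 hx2 hx3 hx4
  rw [hx1, Pi.sub_apply, hx2, hx3]
  have i1 : Integrable fun ζ : ℝ => fourierG V k (glue ξ ζ) *
      Complex.exp (2 * Real.pi * s * ζ * Complex.I) := by
    refine (hx4.integrable_mul (p := 2) (q := 2) (memLp_exp_mul_cauchyKernel s)).congr
      (Eventually.of_forall fun ζ => ?_)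
    simp only [Pi.mul_apply]
    conv_rhs => rw [← cauchyKernel_mul (fourierG V k)]
    ring
  have i2 : Integrable fun ζ : ℝ => fourierG V k (glue ξ ζ) := by
    refine (hx4.integrable_mul (p := 2) (q := 2) memLp_cauchyKernel).congr
      (Eventually.of_forall fun ζ => ?_)
    simp only [Pi.mul_apply]
    conv_rhs => rw [← cauchyKernel_mul (fourierG V k)]
    ring
  -- the coefficient of the slice minus `Ĝ` is `∫ V̂ (e^{2πisζ} - 1) dζ`; Cauchy-Schwarz with the
  -- weight `1 + iζ` bounds its square by the modulus of continuity
  rw [← integral_sub i1 i2]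
  have h3 : ∀ ζ : ℝ, fourierG V k (glue ξ ζ) * Complex.exp (2 * Real.pi * s * ζ * Complex.I) -
      fourierG V k (glue ξ ζ) = (1 + Complex.I * (glue ξ ζ) (Fin.last d)) *
        fourierG V k (glue ξ ζ) *
        (cauchyKernel ζ * (Complex.exp (2 * Real.pi * s * ζ * Complex.I) - 1)) := by
    intro ζ
    conv_lhs => rw [← cauchyKernel_mul (fourierG V k)]
    ring
  simp_rw [h3]
  exact enorm_integral_mul_sq_le hx4.1
    (continuous_cauchyKernel.mul (by fun_prop)).aestronglyMeasurable

end Trace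

/-! ### Test functions on the half cylinder -/

section Tests

variable {T : ℝ} {d : ℕ}

theorem IsTest.continuous {φ : Cyl T (d + 1) → ℂ} (hφ : IsTest φ) : Continuous φ := by
  have hq : IsOpenQuotientMap (Prod.map ((↑) : ℝ → AddCircle T) (id : Space (d + 1) → _)) :=
    QuotientAddGroup.isOpenQuotientMap_mk.prodMap IsOpenQuotientMap.id
  exact hq.isQuotientMap.continuous_iff.2 hφ.smooth.continuous

theorem dx_eq_fderiv_slice {φ : Cyl T (d + 1) → ℂ} (hφ : IsTest φ) (j : Fin (d + 1))
    (t : AddCircle T) (x : Space (d + 1)) :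
    dx j φ (t, x) = fderiv ℝ (fun y => φ (t, y)) x (EuclideanSpace.single j 1) := by
  obtain ⟨t, rfl⟩ := QuotientAddGroup.mk_surjective t
  have hd : ContDiff ℝ ∞ fun y : Space (d + 1) => φ ((t : AddCircle T), y) :=
    hφ.smooth.comp (contDiff_const.prodMk contDiff_id)
  rw [← (hd.differentiable (by simp) x).lineDeriv_eq_fderiv, lineDeriv]
  simp only [dx]
  congr 1
  funext s
  have : EuclideanSpace.single j s = s • (EuclideanSpace.single j (1 : ℝ)) := by
    ext i; simp
  rw [this]

theorem contDiff_slice {φ : Cyl T (d + 1) → ℂ} (hφ : IsTest φ) (t : AddCircle T) :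
    ContDiff ℝ ∞ fun y : Space (d + 1) => φ (t, y) := by
  obtain ⟨t, rfl⟩ := QuotientAddGroup.mk_surjective t
  exact hφ.smooth.comp (contDiff_const.prodMk contDiff_id)

theorem dx_coe {φ : Cyl T (d + 1) → ℂ} (hφ : IsTest φ) (j : Fin (d + 1)) (p : ℝ × Space (d + 1)) :
    dx j φ ((p.1 : AddCircle T), p.2) =
      fderiv ℝ (fun p : ℝ × Space (d + 1) => φ ((p.1 : AddCircle T), p.2)) p
        (0, EuclideanSpace.single j 1) := by
  rw [← (hφ.smooth.differentiable (by simp) p).lineDeriv_eq_fderiv, lineDeriv]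
  simp only [dx]
  congr 1
  funext s
  have : EuclideanSpace.single j s = s • (EuclideanSpace.single j (1 : ℝ)) := by
    ext i; simp
  rw [this]
  simp

theorem dt_coe {φ : Cyl T (d + 1) → ℂ} (hφ : IsTest φ) (p : ℝ × Space (d + 1)) :
    dt φ ((p.1 : AddCircle T), p.2) =
      fderiv ℝ (fun p : ℝ × Space (d + 1) => φ ((p.1 : AddCircle T), p.2)) p (1, 0) := by
  rw [← (hφ.smooth.differentiable (by simp) p).lineDeriv_eq_fderiv, lineDeriv]
  simp [dt]

theorem isTest_of_support {φ ψ : Cyl T (d + 1) → ℂ} (hφ : IsTest φ)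
    (hs : ContDiff ℝ ∞ fun p : ℝ × Space (d + 1) => ψ ((p.1 : AddCircle T), p.2))
    (hsub : ∀ p, p ∉ tsupport φ → ψ p = 0) : IsTest ψ := by
  have h1 : tsupport ψ ⊆ tsupport φ := by
    refine closure_minimal (fun p hp => ?_) (isClosed_tsupport φ)
    by_contra h
    exact hp (hsub p h)
  exact ⟨hs, hφ.compact.of_isClosed_subset (isClosed_tsupport ψ) h1, h1.trans hφ.support⟩

theorem IsTest.dx {φ : Cyl T (d + 1) → ℂ} (hφ : IsTest φ) (j : Fin (d + 1)) :
    IsTest (dx j φ) := by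
  refine isTest_of_support hφ ?_ fun p hp => ?_
  · simp_rw [dx_coe hφ]
    exact (hφ.smooth.fderiv_right (m := ∞) (by simp)).clm_apply contDiff_const
  · have h0 : φ =ᶠ[𝓝 p] 0 := notMem_tsupport_iff_eventuallyEq.1 hp
    have hc : Tendsto (fun s : ℝ => ((p.1, p.2 + EuclideanSpace.single j s) : Cyl T (d + 1)))
        (𝓝 0) (𝓝 p) := by
      have : Continuous fun s : ℝ =>
          ((p.1, p.2 + s • EuclideanSpace.single j (1 : ℝ)) : Cyl T (d + 1)) := by fun_prop
      have h := this.tendsto 0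
      simp only [zero_smul, add_zero] at h
      refine h.congr fun s => ?_
      congr 2
      ext i; simp
    have h1 : (fun s : ℝ => φ (p.1, p.2 + EuclideanSpace.single j s)) =ᶠ[𝓝 0] fun _ => 0 :=
      hc.eventually h0
    simp only [CHG.dx]
    rw [h1.deriv_eq]
    simp

theorem IsTest.dt {φ : Cyl T (d + 1) → ℂ} (hφ : IsTest φ) : IsTest (dt φ) := by
  refine isTest_of_support hφ ?_ fun p hp => ?_
  · simp_rw [dt_coe hφ]
    exact (hφ.smooth.fderiv_right (m := ∞) (by simp)).clm_apply contDiff_const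
  · have h0 : φ =ᶠ[𝓝 p] 0 := notMem_tsupport_iff_eventuallyEq.1 hp
    have hc : Tendsto (fun s : ℝ => ((p.1 + (s : AddCircle T), p.2) : Cyl T (d + 1)))
        (𝓝 0) (𝓝 p) := by
      have : Continuous fun s : ℝ => ((p.1 + (s : AddCircle T), p.2) : Cyl T (d + 1)) :=
        (continuous_const.add (AddCircle.continuous_mk' T)).prodMk continuous_const
      have h := this.tendsto 0
      simpa using h
    have h1 : (fun s : ℝ => φ (p.1 + (s : AddCircle T), p.2)) =ᶠ[𝓝 0] fun _ => 0 :=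
      hc.eventually h0
    simp only [CHG.dt]
    rw [h1.deriv_eq]
    simp

theorem IsTest.zero : IsTest (0 : Cyl T (d + 1) → ℂ) where
  smooth := contDiff_const
  compact := HasCompactSupport.zero
  support := by simp [tsupport]

theorem IsTest.add {φ ψ : Cyl T (d + 1) → ℂ} (hφ : IsTest φ) (hψ : IsTest ψ) :
    IsTest (φ + ψ) where
  smooth := hφ.smooth.add hψ.smooth
  compact := hφ.compact.add hψ.compact
  support := (tsupport_add φ ψ).trans (Set.union_subset hφ.support hψ.support)

theorem IsTest.sum {ι : Type*} (s : Finset ι) {φ : ι → Cyl T (d + 1) → ℂ}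
    (hφ : ∀ i, IsTest (φ i)) : IsTest (∑ i ∈ s, φ i) := by
  classical
  induction s using Finset.induction_on with
  | empty => simpa using IsTest.zero
  | insert a s ha ih => rw [Finset.sum_insert ha]; exact (hφ a).add ih

theorem lap_eq_sum (φ : Cyl T (d + 1) → ℂ) : lap φ = ∑ j, CHG.dx j (CHG.dx j φ) := by
  funext p; simp [lap, Finset.sum_apply]

theorem IsTest.lap {φ : Cyl T (d + 1) → ℂ} (hφ : IsTest φ) : IsTest (lap φ) := by
  rw [lap_eq_sum]
  exact IsTest.sum _ fun j => (hφ.dx j).dx j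

theorem IsTest.neg {φ : Cyl T (d + 1) → ℂ} (hφ : IsTest φ) : IsTest (-φ) :=
  isTest_of_support hφ hφ.smooth.neg fun p hp => by simp [image_eq_zero_of_notMem_tsupport hp]

/-- The character `e^{2πikt/T + 2πi η·x}`. -/
def character (k : ℤ) (η : Space (d + 1)) (p : Cyl T (d + 1)) : ℂ :=
  (fourier k p.1 : ℂ) * Complex.exp (2 * Real.pi * (inner ℝ p.2 η : ℝ) * Complex.I)

theorem continuous_character (k : ℤ) (η : Space (d + 1)) :
    Continuous (character (T := T) k η) := by
  refine ((map_continuous (fourier (T := T) k)).comp continuous_fst).mul ?_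
  have : Continuous fun p : Cyl T (d + 1) => inner ℝ p.2 η :=
    continuous_snd.inner continuous_const
  fun_prop

/-- The formal adjoint of the operator `∂ₜ - Δ(∂ₜ - Δ)`. -/
def adjointOp (φ : Cyl T (d + 1) → ℂ) : Cyl T (d + 1) → ℂ :=
  -dt φ + lap (dt φ) + lap (lap φ)

theorem IsTest.adjointOp {φ : Cyl T (d + 1) → ℂ} (hφ : IsTest φ) : IsTest (adjointOp φ) :=
  (hφ.dt.neg.add hφ.dt.lap).add hφ.lap.lap

/-- The symbol `D(τ, ξ)` at the frequency `(k, η)`. -/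
def symD (T : ℝ) {d : ℕ} (k : ℤ) (η : Space (d + 1)) : ℂ :=
  (symbolD (tfreq T k) (tang (xfreq η))).eval (xfreq η (Fin.last d) : ℂ)

theorem norm_tang_sq (x : Space (d + 1)) : ‖x‖ ^ 2 = ‖tang x‖ ^ 2 + x (Fin.last d) ^ 2 := by
  conv_lhs => rw [← glue_tang x]
  exact norm_glue_sq _ _

theorem symD_eq (k : ℤ) (η : Space (d + 1)) :
    symD T k η = Complex.I * tfreq T k + ((‖xfreq η‖ ^ 2 : ℝ) : ℂ) *
      (Complex.I * tfreq T k + ((‖xfreq η‖ ^ 2 : ℝ) : ℂ)) := by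
  rw [symD, symbolD, norm_tang_sq]
  simp

theorem contDiff_fourier_coe (k : ℤ) :
    ContDiff ℝ ∞ fun t : ℝ => (fourier k (t : AddCircle T) : ℂ) := by
  simp only [fourier_coe_apply]
  refine ContDiff.cexp ?_
  exact (contDiff_const.mul Complex.ofRealCLM.contDiff).div_const _

end Tests

/-! ### Pairing of test functions with characters -/

section Pairing

variable {T : ℝ} [hT : Fact (0 < T)] {d : ℕ}

theorem IsTest.memLp {φ : Cyl T (d + 1) → ℂ} (hφ : IsTest φ) : MemLp φ 2 :=
  hφ.continuous.memLp_of_hasCompactSupport hφ.compact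

theorem IsTest.integrable_mul_character {φ : Cyl T (d + 1) → ℂ} (hφ : IsTest φ) (k : ℤ)
    (η : Space (d + 1)) : Integrable fun p => φ p * character k η p :=
  (hφ.continuous.mul (continuous_character k η)).integrable_of_hasCompactSupport
    hφ.compact.mul_right

/-- The pairing of a test function with a character. -/
def charPairing (φ : Cyl T (d + 1) → ℂ) (k : ℤ) (η : Space (d + 1)) : ℂ :=
  ∫ p, φ p * character k η p

/-- Integration by parts in space, slice by slice in time. -/
theorem charPairing_dx {φ : Cyl T (d + 1) → ℂ} (hφ : IsTest φ) (j : Fin (d + 1)) (k : ℤ)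
    (η : Space (d + 1)) :
    charPairing (dx j φ) k η = -(Complex.I * (xfreq η j : ℝ)) * charPairing φ k η := by
  unfold charPairing
  rw [Measure.volume_eq_prod, integral_prod _ ((hφ.dx j).integrable_mul_character k η),
    integral_prod _ (hφ.integrable_mul_character k η), ← integral_const_mul]
  refine integral_congr_ae (Eventually.of_forall fun t => ?_)
  simp only
  set E : Space (d + 1) → ℂ := fun x => character k η (t, x) with hE
  have hEd : ContDiff ℝ ∞ E := by
    simp only [hE, character]
    refine contDiff_const.mul (ContDiff.cexp ?_)
    exact (contDiff_const.mul (Complex.ofRealCLM.contDiff.comp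
      (contDiff_id.inner ℝ contDiff_const))).mul contDiff_const
  have hf := contDiff_slice hφ t
  have hfE : ∀ x, fderiv ℝ E x (EuclideanSpace.single j 1) =
      (Complex.I * (xfreq η j : ℝ)) * E x := by
    intro x
    rw [← (hEd.differentiable (by simp) x).lineDeriv_eq_fderiv, lineDeriv]
    have h1 : HasDerivAt (fun s : ℝ => E (x + s • EuclideanSpace.single j (1 : ℝ)))
        ((Complex.I * (xfreq η j : ℝ)) * E x) 0 := by
      have e : ∀ s : ℝ, E (x + s • EuclideanSpace.single j (1 : ℝ)) =
          E x * Complex.exp ((s : ℂ) * (Complex.I * (xfreq η j : ℝ))) := by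
        intro s
        simp only [hE, character]
        rw [mul_assoc (fourier k t : ℂ), ← Complex.exp_add]
        congr 2
        simp only [inner_add_left, inner_smul_left, EuclideanSpace.inner_single_left, xfreq,
          PiLp.smul_apply]
        simp
        ring
      simp_rw [e]
      have h2 : HasDerivAt (fun s : ℝ => (s : ℂ) * (Complex.I * (xfreq η j : ℝ)))
          (1 * (Complex.I * (xfreq η j : ℝ))) 0 :=
        (Complex.ofRealCLM.hasDerivAt (x := 0)).mul_const _
      have h3 := (h2.cexp).const_mul (E x)
      refine h3.congr_deriv ?_
      simp
      ring
    exact h1.deriv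
  have hcs : HasCompactSupport fun x : Space (d + 1) => φ (t, x) := by
    refine HasCompactSupport.intro (hφ.compact.isCompact.image continuous_snd) fun x hx => ?_
    by_contra h
    exact hx ⟨(t, x), subset_tsupport φ h, rfl⟩
  have h1 : Continuous fun x => fderiv ℝ (fun y => φ (t, y)) x (EuclideanSpace.single j 1) :=
    (hf.continuous_fderiv (by simp)).clm_apply continuous_const
  have h2 : Continuous fun x => fderiv ℝ E x (EuclideanSpace.single j 1) :=
    (hEd.continuous_fderiv (by simp)).clm_apply continuous_const
  have hibp := integral_mul_fderiv_eq_neg_fderiv_mul_of_integrable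
    (μ := (volume : Measure (Space (d + 1)))) (f := fun x => φ (t, x)) (g := E)
    (v := EuclideanSpace.single j 1)
    ((h1.mul hEd.continuous).integrable_of_hasCompactSupport
      ((hcs.fderiv_apply (𝕜 := ℝ) _).mul_right))
    ((hf.continuous.mul h2).integrable_of_hasCompactSupport hcs.mul_right)
    ((hf.continuous.mul hEd.continuous).integrable_of_hasCompactSupport hcs.mul_right)
    (fun x _ => hf.differentiable (by simp) x) (fun x _ => hEd.differentiable (by simp) x)
  simp_rw [dx_eq_fderiv_slice hφ]
  rw [← neg_eq_iff_eq_neg] at hibp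
  rw [← hibp, neg_mul, ← integral_const_mul]
  congr 1
  refine integral_congr_ae (Eventually.of_forall fun x => ?_)
  simp only [hfE]
  ring

/-- Integration by parts in time: the periodic test function is lifted to an interval of length `T`.
-/
theorem charPairing_dt {φ : Cyl T (d + 1) → ℂ} (hφ : IsTest φ) (k : ℤ) (η : Space (d + 1)) :
    charPairing (dt φ) k η = -(Complex.I * (tfreq T k : ℝ)) * charPairing φ k η := by
  unfold charPairing
  have hT0 : (T : ℂ) ≠ 0 := by exact_mod_cast hT.out.ne'
  rw [Measure.volume_eq_prod, integral_prod_symm _ (hφ.dt.integrable_mul_character k η),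
    integral_prod_symm _ (hφ.integrable_mul_character k η), ← integral_const_mul]
  refine integral_congr_ae (Eventually.of_forall fun x => ?_)
  simp only
  rw [← AddCircle.intervalIntegral_preimage T 0, ← AddCircle.intervalIntegral_preimage T 0]
  set f : ℝ → ℂ := fun s => φ ((s : AddCircle T), x) with hf
  set E : ℝ → ℂ := fun s => character k η ((s : AddCircle T), x) with hE
  have hfd : ContDiff ℝ ∞ f := hφ.smooth.comp (contDiff_id.prodMk contDiff_const)
  have hfd' : ∀ s : ℝ, HasDerivAt f (dt φ ((s : AddCircle T), x)) s := by
    intro s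
    have h1 := (hfd.differentiable (by simp) s).hasDerivAt
    have h2 : deriv f s = dt φ ((s : AddCircle T), x) := by
      simp only [dt]
      have := deriv_comp_const_add (f := f) s 0
      rw [add_zero] at this
      rw [← this]
      congr 1
    rwa [h2] at h1
  have hEd' : ∀ s, HasDerivAt E ((Complex.I * (tfreq T k : ℝ)) * E s) s := by
    intro s
    have h1 := (hasDerivAt_fourier T k s).mul_const
      (Complex.exp (2 * Real.pi * (inner ℝ x η : ℝ) * Complex.I))
    refine h1.congr_deriv ?_
    simp only [hE, character, tfreq]
    push_cast
    field_simp
  have hcf : Continuous fun s : ℝ => dt φ ((s : AddCircle T), x) :=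
    hφ.dt.continuous.comp ((AddCircle.continuous_mk' T).prodMk continuous_const)
  have hcE : Continuous E :=
    (continuous_character k η).comp ((AddCircle.continuous_mk' T).prodMk continuous_const)
  have hibp := intervalIntegral.integral_mul_deriv_eq_deriv_mul (a := 0) (b := 0 + T)
    (fun s _ => hfd' s) (fun s _ => hEd' s) (hcf.intervalIntegrable _ _)
    ((continuous_const.mul hcE).intervalIntegrable _ _)
  have hper : f (0 + T) * E (0 + T) = f 0 * E 0 := by
    simp [hf, hE, AddCircle.coe_period]
  rw [hper, sub_self, zero_sub, ← neg_eq_iff_eq_neg] at hibp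
  rw [← hibp, neg_mul, ← intervalIntegral.integral_const_mul]
  congr 1
  refine intervalIntegral.integral_congr fun s _ => ?_
  simp only [hf, hE]
  ring

theorem charPairing_sum {ι : Type*} (s : Finset ι) {φ : ι → Cyl T (d + 1) → ℂ}
    (hφ : ∀ i, IsTest (φ i)) (k : ℤ) (η : Space (d + 1)) :
    charPairing (∑ i ∈ s, φ i) k η = ∑ i ∈ s, charPairing (φ i) k η := by
  unfold charPairing
  rw [← integral_finsetSum _ fun i _ => (hφ i).integrable_mul_character k η]
  simp [Finset.sum_apply, Finset.sum_mul]

theorem charPairing_add {φ ψ : Cyl T (d + 1) → ℂ} (hφ : IsTest φ) (hψ : IsTest ψ) (k : ℤ)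
    (η : Space (d + 1)) :
    charPairing (φ + ψ) k η = charPairing φ k η + charPairing ψ k η := by
  unfold charPairing
  rw [← integral_add (hφ.integrable_mul_character k η) (hψ.integrable_mul_character k η)]
  simp [add_mul]

theorem charPairing_neg (φ : Cyl T (d + 1) → ℂ) (k : ℤ) (η : Space (d + 1)) :
    charPairing (-φ) k η = -charPairing φ k η := by
  unfold charPairing
  rw [← integral_neg]
  simp

theorem charPairing_lap {φ : Cyl T (d + 1) → ℂ} (hφ : IsTest φ) (k : ℤ) (η : Space (d + 1)) :
    charPairing (lap φ) k η = -((‖xfreq η‖ ^ 2 : ℝ) : ℂ) * charPairing φ k η := by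
  rw [lap_eq_sum, charPairing_sum _ fun j => (hφ.dx j).dx j, EuclideanSpace.norm_sq_eq]
  simp_rw [fun j => charPairing_dx (hφ.dx j) j k η, fun j => charPairing_dx hφ j k η]
  push_cast
  rw [← Finset.sum_neg_distrib, Finset.sum_mul]
  refine Finset.sum_congr rfl fun j _ => ?_
  rw [Real.norm_eq_abs, ← Complex.ofReal_pow, sq_abs, ← mul_assoc]
  push_cast
  linear_combination (-(xfreq η j : ℂ) ^ 2 * charPairing φ k η) * Complex.I_sq.symm

theorem charPairing_adjointOp {φ : Cyl T (d + 1) → ℂ} (hφ : IsTest φ) (k : ℤ)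
    (η : Space (d + 1)) :
    charPairing (adjointOp φ) k η = symD T k η * charPairing φ k η := by
  rw [adjointOp, charPairing_add (hφ.dt.neg.add hφ.dt.lap) hφ.lap.lap,
    charPairing_add hφ.dt.neg hφ.dt.lap, charPairing_neg, charPairing_lap hφ.dt,
    charPairing_lap hφ.lap, charPairing_lap hφ, charPairing_dt hφ, symD_eq]
  ring

/-- The pairing of `φ` with the characters is, up to conjugation and normalization, the Fourier
transform of `φ̄`; this reduces Parseval's formula for the bilinear pairing to the one for the inner
product. -/
theorem IsTest.fourierG_star {φ : Cyl T (d + 1) → ℂ} (hφ : IsTest φ) (k : ℤ) :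
    fourierG (hφ.memLp.star.toLp (star φ)) k =ᵐ[volume] fun η =>
      (T : ℂ)⁻¹ * starRingEnd ℂ (charPairing φ k η) := by
  set L : L2 T (d + 1) := hφ.memLp.star.toLp (star φ) with hL
  set c : Space (d + 1) → ℂ := fun x => fourierCoeff (fun t : AddCircle T => star φ (t, x)) k
    with hc
  have hae : timeCoeff L k =ᵐ[volume] c := timeCoeff_congr hφ.memLp.star.coeFn_toLp k
  have hc' : ∀ x, c x = (T : ℂ)⁻¹ *
      ∫ t : AddCircle T, starRingEnd ℂ (φ (t, x) * (fourier k t : ℂ)) := by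
    intro x
    rw [hc]
    simp only [fourierCoeff]
    rw [AddCircle.integral_haarAddCircle, Complex.real_smul]
    push_cast
    congr 1
    refine integral_congr_ae (Eventually.of_forall fun t => ?_)
    simp [mul_comm]
  have hint : Integrable (fun p : Cyl T (d + 1) => starRingEnd ℂ (φ p * (fourier k p.1 : ℂ))) := by
    refine Continuous.integrable_of_hasCompactSupport ?_ ?_
    · exact Complex.continuous_conj.comp (hφ.continuous.mul
        ((map_continuous (fourier (T := T) k)).comp continuous_fst))
    · exact hφ.compact.mul_right.comp_left (g := starRingEnd ℂ) (by simp)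
  have hcint : Integrable c := by
    have h4 := (Integrable.integral_prod_right hint).const_mul (T : ℂ)⁻¹
    exact h4.congr (Eventually.of_forall fun x => (hc' x).symm)
  have hcm : MemLp c 2 := (memLp_congr_ae hae).1 (memLp_timeCoeff L k)
  have h5 : fourierG L k = 𝓕 (hcm.toLp c) := by
    rw [fourierG]; congr 1; exact MemLp.toLp_congr _ _ hae
  rw [h5]
  refine (fourier_toLp_ae_eq hcint hcm).trans (Eventually.of_forall fun η => ?_)
  simp only
  rw [Real.fourier_eq', charPairing, ← integral_conj, Measure.volume_eq_prod,
    integral_prod_symm, ← integral_const_mul]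
  · refine integral_congr_ae (Eventually.of_forall fun x => ?_)
    simp only [hc', smul_eq_mul]
    rw [mul_left_comm, ← integral_const_mul]
    congr 1
    refine integral_congr_ae (Eventually.of_forall fun t => ?_)
    simp only [character, map_mul, ← Complex.exp_conj, Complex.conj_ofReal, Complex.conj_I]
    have : (starRingEnd ℂ) (2 : ℂ) = 2 := Complex.conj_ofReal 2
    rw [this, mul_comm, ← mul_assoc]
    congr 2
    push_cast
    ring
  · exact (Complex.conjCLE : ℂ →L[ℝ] ℂ).integrable_comp (hφ.integrable_mul_character k η)

theorem IsTest.memLp_charPairing {φ : Cyl T (d + 1) → ℂ} (hφ : IsTest φ) (k : ℤ) :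
    MemLp (charPairing φ k) 2 := by
  have hT0 : (T : ℂ) ≠ 0 := by exact_mod_cast hT.out.ne'
  have h1 := ((Lp.memLp (fourierG (hφ.memLp.star.toLp (star φ)) k)).star).const_mul (T : ℂ)
  refine (memLp_congr_ae ?_).1 h1
  filter_upwards [hφ.fourierG_star k] with η hη
  simp only [Pi.star_apply, hη, star_mul', RCLike.star_def, map_inv₀, Complex.conj_ofReal,
    Complex.conj_conj]
  field_simp

/-- Parseval's formula for the pairing of a test function with an element of `L²`. -/
theorem hasSum_pairing {φ : Cyl T (d + 1) → ℂ} (hφ : IsTest φ) (U : L2 T (d + 1)) :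
    HasSum (fun k : ℤ => ∫ η, charPairing φ k η * fourierG U k η)
      (∫ p in Gplus T d, restr U p * φ p) := by
  have hT0 : (T : ℂ) ≠ 0 := by exact_mod_cast hT.out.ne'
  have h1 : ∫ p in Gplus T d, restr U p * φ p = ∫ p, U p * φ p := by
    have h2 : ∫ p in Gplus T d, restr U p * φ p = ∫ p in Gplus T d, U p * φ p := by
      refine integral_congr_ae ?_
      filter_upwards [restr_ae_eq U] with p hp
      rw [hp]
    rw [h2]
    refine setIntegral_eq_integral_of_forall_compl_eq_zero fun p hp => ?_
    rw [image_eq_zero_of_notMem_tsupport (fun h => hp (hφ.support h)), mul_zero]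
  set L : L2 T (d + 1) := hφ.memLp.star.toLp (star φ) with hL
  have h3 := hφ.fourierG_star
  rw [h1, integral_mul_eq_inner hφ.memLp U]
  have h6 := hasSum_inner_fourierG L U
  have e : (fun k : ℤ => ∫ η, charPairing φ k η * fourierG U k η) =
      fun k : ℤ => (T : ℂ) * inner ℂ (fourierG L k) (fourierG U k) := by
    funext k
    rw [L2.inner_def, ← integral_const_mul]
    refine integral_congr_ae ?_
    filter_upwards [h3 k] with η hη
    rw [← hL] at hη
    simp [hη]
    field_simp
  rw [e]
  exact h6

/-- If `D Û = F̂` then `u = r⁺ U` solves the equation with right-hand side `r⁺ F`. -/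
theorem weakEq_of_symbol {U F : L2 T (d + 1)}
    (h : ∀ k, ∀ᵐ η, fourierG F k η = symD T k η * fourierG U k η) :
    WeakEq (restr U) (restr F) := by
  intro φ hφ
  have h1 := hasSum_pairing hφ.adjointOp U
  have h2 := hasSum_pairing hφ F
  have e : (fun k : ℤ => ∫ η, charPairing (adjointOp φ) k η * fourierG U k η) =
      fun k : ℤ => ∫ η, charPairing φ k η * fourierG F k η := by
    funext k
    refine integral_congr_ae ?_
    filter_upwards [h k] with η hη
    rw [charPairing_adjointOp hφ, hη]
    ring
  rw [e] at h1
  exact h1.unique h2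

theorem isWeakNormalDeriv_of_symbol {U W : L2 T (d + 1)}
    (h : ∀ k, ∀ᵐ η, fourierG W k η = Complex.I * (xfreq η (Fin.last d) : ℝ) * fourierG U k η) :
    IsWeakNormalDeriv (restr U) (restr W) := by
  intro φ hφ
  have h1 := hasSum_pairing (hφ.dx (Fin.last d)) U
  have h2 := (hasSum_pairing hφ W).neg
  have e : (fun k : ℤ => ∫ η, charPairing (dx (Fin.last d) φ) k η * fourierG U k η) =
      fun k : ℤ => -∫ η, charPairing φ k η * fourierG W k η := by
    funext k
    rw [← integral_neg]
    refine integral_congr_ae ?_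
    filter_upwards [h k] with η hη
    rw [charPairing_dx hφ, hη]
    ring
  rw [e] at h1
  exact h1.unique h2

/-- Smooth real functions with compact support in the open half space. -/
structure IsHalfSpaceTest (g : Space (d + 1) → ℝ) : Prop where
  smooth : ContDiff ℝ ∞ g
  compact : HasCompactSupport g
  support : tsupport g ⊆ {x | 0 < x (Fin.last d)}

/-- The test function `e^{-2πikt/T} g(x)`, which singles out the time frequency `k`. -/
def modeTest (k : ℤ) (g : Space (d + 1) → ℝ) (p : Cyl T (d + 1)) : ℂ :=
  (fourier (-k) p.1 : ℂ) * (g p.2 : ℂ)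

theorem isTest_modeTest (k : ℤ) {g : Space (d + 1) → ℝ} (hg : IsHalfSpaceTest g) :
    IsTest (modeTest (T := T) k g) where
  smooth := ((contDiff_fourier_coe (-k)).comp contDiff_fst).mul
    (Complex.ofRealCLM.contDiff.comp (hg.smooth.comp contDiff_snd))
  compact := by
    refine HasCompactSupport.intro (isCompact_univ.prod hg.compact.isCompact) fun p hp => ?_
    have : p.2 ∉ tsupport g := fun h => hp ⟨Set.mem_univ _, h⟩
    simp [modeTest, image_eq_zero_of_notMem_tsupport this]
  support := by
    have h1 : tsupport (modeTest (T := T) k g) ⊆ Prod.snd ⁻¹' tsupport g := by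
      refine closure_minimal (fun p hp => ?_) ((isClosed_tsupport g).preimage continuous_snd)
      by_contra h
      refine hp ?_
      have h' : p.2 ∉ tsupport g := h
      simp [modeTest, image_eq_zero_of_notMem_tsupport h']
    exact fun p hp => hg.support (h1 hp)

theorem charPairing_modeTest {k j : ℤ} (hj : j ≠ k) {g : Space (d + 1) → ℝ}
    (hg : IsHalfSpaceTest g) (η : Space (d + 1)) :
    charPairing (modeTest (T := T) k g) j η = 0 := by
  unfold charPairing
  rw [Measure.volume_eq_prod,
    integral_prod_symm _ ((isTest_modeTest k hg).integrable_mul_character j η)]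
  refine integral_eq_zero_of_ae (Eventually.of_forall fun x => ?_)
  have h1 : ∀ t : AddCircle T, modeTest k g (t, x) * character j η (t, x) =
      ((g x : ℂ) * Complex.exp (2 * Real.pi * (inner ℝ x η : ℝ) * Complex.I)) *
        ((fourier (-k) t : ℂ) • (fourier j t : ℂ)) := by
    intro t; simp only [modeTest, character, smul_eq_mul]; ring
  simp_rw [h1]
  rw [integral_const_mul]
  have h2 : ∫ t : AddCircle T, (fourier (-k) t : ℂ) • (fourier j t : ℂ) =
      T * fourierCoeff (T := T) (fourier j) k := by
    rw [fourierCoeff, AddCircle.volume_eq_smul_haarAddCircle, integral_smul_measure,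
      ENNReal.toReal_ofReal hT.out.le, Complex.real_smul]
  rw [h2, fourierCoeff_fourier, Pi.single_eq_of_ne hj.symm]
  simp

theorem integral_restr_mul_modeTest (F : L2 T (d + 1)) (k : ℤ) {g : Space (d + 1) → ℝ}
    (hg : IsHalfSpaceTest g) :
    ∫ p in Gplus T d, restr F p * modeTest k g p = T * ∫ x, (g x : ℂ) * timeCoeff F k x := by
  have hφ := isTest_modeTest (T := T) k hg
  have h2 : ∫ p in Gplus T d, restr F p * modeTest k g p =
      ∫ p in Gplus T d, F p * modeTest k g p := by
    refine integral_congr_ae ?_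
    filter_upwards [restr_ae_eq F] with p hp
    rw [hp]
  rw [h2, setIntegral_eq_integral_of_forall_compl_eq_zero fun p hp => by
    rw [image_eq_zero_of_notMem_tsupport (fun h => hp (hφ.support h)), mul_zero]]
  have hint : Integrable (fun p : Cyl T (d + 1) => F p * modeTest k g p)
      ((volume : Measure (AddCircle T)).prod (volume : Measure (Space (d + 1)))) :=
    (Lp.memLp F).integrable_mul (p := 2) (q := 2) hφ.memLp
  have h3 : ∫ p : Cyl T (d + 1), F p * modeTest k g p =
      ∫ x : Space (d + 1), ∫ t : AddCircle T, F (t, x) * modeTest k g (t, x) :=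
    integral_prod_symm _ hint
  rw [h3, ← integral_const_mul]
  refine integral_congr_ae (Eventually.of_forall fun x => ?_)
  simp only
  rw [timeCoeff, fourierCoeff, AddCircle.integral_haarAddCircle, Complex.real_smul]
  have hT0 : (T : ℂ) ≠ 0 := by exact_mod_cast hT.out.ne'
  push_cast
  rw [mul_left_comm, mul_inv_cancel_left₀ hT0, ← integral_const_mul]
  refine integral_congr_ae (Eventually.of_forall fun t => ?_)
  simp only [modeTest, smul_eq_mul]
  ring

theorem anticausal_of_forall_modeTest {F : L2 T (d + 1)} {k : ℤ}
    (h : ∀ g : Space (d + 1) → ℝ, IsHalfSpaceTest g →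
      ∫ p in Gplus T d, restr F p * modeTest k g p = 0) :
    Anticausal (fourierG F k : Space (d + 1) → ℂ) := by
  have hT0 : (T : ℂ) ≠ 0 := by exact_mod_cast hT.out.ne'
  have h1 : ∀ᵐ x : Space (d + 1), x ∈ {x : Space (d + 1) | 0 < x (Fin.last d)} →
      timeCoeff F k x = 0 := by
    refine IsOpen.ae_eq_zero_of_integral_contDiff_smul_eq_zero ?_
      ((memLp_timeCoeff F k).locallyIntegrable_two.locallyIntegrableOn _) fun g hg hgc hgs => ?_
    · exact isOpen_lt continuous_const (by fun_prop)
    · have h2 := h g ⟨hg, hgc, hgs⟩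
      rw [integral_restr_mul_modeTest F k ⟨hg, hgc, hgs⟩, mul_eq_zero] at h2
      simpa using h2.resolve_left hT0
  rw [fourierG, anticausal_fourier_iff]
  filter_upwards [h1, (memLp_timeCoeff F k).coeFn_toLp] with x hx hx2 h0
  rw [hx2]; exact hx h0

/-- The fundamental lemma of the calculus of variations on the half cylinder. -/
theorem restr_eq_of_forall_test {F G : L2 T (d + 1)}
    (h : ∀ φ : Cyl T (d + 1) → ℂ, IsTest φ →
      ∫ p in Gplus T d, restr F p * φ p = ∫ p in Gplus T d, restr G p * φ p) :
    restr F = restr G := by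
  rw [← sub_eq_zero, ← restr_sub, restr_eq_zero_iff_anticausal]
  intro k
  refine anticausal_of_forall_modeTest fun g hg => ?_
  have h1 := h _ (isTest_modeTest k hg)
  rw [integral_restr_mul_modeTest _ k hg] at h1 ⊢
  rw [integral_restr_mul_modeTest _ k hg] at h1
  have hs : timeCoeff (F - G) k =ᵐ[volume] timeCoeff F k - timeCoeff G k := by
    have h3 := timeCoeff_add F ((-1 : ℂ) • G) k
    have h4 := timeCoeff_smul (-1) G k
    have e : F + (-1 : ℂ) • G = F - G := by rw [neg_one_smul, ← sub_eq_add_neg]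
    rw [e] at h3
    filter_upwards [h3, h4] with x hx hx2
    rw [hx, Pi.add_apply, hx2]
    simp [sub_eq_add_neg]
  have hgm : MemLp (fun x => (g x : ℂ)) 2 :=
    (Complex.continuous_ofReal.comp hg.smooth.continuous).memLp_of_hasCompactSupport
      (hg.compact.comp_left (g := fun r : ℝ => (r : ℂ)) (by simp))
  have h5 : ∫ x, (g x : ℂ) * timeCoeff (F - G) k x =
      (∫ x, (g x : ℂ) * timeCoeff F k x) - ∫ x, (g x : ℂ) * timeCoeff G k x := by
    have i1 : Integrable fun x => (g x : ℂ) * timeCoeff F k x :=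
      hgm.integrable_mul (p := 2) (q := 2) (memLp_timeCoeff F k)
    have i2 : Integrable fun x => (g x : ℂ) * timeCoeff G k x :=
      hgm.integrable_mul (p := 2) (q := 2) (memLp_timeCoeff G k)
    rw [← integral_sub i1 i2]
    refine integral_congr_ae ?_
    filter_upwards [hs] with x hx
    rw [hx, Pi.sub_apply]; ring
  rw [h5, mul_sub, h1, sub_self]

/-- At each time frequency, a weak solution `r⁺ U` of the equation with right-hand side `r⁺ F` has
`D Û = F̂` up to the Fourier transform of a function that vanishes on the half space. -/
theorem WeakEq.anticausal {U F : L2 T (d + 1)} (h : WeakEq (restr U) (restr F)) (k : ℤ)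
    (hU : MemLp (fun η => symD T k η * fourierG U k η) 2) :
    Anticausal fun η => symD T k η * fourierG U k η - fourierG F k η := by
  classical
  -- `D Û` need not be square summable over all `k`, so the function with transform `D Û` is formed
  -- at the time frequency `k` only, and compared with `F` by tests that see no other frequency
  set F1 : L2 T (d + 1) := mode k (𝓕⁻ (hU.toLp _)) with hF1
  have h1 : fourierG F1 k = hU.toLp _ := by
    rw [hF1, fourierG_mode, if_pos rfl, FourierTransform.fourier_fourierInv_eq]
  have hA : Anticausal (fourierG (F1 - F) k : Space (d + 1) → ℂ) := by
    refine anticausal_of_forall_modeTest fun g hg => ?_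
    have hφ := isTest_modeTest (T := T) k hg
    have s1 := (hasSum_pairing hφ (F1 - F)).unique
      (hasSum_single k fun j hj => by simp [charPairing_modeTest hj hg])
    have s2 := (hasSum_pairing hφ F).unique
      (hasSum_single k fun j hj => by simp [charPairing_modeTest hj hg])
    have s3 := (hasSum_pairing hφ.adjointOp U).unique
      (hasSum_single k fun j hj => by
        simp [charPairing_adjointOp hφ, charPairing_modeTest hj hg])
    have s4 := h _ hφ
    have s5 : ∫ p in Gplus T d, restr U p * adjointOp (modeTest k g) p =
      ∫ p in Gplus T d, restr F p * modeTest k g p := s4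
    rw [s3, s2] at s5
    rw [s1, fourierG_sub, h1]
    have s6 : ∫ η, charPairing (modeTest (T := T) k g) k η * (hU.toLp _ - fourierG F k :
        Lp ℂ 2 (volume : Measure (Space (d + 1)))) η =
        ∫ η, (charPairing (adjointOp (modeTest (T := T) k g)) k η * fourierG U k η -
          charPairing (modeTest (T := T) k g) k η * fourierG F k η) := by
      refine integral_congr_ae ?_
      filter_upwards [Lp.coeFn_sub (hU.toLp _) (fourierG F k), hU.coeFn_toLp] with η h2 h3
      rw [h2, Pi.sub_apply, h3, charPairing_adjointOp hφ]
      ring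
    have hm : MemLp (charPairing (modeTest (T := T) k g) k) 2 := hφ.memLp_charPairing k
    rw [s6, integral_sub, s5, sub_self]
    · refine (hm.integrable_mul (p := 2) (q := 2) hU).congr (Eventually.of_forall fun η => ?_)
      simp only [Pi.mul_apply, charPairing_adjointOp hφ]; ring
    · exact hm.integrable_mul (p := 2) (q := 2) (Lp.memLp _)
  refine hA.congr ?_
  rw [fourierG_sub, h1]
  filter_upwards [Lp.coeFn_sub (hU.toLp _) (fourierG F k), hU.coeFn_toLp] with η h2 h3
  rw [h2, Pi.sub_apply, h3]

end Pairing

/-! ### The roots of the symbol -/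

theorem sqrt_sq_and_re_pos {w : ℂ} (hw : w ∈ Complex.slitPlane) :
    (w ^ (1 / 2 : ℂ)) ^ 2 = w ∧ 0 < (w ^ (1 / 2 : ℂ)).re := by
  have hw0 : w ≠ 0 := Complex.slitPlane_ne_zero hw
  refine ⟨by rw [← Complex.cpow_nat_mul]; simp, ?_⟩
  rw [Complex.cpow_def_of_ne_zero hw0, Complex.exp_re]
  have e : (Complex.log w * (1 / 2 : ℂ)).im = w.arg / 2 := by
    have : Complex.log w * (1 / 2 : ℂ) = ((1 / 2 : ℝ) : ℂ) * Complex.log w := by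
      push_cast; ring
    rw [this, Complex.im_ofReal_mul, Complex.log_im]; ring
  rw [e]
  refine mul_pos (Real.exp_pos _) (Real.cos_pos_of_mem_Ioo ⟨?_, ?_⟩)
  · have := Complex.neg_pi_lt_arg w; linarith
  · have := lt_of_le_of_ne (Complex.arg_le_pi w) (Complex.mem_slitPlane_iff_arg.1 hw).1
    linarith

/-- The principal square root lies in a fixed sector around the positive axis if its argument
avoids a sector around the negative axis. -/
theorem sqrt_sector {w : ℂ} (hw : w ∈ Complex.slitPlane) (hs : -|w.im| ≤ w.re) :
    (w ^ (1 / 2 : ℂ)) ^ 2 = w ∧ 0 < (w ^ (1 / 2 : ℂ)).re ∧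
      |(w ^ (1 / 2 : ℂ)).im| ≤ 3 * (w ^ (1 / 2 : ℂ)).re := by
  obtain ⟨h2, hre⟩ := sqrt_sq_and_re_pos hw
  set s := w ^ (1 / 2 : ℂ)
  refine ⟨h2, hre, ?_⟩
  have e1 : w.re = s.re ^ 2 - s.im ^ 2 := by rw [← h2, sq]; simp [Complex.mul_re]; ring
  have e2 : w.im = 2 * s.re * s.im := by rw [← h2, sq]; simp [Complex.mul_im]; ring
  rw [e1, e2, abs_mul, abs_of_pos (by linarith : (0 : ℝ) < 2 * s.re)] at hs
  by_contra! h
  have h3 : s.im ^ 2 = |s.im| ^ 2 := (sq_abs _).symm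
  nlinarith [abs_nonneg s.im]

/-- A square root of the discriminant of `p² - iτp + iτ`. -/
def discRoot (τ : ℝ) : ℂ := (-(τ : ℂ) ^ 2 - 4 * Complex.I * τ) ^ (1 / 2 : ℂ)

/-- The root of `p² - iτp + iτ` with positive real part. -/
def pRoot (τ : ℝ) : ℂ := (Complex.I * τ + discRoot τ) / 2

/-- The root of `q² - iτq + iτ` with negative real part. -/
def qRoot (τ : ℝ) : ℂ := (Complex.I * τ - discRoot τ) / 2

/-- The number `a` with `a² = |ξ'|² + p` and `Re a > 0`. -/
def aRoot {d : ℕ} (τ : ℝ) (ξ' : Space d) : ℂ := (((‖ξ'‖ ^ 2 : ℝ) : ℂ) + pRoot τ) ^ (1 / 2 : ℂ)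

/-- The number `b` with `b² = |ξ'|² + q` and `Re b > 0`. -/
def bRoot {d : ℕ} (τ : ℝ) (ξ' : Space d) : ℂ := (((‖ξ'‖ ^ 2 : ℝ) : ℂ) + qRoot τ) ^ (1 / 2 : ℂ)

theorem stronglyMeasurable_aRoot {d : ℕ} (τ : ℝ) :
    StronglyMeasurable (aRoot τ : Space d → ℂ) := by
  refine Measurable.stronglyMeasurable ?_
  unfold aRoot
  fun_prop

theorem stronglyMeasurable_bRoot {d : ℕ} (τ : ℝ) :
    StronglyMeasurable (bRoot τ : Space d → ℂ) := by
  refine Measurable.stronglyMeasurable ?_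
  unfold bRoot
  fun_prop

theorem discRoot_spec {τ : ℝ} (hτ : τ ≠ 0) :
    discRoot τ ^ 2 = -(τ : ℂ) ^ 2 - 4 * Complex.I * τ ∧ 0 < (discRoot τ).re := by
  refine sqrt_sq_and_re_pos (Or.inr ?_)
  have him : (-(τ : ℂ) ^ 2 - 4 * Complex.I * τ).im = -4 * τ := by rw [sq]; simp
  rw [him]; simpa using hτ

theorem pRoot_add_qRoot (τ : ℝ) : pRoot τ + qRoot τ = Complex.I * τ := by
  unfold pRoot qRoot; ring

theorem pRoot_mul_qRoot {τ : ℝ} (hτ : τ ≠ 0) : pRoot τ * qRoot τ = Complex.I * τ := by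
  have h := (discRoot_spec hτ).1
  unfold pRoot qRoot
  linear_combination (-1 / 4 : ℂ) * h + (τ : ℂ) ^ 2 / 4 * Complex.I_sq

/-- For the discriminant root `x + iy` one has `x² - y² = -τ²` and `xy = -2τ`, so that `τ` and `y`
have opposite signs and `|τ| ≤ |y|`: the imaginary parts of `iτ` and of the root nearly cancel in
`p` and add up in `q`. -/
theorem pRoot_qRoot_bounds {τ : ℝ} (hτ : τ ≠ 0) :
    0 < (pRoot τ).re ∧ |(pRoot τ).im| ≤ (pRoot τ).re ∧ -|(qRoot τ).im| ≤ (qRoot τ).re ∧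
      |τ| ≤ |(qRoot τ).im| := by
  obtain ⟨h1, hx⟩ := discRoot_spec hτ
  set x := (discRoot τ).re with hxd
  set y := (discRoot τ).im with hyd
  have e1 : x ^ 2 - y ^ 2 = -τ ^ 2 := by
    have := congrArg Complex.re h1
    simp [sq, Complex.mul_re] at this
    rw [← hxd, ← hyd] at this
    linarith
  have e2 : x * y = -2 * τ := by
    have := congrArg Complex.im h1
    simp [sq, Complex.mul_im] at this
    rw [← hxd, ← hyd] at this
    linarith
  have p1 : (pRoot τ).re = x / 2 := by simp [pRoot, hxd]
  have p2 : (pRoot τ).im = (τ + y) / 2 := by simp [pRoot, hyd]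
  have q1 : (qRoot τ).re = -x / 2 := by simp [qRoot, hxd]
  have q2 : (qRoot τ).im = (τ - y) / 2 := by simp [qRoot, hyd]
  rw [p1, p2, q1, q2]
  rcases lt_or_gt_of_ne hτ with h | h
  · have hy : 0 < y := by
      by_contra! hy
      nlinarith
    have hty : -τ ≤ y := by nlinarith
    have h3 : (τ + y) ≤ x := by nlinarith
    have h4 : x ≤ y - τ := by nlinarith
    rw [abs_of_neg h, abs_of_nonneg (by linarith : 0 ≤ (τ + y) / 2),
      abs_of_nonpos (by linarith : (τ - y) / 2 ≤ 0)]
    refine ⟨by linarith, by linarith, by linarith, by linarith⟩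
  · have hy : y < 0 := by
      by_contra! hy
      nlinarith
    have hty : τ ≤ -y := by nlinarith
    have h3 : -(τ + y) ≤ x := by nlinarith
    have h4 : x ≤ τ - y := by nlinarith
    rw [abs_of_pos h, abs_of_nonpos (by linarith : (τ + y) / 2 ≤ 0),
      abs_of_nonneg (by linarith : 0 ≤ (τ - y) / 2)]
    refine ⟨by linarith, by linarith, by linarith, by linarith⟩

variable {d : ℕ}

theorem aRoot_spec {τ : ℝ} (hτ : τ ≠ 0) (ξ' : Space d) :
    aRoot τ ξ' ^ 2 = ((‖ξ'‖ ^ 2 : ℝ) : ℂ) + pRoot τ ∧ 0 < (aRoot τ ξ').re ∧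
      |(aRoot τ ξ').im| ≤ 3 * (aRoot τ ξ').re := by
  obtain ⟨h1, h2, -, -⟩ := pRoot_qRoot_bounds hτ
  have hX : 0 ≤ ‖ξ'‖ ^ 2 := by positivity
  refine sqrt_sector (Or.inl ?_) ?_
  · rw [Complex.add_re, Complex.ofReal_re]; linarith
  · rw [Complex.add_re, Complex.ofReal_re]
    have := abs_nonneg (((‖ξ'‖ ^ 2 : ℝ) : ℂ) + pRoot τ).im
    linarith

theorem bRoot_spec {τ : ℝ} (hτ : τ ≠ 0) (ξ' : Space d) :
    bRoot τ ξ' ^ 2 = ((‖ξ'‖ ^ 2 : ℝ) : ℂ) + qRoot τ ∧ 0 < (bRoot τ ξ').re ∧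
      |(bRoot τ ξ').im| ≤ 3 * (bRoot τ ξ').re := by
  obtain ⟨-, -, h3, h4⟩ := pRoot_qRoot_bounds hτ
  have hX : 0 ≤ ‖ξ'‖ ^ 2 := by positivity
  have him : (((‖ξ'‖ ^ 2 : ℝ) : ℂ) + qRoot τ).im = (qRoot τ).im := by
    rw [Complex.add_im, Complex.ofReal_im, zero_add]
  refine sqrt_sector (Or.inr ?_) ?_
  · rw [him]
    have : 0 < |τ| := abs_pos.2 hτ
    exact abs_pos.1 (this.trans_le h4)
  · rw [him, Complex.add_re, Complex.ofReal_re]; linarith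

/-- As `|τ| → ∞`, the root `p` stays bounded whereas `q` grows like `τ`, because `p + q = pq = iτ`.
This is what makes the two roots of `D⁻` scale differently. -/
theorem norm_pRoot_qRoot {τ : ℝ} (hτ : τ ≠ 0) :
    ‖pRoot τ‖ ≤ 1 ∧ |τ| ≤ ‖qRoot τ‖ ∧ ‖qRoot τ‖ ≤ |τ| + 1 ∧ |τ| ≤ ‖pRoot τ‖ * (|τ| + 1) := by
  obtain ⟨-, -, -, h4⟩ := pRoot_qRoot_bounds hτ
  have ht : 0 < |τ| := abs_pos.2 hτ
  have hq : |τ| ≤ ‖qRoot τ‖ := h4.trans (Complex.abs_im_le_norm _)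
  have hpq : ‖pRoot τ‖ * ‖qRoot τ‖ = |τ| := by
    rw [← norm_mul, pRoot_mul_qRoot hτ]; simp
  have hp : ‖pRoot τ‖ ≤ 1 := by
    have := norm_nonneg (pRoot τ)
    by_contra! h
    nlinarith
  have hq2 : ‖qRoot τ‖ ≤ |τ| + 1 := by
    have e : qRoot τ = Complex.I * τ - pRoot τ := by rw [← pRoot_add_qRoot τ]; ring
    calc ‖qRoot τ‖ ≤ ‖Complex.I * τ‖ + ‖pRoot τ‖ := by rw [e]; exact norm_sub_le _ _
      _ ≤ |τ| + 1 := by simpa using hp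
  refine ⟨hp, hq, hq2, ?_⟩
  have := norm_nonneg (pRoot τ)
  nlinarith

/-- The factorization `D = (z² + a²) (z² + b²)`. -/
theorem symbolD_eq_prod {τ : ℝ} (hτ : τ ≠ 0) (ξ' : Space d) :
    symbolD τ ξ' = (({Complex.I * aRoot τ ξ', -(Complex.I * aRoot τ ξ'), Complex.I * bRoot τ ξ',
      -(Complex.I * bRoot τ ξ')} : Multiset ℂ).map fun ρ => X - C ρ).prod := by
  have ha := (aRoot_spec hτ ξ').1
  have hb := (bRoot_spec hτ ξ').1
  have hp := pRoot_add_qRoot τ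
  have hq := pRoot_mul_qRoot hτ
  set a := aRoot τ ξ'
  set b := bRoot τ ξ'
  push_cast at ha hb
  have e1 : C (a ^ 2) + C (b ^ 2) = C (2 * (‖ξ'‖ : ℂ) ^ 2 + Complex.I * τ) := by
    rw [← C_add, ha, hb]; congr 1; linear_combination hp
  have e2 : C (a ^ 2) * C (b ^ 2) =
      C ((‖ξ'‖ : ℂ) ^ 4 + (‖ξ'‖ : ℂ) ^ 2 * (Complex.I * τ) + Complex.I * τ) := by
    rw [← C_mul, ha, hb]; congr 1; linear_combination (‖ξ'‖ : ℂ) ^ 2 * hp + hq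
  have hI : (C Complex.I : ℂ[X]) ^ 2 = -1 := by
    rw [← C_pow, Complex.I_sq, C_neg, C_1]
  simp only [symbolD, Multiset.insert_eq_cons, Multiset.map_cons, Multiset.map_singleton,
    Multiset.prod_cons, Multiset.prod_singleton, C_neg, C_mul, C_add, C_pow, C_ofNat] at e1 e2 ⊢
  linear_combination (-X ^ 2 : ℂ[X]) * e1 - e2 +
    (X ^ 2 * (C a ^ 2 + C b ^ 2) - (C Complex.I ^ 2 - 1) * C a ^ 2 * C b ^ 2) * hI

theorem roots_symbolD {τ : ℝ} (hτ : τ ≠ 0) (ξ' : Space d) :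
    (symbolD τ ξ').roots = {Complex.I * aRoot τ ξ', -(Complex.I * aRoot τ ξ'),
      Complex.I * bRoot τ ξ', -(Complex.I * bRoot τ ξ')} := by
  rw [symbolD_eq_prod hτ, roots_multiset_prod_X_sub_C]

theorem symbolDplus_eq {τ : ℝ} (hτ : τ ≠ 0) (ξ' : Space d) :
    symbolDplus τ ξ' = (X - C (Complex.I * aRoot τ ξ')) * (X - C (Complex.I * bRoot τ ξ')) := by
  have ha := (aRoot_spec hτ ξ').2.1
  have hb := (bRoot_spec hτ ξ').2.1
  rw [symbolDplus, roots_symbolD hτ]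
  simp only [Multiset.insert_eq_cons]
  rw [Multiset.filter_cons_of_pos _ (by simpa using ha),
    Multiset.filter_cons_of_neg _ (by simpa using ha.le),
    Multiset.filter_cons_of_pos _ (by simpa using hb), Multiset.filter_singleton,
    if_neg (by simpa using hb.le)]
  simp

theorem symbolDminus_eq {τ : ℝ} (hτ : τ ≠ 0) (ξ' : Space d) :
    symbolDminus τ ξ' = (X + C (Complex.I * aRoot τ ξ')) * (X + C (Complex.I * bRoot τ ξ')) := by
  have ha := (aRoot_spec hτ ξ').2.1
  have hb := (bRoot_spec hτ ξ').2.1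
  rw [symbolDminus, roots_symbolD hτ]
  simp only [Multiset.insert_eq_cons]
  rw [Multiset.filter_cons_of_neg _ (by simpa using ha.le),
    Multiset.filter_cons_of_pos _ (by simpa using ha),
    Multiset.filter_cons_of_neg _ (by simpa using hb.le), Multiset.filter_singleton,
    if_pos (by simpa using hb)]
  simp

/-- `D⁺` has degree two, so that no nonzero polynomial of degree at most one is a multiple of
it. -/
theorem lopatinskiiShapiro_dirichletSymbol : LopatinskiiShapiro (d := d) dirichletSymbol := by
  intro τ hτ ξ' c hdvd
  rw [symbolDplus_eq hτ] at hdvd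
  have hdeg : ((X - C (Complex.I * aRoot τ ξ')) * (X - C (Complex.I * bRoot τ ξ'))).degree = 2 := by
    rw [degree_mul, degree_X_sub_C, degree_X_sub_C]; rfl
  have hs : ∑ i, C (c i) * dirichletSymbol i τ ξ' = C (c 1 * Complex.I) * X + C (c 0) := by
    simp [Fin.sum_univ_two, dirichletSymbol]
    ring
  rw [hs] at hdvd
  have h0 : C (c 1 * Complex.I) * X + C (c 0) = 0 := by
    refine eq_zero_of_dvd_of_degree_lt hdvd ?_
    rw [hdeg]
    exact lt_of_le_of_lt degree_linear_le (by norm_num)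
  have h1 := congrArg (fun p : ℂ[X] => p.coeff 1) h0
  have h2 := congrArg (fun p : ℂ[X] => p.coeff 0) h0
  simp [coeff_C] at h1 h2
  funext i
  fin_cases i <;> simp [h1, h2]

/-! ### Estimates for the symbol -/

/-- Comparison of `|z + ic|²` with `z² + |c|²` for `c` in the sector `|Im c| ≤ 3 Re c`. -/
theorem le_norm_add_I_mul {c : ℂ} (hc : |c.im| ≤ 3 * c.re) (z : ℝ) :
    z ^ 2 + ‖c‖ ^ 2 ≤ 28 * ‖(z : ℂ) + Complex.I * c‖ ^ 2 := by
  rw [← Complex.normSq_eq_norm_sq, ← Complex.normSq_eq_norm_sq, Complex.normSq_apply,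
    Complex.normSq_apply]
  simp
  have h := abs_le.1 hc
  nlinarith [sq_nonneg (z - 2 * c.im),
    mul_nonneg (sub_nonneg.2 h.2) (by linarith : 0 ≤ c.im + 3 * c.re)]

theorem norm_add_I_mul_le (c : ℂ) (z : ℝ) :
    ‖(z : ℂ) + Complex.I * c‖ ^ 2 ≤ 2 * (z ^ 2 + ‖c‖ ^ 2) := by
  have h : ‖(z : ℂ) + Complex.I * c‖ ≤ |z| + ‖c‖ :=
    (norm_add_le _ _).trans (by simp)
  have h2 := pow_le_pow_left₀ (norm_nonneg _) h 2
  nlinarith [sq_nonneg (|z| - ‖c‖), sq_abs z]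

/-- Upper and lower bounds for the roots, uniformly in the time frequencies `|τ| ≥ τ₀`: `|a|² ∼ 1 +
|ξ'|²` and `|b|² ∼ |τ| + |ξ'|²`. -/
structure RootBounds (d : ℕ) (τ₀ C : ℝ) : Prop where
  one_le : 1 ≤ C
  le_a : ∀ τ, τ₀ ≤ |τ| → ∀ ξ' : Space d, 1 + ‖ξ'‖ ^ 2 ≤ C * ‖aRoot τ ξ'‖ ^ 2
  le_b : ∀ τ, τ₀ ≤ |τ| → ∀ ξ' : Space d, 1 + |τ| + ‖ξ'‖ ^ 2 ≤ C * ‖bRoot τ ξ'‖ ^ 2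
  a_le : ∀ τ, τ₀ ≤ |τ| → ∀ ξ' : Space d, ‖aRoot τ ξ'‖ ^ 2 ≤ C * (1 + ‖ξ'‖ ^ 2)
  b_le : ∀ τ, τ₀ ≤ |τ| → ∀ ξ' : Space d, ‖bRoot τ ξ'‖ ^ 2 ≤ C * (|τ| + ‖ξ'‖ ^ 2)
  a_le_b : ∀ τ, τ₀ ≤ |τ| → ∀ ξ' : Space d, ‖aRoot τ ξ'‖ ^ 2 ≤ C * ‖bRoot τ ξ'‖ ^ 2

theorem exists_rootBounds (d : ℕ) {τ₀ : ℝ} (h0 : 0 < τ₀) : ∃ C, RootBounds d τ₀ C := by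
  set K : ℝ := 1 + 1 / τ₀ with hK
  have hK1 : 1 ≤ K := by have : 0 < 1 / τ₀ := by positivity
                         linarith
  have hne : ∀ τ : ℝ, τ₀ ≤ |τ| → τ ≠ 0 := fun τ h => abs_pos.1 (h0.trans_le h)
  have hKτ : ∀ τ : ℝ, τ₀ ≤ |τ| → |τ| + 1 ≤ K * |τ| := by
    intro τ h
    have : 1 ≤ 1 / τ₀ * |τ| := by rw [div_mul_eq_mul_div, one_mul, le_div_iff₀ h0]; linarith
    rw [hK]; linarith
  have hp : ∀ τ : ℝ, τ₀ ≤ |τ| → 1 ≤ K * ‖pRoot τ‖ := by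
    intro τ h
    have h1 := (norm_pRoot_qRoot (hne τ h)).2.2.2
    have h2 := hKτ τ h
    have h3 := h0.trans_le h
    have h4 := norm_nonneg (pRoot τ)
    have h5 : |τ| ≤ (K * ‖pRoot τ‖) * |τ| := h1.trans (by nlinarith)
    by_contra! h6
    nlinarith
  have ha : ∀ τ, τ₀ ≤ |τ| → ∀ ξ' : Space d, 1 + ‖ξ'‖ ^ 2 ≤ 2 * K * ‖aRoot τ ξ'‖ ^ 2 := by
    intro τ h ξ'
    have h1 := (aRoot_spec (hne τ h) ξ').1
    have h2 := (pRoot_qRoot_bounds (hne τ h)).1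
    rw [← norm_pow, h1]
    have hX : 0 ≤ ‖ξ'‖ ^ 2 := by positivity
    have h3 : ‖ξ'‖ ^ 2 ≤ ‖((‖ξ'‖ ^ 2 : ℝ) : ℂ) + pRoot τ‖ := by
      refine le_trans ?_ (Complex.re_le_norm _)
      rw [Complex.add_re, Complex.ofReal_re]; linarith
    have h4 : ‖pRoot τ‖ ≤ ‖((‖ξ'‖ ^ 2 : ℝ) : ℂ) + pRoot τ‖ := by
      refine (sq_le_sq₀ (norm_nonneg _) (norm_nonneg _)).1 ?_
      rw [← Complex.normSq_eq_norm_sq, ← Complex.normSq_eq_norm_sq, Complex.normSq_apply,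
        Complex.normSq_apply, Complex.add_re, Complex.ofReal_re, Complex.add_im, Complex.ofReal_im]
      nlinarith
    have := hp τ h
    nlinarith
  have ha' : ∀ τ, τ₀ ≤ |τ| → ∀ ξ' : Space d, ‖aRoot τ ξ'‖ ^ 2 ≤ 1 + ‖ξ'‖ ^ 2 := by
    intro τ h ξ'
    rw [← norm_pow, (aRoot_spec (hne τ h) ξ').1]
    refine (norm_add_le _ _).trans ?_
    have h1 := (norm_pRoot_qRoot (hne τ h)).1
    rw [Complex.norm_real, Real.norm_of_nonneg (by positivity)]
    linarith
  have hb : ∀ τ, τ₀ ≤ |τ| → ∀ ξ' : Space d, ‖bRoot τ ξ'‖ ^ 2 ≤ K * (|τ| + ‖ξ'‖ ^ 2) := by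
    intro τ h ξ'
    rw [← norm_pow, (bRoot_spec (hne τ h) ξ').1]
    refine (norm_add_le _ _).trans ?_
    have h1 := (norm_pRoot_qRoot (hne τ h)).2.2.1
    have h2 := hKτ τ h
    have hX : 0 ≤ ‖ξ'‖ ^ 2 := by positivity
    rw [Complex.norm_real, Real.norm_of_nonneg (by positivity)]
    nlinarith
  have hb' : ∀ τ, τ₀ ≤ |τ| → ∀ ξ' : Space d,
      1 + |τ| + ‖ξ'‖ ^ 2 ≤ 4 * K * ‖bRoot τ ξ'‖ ^ 2 := by
    intro τ h ξ'
    have h1 := (bRoot_spec (hne τ h) ξ').1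
    have h2 := (pRoot_qRoot_bounds (hne τ h)).2.2.2
    have h3 := (norm_pRoot_qRoot (hne τ h)).2.2.1
    have h4 := hKτ τ h
    rw [← norm_pow, h1]
    set w := ((‖ξ'‖ ^ 2 : ℝ) : ℂ) + qRoot τ with hw
    have h5 : |τ| ≤ ‖w‖ := by
      refine h2.trans (le_trans (le_of_eq ?_) (Complex.abs_im_le_norm w))
      rw [hw, Complex.add_im, Complex.ofReal_im, zero_add]
    have h6 : ‖ξ'‖ ^ 2 ≤ ‖w‖ + ‖qRoot τ‖ := by
      have : ((‖ξ'‖ ^ 2 : ℝ) : ℂ) = w - qRoot τ := by rw [hw]; ring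
      have h7 := norm_sub_le w (qRoot τ)
      rwa [← this, Complex.norm_real, Real.norm_of_nonneg (by positivity)] at h7
    nlinarith
  refine ⟨4 * K * K, by nlinarith, fun τ h ξ' => ?_, fun τ h ξ' => ?_, fun τ h ξ' => ?_,
    fun τ h ξ' => ?_, fun τ h ξ' => ?_⟩
  · refine (ha τ h ξ').trans (mul_le_mul_of_nonneg_right (by nlinarith) (by positivity))
  · refine (hb' τ h ξ').trans (mul_le_mul_of_nonneg_right (by nlinarith) (by positivity))
  · refine (ha' τ h ξ').trans ?_
    have : 0 ≤ 1 + ‖ξ'‖ ^ 2 := by positivity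
    nlinarith [mul_nonneg (by nlinarith : 0 ≤ 4 * K * K - 1) this]
  · refine (hb τ h ξ').trans (mul_le_mul_of_nonneg_right (by nlinarith) (by positivity))
  · have h1 := ha' τ h ξ'
    have h2 := hb' τ h ξ'
    have h3 := abs_nonneg τ
    have : 4 * K * ‖bRoot τ ξ'‖ ^ 2 ≤ 4 * K * K * ‖bRoot τ ξ'‖ ^ 2 :=
      mul_le_mul_of_nonneg_right (by nlinarith) (by positivity)
    linarith

/-! ### Integrals over the normal frequency -/

theorem tendsto_one_sub_div {l : Filter ℝ} (hl : Tendsto (fun x : ℝ => (x : ℂ)⁻¹) l (𝓝 0))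
    (ρ c : ℂ) : Tendsto (fun x : ℝ => c - ρ * (x : ℂ)⁻¹) l (𝓝 c) := by
  simpa using (hl.const_mul ρ).const_sub c

theorem tendsto_ofReal_inv_atTop : Tendsto (fun x : ℝ => (x : ℂ)⁻¹) atTop (𝓝 0) := by
  have h := (Complex.continuous_ofReal.tendsto 0).comp tendsto_inv_atTop_zero
  refine (h.congr fun x => ?_)
  simp

theorem tendsto_log_sub_log_atTop (ρ σ : ℂ) :
    Tendsto (fun x : ℝ => Complex.log (x - ρ) - Complex.log (x - σ)) atTop (𝓝 0) := by
  have h1 : ∀ ρ : ℂ, Tendsto (fun x : ℝ => Complex.log (1 - ρ * (x : ℂ)⁻¹)) atTop (𝓝 0) := by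
    intro ρ
    have h2 := tendsto_one_sub_div tendsto_ofReal_inv_atTop ρ 1
    have h3 := (continuousAt_clog Complex.one_mem_slitPlane).tendsto.comp h2
    rwa [Complex.log_one] at h3
  have h4 := (h1 ρ).sub (h1 σ)
  rw [sub_zero] at h4
  refine h4.congr' ?_
  have hne : ∀ ρ : ℂ, ∀ᶠ x : ℝ in atTop, (1 - ρ * (x : ℂ)⁻¹) ≠ 0 := fun ρ =>
    (tendsto_one_sub_div tendsto_ofReal_inv_atTop ρ 1).eventually_ne one_ne_zero
  filter_upwards [hne ρ, hne σ, eventually_gt_atTop 0] with x h5 h6 hx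
  have hx0 : (x : ℂ) ≠ 0 := by exact_mod_cast hx.ne'
  have e : ∀ ρ : ℂ, (x : ℂ) - ρ = (x : ℂ) * (1 - ρ * (x : ℂ)⁻¹) := by
    intro ρ; field_simp
  rw [e ρ, e σ, Complex.log_ofReal_mul hx h5, Complex.log_ofReal_mul hx h6]
  ring

/-- At `-∞` the two logarithms approach the negative axis from opposite sides, so their branches
differ by `2πi`; this is the source of all residues below. -/
theorem tendsto_log_sub_log_atBot {ρ σ : ℂ} (hρ : 0 < ρ.im) (hσ : σ.im < 0) :
    Tendsto (fun x : ℝ => Complex.log (x - ρ) - Complex.log (x - σ)) atBot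
      (𝓝 (-(2 * Real.pi * Complex.I))) := by
  have him : ∀ (ρ : ℂ) (y : ℝ), (-1 - ρ * (y : ℂ)⁻¹).im = -(ρ.im * y⁻¹) := by
    intro ρ y
    rw [← Complex.ofReal_inv]
    simp [Complex.mul_im]
  have h1 : Tendsto (fun y : ℝ => Complex.log (-1 - ρ * (y : ℂ)⁻¹)) atTop
      (𝓝 (Real.log ‖(-1 : ℂ)‖ - Real.pi * Complex.I)) := by
    refine (Complex.tendsto_log_nhdsWithin_im_neg_of_re_neg_of_im_zero (z := -1) (by simp)
      (by simp)).comp ?_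
    refine tendsto_nhdsWithin_iff.2 ⟨tendsto_one_sub_div tendsto_ofReal_inv_atTop ρ _, ?_⟩
    filter_upwards [eventually_gt_atTop 0] with y hy
    show (-1 - ρ * (y : ℂ)⁻¹).im < 0
    rw [him]
    have : 0 < ρ.im * y⁻¹ := by positivity
    linarith
  have h2 : Tendsto (fun y : ℝ => Complex.log (-1 - σ * (y : ℂ)⁻¹)) atTop
      (𝓝 (Real.log ‖(-1 : ℂ)‖ + Real.pi * Complex.I)) := by
    refine (Complex.tendsto_log_nhdsWithin_im_nonneg_of_re_neg_of_im_zero (z := -1) (by simp)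
      (by simp)).comp ?_
    refine tendsto_nhdsWithin_iff.2 ⟨tendsto_one_sub_div tendsto_ofReal_inv_atTop σ _, ?_⟩
    filter_upwards [eventually_gt_atTop 0] with y hy
    show 0 ≤ (-1 - σ * (y : ℂ)⁻¹).im
    rw [him]
    have : 0 < -σ.im * y⁻¹ := mul_pos (by linarith) (by positivity)
    linarith
  have h3 := h1.sub h2
  have e0 : (Real.log ‖(-1 : ℂ)‖ - Real.pi * Complex.I) -
      (Real.log ‖(-1 : ℂ)‖ + Real.pi * Complex.I) = -(2 * Real.pi * Complex.I) := by ring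
  rw [e0] at h3
  have h4 := h3.comp tendsto_neg_atBot_atTop
  refine h4.congr' ?_
  filter_upwards [eventually_lt_atBot 0] with x hx
  have hx0 : (x : ℂ) ≠ 0 := by exact_mod_cast hx.ne
  have e : ∀ ρ : ℂ, (x : ℂ) - ρ = ((-x : ℝ) : ℂ) * (-1 - ρ * ((-x : ℝ) : ℂ)⁻¹) := by
    intro ρ; push_cast; field_simp
    ring
  have hne : ∀ ρ : ℂ, ρ.im ≠ 0 → (-1 - ρ * ((-x : ℝ) : ℂ)⁻¹) ≠ 0 := by
    intro ρ h h0
    have := congrArg Complex.im h0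
    rw [him] at this
    simp at this
    exact this.elim h hx.ne
  simp only [Function.comp]
  rw [e ρ, e σ, Complex.log_ofReal_mul (by linarith) (hne ρ hρ.ne'),
    Complex.log_ofReal_mul (by linarith) (hne σ hσ.ne)]
  ring

theorem sub_ne_zero_of_im {ρ : ℂ} (hρ : ρ.im ≠ 0) (x : ℝ) : (x : ℂ) - ρ ≠ 0 := by
  intro h
  have := congrArg Complex.im h
  simp at this
  exact hρ this

theorem memLp_inv_sub {ρ : ℂ} (hρ : ρ.im ≠ 0) : MemLp (fun x : ℝ => ((x : ℂ) - ρ)⁻¹) 2 := by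
  have hc : Continuous fun x : ℝ => ((x : ℂ) - ρ)⁻¹ :=
    Continuous.inv₀ (by fun_prop) (sub_ne_zero_of_im hρ)
  rw [memLp_two_iff_integrable_sq_norm hc.aestronglyMeasurable]
  have h1 := ((integrable_inv_one_add_sq.comp_div hρ).comp_sub_right ρ.re).const_mul (ρ.im ^ 2)⁻¹
  refine h1.congr (Eventually.of_forall fun x => ?_)
  simp only
  rw [norm_inv, inv_pow, ← Complex.normSq_eq_norm_sq, Complex.normSq_apply, ← mul_inv]
  congr 1
  simp
  field_simp
  ring

theorem integrable_inv_sub_mul_pow {ρ σ : ℂ} (hρ : ρ.im ≠ 0) (hσ : σ.im ≠ 0) (m : ℕ) :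
    Integrable fun x : ℝ => ((x : ℂ) - ρ)⁻¹ * (((x : ℂ) - σ)⁻¹) ^ (m + 1) := by
  have hc : Continuous fun x : ℝ => ((x : ℂ) - σ)⁻¹ :=
    Continuous.inv₀ (by fun_prop) (sub_ne_zero_of_im hσ)
  have h1 : Integrable fun x : ℝ => ((x : ℂ) - ρ)⁻¹ * ((x : ℂ) - σ)⁻¹ :=
    (memLp_inv_sub hρ).integrable_mul (p := 2) (q := 2) (memLp_inv_sub hσ)
  have h2 := h1.mul_bdd (c := (|σ.im|⁻¹) ^ m) (hc.pow m).aestronglyMeasurable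
    (Eventually.of_forall fun x => by
      rw [Pi.pow_apply, norm_pow]
      refine pow_le_pow_left₀ (norm_nonneg _) ?_ m
      rw [norm_inv]
      refine inv_anti₀ (abs_pos.2 hσ) ?_
      simpa using Complex.abs_im_le_norm ((x : ℂ) - σ))
  refine h2.congr (Eventually.of_forall fun x => ?_)
  simp only [Pi.pow_apply]; ring

theorem integral_inv_sub_pow {σ : ℂ} (hσ : σ.im ≠ 0) (m : ℕ) :
    ∫ x : ℝ, (((x : ℂ) - σ)⁻¹) ^ (m + 2) = 0 := by
  have hd : ∀ x : ℝ, HasDerivAt (fun x : ℝ => (-(m + 1 : ℂ)⁻¹) * (((x : ℂ) - σ)⁻¹) ^ (m + 1))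
      ((((x : ℂ) - σ)⁻¹) ^ (m + 2)) x := by
    intro x
    have h0 := sub_ne_zero_of_im hσ x
    have h1 : HasDerivAt (fun x : ℝ => (x : ℂ) - σ) 1 x :=
      (Complex.ofRealCLM.hasDerivAt (x := x)).sub_const σ
    have h2 := ((h1.inv h0).pow (m + 1)).const_mul (-(m + 1 : ℂ)⁻¹)
    refine h2.congr_deriv ?_
    have : (m + 1 : ℂ) ≠ 0 := by exact_mod_cast Nat.succ_ne_zero m
    simp
    field_simp
    ring
  have hi : Integrable fun x : ℝ => (((x : ℂ) - σ)⁻¹) ^ (m + 2) := by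
    refine (integrable_inv_sub_mul_pow hσ hσ m).congr (Eventually.of_forall fun x => ?_)
    simp only; ring
  have hlim : ∀ l : Filter ℝ, Tendsto (fun x : ℝ => ‖(x : ℂ) - σ‖) l atTop →
      Tendsto (fun x : ℝ => (-(m + 1 : ℂ)⁻¹) * (((x : ℂ) - σ)⁻¹) ^ (m + 1)) l (𝓝 0) := by
    intro l hl
    have h1 : Tendsto (fun x : ℝ => ((x : ℂ) - σ)⁻¹) l (𝓝 0) := by
      rw [tendsto_zero_iff_norm_tendsto_zero]
      simp_rw [norm_inv]
      exact tendsto_inv_atTop_zero.comp hl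
    simpa using (h1.pow (m + 1)).const_mul (-(m + 1 : ℂ)⁻¹)
  have hre : ∀ x : ℝ, |x - σ.re| ≤ ‖(x : ℂ) - σ‖ := fun x => by
    simpa using Complex.abs_re_le_norm ((x : ℂ) - σ)
  rw [integral_of_hasDerivAt_of_tendsto hd hi
    (hlim atBot (tendsto_atTop_mono hre (tendsto_abs_atBot_atTop.comp
      (tendsto_atBot_add_const_right _ _ tendsto_id))))
    (hlim atTop (tendsto_atTop_mono hre (tendsto_abs_atTop_atTop.comp
      (tendsto_atTop_add_const_right _ _ tendsto_id)))), sub_zero]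

theorem sub_ne_zero_of_im_lt {ρ σ : ℂ} (hρ : 0 < ρ.im) (hσ : σ.im < 0) : ρ - σ ≠ 0 := by
  intro h
  have := congrArg Complex.im h
  simp at this
  linarith

theorem inv_sub_mul_inv_sub {x ρ σ : ℂ} (h : ρ - σ ≠ 0) (hρ : x - ρ ≠ 0) (hσ : x - σ ≠ 0) :
    (x - ρ)⁻¹ * (x - σ)⁻¹ = (ρ - σ)⁻¹ * ((x - ρ)⁻¹ - (x - σ)⁻¹) := by
  have e : ρ - σ = (x - σ) - (x - ρ) := by ring
  rw [e] at h ⊢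
  generalize x - ρ = u at *
  generalize x - σ = v at *
  field_simp

/-- The residue of `1 / ((x - ρ) (x - σ)^m)` at `ρ`. -/
theorem integral_inv_sub_mul_pow {ρ σ : ℂ} (hρ : 0 < ρ.im) (hσ : σ.im < 0) (m : ℕ) :
    ∫ x : ℝ, ((x : ℂ) - ρ)⁻¹ * (((x : ℂ) - σ)⁻¹) ^ (m + 1) =
      2 * Real.pi * Complex.I / (ρ - σ) ^ (m + 1) := by
  have hne := sub_ne_zero_of_im_lt hρ hσ
  induction m with
  | zero =>
    have hd : ∀ x : ℝ, HasDerivAt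
        (fun x : ℝ => (ρ - σ)⁻¹ * (Complex.log (x - ρ) - Complex.log (x - σ)))
        (((x : ℂ) - ρ)⁻¹ * (((x : ℂ) - σ)⁻¹) ^ (0 + 1)) x := by
      intro x
      have h1 : ∀ ρ : ℂ, HasDerivAt (fun x : ℝ => (x : ℂ) - ρ) 1 x := fun ρ =>
        (Complex.ofRealCLM.hasDerivAt (x := x)).sub_const ρ
      have hs : ∀ ρ : ℂ, ρ.im ≠ 0 → (x : ℂ) - ρ ∈ Complex.slitPlane := fun ρ h =>
        Or.inr (by simpa using h)
      have h2 := (((h1 ρ).clog_real (hs ρ hρ.ne')).sub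
        ((h1 σ).clog_real (hs σ hσ.ne))).const_mul (ρ - σ)⁻¹
      refine h2.congr_deriv ?_
      rw [zero_add, pow_one, inv_sub_mul_inv_sub hne (sub_ne_zero_of_im hρ.ne' x)
        (sub_ne_zero_of_im hσ.ne x), one_div, one_div]
    rw [integral_of_hasDerivAt_of_tendsto hd (integrable_inv_sub_mul_pow hρ.ne' hσ.ne 0)
      ((tendsto_log_sub_log_atBot hρ hσ).const_mul _)
      ((tendsto_log_sub_log_atTop ρ σ).const_mul _)]
    field_simp
    ring
  | succ m ih =>
    have h1 : ∀ x : ℝ, ((x : ℂ) - ρ)⁻¹ * (((x : ℂ) - σ)⁻¹) ^ (m + 1 + 1) =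
        (ρ - σ)⁻¹ * (((x : ℂ) - ρ)⁻¹ * (((x : ℂ) - σ)⁻¹) ^ (m + 1)) -
          (ρ - σ)⁻¹ * (((x : ℂ) - σ)⁻¹) ^ (m + 2) := by
      intro x
      rw [pow_succ', ← mul_assoc, inv_sub_mul_inv_sub hne (sub_ne_zero_of_im hρ.ne' x)
        (sub_ne_zero_of_im hσ.ne x)]
      ring
    simp_rw [h1]
    rw [integral_sub, integral_const_mul, integral_const_mul, ih, integral_inv_sub_pow hσ.ne]
    · field_simp
      ring
    · exact (integrable_inv_sub_mul_pow hρ.ne' hσ.ne m).const_mul _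
    · refine Integrable.const_mul ?_ _
      refine (integrable_inv_sub_mul_pow hσ.ne hσ.ne m).congr (Eventually.of_forall fun x => ?_)
      simp only; ring

theorem integral_comp_two_pi (f : ℝ → ℂ) :
    ∫ ζ : ℝ, f (2 * Real.pi * ζ) = (2 * Real.pi : ℂ)⁻¹ * ∫ x, f x := by
  rw [Measure.integral_comp_mul_left f (2 * Real.pi), abs_of_pos (by positivity),
    Complex.real_smul]
  push_cast
  ring

theorem integral_div_add_sq {A : ℝ} (hA : 0 < A) :
    Integrable (fun ζ : ℝ => A / ((2 * Real.pi * ζ) ^ 2 + A ^ 2)) ∧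
      ∫ ζ : ℝ, A / ((2 * Real.pi * ζ) ^ 2 + A ^ 2) = 1 / 2 := by
  have e : (fun ζ : ℝ => A / ((2 * Real.pi * ζ) ^ 2 + A ^ 2)) =
      fun ζ => A⁻¹ * (1 + (2 * Real.pi / A * ζ) ^ 2)⁻¹ := by
    funext ζ
    field_simp
    ring
  have hpi : 0 < 2 * Real.pi / A := by positivity
  rw [e]
  refine ⟨(integrable_inv_one_add_sq.comp_mul_left' hpi.ne').const_mul _, ?_⟩
  rw [integral_const_mul, Measure.integral_comp_mul_left (fun x : ℝ => (1 + x ^ 2)⁻¹),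
    integral_univ_inv_one_add_sq, abs_of_pos (by positivity), smul_eq_mul]
  field_simp

/-- A kernel whose square is dominated by the Poisson kernel `A / (z² + A²)` is bounded in `L²`
uniformly in `A`. -/
theorem memLp_of_le_div {r : ℝ → ℂ} (hr : AEStronglyMeasurable r) {A M : ℝ} (hA : 0 < A)
    (h : ∀ ζ, ‖r ζ‖ ^ 2 ≤ M * (A / ((2 * Real.pi * ζ) ^ 2 + A ^ 2))) :
    MemLp r 2 ∧ ∫⁻ ζ, ‖r ζ‖ₑ ^ 2 ≤ ENNReal.ofReal M := by
  obtain ⟨hi, hv⟩ := integral_div_add_sq hA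
  have hM : 0 ≤ M := by
    by_contra! hM
    have h1 := (sq_nonneg ‖r 0‖).trans (h 0)
    have : 0 < A / ((2 * Real.pi * 0) ^ 2 + A ^ 2) := by positivity
    nlinarith
  have hle : ∫⁻ ζ, ‖r ζ‖ₑ ^ 2 ≤ ENNReal.ofReal M := by
    calc ∫⁻ ζ, ‖r ζ‖ₑ ^ 2
        ≤ ∫⁻ ζ, ENNReal.ofReal (M * (A / ((2 * Real.pi * ζ) ^ 2 + A ^ 2))) := by
          refine lintegral_mono fun ζ => ?_
          rw [← ofReal_norm, ← ENNReal.ofReal_pow (norm_nonneg _)]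
          exact ENNReal.ofReal_le_ofReal (h ζ)
      _ = ENNReal.ofReal (∫ ζ, M * (A / ((2 * Real.pi * ζ) ^ 2 + A ^ 2))) := by
          rw [ofReal_integral_eq_lintegral_ofReal (hi.const_mul M)]
          exact Eventually.of_forall fun ζ => by positivity
      _ ≤ ENNReal.ofReal M := by
          rw [integral_const_mul, hv]
          exact ENNReal.ofReal_le_ofReal (by linarith)
  exact ⟨(memLp_two_iff_lintegral hr).2 (hle.trans_lt ENNReal.ofReal_lt_top), hle⟩

/-- Integration over the normal frequency against kernels that are uniformly bounded in `L²`. -/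
theorem SqSummable.integral_mul {d : ℕ} {H r : ℤ → Space (d + 1) → ℂ} (hH : SqSummable volume H)
    (hr : ∀ k, AEStronglyMeasurable (r k)) (M : ℝ)
    (hle : ∀ k, H k =ᵐ[volume] 0 ∨
      ∀ ξ : Space d, ∫⁻ ζ : ℝ, ‖r k (glue ξ ζ)‖ₑ ^ 2 ≤ ENNReal.ofReal M) :
    SqSummable volume fun k (ξ : Space d) => ∫ ζ : ℝ, r k (glue ξ ζ) * H k (glue ξ ζ) := by
  refine ⟨fun k => ?_, ?_⟩
  · exact ((aestronglyMeasurable_glue (hr k)).mul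
      (aestronglyMeasurable_glue (hH.1 k))).integral_prod_right'
  · refine (ENNReal.tsum_le_tsum (g := fun k => ENNReal.ofReal M * ∫⁻ η, ‖H k η‖ₑ ^ 2)
      fun k => ?_).trans_lt ?_
    · rw [← lintegral_const_mul' _ _ ENNReal.ofReal_ne_top,
        lintegral_glue (((hH.1 k).enorm.pow_const 2).const_mul _)]
      rcases hle k with h | h
      · refine lintegral_mono_ae ?_
        filter_upwards [ae_ae_glue h] with ξ hξ
        have : ∫ ζ : ℝ, r k (glue ξ ζ) * H k (glue ξ ζ) = 0 := by
          refine integral_eq_zero_of_ae ?_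
          filter_upwards [hξ] with ζ hζ
          simp [hζ]
        rw [this]; simp
      · refine lintegral_mono_ae ?_
        filter_upwards [(aestronglyMeasurable_glue (hr k)).prodMk_left,
          (aestronglyMeasurable_glue (hH.1 k)).prodMk_left] with ξ h1 h2
        refine (enorm_integral_mul_sq_le h1 h2).trans ?_
        rw [lintegral_const_mul' _ _ ENNReal.ofReal_ne_top]
        exact mul_le_mul_left (h ξ) _
    · rw [ENNReal.tsum_mul_left]
      exact ENNReal.mul_lt_top ENNReal.ofReal_lt_top hH.2

theorem ae_integrable_kernel_mul {d : ℕ} {H : Space (d + 1) → ℂ} (hH : MemLp H 2)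
    {r : Space (d + 1) → ℂ} (hr : ∀ ξ : Space d, MemLp (fun ζ : ℝ => r (glue ξ ζ)) 2) :
    ∀ᵐ ξ : Space d, Integrable fun ζ : ℝ => r (glue ξ ζ) * H (glue ξ ζ) := by
  filter_upwards [ae_memLp_glue hH] with ξ hξ
  exact (hr ξ).integrable_mul (p := 2) (q := 2) hξ

/-! ### Closure properties of the anticausal functions -/

theorem IsHalfLineTest.deriv {ψ : ℝ → ℂ} (hψ : IsHalfLineTest ψ) : IsHalfLineTest (deriv ψ) where
  smooth := hψ.smooth.deriv'
  compact := hψ.compact.deriv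
  support := tsupport_deriv_subset.trans hψ.support

theorem IsHalfLineTest.integrable_mul_fourierInv {ψ W : ℝ → ℂ} (hψ : IsHalfLineTest ψ)
    (hW : MemLp W 2) : Integrable fun ζ => W ζ * 𝓕⁻ ψ ζ :=
  hW.integrable_mul (p := 2) (q := 2) hψ.memLp_fourierInv

theorem Anticausal.sub {d : ℕ} {V W : Space (d + 1) → ℂ} (hV : Anticausal V) (hW : Anticausal W)
    (hV2 : MemLp V 2) (hW2 : MemLp W 2) : Anticausal fun η => V η - W η := by
  intro ψ hψ
  filter_upwards [hV ψ hψ, hW ψ hψ, ae_memLp_glue hV2, ae_memLp_glue hW2] with ξ h1 h2 h3 h4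
  simp_rw [sub_mul]
  rw [integral_sub (hψ.integrable_mul_fourierInv h3) (hψ.integrable_mul_fourierInv h4), h1, h2,
    sub_zero]

theorem Anticausal.tang_mul {d : ℕ} {V : Space (d + 1) → ℂ} (hV : Anticausal V)
    (c : Space d → ℂ) : Anticausal fun η => c (tang η) * V η := by
  intro ψ hψ
  filter_upwards [hV ψ hψ] with ξ h1
  simp_rw [tang_glue, mul_assoc]
  rw [integral_const_mul, h1, mul_zero]

/-- Differentiation preserves the support condition. -/
theorem Anticausal.last_mul {d : ℕ} {V : Space (d + 1) → ℂ} (hV : Anticausal V) :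
    Anticausal fun η => (η (Fin.last d) : ℂ) * V η := by
  intro ψ hψ
  filter_upwards [hV _ hψ.deriv] with ξ h1
  have h2 : ∀ ζ : ℝ, 𝓕⁻ (deriv ψ) ζ = -(2 * Real.pi * Complex.I * ζ) * 𝓕⁻ ψ ζ := by
    intro ζ
    rw [Real.fourierInv_eq_fourier_neg, Real.fourierInv_eq_fourier_neg, Real.fourier_deriv]
    · simp
    · exact hψ.smooth.continuous.integrable_of_hasCompactSupport hψ.compact
    · exact hψ.smooth.differentiable (by simp)
    · exact hψ.deriv.smooth.continuous.integrable_of_hasCompactSupport hψ.deriv.compact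
  have h3 : ∀ ζ : ℝ, ((glue ξ ζ) (Fin.last d) : ℂ) * V (glue ξ ζ) * 𝓕⁻ ψ ζ =
      (-(2 * Real.pi * Complex.I))⁻¹ * (V (glue ξ ζ) * 𝓕⁻ (deriv ψ) ζ) := by
    intro ζ
    have : (Real.pi : ℂ) ≠ 0 := by exact_mod_cast Real.pi_ne_zero
    have := Complex.I_ne_zero
    rw [h2, glue_last]
    field_simp
  simp_rw [h3]
  rw [integral_const_mul, h1, mul_zero]

/-- A function that vanishes on the half space and has a trace has trace zero. To apply the
uniqueness of traces, `V` is placed at the time frequency zero of a cylinder of period one. -/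
theorem Anticausal.integral_eq_zero {d : ℕ} {V : Space (d + 1) → ℂ} (hV : Anticausal V)
    (h1 : MemLp V 2) (h2 : MemLp (fun η => (η (Fin.last d) : ℂ) * V η) 2) :
    ∀ᵐ ξ : Space d, ∫ ζ : ℝ, V (glue ξ ζ) = 0 := by
  have : Fact ((0 : ℝ) < 1) := ⟨one_pos⟩
  have hG2 : MemLp (fun ξ : Space d => ∫ ζ : ℝ, V (glue ξ ζ)) 2 := by
    have := memLp_partial_fourier h1 h2 0
    simpa using this
  have hS : ∀ {n : ℕ} {h : Space n → ℂ}, MemLp h 2 →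
      SqSummable volume fun (k : ℤ) => if k = 0 then h else 0 := by
    intro n h hh
    refine ⟨fun k => ?_, ?_⟩
    · by_cases hk : k = 0
      · simpa [hk] using hh.1
      · simpa [hk] using aestronglyMeasurable_zero
    · rw [tsum_eq_single 0 fun k hk => by simp [hk]]
      simpa using (memLp_two_iff_lintegral hh.1).1 hh
  obtain ⟨U, hU⟩ := (hS h1).exists_fourierG 1
  obtain ⟨G, hG⟩ := (hS hG2).exists_fourierG 1
  have ht : HasTrace (restr U) G := by
    refine hasTrace_restr ((hS h2).mono (fun k => ?_) 1 fun k => ?_) fun k => ?_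
    · exact (Continuous.aestronglyMeasurable (by fun_prop)).mul (Lp.memLp _).1
    · filter_upwards [hU k] with η hη
      rw [hη]
      split_ifs <;> simp
    · filter_upwards [hG k, ae_ae_glue (hU k)] with ξ h3 h4
      rw [h3, integral_congr_ae h4]
      split_ifs <;> simp
  have h0 : restr U = 0 := by
    rw [restr_eq_zero_iff_anticausal]
    intro k
    by_cases hk : k = 0
    · subst hk
      exact hV.congr (by simpa using (hU 0).symm)
    · exact anticausal_of_ae_zero (by simpa [hk] using hU k)
  have ht0 : HasTrace (restr U) (0 : L2 1 d) := by
    have := hasTrace_restr (V := (0 : L2 1 (d + 1))) (G := 0) (d := d) (T := 1) ?_ ?_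
    · rw [h0]
      have e : restr (0 : L2 1 (d + 1)) = 0 := map_zero _
      rwa [e] at this
    · refine (sqSummable_fourierG (0 : L2 1 (d + 1))).mono (fun k => ?_) 1 fun k => ?_
      · exact (Continuous.aestronglyMeasurable (by fun_prop)).mul (Lp.memLp _).1
      · rw [fourierG_zero]
        exact Eventually.of_forall fun η => by simp
    · intro k
      rw [fourierG_zero, fourierG_zero]
      filter_upwards [Lp.coeFn_zero ℂ 2 (volume : Measure (Space d)),
        ae_ae_glue (Lp.coeFn_zero ℂ 2 (volume : Measure (Space (d + 1))))] with ξ h5 h6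
      rw [h5, integral_congr_ae h6]
      simp
  have hG0 := ht.unique ht0
  have h7 := hG 0
  rw [hG0, fourierG_zero] at h7
  filter_upwards [h7, Lp.coeFn_zero ℂ 2 (volume : Measure (Space d))] with ξ h8 h9
  rw [h9] at h8
  simpa using h8.symm

/-! ### The operator `op[1 / D⁻]` on the half cylinder -/

section Freq

variable {d : ℕ}

/-- The root `a` at the frequency `(k, ξ)`. -/
def freqA (T : ℝ) (k : ℤ) (ξ : Space d) : ℂ := aRoot (tfreq T k) (xfreq ξ)

/-- The root `b` at the frequency `(k, ξ)`. -/
def freqB (T : ℝ) (k : ℤ) (ξ : Space d) : ℂ := bRoot (tfreq T k) (xfreq ξ)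

/-- The angular normal frequency. -/
def zfreq (η : Space (d + 1)) : ℝ := 2 * Real.pi * η (Fin.last d)

@[simp] theorem zfreq_glue (ξ : Space d) (ζ : ℝ) : zfreq (glue ξ ζ) = 2 * Real.pi * ζ := by
  simp [zfreq]

theorem continuous_zfreq : Continuous (zfreq : Space (d + 1) → ℝ) := by
  unfold zfreq; fun_prop

@[fun_prop] theorem measurable_zfreq : Measurable (zfreq : Space (d + 1) → ℝ) :=
  continuous_zfreq.measurable

theorem tang_xfreq (η : Space (d + 1)) : tang (xfreq η) = xfreq (tang η) := by
  ext j; simp [tang, xfreq]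

theorem xfreq_last (η : Space (d + 1)) : xfreq η (Fin.last d) = zfreq η := by
  simp [xfreq, zfreq]

theorem continuous_xfreq {n : ℕ} : Continuous (xfreq : Space n → Space n) := by
  unfold xfreq; fun_prop

theorem norm_xfreq_sq (η : Space (d + 1)) :
    ‖xfreq η‖ ^ 2 = ‖xfreq (tang η)‖ ^ 2 + zfreq η ^ 2 := by
  rw [norm_tang_sq, tang_xfreq, xfreq_last]

@[fun_prop] theorem measurable_freqA (T : ℝ) (k : ℤ) :
    Measurable (freqA T k : Space d → ℂ) :=
  (stronglyMeasurable_aRoot _).measurable.comp continuous_xfreq.measurable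

@[fun_prop] theorem measurable_freqB (T : ℝ) (k : ℤ) :
    Measurable (freqB T k : Space d → ℂ) :=
  (stronglyMeasurable_bRoot _).measurable.comp continuous_xfreq.measurable

@[fun_prop] theorem measurable_tang : Measurable (tang : Space (d + 1) → Space d) :=
  continuous_tang.measurable

theorem continuous_symD (T : ℝ) (k : ℤ) : Continuous (symD T k : Space (d + 1) → ℂ) := by
  have h : (symD T k : Space (d + 1) → ℂ) = fun η => Complex.I * tfreq T k +
      ((‖xfreq η‖ ^ 2 : ℝ) : ℂ) * (Complex.I * tfreq T k + ((‖xfreq η‖ ^ 2 : ℝ) : ℂ)) :=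
    funext fun η => symD_eq k η
  rw [h]
  have := (continuous_xfreq (n := d + 1)).norm
  fun_prop

end Freq

section Solve

variable {T : ℝ} [hT : Fact (0 < T)] {d : ℕ}

theorem le_abs_tfreq {k : ℤ} (hk : k ≠ 0) : 2 * Real.pi / T ≤ |tfreq T k| := by
  have h1 : (1 : ℝ) ≤ |(k : ℝ)| := by exact_mod_cast Int.one_le_abs hk
  have hT0 := hT.out
  rw [tfreq, abs_div, abs_mul, abs_of_pos hT0, abs_of_pos (by positivity : 0 < 2 * Real.pi)]
  have : 0 < 2 * Real.pi := by positivity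
  refine div_le_div_of_nonneg_right ?_ hT0.le
  nlinarith

variable (T) in
theorem tfreq_ne_zero {k : ℤ} (hk : k ≠ 0) : tfreq T k ≠ 0 := by
  have hT0 := hT.out
  have := le_abs_tfreq (T := T) hk
  have h2 : 0 < 2 * Real.pi / T := by positivity
  exact abs_pos.1 (h2.trans_le this)

variable (T) in
theorem freqA_spec {k : ℤ} (hk : k ≠ 0) (ξ : Space d) :
    0 < (freqA T k ξ).re ∧ |(freqA T k ξ).im| ≤ 3 * (freqA T k ξ).re :=
  (aRoot_spec (tfreq_ne_zero T hk) _).2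

variable (T) in
theorem freqB_spec {k : ℤ} (hk : k ≠ 0) (ξ : Space d) :
    0 < (freqB T k ξ).re ∧ |(freqB T k ξ).im| ≤ 3 * (freqB T k ξ).re :=
  (bRoot_spec (tfreq_ne_zero T hk) _).2

theorem symD_eq_prod {k : ℤ} (hk : k ≠ 0) (η : Space (d + 1)) :
    symD T k η = (zfreq η - Complex.I * freqA T k (tang η)) *
      (zfreq η + Complex.I * freqA T k (tang η)) * ((zfreq η - Complex.I * freqB T k (tang η)) *
      (zfreq η + Complex.I * freqB T k (tang η))) := by
  rw [symD, symbolD_eq_prod (tfreq_ne_zero T hk)]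
  simp only [Multiset.insert_eq_cons, Multiset.map_cons, Multiset.map_singleton,
    Multiset.prod_cons, Multiset.prod_singleton, eval_mul, eval_sub, eval_X, eval_C, xfreq_last,
    tang_xfreq, freqA, freqB]
  ring

theorem invDminus_eq {k : ℤ} (hk : k ≠ 0) (η : Space (d + 1)) :
    invDminus (tfreq T k) (xfreq η) = (zfreq η + Complex.I * freqA T k (tang η))⁻¹ *
      (zfreq η + Complex.I * freqB T k (tang η))⁻¹ := by
  rw [invDminus, symbolDminus_eq (tfreq_ne_zero T hk), ← mul_inv]
  simp only [eval_mul, eval_add, eval_X, eval_C, xfreq_last, tang_xfreq, freqA, freqB]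

theorem zfreq_add_ne_zero {c : ℂ} (hc : 0 < c.re) (z : ℝ) : (z : ℂ) + Complex.I * c ≠ 0 := by
  intro h
  have := congrArg Complex.im h
  simp at this
  linarith

theorem zfreq_sub_ne_zero {c : ℂ} (hc : 0 < c.re) (z : ℝ) : (z : ℂ) - Complex.I * c ≠ 0 := by
  intro h
  have := congrArg Complex.im h
  simp at this
  linarith

theorem norm_inv_add_sq_le {c : ℂ} (hc0 : 0 < c.re) (hc : |c.im| ≤ 3 * c.re) (z : ℝ) :
    ‖((z : ℂ) + Complex.I * c)⁻¹‖ ^ 2 ≤ 28 * (z ^ 2 + ‖c‖ ^ 2)⁻¹ := by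
  have h := le_norm_add_I_mul hc z
  have hc1 : 0 < ‖c‖ := norm_pos_iff.2 fun h => by simp [h] at hc0
  have h2 : 0 < ‖(z : ℂ) + Complex.I * c‖ := norm_pos_iff.2 (zfreq_add_ne_zero hc0 z)
  rw [norm_inv, inv_pow, ← div_eq_mul_inv, le_div_iff₀ (by positivity),
    inv_mul_le_iff₀ (by positivity)]
  linarith

theorem norm_inv_sub_sq_le {c : ℂ} (hc0 : 0 < c.re) (hc : |c.im| ≤ 3 * c.re) (z : ℝ) :
    ‖((z : ℂ) - Complex.I * c)⁻¹‖ ^ 2 ≤ 28 * (z ^ 2 + ‖c‖ ^ 2)⁻¹ := by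
  have h := norm_inv_add_sq_le hc0 hc (-z)
  have e : ((-z : ℝ) : ℂ) + Complex.I * c = -((z : ℂ) - Complex.I * c) := by push_cast; ring
  rw [e, inv_neg, norm_neg] at h
  simpa using h

variable (T d) in
/-- The bounds for the roots at the nonzero time frequencies. -/
theorem exists_freq_bounds : ∃ C : ℝ, 1 ≤ C ∧ ∀ k : ℤ, k ≠ 0 → ∀ ξ : Space d,
    1 ≤ C * ‖freqA T k ξ‖ ^ 2 ∧ 1 ≤ C * ‖freqB T k ξ‖ ^ 2 ∧
    ‖freqB T k ξ‖ ^ 2 ≤ C * (|tfreq T k| + ‖xfreq ξ‖ ^ 2) ∧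
    ‖freqA T k ξ‖ ^ 2 ≤ C * ‖freqB T k ξ‖ ^ 2 ∧
    ‖freqA T k ξ‖ ^ 2 ≤ C * (1 + ‖xfreq ξ‖ ^ 2) := by
  have h0 : 0 < 2 * Real.pi / T := div_pos (by positivity) hT.out
  obtain ⟨C, hC⟩ := exists_rootBounds d h0
  refine ⟨C, hC.one_le, fun k hk ξ => ?_⟩
  have h1 := le_abs_tfreq (T := T) hk
  refine ⟨le_trans ?_ (hC.le_a _ h1 _), le_trans ?_ (hC.le_b _ h1 _), hC.b_le _ h1 _,
    hC.a_le_b _ h1 _, hC.a_le _ h1 _⟩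
  · nlinarith [sq_nonneg ‖xfreq ξ‖]
  · nlinarith [sq_nonneg ‖xfreq ξ‖, abs_nonneg (tfreq T k)]

variable (T d) in
/-- The symbol `1 / D⁻` and its product with `z` are bounded. -/
theorem exists_norm_invDminus_le : ∃ C : ℝ, ∀ k : ℤ, k ≠ 0 → ∀ η : Space (d + 1),
    ‖invDminus (tfreq T k) (xfreq η)‖ ≤ C ∧
      ‖(zfreq η : ℂ) * invDminus (tfreq T k) (xfreq η)‖ ≤ C := by
  obtain ⟨C, hC1, hC⟩ := exists_freq_bounds T d
  refine ⟨28 * C, fun k hk η => ?_⟩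
  obtain ⟨h1, h2, -⟩ := hC k hk (tang η)
  obtain ⟨ha0, ha⟩ := freqA_spec T hk (tang η)
  obtain ⟨hb0, hb⟩ := freqB_spec T hk (tang η)
  have e1 := norm_inv_add_sq_le ha0 ha (zfreq η)
  have e2 := norm_inv_add_sq_le hb0 hb (zfreq η)
  have hsq := sq_nonneg (zfreq η)
  have pa : 0 < zfreq η ^ 2 + ‖freqA T k (tang η)‖ ^ 2 := by nlinarith
  have pb : 0 < zfreq η ^ 2 + ‖freqB T k (tang η)‖ ^ 2 := by nlinarith
  have f2 : (zfreq η ^ 2 + ‖freqB T k (tang η)‖ ^ 2)⁻¹ ≤ C := by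
    rw [inv_le_comm₀ pb (by linarith), inv_eq_one_div, div_le_iff₀ (by linarith)]
    nlinarith
  have f1 : (zfreq η ^ 2 + ‖freqA T k (tang η)‖ ^ 2)⁻¹ ≤ C := by
    rw [inv_le_comm₀ pa (by linarith), inv_eq_one_div, div_le_iff₀ (by linarith)]
    nlinarith
  have f3 : zfreq η ^ 2 * (zfreq η ^ 2 + ‖freqA T k (tang η)‖ ^ 2)⁻¹ ≤ 1 := by
    rw [← div_eq_mul_inv, div_le_one pa]; nlinarith [sq_nonneg ‖freqA T k (tang η)‖]
  have g2 : ‖((zfreq η : ℂ) + Complex.I * freqB T k (tang η))⁻¹‖ ^ 2 ≤ 28 * C := by linarith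
  rw [invDminus_eq hk]
  constructor
  · rw [norm_mul]
    have g1 : ‖((zfreq η : ℂ) + Complex.I * freqA T k (tang η))⁻¹‖ ^ 2 ≤ 28 * C := by linarith
    nlinarith [sq_nonneg (‖((zfreq η : ℂ) + Complex.I * freqA T k (tang η))⁻¹‖ -
      ‖((zfreq η : ℂ) + Complex.I * freqB T k (tang η))⁻¹‖)]
  · rw [← mul_assoc, norm_mul, norm_mul, Complex.norm_real, Real.norm_eq_abs]
    have g1 : (|zfreq η| * ‖((zfreq η : ℂ) + Complex.I * freqA T k (tang η))⁻¹‖) ^ 2 ≤ 28 * C := by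
      rw [mul_pow, sq_abs]
      nlinarith [mul_le_mul_of_nonneg_left e1 hsq]
    nlinarith [sq_nonneg (|zfreq η| * ‖((zfreq η : ℂ) + Complex.I * freqA T k (tang η))⁻¹‖ -
      ‖((zfreq η : ℂ) + Complex.I * freqB T k (tang η))⁻¹‖)]

theorem measurable_invDminus (k : ℤ) (hk : k ≠ 0) :
    Measurable fun η : Space (d + 1) => invDminus (tfreq T k) (xfreq η) := by
  have : (fun η : Space (d + 1) => invDminus (tfreq T k) (xfreq η)) = fun η =>
      (zfreq η + Complex.I * freqA T k (tang η))⁻¹ *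
      (zfreq η + Complex.I * freqB T k (tang η))⁻¹ := funext fun η => invDminus_eq hk η
  rw [this]
  fun_prop

/-- Multiplication by `1 / D⁻` preserves the support condition. -/
theorem Anticausal.invDminus_mul {k : ℤ} (hk : k ≠ 0) {W : Space (d + 1) → ℂ}
    (hW : StronglyMeasurable W) (hW2 : MemLp W 2) (h : Anticausal W) :
    Anticausal fun η => invDminus (tfreq T k) (xfreq η) * W η := by
  have e : ∀ (c : Space d → ℂ) (η : Space (d + 1)), (2 * Real.pi * η (Fin.last d) : ℂ) -
      -(Complex.I * c (tang η)) = zfreq η + Complex.I * c (tang η) := by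
    intro c η; simp [zfreq]
  have h1 := h.mul_inv_sub hW hW2 (ρ := fun ξ => -(Complex.I * freqB T k ξ)) fun ξ => by
    simpa using (freqB_spec T hk ξ).1
  simp_rw [e] at h1
  have hm1 : StronglyMeasurable fun η : Space (d + 1) =>
      (zfreq η + Complex.I * freqB T k (tang η))⁻¹ * W η := by
    refine StronglyMeasurable.mul (Measurable.stronglyMeasurable ?_) hW
    fun_prop
  obtain ⟨C, hC1, hC⟩ := exists_freq_bounds T d
  have hm2 : MemLp (fun η : Space (d + 1) =>
      (zfreq η + Complex.I * freqB T k (tang η))⁻¹ * W η) 2 := by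
    refine hW2.of_le_mul (c := 28 * C) hm1.aestronglyMeasurable
      (Eventually.of_forall fun η => ?_)
    rw [norm_mul]
    refine mul_le_mul_of_nonneg_right ?_ (norm_nonneg _)
    obtain ⟨-, h2, -⟩ := hC k hk (tang η)
    obtain ⟨hb0, hb⟩ := freqB_spec T hk (tang η)
    have e2 := norm_inv_add_sq_le hb0 hb (zfreq η)
    have hsq := sq_nonneg (zfreq η)
    have pb : 0 < zfreq η ^ 2 + ‖freqB T k (tang η)‖ ^ 2 := by nlinarith
    have f2 : (zfreq η ^ 2 + ‖freqB T k (tang η)‖ ^ 2)⁻¹ ≤ C := by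
      rw [inv_le_comm₀ pb (by linarith), inv_eq_one_div, div_le_iff₀ (by linarith)]
      nlinarith
    by_contra! h3
    nlinarith
  have h2 := h1.mul_inv_sub hm1 hm2 (ρ := fun ξ => -(Complex.I * freqA T k ξ)) fun ξ => by
    simpa using (freqA_spec T hk ξ).1
  simp_rw [e] at h2
  refine h2.congr (Eventually.of_forall fun η => ?_)
  simp only
  rw [invDminus_eq hk, mul_assoc]

theorem fourierG_ae_zero {n : ℕ} {F : L2 T n} (hF : F ∈ L2perp T n) :
    fourierG F 0 =ᵐ[volume] 0 := by
  rw [mem_L2perp_iff.1 hF]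
  exact Lp.coeFn_zero ℂ 2 _

theorem exists_isOp_invDminus {F : L2 T (d + 1)} (hF : F ∈ L2perp T (d + 1)) :
    ∃ V : L2 T (d + 1), IsOp invDminus F V := by
  obtain ⟨C, hC⟩ := exists_norm_invDminus_le T d
  have h : SqSummable volume fun (k : ℤ) (η : Space (d + 1)) =>
      invDminus (tfreq T k) (xfreq η) * fourierG F k η := by
    refine (sqSummable_fourierG F).mono (fun k => ?_) C fun k => ?_
    · by_cases hk : k = 0
      · subst hk
        refine (aestronglyMeasurable_zero (β := ℂ)).congr ?_
        filter_upwards [fourierG_ae_zero hF] with η hη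
        simp [hη]
      · exact (measurable_invDminus k hk).aestronglyMeasurable.mul (Lp.memLp _).1
    · by_cases hk : k = 0
      · subst hk
        filter_upwards [fourierG_ae_zero hF] with η hη
        simp [hη]
      · refine Eventually.of_forall fun η => ?_
        rw [norm_mul]
        exact mul_le_mul_of_nonneg_right (hC k hk η).1 (norm_nonneg _)
  exact h.exists_fourierG T

theorem sqSummable_last_mul_of_isOp {F V : L2 T (d + 1)} (hF : F ∈ L2perp T (d + 1))
    (hV : IsOp invDminus F V) :
    SqSummable volume fun k (η : Space (d + 1)) => (η (Fin.last d) : ℂ) * fourierG V k η := by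
  obtain ⟨C, hC⟩ := exists_norm_invDminus_le T d
  refine (sqSummable_fourierG F).mono (fun k => ?_) C fun k => ?_
  · exact (Continuous.aestronglyMeasurable (by fun_prop)).mul (Lp.memLp _).1
  · by_cases hk : k = 0
    · subst hk
      filter_upwards [fourierG_ae_zero hF, hV 0] with η hη h2
      simp [hη, h2]
    · filter_upwards [hV k] with η h2
      rw [h2, ← mul_assoc, norm_mul]
      refine mul_le_mul_of_nonneg_right (le_trans ?_ (hC k hk η).2) (norm_nonneg _)
      rw [norm_mul, norm_mul]
      refine mul_le_mul_of_nonneg_right ?_ (norm_nonneg _)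
      rw [Complex.norm_real, Complex.norm_real, zfreq, norm_mul]
      refine le_mul_of_one_le_left (norm_nonneg _) ?_
      rw [Real.norm_of_nonneg (by positivity)]
      linarith [Real.two_le_pi]

/-- The value of `op[1 / D⁻]` on the half space is determined by that of the argument. -/
theorem restr_eq_of_isOp {F F' V V' : L2 T (d + 1)} (hF : F ∈ L2perp T (d + 1))
    (hF' : F' ∈ L2perp T (d + 1)) (hV : IsOp invDminus F V) (hV' : IsOp invDminus F' V')
    (h : restr F' = restr F) : restr V' = restr V := by
  rw [← sub_eq_zero, ← restr_sub, restr_eq_zero_iff_anticausal] at h ⊢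
  intro k
  by_cases hk : k = 0
  · subst hk
    refine anticausal_of_ae_zero ?_
    rw [fourierG_sub]
    filter_upwards [Lp.coeFn_sub (fourierG V' 0) (fourierG V 0), hV 0, hV' 0,
      fourierG_ae_zero hF, fourierG_ae_zero hF'] with η h1 h2 h3 h4 h5
    rw [h1, Pi.sub_apply, h2, h3, h4, h5]; simp
  · refine ((h k).invDminus_mul (T := T) hk (Lp.stronglyMeasurable _) (Lp.memLp _)).congr ?_
    rw [fourierG_sub, fourierG_sub]
    filter_upwards [Lp.coeFn_sub (fourierG V' k) (fourierG V k), hV k, hV' k,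
      Lp.coeFn_sub (fourierG F' k) (fourierG F k)] with η h1 h2 h3 h4
    rw [h1, h4, Pi.sub_apply, Pi.sub_apply, h2, h3]
    ring

theorem SqSummable.integral {V : ℤ → Space (d + 1) → ℂ} (hV : SqSummable volume V)
    (hV' : SqSummable volume fun k η => (η (Fin.last d) : ℂ) * V k η) :
    SqSummable volume fun k (ξ : Space d) => ∫ ζ : ℝ, V k (glue ξ ζ) := by
  have h1 : SqSummable volume fun k (η : Space (d + 1)) =>
      (1 + Complex.I * η (Fin.last d)) * V k η := by
    refine (hV.add (hV'.const_mul Complex.I)).mono (fun k => ?_) 1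
      fun k => Eventually.of_forall fun η => ?_
    · exact (Continuous.aestronglyMeasurable (by fun_prop)).mul (hV.1 k)
    · rw [one_mul]; apply le_of_eq; congr 1; ring
  have hc := (memLp_two_iff_lintegral continuous_cauchyKernel.aestronglyMeasurable).1
    memLp_cauchyKernel
  have h2 := h1.integral_mul (r := fun _ η => cauchyKernel (η (Fin.last d))) (fun k =>
    (continuous_cauchyKernel.comp (by fun_prop)).aestronglyMeasurable)
    (∫⁻ ζ, ‖cauchyKernel ζ‖ₑ ^ 2).toReal (fun k => Or.inr fun ξ => by
      rw [ENNReal.ofReal_toReal hc.ne]; simp)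
  refine h2.mono (fun k => (aestronglyMeasurable_glue (hV.1 k)).integral_prod_right') 1
    fun k => Eventually.of_forall fun ξ => ?_
  rw [one_mul]
  apply le_of_eq; congr 2
  funext ζ
  have := cauchyKernel_mul (V k) ξ ζ
  rw [glue_last] at this ⊢
  exact this.symm

theorem ae_integrable_glue {W : Space (d + 1) → ℂ} (hW : MemLp W 2)
    (hW' : MemLp (fun η => (η (Fin.last d) : ℂ) * W η) 2) :
    ∀ᵐ ξ : Space d, Integrable fun ζ : ℝ => W (glue ξ ζ) := by
  filter_upwards [ae_memLp_glue (memLp_one_add_mul hW hW')] with ξ hξ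
  refine (memLp_cauchyKernel.integrable_mul (p := 2) (q := 2) hξ).congr
    (Eventually.of_forall fun ζ => ?_)
  exact cauchyKernel_mul W ξ ζ

/-- The multiplier `1 / D⁻` gains a normal derivative, so that `op[D⁻]⁻¹₊ f` has a trace. -/
theorem exists_trace_transform {F V : L2 T (d + 1)} (hF : F ∈ L2perp T (d + 1))
    (hV : IsOp invDminus F V) : ∃ G : L2 T d,
      (∀ k, fourierG G k =ᵐ[volume] fun ξ => ∫ ζ : ℝ, fourierG V k (glue ξ ζ)) ∧
      HasTrace (restr V) G := by
  have h1 := sqSummable_last_mul_of_isOp hF hV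
  obtain ⟨G, hG⟩ := ((sqSummable_fourierG V).integral h1).exists_fourierG T
  exact ⟨G, hG, hasTrace_restr h1 hG⟩

/-- The anisotropic Sobolev norm on the Fourier side. -/
theorem mem_Hperp_iff {n : ℕ} {s r : ℝ} {f : L2 T n} :
    f ∈ Hperp T n s r ↔ f ∈ L2perp T n ∧ SqSummable volume fun k (η : Space n) =>
      (weight s r (tfreq T k) (xfreq η) : ℂ) * fourierG f k η := by
  have hm : ∀ k, AEStronglyMeasurable (fun η : Space n =>
      (weight s r (tfreq T k) (xfreq η) : ℂ) * fourierG f k η) volume := by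
    intro k
    refine AEStronglyMeasurable.mul ?_ (Lp.memLp _).1
    refine Measurable.aestronglyMeasurable ?_
    have : Measurable (xfreq : Space n → Space n) := continuous_xfreq.measurable
    unfold weight
    fun_prop
  have e : ∀ (k : ℤ) (η : Space n),
      (‖weight s r (tfreq T k) (xfreq η)‖ₑ * ‖fourierG f k η‖ₑ) ^ 2 =
      ‖(weight s r (tfreq T k) (xfreq η) : ℂ) * fourierG f k η‖ₑ ^ 2 := by
    intro k η
    rw [enorm_mul]
    congr 2
    rw [← ofReal_norm, ← ofReal_norm, Complex.norm_real]
  simp only [Hperp, Set.mem_ofPred_eq, SqSummable, e]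
  exact and_congr_right fun _ => ⟨fun h => ⟨hm, h⟩, fun h => h.2⟩

theorem weight_zero_four {n : ℕ} (τ : ℝ) (ξ : Space n) :
    weight 0 4 τ ξ = (1 + ‖ξ‖ ^ 2) ^ 2 := by
  rw [weight, zero_div, Real.rpow_zero, one_mul]
  norm_num

theorem weight_one_two {n : ℕ} (τ : ℝ) (ξ : Space n) :
    weight 1 2 τ ξ = (1 + τ ^ 2) ^ (1 / 2 : ℝ) * (1 + ‖ξ‖ ^ 2) := by
  rw [weight]
  norm_num

theorem abs_le_sqrt_one_add_sq (τ : ℝ) : |τ| ≤ (1 + τ ^ 2) ^ (1 / 2 : ℝ) := by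
  rw [← Real.sqrt_eq_rpow]
  exact Real.abs_le_sqrt (by linarith)

end Solve

/-! ### Necessity of the trace condition -/

section SymbolBound

theorem norm_symD_le (T : ℝ) {d : ℕ} (k : ℤ) (η : Space (d + 1)) :
    ‖symD T k η‖ ≤ (1 + |tfreq T k|) * (1 + ‖xfreq η‖ ^ 2) ^ 2 := by
  rw [symD_eq]
  have h1 : ‖Complex.I * (tfreq T k : ℂ)‖ = |tfreq T k| := by simp
  have h2 : ‖((‖xfreq η‖ ^ 2 : ℝ) : ℂ)‖ = ‖xfreq η‖ ^ 2 := by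
    rw [Complex.norm_real, Real.norm_of_nonneg (by positivity)]
  have h3 : ‖Complex.I * (tfreq T k : ℂ) + ((‖xfreq η‖ ^ 2 : ℝ) : ℂ)‖ ≤
      |tfreq T k| + ‖xfreq η‖ ^ 2 := (norm_add_le _ _).trans (by rw [h1, h2])
  refine (norm_add_le _ _).trans ?_
  rw [h1, norm_mul, h2]
  have := mul_le_mul_of_nonneg_left h3 (sq_nonneg ‖xfreq η‖)
  have ht := abs_nonneg (tfreq T k)
  have hx := sq_nonneg ‖xfreq η‖
  nlinarith [mul_nonneg ht (sq_nonneg (‖xfreq η‖ ^ 2)), mul_nonneg ht hx]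

end SymbolBound

section Necessity

variable {T : ℝ} [hT : Fact (0 < T)] {d : ℕ}

theorem zfreq_sq_le (η : Space (d + 1)) : zfreq η ^ 2 ≤ ‖xfreq η‖ ^ 2 := by
  rw [norm_xfreq_sq]; nlinarith [sq_nonneg ‖xfreq (tang η)‖]

theorem abs_zfreq_pow_le (η : Space (d + 1)) {j : ℕ} (hj : j ≤ 4) :
    |zfreq η| ^ j ≤ (1 + ‖xfreq η‖ ^ 2) ^ 2 := by
  have h1 : |zfreq η| ^ j ≤ (max 1 |zfreq η|) ^ 4 :=
    (pow_le_pow_left₀ (abs_nonneg _) (le_max_right _ _) j).trans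
      (pow_le_pow_right₀ (le_max_left _ _) hj)
  have h2 : (max 1 |zfreq η|) ^ 2 ≤ 1 + ‖xfreq η‖ ^ 2 := by
    have := zfreq_sq_le η
    rcases max_cases 1 |zfreq η| with ⟨h, -⟩ | ⟨h, -⟩ <;> rw [h]
    · nlinarith [sq_nonneg (zfreq η)]
    · rw [sq_abs]; linarith
  calc |zfreq η| ^ j ≤ ((max 1 |zfreq η|) ^ 2) ^ 2 := by rw [← pow_mul]; exact h1
    _ ≤ _ := pow_le_pow_left₀ (by positivity) h2 2

theorem sqSummable_zfreq_pow {U : L2 T (d + 1)} (hU : U ∈ Hperp T (d + 1) 0 4) {j : ℕ}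
    (hj : j ≤ 4) :
    SqSummable volume fun k (η : Space (d + 1)) => (zfreq η : ℂ) ^ j * fourierG U k η := by
  refine (mem_Hperp_iff.1 hU).2.mono (fun k => ?_) 1 fun k => Eventually.of_forall fun η => ?_
  · exact (Measurable.aestronglyMeasurable (by fun_prop)).mul (Lp.memLp _).1
  · rw [one_mul, norm_mul, norm_mul]
    refine mul_le_mul_of_nonneg_right ?_ (norm_nonneg _)
    rw [norm_pow, Complex.norm_real, Complex.norm_real, weight_zero_four, Real.norm_eq_abs,
      Real.norm_of_nonneg (by positivity)]
    exact abs_zfreq_pow_le η hj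

theorem last_eq_zfreq (η : Space (d + 1)) :
    (η (Fin.last d) : ℂ) = (2 * Real.pi : ℂ)⁻¹ * zfreq η := by
  have : (Real.pi : ℂ) ≠ 0 := by exact_mod_cast Real.pi_ne_zero
  simp only [zfreq]
  push_cast
  field_simp

theorem SqSummable.last_mul {W : ℤ → Space (d + 1) → ℂ}
    (hW : SqSummable volume fun k η => (zfreq η : ℂ) * W k η) :
    SqSummable volume fun k η => (η (Fin.last d) : ℂ) * W k η := by
  have := hW.const_mul (2 * Real.pi : ℂ)⁻¹
  simp_rw [last_eq_zfreq, mul_assoc]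
  exact this

theorem memLp_last_mul {W : Space (d + 1) → ℂ} (hW : MemLp (fun η => (zfreq η : ℂ) * W η) 2) :
    MemLp (fun η => (η (Fin.last d) : ℂ) * W η) 2 := by
  have := hW.const_mul (2 * Real.pi : ℂ)⁻¹
  simp_rw [last_eq_zfreq, mul_assoc]
  exact this

theorem Anticausal.zfreq_mul {V : Space (d + 1) → ℂ} (hV : Anticausal V) :
    Anticausal fun η => (zfreq η : ℂ) * V η := by
  refine (hV.last_mul.tang_mul fun _ => (2 * Real.pi : ℂ)).congr (Eventually.of_forall fun η => ?_)
  simp [zfreq]; ring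

/-- A vanishing trace, on the Fourier side. -/
theorem integral_eq_zero_of_hasTrace {U : L2 T (d + 1)}
    (hU : SqSummable volume fun k (η : Space (d + 1)) => (zfreq η : ℂ) * fourierG U k η)
    (h0 : HasTrace (restr U) (0 : L2 T d)) (k : ℤ) :
    ∀ᵐ ξ : Space d, ∫ ζ : ℝ, fourierG U k (glue ξ ζ) = 0 := by
  obtain ⟨G, hG⟩ := ((sqSummable_fourierG U).integral hU.last_mul).exists_fourierG T
  have h1 := (hasTrace_restr hU.last_mul hG).unique h0
  have h2 := hG k
  rw [h1, fourierG_zero] at h2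
  filter_upwards [h2, Lp.coeFn_zero ℂ 2 (volume : Measure (Space d))] with ξ h3 h4
  rw [← h3, h4]; rfl

theorem exists_normalDeriv {U : L2 T (d + 1)}
    (hU : SqSummable volume fun k (η : Space (d + 1)) => (zfreq η : ℂ) * fourierG U k η) :
    ∃ W : L2 T (d + 1), (∀ k, fourierG W k =ᵐ[volume] fun η =>
      Complex.I * (zfreq η * fourierG U k η)) ∧ IsWeakNormalDeriv (restr U) (restr W) := by
  obtain ⟨W, hW⟩ := (hU.const_mul Complex.I).exists_fourierG T
  refine ⟨W, hW, isWeakNormalDeriv_of_symbol fun k => ?_⟩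
  filter_upwards [hW k] with η hη
  rw [hη, xfreq_last]; ring

theorem integral_zfreq_eq_zero_of_hasTrace {U : L2 T (d + 1)} (hU : U ∈ Hperp T (d + 1) 0 4)
    {w : L2plus T d} (hw : IsWeakNormalDeriv (restr U) w) (h0 : HasTrace w (0 : L2 T d)) (k : ℤ) :
    ∀ᵐ ξ : Space d, ∫ ζ : ℝ, (2 * Real.pi * ζ : ℂ) * fourierG U k (glue ξ ζ) = 0 := by
  have h1 : SqSummable volume fun k (η : Space (d + 1)) => (zfreq η : ℂ) * fourierG U k η := by
    simpa using sqSummable_zfreq_pow hU (j := 1) (by norm_num)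
  obtain ⟨W, hW, hWn⟩ := exists_normalDeriv h1
  obtain ⟨W', rfl⟩ := restr_surjective w
  have h2 : restr W' = restr W := restr_eq_of_forall_test fun φ hφ => by
    have e1 := hw φ hφ
    rw [hWn φ hφ] at e1
    exact (neg_injective e1).symm
  rw [h2] at h0
  have h3 : SqSummable volume fun k (η : Space (d + 1)) => (zfreq η : ℂ) * fourierG W k η := by
    refine (sqSummable_zfreq_pow hU (j := 2) (by norm_num)).mono (fun k => ?_) 1 fun k => ?_
    · exact (Measurable.aestronglyMeasurable (by fun_prop)).mul (Lp.memLp _).1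
    · filter_upwards [hW k] with η hη
      rw [hη]
      apply le_of_eq
      simp only [norm_mul, norm_pow, Complex.norm_I]
      ring
  filter_upwards [integral_eq_zero_of_hasTrace h3 h0 k, ae_ae_glue (hW k)] with ξ h4 h5
  rw [integral_congr_ae h5, integral_const_mul] at h4
  have h6 := (mul_eq_zero.1 h4).resolve_left Complex.I_ne_zero
  rw [← h6]
  refine integral_congr_ae (Eventually.of_forall fun ζ => ?_)
  simp

theorem memLp_symD_mul {U : L2 T (d + 1)} (hU : U ∈ Hperp T (d + 1) 0 4) (k : ℤ) :
    MemLp (fun η => symD T k η * fourierG U k η) 2 := by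
  refine ((mem_Hperp_iff.1 hU).2.memLp k).of_le_mul (c := 1 + |tfreq T k|)
    ((continuous_symD T k).aestronglyMeasurable.mul (Lp.memLp _).1)
    (Eventually.of_forall fun η => ?_)
  rw [norm_mul, norm_mul, ← mul_assoc]
  refine mul_le_mul_of_nonneg_right ?_ (norm_nonneg _)
  rw [Complex.norm_real, weight_zero_four, Real.norm_of_nonneg (by positivity)]
  exact norm_symD_le T k η

/-- For a solution with vanishing Dirichlet data, the trace of `op[D⁻]⁻¹₊ f` is the trace of
`-∂ₙ²u`. Indeed `D Û - F̂` is anticausal, hence so is `D⁺ Û - F̂ / D⁻`, whose integral over the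
normal frequency vanishes; and in `D⁺ = z² - i(a + b)z - ab` the two lower terms integrate to zero
by the boundary conditions. -/
theorem integral_isOp_eq {F V U : L2 T (d + 1)} (hV : IsOp invDminus F V)
    (hU : U ∈ Hperp T (d + 1) 0 4) (hs : SolvesDirichlet (restr U) (restr F)) {k : ℤ}
    (hk : k ≠ 0) :
    ∀ᵐ ξ : Space d, ∫ ζ : ℝ, fourierG V k (glue ξ ζ) =
      ∫ ζ : ℝ, (2 * Real.pi * ζ : ℂ) ^ 2 * fourierG U k (glue ξ ζ) := by
  obtain ⟨C, hC⟩ := exists_norm_invDminus_le T d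
  have hH1 := memLp_symD_mul hU k
  have hA := hs.eqn.anticausal k hH1
  set H : Space (d + 1) → ℂ := fun η => symD T k η * fourierG U k η - fourierG F k η with hH
  have hH2 : MemLp H 2 := hH1.sub (Lp.memLp _)
  have hHm : StronglyMeasurable H :=
    ((continuous_symD T k).stronglyMeasurable.mul (Lp.stronglyMeasurable _)).sub
      (Lp.stronglyMeasurable _)
  have hJ := hA.invDminus_mul (T := T) hk hHm hH2
  set J : Space (d + 1) → ℂ := fun η => invDminus (tfreq T k) (xfreq η) * H η with hJdef
  have hJm : AEStronglyMeasurable J volume :=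
    (measurable_invDminus k hk).aestronglyMeasurable.mul hH2.1
  have hJ2 : MemLp J 2 := hH2.of_le_mul (c := C) hJm (Eventually.of_forall fun η => by
    rw [hJdef, norm_mul]; exact mul_le_mul_of_nonneg_right (hC k hk η).1 (norm_nonneg _))
  have hJ3 : MemLp (fun η => (zfreq η : ℂ) * J η) 2 := by
    refine hH2.of_le_mul (c := C) ((Measurable.aestronglyMeasurable (by fun_prop)).mul hJm)
      (Eventually.of_forall fun η => ?_)
    rw [hJdef, ← mul_assoc, norm_mul]
    exact mul_le_mul_of_nonneg_right (hC k hk η).2 (norm_nonneg _)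
  have h0 := hJ.integral_eq_zero hJ2 (memLp_last_mul hJ3)
  obtain ⟨w, hw, hw0⟩ := hs.trace_one
  have hS1 : SqSummable volume fun k (η : Space (d + 1)) => (zfreq η : ℂ) * fourierG U k η := by
    simpa using sqSummable_zfreq_pow hU (j := 1) (by norm_num)
  have hi : ∀ j ≤ 3, ∀ᵐ ξ : Space d, Integrable fun ζ : ℝ =>
      (zfreq (glue ξ ζ) : ℂ) ^ j * fourierG U k (glue ξ ζ) := by
    intro j hj
    refine ae_integrable_glue ((sqSummable_zfreq_pow hU (by omega)).memLp k) (memLp_last_mul ?_)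
    refine (memLp_congr_ae (Eventually.of_forall fun η => ?_)).1
      ((sqSummable_zfreq_pow hU (j := j + 1) (by omega)).memLp k)
    ring
  have hiV : ∀ᵐ ξ : Space d, Integrable fun ζ : ℝ => J (glue ξ ζ) :=
    ae_integrable_glue hJ2 (memLp_last_mul hJ3)
  filter_upwards [h0, integral_eq_zero_of_hasTrace hS1 hs.trace_zero k,
    integral_zfreq_eq_zero_of_hasTrace hU hw hw0 k, ae_ae_glue (hV k), hi 0 (by norm_num),
    hi 1 (by norm_num), hi 2 (by norm_num), hiV] with ξ e0 e1 e2 e3 i0 i1 i2 iJ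
  obtain ⟨ha, -⟩ := freqA_spec T hk ξ
  obtain ⟨hb, -⟩ := freqB_spec T hk ξ
  set a := freqA T k ξ
  set b := freqB T k ξ
  have key : ∀ᵐ ζ : ℝ, fourierG V k (glue ξ ζ) =
      (2 * Real.pi * ζ : ℂ) ^ 2 * fourierG U k (glue ξ ζ) -
      (Complex.I * (a + b)) * ((2 * Real.pi * ζ : ℂ) * fourierG U k (glue ξ ζ)) -
      (a * b) * fourierG U k (glue ξ ζ) - J (glue ξ ζ) := by
    filter_upwards [e3] with ζ h3
    rw [h3, hJdef, hH]
    simp only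
    rw [symD_eq_prod hk, invDminus_eq hk]
    simp only [tang_glue, zfreq_glue]
    have n1 := zfreq_add_ne_zero ha (2 * Real.pi * ζ)
    have n2 := zfreq_add_ne_zero hb (2 * Real.pi * ζ)
    push_cast at n1 n2 ⊢
    simp only [a, b] at n1 n2 ⊢
    field_simp
    linear_combination (freqA T k ξ * freqB T k ξ * fourierG U k (glue ξ ζ)) *
      (2 * Real.pi * ζ + Complex.I * freqA T k ξ) *
      (2 * Real.pi * ζ + Complex.I * freqB T k ξ) * Complex.I_sq
  simp only [zfreq_glue, pow_zero, pow_one, one_mul] at i0 i1 i2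
  push_cast at i1 i2
  have i3 : Integrable fun ζ : ℝ => (2 * Real.pi * ζ : ℂ) ^ 2 * fourierG U k (glue ξ ζ) -
      (Complex.I * (a + b)) * ((2 * Real.pi * ζ : ℂ) * fourierG U k (glue ξ ζ)) :=
    i2.sub (i1.const_mul _)
  have i4 : Integrable fun ζ : ℝ => (2 * Real.pi * ζ : ℂ) ^ 2 * fourierG U k (glue ξ ζ) -
      (Complex.I * (a + b)) * ((2 * Real.pi * ζ : ℂ) * fourierG U k (glue ξ ζ)) -
      (a * b) * fourierG U k (glue ξ ζ) := i3.sub (i0.const_mul _)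
  rw [integral_congr_ae key, integral_sub i4 iJ, integral_sub i3 (i0.const_mul _),
    integral_sub i2 (i1.const_mul _), integral_const_mul, integral_const_mul, e0, e1, e2]
  simp

/-- The trace of `∂ₙ²u` for `u ∈ H^{(0,4)}` is in `H^{(0,3/2)}`, by the Cauchy-Schwarz inequality in
the normal frequency. -/
theorem sqSummable_weight_zero {U : L2 T (d + 1)} (hU : U ∈ Hperp T (d + 1) 0 4) :
    SqSummable volume fun k (ξ : Space d) => (weight 0 (3 / 2) (tfreq T k) (xfreq ξ) : ℂ) *
      ∫ ζ : ℝ, (2 * Real.pi * ζ : ℂ) ^ 2 * fourierG U k (glue ξ ζ) := by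
  set r : ℤ → Space (d + 1) → ℂ := fun k η => (weight 0 (3 / 2) (tfreq T k) (xfreq (tang η)) : ℂ) *
    ((zfreq η : ℂ) ^ 2 * (((1 + ‖xfreq η‖ ^ 2) ^ 2 : ℝ) : ℂ)⁻¹) with hr
  have hm : ∀ n, Measurable (xfreq : Space n → Space n) := fun n => continuous_xfreq.measurable
  have hrm : ∀ k, Measurable (r k) := by
    intro k
    have := hm (d + 1)
    have := hm d
    simp only [hr, weight]
    fun_prop
  have h1 := (mem_Hperp_iff.1 hU).2.integral_mul (r := r)
    (fun k => (hrm k).aestronglyMeasurable) 1 (fun k => Or.inr fun ξ => ?_)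
  · refine h1.mono (fun k => ?_) 1 fun k => Eventually.of_forall fun ξ => ?_
    · refine AEStronglyMeasurable.mul ?_ ?_
      · refine Measurable.aestronglyMeasurable ?_
        have := hm d
        unfold weight
        fun_prop
      · refine (AEStronglyMeasurable.integral_prod_right' (f := fun p : Space d × ℝ =>
          (2 * Real.pi * p.2 : ℂ) ^ 2 * fourierG U k (glue p.1 p.2)) ?_)
        exact (Measurable.aestronglyMeasurable (by fun_prop)).mul
          (aestronglyMeasurable_glue (Lp.memLp _).1)
    · rw [one_mul, ← integral_const_mul]
      apply le_of_eq; congr 2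
      funext ζ
      have : (((1 + ‖xfreq (glue ξ ζ)‖ ^ 2) ^ 2 : ℝ) : ℂ) ≠ 0 := by
        rw [Complex.ofReal_ne_zero]; positivity
      simp only [hr, tang_glue, zfreq_glue, weight_zero_four]
      push_cast at this ⊢
      rw [mul_assoc _ ((_ : ℂ) ^ 2 * _), mul_assoc _ _ ((_ : ℂ) * _), inv_mul_cancel_left₀ this]
  · set A : ℝ := Real.sqrt (1 + ‖xfreq ξ‖ ^ 2) with hA
    have hA1 : A ^ 2 = 1 + ‖xfreq ξ‖ ^ 2 := Real.sq_sqrt (by positivity)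
    have hA0 : 0 < A := Real.sqrt_pos.2 (by positivity)
    have hw : weight 0 (3 / 2) (tfreq T k) (xfreq ξ) ^ 2 = A ^ 3 := by
      rw [weight, zero_div, Real.rpow_zero, one_mul, ← hA1, ← Real.rpow_natCast,
        ← Real.rpow_natCast A 2, ← Real.rpow_mul hA0.le, ← Real.rpow_mul hA0.le,
        ← Real.rpow_natCast]
      norm_num
    refine (memLp_of_le_div ?_ hA0 fun ζ => ?_).2
    · exact ((hrm k).comp (continuous_glue.comp
        (continuous_const.prodMk continuous_id)).measurable).aestronglyMeasurable
    · simp only [hr, tang_glue, zfreq_glue]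
      rw [norm_mul, norm_mul, norm_inv, norm_pow, Complex.norm_real, Complex.norm_real,
        Complex.norm_real, mul_pow, mul_pow, Real.norm_eq_abs, sq_abs, hw, norm_xfreq_sq, tang_glue,
        zfreq_glue, Real.norm_eq_abs, Real.norm_eq_abs, sq_abs]
      set z := 2 * Real.pi * ζ
      have hN : 1 + (‖xfreq ξ‖ ^ 2 + z ^ 2) = z ^ 2 + A ^ 2 := by rw [hA1]; ring
      rw [hN, abs_of_nonneg (by positivity), one_mul, inv_pow, le_div_iff₀ (by positivity)]
      set N := z ^ 2 + A ^ 2 with hNd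
      have hN0 : 0 < N := by positivity
      have hz : (z ^ 2) ^ 2 ≤ N ^ 2 := pow_le_pow_left₀ (sq_nonneg _) (by rw [hNd]; nlinarith) 2
      have hAN : A ^ 2 ≤ N := by rw [hNd]; nlinarith [sq_nonneg z]
      have e : A ^ 3 * ((z ^ 2) ^ 2 * ((N ^ 2) ^ 2)⁻¹) * N = A * (A ^ 2 * (z ^ 2) ^ 2 / N ^ 3) := by
        field_simp
      rw [e]
      refine mul_le_of_le_one_right hA0.le ?_
      rw [div_le_one (by positivity)]
      calc A ^ 2 * (z ^ 2) ^ 2 ≤ N * N ^ 2 := mul_le_mul hAN hz (by positivity) hN0.le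
        _ = N ^ 3 := by ring

/-- The trace of `∂ₙ²u` for `u ∈ 𝔼` is in `H^{(3/4,0)}`. The two memberships that define `𝔼` may be
witnessed by different extensions `U` and `U'`. With `L = |τ|^{1/2}` and `κ = 1 / (z + iL)` there is
a partition `1 = κ²z² + m` at the normal frequency `L`: the high frequencies `κ²z⁴ Û` are controlled
by four normal derivatives of `U`, and the low ones `m z² Û'` by `∂ₜ∂ₙ²U'`. Since `m` has its poles
in the lower half plane only, `m z² (Û - Û')` is anticausal and integrates to zero, so that
exchanging the extensions is harmless. -/
theorem sqSummable_abs_tfreq {U U' : L2 T (d + 1)} (hU : U ∈ Hperp T (d + 1) 0 4)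
    (hU' : U' ∈ Hperp T (d + 1) 1 2) (h : restr U = restr U') :
    SqSummable volume fun k (ξ : Space d) => ((|tfreq T k| ^ (3 / 4 : ℝ) : ℝ) : ℂ) *
      ∫ ζ : ℝ, (2 * Real.pi * ζ : ℂ) ^ 2 * fourierG U k (glue ξ ζ) := by
  set L : ℤ → ℝ := fun k => Real.sqrt |tfreq T k| with hL
  set κ : ℤ → Space (d + 1) → ℂ := fun k η => ((zfreq η : ℂ) + Complex.I * (L k : ℂ))⁻¹ with hκ
  set w : ℤ → ℝ := fun k => |tfreq T k| ^ (3 / 4 : ℝ) with hw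
  have hL0 : ∀ k, k ≠ 0 → 0 < L k := fun k hk =>
    Real.sqrt_pos.2 (abs_pos.2 (tfreq_ne_zero T hk))
  have hL2 : ∀ k, L k ^ 2 = |tfreq T k| := fun k => Real.sq_sqrt (abs_nonneg _)
  have hwL : ∀ k, k ≠ 0 → w k ^ 2 = L k ^ 3 := by
    intro k hk
    have h0 := (hL0 k hk).le
    rw [hw]
    simp only
    rw [← hL2, ← Real.rpow_natCast, ← Real.rpow_natCast (L k) 2, ← Real.rpow_mul h0,
      ← Real.rpow_mul h0, ← Real.rpow_natCast]
    norm_num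
  have hκm : ∀ k, Measurable (κ k) := fun k => by simp only [hκ]; fun_prop
  have hκn : ∀ k, k ≠ 0 → ∀ η, ‖κ k η‖ ^ 2 = (zfreq η ^ 2 + L k ^ 2)⁻¹ := by
    intro k hk η
    rw [hκ, norm_inv, inv_pow, ← Complex.normSq_eq_norm_sq, Complex.normSq_apply]
    simp [sq]
  have hκL : ∀ k, k ≠ 0 → ∀ η, L k * ‖κ k η‖ ≤ 1 := by
    intro k hk η
    have h1 := hκn k hk η
    have h0 := hL0 k hk
    have : (L k * ‖κ k η‖) ^ 2 ≤ 1 := by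
      rw [mul_pow, h1, ← div_eq_mul_inv, div_le_one (by positivity)]
      nlinarith [sq_nonneg (zfreq η)]
    exact (sq_le_one_iff₀ (by positivity)).1 this
  -- the low-pass factor `m = 1 - κ²z²`, written as a polynomial in `κ` without constant term
  set m : ℤ → Space (d + 1) → ℂ := fun k η =>
    2 * Complex.I * L k * κ k η + (L k : ℂ) ^ 2 * κ k η ^ 2 with hm
  have hmm : ∀ k, Measurable (m k) := fun k => by
    have := hκm k
    simp only [hm]; fun_prop
  have hmn : ∀ k, k ≠ 0 → ∀ η, ‖m k η‖ ≤ 3 * (L k * ‖κ k η‖) := by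
    intro k hk η
    have h0 := hL0 k hk
    have h1 := hκL k hk η
    have h2 : 0 ≤ L k * ‖κ k η‖ := by positivity
    have e1 : ‖2 * Complex.I * L k * κ k η‖ = 2 * (L k * ‖κ k η‖) := by
      simp [abs_of_pos h0]; ring
    have e2 : ‖(L k : ℂ) ^ 2 * κ k η ^ 2‖ = (L k * ‖κ k η‖) ^ 2 := by
      simp [mul_pow]
    refine (norm_add_le _ _).trans ?_
    rw [e1, e2]
    nlinarith
  have hsplit : ∀ k, k ≠ 0 → ∀ η : Space (d + 1),
      (1 : ℂ) = κ k η ^ 2 * (zfreq η : ℂ) ^ 2 + m k η := by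
    intro k hk η
    have hne := zfreq_add_ne_zero (c := (L k : ℂ)) (by simpa using hL0 k hk) (zfreq η)
    simp only [hm, hκ]
    field_simp
    linear_combination (-(L k : ℂ) ^ 2) * Complex.I_sq
  have hglue : ∀ ξ : Space d, Measurable fun ζ : ℝ => glue ξ ζ := fun ξ =>
    (continuous_glue.comp (continuous_const.prodMk continuous_id)).measurable
  -- high frequencies: `z⁴ Û` against `|τ|^{3/4} κ²`
  have hH4 := sqSummable_zfreq_pow hU (j := 4) le_rfl
  have b1 : ∀ k, k ≠ 0 → ∀ (ξ : Space d) (ζ : ℝ), ‖(w k : ℂ) * κ k (glue ξ ζ) ^ 2‖ ^ 2 ≤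
      9 * (L k / ((2 * Real.pi * ζ) ^ 2 + L k ^ 2)) := by
    intro k hk ξ ζ
    have h0 := hL0 k hk
    have h1 := hκL k hk (glue ξ ζ)
    have h2 := hκn k hk (glue ξ ζ)
    rw [zfreq_glue] at h2
    have e : ‖(w k : ℂ) * κ k (glue ξ ζ) ^ 2‖ ^ 2 =
        L k * ‖κ k (glue ξ ζ)‖ ^ 2 * (L k * ‖κ k (glue ξ ζ)‖) ^ 2 := by
      rw [norm_mul, norm_pow, Complex.norm_real, mul_pow, Real.norm_eq_abs, sq_abs, hwL k hk]
      ring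
    rw [e, div_eq_mul_inv, ← h2]
    have h3 : (L k * ‖κ k (glue ξ ζ)‖) ^ 2 ≤ 1 := pow_le_one₀ (by positivity) h1
    have h4 : 0 ≤ L k * ‖κ k (glue ξ ζ)‖ ^ 2 := by positivity
    nlinarith
  have b2 : ∀ k, k ≠ 0 → ∀ (ξ : Space d) (ζ : ℝ),
      ‖((w k / L k ^ 2 : ℝ) : ℂ) * m k (glue ξ ζ)‖ ^ 2 ≤
      9 * (L k / ((2 * Real.pi * ζ) ^ 2 + L k ^ 2)) := by
    intro k hk ξ ζ
    have h0 := hL0 k hk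
    have h1 := hmn k hk (glue ξ ζ)
    have h2 := hκn k hk (glue ξ ζ)
    rw [zfreq_glue] at h2
    rw [norm_mul, Complex.norm_real, mul_pow, Real.norm_eq_abs, sq_abs, div_pow, hwL k hk,
      div_eq_mul_inv (L k), ← h2]
    have h3 : ‖m k (glue ξ ζ)‖ ^ 2 ≤ (3 * (L k * ‖κ k (glue ξ ζ)‖)) ^ 2 :=
      pow_le_pow_left₀ (norm_nonneg _) h1 2
    calc L k ^ 3 / (L k ^ 2) ^ 2 * ‖m k (glue ξ ζ)‖ ^ 2
        ≤ L k ^ 3 / (L k ^ 2) ^ 2 * (3 * (L k * ‖κ k (glue ξ ζ)‖)) ^ 2 :=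
          mul_le_mul_of_nonneg_left h3 (by positivity)
      _ = 9 * (L k * ‖κ k (glue ξ ζ)‖ ^ 2) := by field_simp; ring
  have hsum1 := hH4.integral_mul (r := fun k η => if k = 0 then 0 else (w k : ℂ) * κ k η ^ 2)
    (fun k => by
      have := hκm k
      split_ifs
      · exact aestronglyMeasurable_zero
      · exact (Measurable.aestronglyMeasurable (by fun_prop))) 9 (fun k => Or.inr fun ξ => by
      by_cases hk : k = 0
      · simp [hk]
      · simp only [hk, if_false]
        refine (memLp_of_le_div ?_ (hL0 k hk) (b1 k hk ξ)).2
        have := (hκm k).comp (hglue ξ)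
        exact ((this.pow_const 2).const_mul (w k : ℂ)).aestronglyMeasurable)
  -- low frequencies: `|τ| z² Û'` against `|τ|^{3/4 - 1} m`
  have hH' : SqSummable volume fun k (η : Space (d + 1)) =>
      ((L k : ℂ) ^ 2 * (zfreq η : ℂ) ^ 2) * fourierG U' k η := by
    refine (mem_Hperp_iff.1 hU').2.mono (fun k => ?_) 1 fun k => Eventually.of_forall fun η => ?_
    · exact (Measurable.aestronglyMeasurable (by fun_prop)).mul (Lp.memLp _).1
    · rw [one_mul, norm_mul, norm_mul ((weight 1 2 (tfreq T k) (xfreq η) : ℝ) : ℂ)]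
      refine mul_le_mul_of_nonneg_right ?_ (norm_nonneg _)
      rw [norm_mul, norm_pow, norm_pow, Complex.norm_real, Complex.norm_real, Complex.norm_real,
        Real.norm_eq_abs, Real.norm_eq_abs, sq_abs, sq_abs, hL2, weight_one_two,
        Real.norm_of_nonneg (by positivity)]
      have h1 := zfreq_sq_le η
      exact mul_le_mul (abs_le_sqrt_one_add_sq _) (by linarith) (sq_nonneg _) (by positivity)
  have hsum2 := hH'.integral_mul
    (r := fun k η => if k = 0 then 0 else ((w k / L k ^ 2 : ℝ) : ℂ) * m k η)
    (fun k => by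
      have := hmm k
      split_ifs
      · exact aestronglyMeasurable_zero
      · exact (Measurable.aestronglyMeasurable (by fun_prop))) 9 (fun k => Or.inr fun ξ => by
      by_cases hk : k = 0
      · simp [hk]
      · simp only [hk, if_false]
        refine (memLp_of_le_div ?_ (hL0 k hk) (b2 k hk ξ)).2
        exact (((hmm k).comp (hglue ξ)).const_mul _).aestronglyMeasurable)
  refine (hsum1.add hsum2).mono (fun k => ?_) 1 fun k => ?_
  · refine AEStronglyMeasurable.mul aestronglyMeasurable_const ?_
    refine (AEStronglyMeasurable.integral_prod_right' (f := fun p : Space d × ℝ =>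
      (2 * Real.pi * p.2 : ℂ) ^ 2 * fourierG U k (glue p.1 p.2)) ?_)
    exact (Measurable.aestronglyMeasurable (by fun_prop)).mul
      (aestronglyMeasurable_glue (Lp.memLp _).1)
  by_cases hk : k = 0
  · refine Eventually.of_forall fun ξ => ?_
    have : tfreq T k = 0 := by simp [hk, tfreq]
    simp [this, Real.zero_rpow]
  have h0 := hL0 k hk
  -- the difference of the two extensions vanishes on the half cylinder
  have hW : Anticausal fun η => (zfreq η : ℂ) ^ 2 * (fourierG U k η - fourierG U' k η) := by
    have h1 : Anticausal (fourierG (U - U') k : Space (d + 1) → ℂ) := by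
      refine (restr_eq_zero_iff_anticausal (U - U')).1 ?_ k
      rw [restr_sub, h, sub_self]
    have h2 : Anticausal fun η => fourierG U k η - fourierG U' k η := by
      refine h1.congr ?_
      rw [fourierG_sub]
      exact Lp.coeFn_sub _ _
    refine (h2.zfreq_mul.zfreq_mul).congr (Eventually.of_forall fun η => ?_)
    ring
  have hmemU : MemLp (fun η => (zfreq η : ℂ) ^ 2 * fourierG U k η) 2 :=
    (sqSummable_zfreq_pow hU (by norm_num)).memLp k
  have hLc : (L k : ℂ) ≠ 0 := by exact_mod_cast h0.ne'
  have hmemU' : MemLp (fun η => (zfreq η : ℂ) ^ 2 * fourierG U' k η) 2 := by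
    refine (memLp_congr_ae (Eventually.of_forall fun η => ?_)).1
      ((hH'.memLp k).const_mul ((L k : ℂ) ^ 2)⁻¹)
    field_simp
  set W : Space (d + 1) → ℂ := fun η => (zfreq η : ℂ) ^ 2 * (fourierG U k η - fourierG U' k η)
    with hWd
  have hW2 : MemLp W 2 := by
    refine (memLp_congr_ae (Eventually.of_forall fun η => ?_)).1 (hmemU.sub hmemU')
    simp only [hWd, Pi.sub_apply]; ring
  have hWm : StronglyMeasurable W := by
    refine StronglyMeasurable.mul (Measurable.stronglyMeasurable (by fun_prop)) ?_
    exact (Lp.stronglyMeasurable _).sub (Lp.stronglyMeasurable _)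
  have hκ1 : ∀ {X : Space (d + 1) → ℂ}, StronglyMeasurable X → MemLp X 2 → Anticausal X →
      StronglyMeasurable (fun η => κ k η * X η) ∧ MemLp (fun η => κ k η * X η) 2 ∧
        Anticausal (fun η => κ k η * X η) := by
    intro X hXm hX2 hX
    have hm1 : StronglyMeasurable (fun η => κ k η * X η) := (hκm k).stronglyMeasurable.mul hXm
    refine ⟨hm1, ?_, ?_⟩
    · refine hX2.of_le_mul (c := (L k)⁻¹) hm1.aestronglyMeasurable
        (Eventually.of_forall fun η => ?_)
      rw [norm_mul]
      refine mul_le_mul_of_nonneg_right ?_ (norm_nonneg _)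
      rw [← one_div, le_div_iff₀ h0, mul_comm]
      exact hκL k hk η
    · have := hX.mul_inv_sub hXm hX2 (ρ := fun _ => -(Complex.I * L k)) fun _ => by simpa using h0
      refine this.congr (Eventually.of_forall fun η => ?_)
      simp [hκ, zfreq]
  obtain ⟨hm1, h12, hA1⟩ := hκ1 hWm hW2 hW
  obtain ⟨hm2, h22, hA2⟩ := hκ1 hm1 h12 hA1
  have hJ : Anticausal fun η => m k η * W η := by
    refine ((hA1.tang_mul fun _ => 2 * Complex.I * L k).sub
      (hA2.tang_mul fun _ => -(L k : ℂ) ^ 2) (h12.const_mul _) (h22.const_mul _)).congr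
      (Eventually.of_forall fun η => ?_)
    simp only [hm]; ring
  have hJ2 : MemLp (fun η => m k η * W η) 2 := by
    refine hW2.of_le_mul (c := 3) ((hmm k).aestronglyMeasurable.mul hW2.1)
      (Eventually.of_forall fun η => ?_)
    rw [norm_mul]
    refine mul_le_mul_of_nonneg_right ((hmn k hk η).trans ?_) (norm_nonneg _)
    linarith [hκL k hk η]
  have hJ3 : MemLp (fun η => (zfreq η : ℂ) * (m k η * W η)) 2 := by
    refine hW2.of_le_mul (c := 3 * L k) ((Measurable.aestronglyMeasurable (by fun_prop)).mul hJ2.1)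
      (Eventually.of_forall fun η => ?_)
    rw [← mul_assoc, norm_mul, norm_mul]
    refine mul_le_mul_of_nonneg_right ?_ (norm_nonneg _)
    have h1 := hmn k hk η
    have h2 : ‖(zfreq η : ℂ)‖ * ‖κ k η‖ ≤ 1 := by
      have h3 := hκn k hk η
      have : (‖(zfreq η : ℂ)‖ * ‖κ k η‖) ^ 2 ≤ 1 := by
        rw [mul_pow, h3, Complex.norm_real, Real.norm_eq_abs, sq_abs, ← div_eq_mul_inv,
          div_le_one (by positivity)]
        nlinarith
      exact (sq_le_one_iff₀ (by positivity)).1 this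
    calc ‖(zfreq η : ℂ)‖ * ‖m k η‖ ≤ ‖(zfreq η : ℂ)‖ * (3 * (L k * ‖κ k η‖)) :=
          mul_le_mul_of_nonneg_left h1 (norm_nonneg _)
      _ = 3 * L k * (‖(zfreq η : ℂ)‖ * ‖κ k η‖) := by ring
      _ ≤ 3 * L k * 1 := mul_le_mul_of_nonneg_left h2 (by positivity)
      _ = 3 * L k := by ring
  have hb1 : ∀ ξ : Space d, MemLp (fun ζ : ℝ => (w k : ℂ) * κ k (glue ξ ζ) ^ 2) 2 := fun ξ =>
    (memLp_of_le_div ((((hκm k).comp (hglue ξ)).pow_const 2).const_mul _).aestronglyMeasurable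
      (hL0 k hk) (b1 k hk ξ)).1
  have hb2 : ∀ ξ : Space d, MemLp (fun ζ : ℝ => ((w k / L k ^ 2 : ℝ) : ℂ) * m k (glue ξ ζ)) 2 :=
    fun ξ => (memLp_of_le_div (((hmm k).comp (hglue ξ)).const_mul _).aestronglyMeasurable
      (hL0 k hk) (b2 k hk ξ)).1
  filter_upwards [hJ.integral_eq_zero hJ2 (memLp_last_mul hJ3),
    ae_integrable_kernel_mul (r := fun η => (w k : ℂ) * κ k η ^ 2) (hH4.memLp k) hb1,
    ae_integrable_kernel_mul (r := fun η => ((w k / L k ^ 2 : ℝ) : ℂ) * m k η) (hH'.memLp k) hb2,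
    ae_integrable_glue hJ2 (memLp_last_mul hJ3)] with ξ j0 i1 i2 i3
  rw [one_mul]
  apply le_of_eq
  simp only [hk, if_false]
  congr 1
  rw [← integral_add i1 i2]
  have e : ∀ ζ : ℝ, (w k : ℂ) * ((2 * Real.pi * ζ : ℂ) ^ 2 * fourierG U k (glue ξ ζ)) =
      ((w k : ℂ) * κ k (glue ξ ζ) ^ 2 *
        ((zfreq (glue ξ ζ) : ℂ) ^ 4 * fourierG U k (glue ξ ζ)) +
      ((w k / L k ^ 2 : ℝ) : ℂ) * m k (glue ξ ζ) *
        ((L k : ℂ) ^ 2 * (zfreq (glue ξ ζ) : ℂ) ^ 2 * fourierG U' k (glue ξ ζ))) +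
      (w k : ℂ) * (m k (glue ξ ζ) * W (glue ξ ζ)) := by
    intro ζ
    have h1 := hsplit k hk (glue ξ ζ)
    have hz : (2 * Real.pi * ζ : ℂ) = (zfreq (glue ξ ζ) : ℂ) := by simp
    rw [hz, hWd]
    simp only
    push_cast
    have h2 : ((w k : ℂ) / (L k : ℂ) ^ 2) * m k (glue ξ ζ) *
        ((L k : ℂ) ^ 2 * (zfreq (glue ξ ζ) : ℂ) ^ 2 * fourierG U' k (glue ξ ζ)) =
        (w k : ℂ) * m k (glue ξ ζ) * ((zfreq (glue ξ ζ) : ℂ) ^ 2 * fourierG U' k (glue ξ ζ)) := by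
      field_simp
    rw [h2]
    linear_combination ((w k : ℂ) * (zfreq (glue ξ ζ) : ℂ) ^ 2 * fourierG U k (glue ξ ζ)) * h1
  have i12 : Integrable fun ζ : ℝ => (w k : ℂ) * κ k (glue ξ ζ) ^ 2 *
        ((zfreq (glue ξ ζ) : ℂ) ^ 4 * fourierG U k (glue ξ ζ)) +
      ((w k / L k ^ 2 : ℝ) : ℂ) * m k (glue ξ ζ) *
        ((L k : ℂ) ^ 2 * (zfreq (glue ξ ζ) : ℂ) ^ 2 * fourierG U' k (glue ξ ζ)) := i1.add i2
  rw [← integral_const_mul, integral_congr_ae (Eventually.of_forall e),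
    integral_add i12 (i3.const_mul _), integral_const_mul, j0, mul_zero, add_zero]

variable (T) in
theorem exists_one_add_sq_rpow_le {s : ℝ} (hs : 0 ≤ s) : ∃ C : ℝ, ∀ k : ℤ, k ≠ 0 →
    (1 + tfreq T k ^ 2) ^ (s / 2) ≤ C * |tfreq T k| ^ s := by
  have h0 : 0 < 2 * Real.pi / T := div_pos (by positivity) hT.out
  set τ₀ := 2 * Real.pi / T
  refine ⟨(1 + (τ₀ ^ 2)⁻¹) ^ (s / 2), fun k hk => ?_⟩
  have h1 := le_abs_tfreq (T := T) hk
  have h2 : τ₀ ^ 2 ≤ tfreq T k ^ 2 := by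
    rw [← sq_abs (tfreq T k)]; exact pow_le_pow_left₀ h0.le h1 2
  have h3 : 1 + tfreq T k ^ 2 ≤ (1 + (τ₀ ^ 2)⁻¹) * tfreq T k ^ 2 := by
    have : 1 ≤ (τ₀ ^ 2)⁻¹ * tfreq T k ^ 2 := by
      rw [← div_eq_inv_mul, le_div_iff₀ (by positivity)]; linarith
    linarith
  refine (Real.rpow_le_rpow (by positivity) h3 (by positivity)).trans (le_of_eq ?_)
  rw [Real.mul_rpow (by positivity) (by positivity), ← sq_abs (tfreq T k),
    ← Real.rpow_natCast |tfreq T k|, ← Real.rpow_mul (abs_nonneg _)]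
  congr 2
  push_cast
  ring

theorem mem_L2perp_of_transform {V : L2 T (d + 1)} {G : L2 T d}
    (hG : ∀ k, fourierG G k =ᵐ[volume] fun ξ => ∫ ζ : ℝ, fourierG V k (glue ξ ζ))
    (hV : fourierG V 0 =ᵐ[volume] 0) : G ∈ L2perp T d := by
  rw [mem_L2perp_iff]
  refine Lp.ext ?_
  filter_upwards [hG 0, ae_ae_glue hV, Lp.coeFn_zero ℂ 2 (volume : Measure (Space d))]
    with ξ h1 h2 h3
  rw [h1, h3, integral_congr_ae h2]
  simp

theorem isOp_ae_zero {F V : L2 T (d + 1)} (hF : F ∈ L2perp T (d + 1)) (hV : IsOp invDminus F V) :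
    fourierG V 0 =ᵐ[volume] 0 := by
  filter_upwards [hV 0, fourierG_ae_zero hF] with η h1 h2
  rw [h1, h2]; simp

/-- Necessity: if the problem has a solution in `𝔼`, then the trace of `op[D⁻]⁻¹₊ f` is in `𝔾`. -/
theorem mem_traceSpace_of_solvesDirichlet {F V : L2 T (d + 1)} {G : L2 T d}
    (hF : F ∈ L2perp T (d + 1)) (hV : IsOp invDminus F V)
    (hG : ∀ k, fourierG G k =ᵐ[volume] fun ξ => ∫ ζ : ℝ, fourierG V k (glue ξ ζ))
    {u : L2plus T d} (hu : u ∈ solSpace T d) (hs : SolvesDirichlet u (restr F)) :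
    G ∈ traceSpace T d := by
  obtain ⟨⟨U', hU', hu'⟩, ⟨U, hU, rfl⟩⟩ := hu
  have hperp := mem_L2perp_of_transform hG (isOp_ae_zero hF hV)
  have hae : ∀ k, k ≠ 0 → fourierG G k =ᵐ[volume] fun ξ =>
      ∫ ζ : ℝ, (2 * Real.pi * ζ : ℂ) ^ 2 * fourierG U k (glue ξ ζ) := fun k hk =>
    (hG k).trans (integral_isOp_eq hV hU hs hk)
  have hm : ∀ s r k, AEStronglyMeasurable (fun ξ : Space d =>
      (weight s r (tfreq T k) (xfreq ξ) : ℂ) * fourierG G k ξ) volume := by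
    intro s r k
    refine AEStronglyMeasurable.mul (Measurable.aestronglyMeasurable ?_) (Lp.memLp _).1
    have : Measurable (xfreq : Space d → Space d) := continuous_xfreq.measurable
    unfold weight
    fun_prop
  constructor
  · obtain ⟨C, hC⟩ := exists_one_add_sq_rpow_le T (s := 3 / 4) (by norm_num)
    refine mem_Hperp_iff.2 ⟨hperp, (sqSummable_abs_tfreq hU hU' hu'.symm).mono (hm _ _) C
      fun k => ?_⟩
    by_cases hk : k = 0
    · subst hk
      filter_upwards [fourierG_ae_zero hperp] with ξ h1
      rw [h1]
      simp [tfreq, Real.zero_rpow]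
    · filter_upwards [hae k hk] with ξ h1
      rw [h1, norm_mul, norm_mul, ← mul_assoc]
      refine mul_le_mul_of_nonneg_right ?_ (norm_nonneg _)
      rw [Complex.norm_real, Complex.norm_real, weight, zero_div, Real.rpow_zero, mul_one,
        Real.norm_of_nonneg (by positivity), Real.norm_of_nonneg (by positivity)]
      exact hC k hk
  · refine mem_Hperp_iff.2 ⟨hperp, (sqSummable_weight_zero hU).mono (hm _ _) 1 fun k => ?_⟩
    by_cases hk : k = 0
    · subst hk
      filter_upwards [fourierG_ae_zero hperp] with ξ h1
      rw [h1]
      simp only [Pi.zero_apply, mul_zero, norm_zero]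
      positivity
    · filter_upwards [hae k hk] with ξ h1
      rw [h1, one_mul]

end Necessity

/-! ### The correctors -/

/-- The product `(z - ia)(z + ia)(z - ib)(z + ib)`. -/
def symProd (a b : ℂ) (z : ℝ) : ℂ :=
  (z - Complex.I * a) * (z + Complex.I * a) * ((z - Complex.I * b) * (z + Complex.I * b))

/-- The corrector `D e₀`, where `e₀ = c / ((z - ia)(z + ia)⁴)` is such that `∫ e₀ = 1` and
`∫ (z - ia) e₀ = 0`. -/
def corrA (a b : ℂ) (z : ℝ) : ℂ :=
  -(16 * Complex.I * a ^ 4) * ((z : ℂ) ^ 2 + b ^ 2) * ((z + Complex.I * a)⁻¹) ^ 3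

/-- The corrector `D e₁`, where `e₁ = c / (D⁺ (z + ib)³)` is such that `∫ (z - ia) e₁ = 1`. -/
def corrB (a b : ℂ) (z : ℝ) : ℂ :=
  -(8 * b ^ 3) * (z + Complex.I * a) * ((z + Complex.I * b)⁻¹) ^ 2

/-- Numbers `a`, `b` in the sector `|Im c| ≤ 3 Re c` with `|a|² ≤ C |b|²`. -/
structure RootPair (C : ℝ) (a b : ℂ) : Prop where
  one_le : 1 ≤ C
  re_a : 0 < a.re
  im_a : |a.im| ≤ 3 * a.re
  re_b : 0 < b.re
  im_b : |b.im| ≤ 3 * b.re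
  a_le_b : ‖a‖ ^ 2 ≤ C * ‖b‖ ^ 2

namespace RootPair

variable {C : ℝ} {a b : ℂ}

theorem norm_a_pos (h : RootPair C a b) : 0 < ‖a‖ := norm_pos_iff.2 fun h0 => by
  have := h.re_a; simp [h0] at this

theorem norm_b_pos (h : RootPair C a b) : 0 < ‖b‖ := norm_pos_iff.2 fun h0 => by
  have := h.re_b; simp [h0] at this

theorem symProd_ne_zero (h : RootPair C a b) (z : ℝ) : symProd a b z ≠ 0 :=
  mul_ne_zero (mul_ne_zero (zfreq_sub_ne_zero h.re_a z) (zfreq_add_ne_zero h.re_a z))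
    (mul_ne_zero (zfreq_sub_ne_zero h.re_b z) (zfreq_add_ne_zero h.re_b z))

theorem sub_div_symProd (h : RootPair C a b) (z : ℝ) : (z - Complex.I * a) / symProd a b z =
    (z + Complex.I * a)⁻¹ * ((z - Complex.I * b)⁻¹ * (z + Complex.I * b)⁻¹) := by
  have h1 := zfreq_sub_ne_zero h.re_a z
  rw [symProd, mul_assoc, div_mul_eq_div_div, div_self h1, one_div, mul_inv, mul_inv]

theorem sq_norm_sub_div_symProd_le (h : RootPair C a b) (z : ℝ) :
    ‖(z - Complex.I * a) / symProd a b z‖ ^ 2 ≤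
    28 ^ 3 * ((z ^ 2 + ‖a‖ ^ 2)⁻¹ * ((z ^ 2 + ‖b‖ ^ 2)⁻¹ * (z ^ 2 + ‖b‖ ^ 2)⁻¹)) := by
  have ha := h.norm_a_pos
  have hb := h.norm_b_pos
  rw [h.sub_div_symProd, norm_mul, norm_mul, mul_pow, mul_pow]
  have h1 := norm_inv_add_sq_le h.re_a h.im_a z
  have h2 := norm_inv_add_sq_le h.re_b h.im_b z
  have h3 := norm_inv_sub_sq_le h.re_b h.im_b z
  calc _ ≤ 28 * (z ^ 2 + ‖a‖ ^ 2)⁻¹ *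
        (28 * (z ^ 2 + ‖b‖ ^ 2)⁻¹ * (28 * (z ^ 2 + ‖b‖ ^ 2)⁻¹)) := by gcongr
    _ = _ := by ring

theorem sq_norm_zfreq_mul_le (h : RootPair C a b) (z : ℝ) :
    ‖b‖ ^ 3 * ‖z * ((z - Complex.I * a) / symProd a b z)‖ ^ 2 ≤
      28 ^ 3 * (‖b‖ / (z ^ 2 + ‖b‖ ^ 2)) := by
  have ha := h.norm_a_pos
  have hb := h.norm_b_pos
  have h1 := h.sq_norm_sub_div_symProd_le z
  rw [norm_mul, mul_pow, Complex.norm_real, Real.norm_eq_abs, sq_abs]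
  set Na := z ^ 2 + ‖a‖ ^ 2 with hNa
  set Nb := z ^ 2 + ‖b‖ ^ 2 with hNb
  have pa : 0 < Na := by positivity
  have pb : 0 < Nb := by positivity
  calc _ ≤ ‖b‖ ^ 3 * (z ^ 2 * (28 ^ 3 * (Na⁻¹ * (Nb⁻¹ * Nb⁻¹)))) := by gcongr
    _ = 28 ^ 3 * (‖b‖ / Nb) * ((z ^ 2 / Na) * (‖b‖ ^ 2 / Nb)) := by field_simp
    _ ≤ 28 ^ 3 * (‖b‖ / Nb) * (1 * 1) := by
        gcongr
        · rw [div_le_one pa, hNa]; nlinarith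
        · rw [div_le_one pb, hNb]; nlinarith [sq_nonneg z]
    _ = _ := by ring

theorem sq_norm_inv_symProd_le (h : RootPair C a b) (z : ℝ) :
    ‖b‖ ^ 4 * ‖a‖ ^ 3 * ‖(symProd a b z)⁻¹‖ ^ 2 ≤ 28 ^ 4 * (‖a‖ / (z ^ 2 + ‖a‖ ^ 2)) := by
  have ha := h.norm_a_pos
  have hb := h.norm_b_pos
  have h1 := norm_inv_sub_sq_le h.re_a h.im_a z
  have h2 := h.sq_norm_sub_div_symProd_le z
  have e : (symProd a b z)⁻¹ = ((z : ℂ) - Complex.I * a)⁻¹ *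
      ((z - Complex.I * a) / symProd a b z) := by
    rw [← mul_div_assoc, inv_mul_cancel₀ (zfreq_sub_ne_zero h.re_a z), one_div]
  rw [e, norm_mul, mul_pow]
  set Na := z ^ 2 + ‖a‖ ^ 2 with hNa
  set Nb := z ^ 2 + ‖b‖ ^ 2 with hNb
  have pa : 0 < Na := by positivity
  have pb : 0 < Nb := by positivity
  calc _ ≤ ‖b‖ ^ 4 * ‖a‖ ^ 3 * ((28 * Na⁻¹) * (28 ^ 3 * (Na⁻¹ * (Nb⁻¹ * Nb⁻¹)))) := by gcongr
    _ = 28 ^ 4 * (‖a‖ / Na) * ((‖a‖ ^ 2 / Na) * ((‖b‖ ^ 2 / Nb) * (‖b‖ ^ 2 / Nb))) := by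
        field_simp
    _ ≤ 28 ^ 4 * (‖a‖ / Na) * (1 * (1 * 1)) := by
        have t1 : ‖a‖ ^ 2 / Na ≤ 1 := by rw [div_le_one pa, hNa]; nlinarith [sq_nonneg z]
        have t2 : ‖b‖ ^ 2 / Nb ≤ 1 := by rw [div_le_one pb, hNb]; nlinarith [sq_nonneg z]
        gcongr
    _ = _ := by ring

theorem sq_norm_corrA_le (h : RootPair C a b) (z : ℝ) : ‖corrA a b z‖ ^ 2 ≤
    256 * 28 ^ 3 * 4 * C ^ 2 * (‖b‖ ^ 4 * ‖a‖ ^ 3) * (‖a‖ / (z ^ 2 + ‖a‖ ^ 2)) := by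
  have ha := h.norm_a_pos
  have hb := h.norm_b_pos
  have hC := h.one_le
  have h1 := norm_inv_add_sq_le h.re_a h.im_a z
  have h2 : ‖(z : ℂ) ^ 2 + b ^ 2‖ ≤ z ^ 2 + ‖b‖ ^ 2 := by
    refine (norm_add_le _ _).trans (le_of_eq ?_)
    rw [norm_pow, norm_pow, Complex.norm_real, Real.norm_eq_abs, sq_abs]
  have e : ‖corrA a b z‖ ^ 2 = 256 * ‖a‖ ^ 8 * ‖(z : ℂ) ^ 2 + b ^ 2‖ ^ 2 *
      (‖((z : ℂ) + Complex.I * a)⁻¹‖ ^ 2) ^ 3 := by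
    simp only [corrA, norm_mul, norm_neg, norm_pow, Complex.norm_I, Complex.norm_ofNat]
    ring
  rw [e]
  set Na := z ^ 2 + ‖a‖ ^ 2 with hNa
  set Nb := z ^ 2 + ‖b‖ ^ 2 with hNb
  have pa : 0 < Na := by positivity
  have pb : 0 < Nb := by positivity
  have h3 : ‖a‖ ^ 2 * Nb ≤ 2 * C * ‖b‖ ^ 2 * Na := by
    have := h.a_le_b
    rw [hNa, hNb]
    nlinarith [mul_le_mul_of_nonneg_right this (sq_nonneg z), mul_nonneg (sub_nonneg.2 hC)
      (by positivity : 0 ≤ ‖a‖ ^ 2 * ‖b‖ ^ 2), (by positivity : 0 ≤ C * ‖b‖ ^ 2 * z ^ 2),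
      (by positivity : 0 ≤ C * ‖b‖ ^ 2 * ‖a‖ ^ 2)]
  calc _ ≤ 256 * ‖a‖ ^ 8 * Nb ^ 2 * (28 * Na⁻¹) ^ 3 := by gcongr
    _ = 256 * 28 ^ 3 * ‖a‖ ^ 4 * (‖a‖ ^ 2 * Nb) ^ 2 * (Na⁻¹) ^ 3 := by ring
    _ ≤ 256 * 28 ^ 3 * ‖a‖ ^ 4 * (2 * C * ‖b‖ ^ 2 * Na) ^ 2 * (Na⁻¹) ^ 3 := by gcongr
    _ = _ := by field_simp; ring

theorem sq_norm_corrB_le (h : RootPair C a b) (z : ℝ) : ‖corrB a b z‖ ^ 2 ≤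
    128 * 28 ^ 2 * C * ‖b‖ ^ 5 * (‖b‖ / (z ^ 2 + ‖b‖ ^ 2)) := by
  have ha := h.norm_a_pos
  have hb := h.norm_b_pos
  have hC := h.one_le
  have h1 := norm_inv_add_sq_le h.re_b h.im_b z
  have h2 := norm_add_I_mul_le a z
  have e : ‖corrB a b z‖ ^ 2 = 64 * ‖b‖ ^ 6 * ‖(z : ℂ) + Complex.I * a‖ ^ 2 *
      (‖((z : ℂ) + Complex.I * b)⁻¹‖ ^ 2) ^ 2 := by
    simp only [corrB, norm_mul, norm_neg, norm_pow, Complex.norm_ofNat]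
    ring
  rw [e]
  set Na := z ^ 2 + ‖a‖ ^ 2 with hNa
  set Nb := z ^ 2 + ‖b‖ ^ 2 with hNb
  have pa : 0 < Na := by positivity
  have pb : 0 < Nb := by positivity
  have h3 : Na ≤ C * Nb := by
    have := h.a_le_b
    rw [hNa, hNb]
    nlinarith [mul_nonneg (sub_nonneg.2 hC) (sq_nonneg z)]
  calc _ ≤ 64 * ‖b‖ ^ 6 * (2 * (C * Nb)) * (28 * Nb⁻¹) ^ 2 := by
        gcongr
        exact h2.trans (by linarith)
    _ = _ := by field_simp; ring

theorem corrA_div_symProd (h : RootPair C a b) (z : ℝ) : corrA a b z / symProd a b z =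
    -(16 * Complex.I * a ^ 4) * ((z - Complex.I * a)⁻¹ * ((z - -(Complex.I * a))⁻¹) ^ (3 + 1)) := by
  have h1 := zfreq_sub_ne_zero h.re_a z
  have h2 := zfreq_add_ne_zero h.re_a z
  have h3 := zfreq_sub_ne_zero h.re_b z
  have h4 := zfreq_add_ne_zero h.re_b z
  have e : (z : ℂ) ^ 2 + b ^ 2 = (z - Complex.I * b) * (z + Complex.I * b) := by
    linear_combination (b ^ 2) * Complex.I_sq
  rw [corrA, symProd, e, sub_neg_eq_add]
  generalize (z : ℂ) - Complex.I * a = x1 at *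
  generalize (z : ℂ) + Complex.I * a = x2 at *
  generalize (z : ℂ) - Complex.I * b = x3 at *
  generalize (z : ℂ) + Complex.I * b = x4 at *
  rw [show 3 + 1 = 4 from rfl]
  field_simp

theorem sub_mul_corrA_div_symProd (h : RootPair C a b) (z : ℝ) :
    (z - Complex.I * a) * (corrA a b z / symProd a b z) =
    -(16 * Complex.I * a ^ 4) * ((z - -(Complex.I * a))⁻¹) ^ (2 + 2) := by
  have h1 := zfreq_sub_ne_zero h.re_a z
  rw [h.corrA_div_symProd, mul_left_comm, mul_inv_cancel_left₀ h1]

theorem corrB_div_symProd (h : RootPair C a b) (z : ℝ) : corrB a b z / symProd a b z =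
    -(8 * b ^ 3) * ((z - Complex.I * a)⁻¹ * ((z - Complex.I * b)⁻¹ *
      ((z + Complex.I * b)⁻¹) ^ 3)) := by
  have h1 := zfreq_sub_ne_zero h.re_a z
  have h2 := zfreq_add_ne_zero h.re_a z
  have h3 := zfreq_sub_ne_zero h.re_b z
  have h4 := zfreq_add_ne_zero h.re_b z
  rw [corrB, symProd]
  generalize (z : ℂ) - Complex.I * a = x1 at *
  generalize (z : ℂ) + Complex.I * a = x2 at *
  generalize (z : ℂ) - Complex.I * b = x3 at *
  generalize (z : ℂ) + Complex.I * b = x4 at *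
  field_simp

theorem sub_mul_corrB_div_symProd (h : RootPair C a b) (z : ℝ) :
    (z - Complex.I * a) * (corrB a b z / symProd a b z) =
    -(8 * b ^ 3) * ((z - Complex.I * b)⁻¹ * ((z - -(Complex.I * b))⁻¹) ^ (2 + 1)) := by
  have h1 := zfreq_sub_ne_zero h.re_a z
  rw [h.corrB_div_symProd, mul_left_comm, mul_inv_cancel_left₀ h1, sub_neg_eq_add]

theorem integral_corrA (h : RootPair C a b) : Integrable (fun ζ : ℝ => corrA a b (2 * Real.pi * ζ) /
      symProd a b (2 * Real.pi * ζ)) ∧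
    ∫ ζ : ℝ, corrA a b (2 * Real.pi * ζ) / symProd a b (2 * Real.pi * ζ) = 1 := by
  have ha : a ≠ 0 := norm_pos_iff.1 h.norm_a_pos
  have i1 : 0 < (Complex.I * a).im := by simpa using h.re_a
  have i2 : (-(Complex.I * a)).im < 0 := by simpa using h.re_a
  have hpi : (Real.pi : ℂ) ≠ 0 := by exact_mod_cast Real.pi_ne_zero
  simp_rw [h.corrA_div_symProd]
  constructor
  · exact ((integrable_inv_sub_mul_pow i1.ne' i2.ne 3).comp_mul_left'
      (by positivity : 2 * Real.pi ≠ 0)).const_mul _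
  · rw [integral_const_mul, integral_comp_two_pi (fun z : ℝ => ((z : ℂ) - Complex.I * a)⁻¹ *
      (((z : ℂ) - -(Complex.I * a))⁻¹) ^ (3 + 1)), integral_inv_sub_mul_pow i1 i2]
    have : (Complex.I * a - -(Complex.I * a)) ^ (3 + 1) = 16 * a ^ 4 := by
      rw [show Complex.I * a - -(Complex.I * a) = 2 * Complex.I * a by ring, mul_pow, mul_pow,
        Complex.I_pow_four]
      norm_num
    rw [this]
    have hI := Complex.I_ne_zero
    field_simp
    rw [show Complex.I ^ 2 = -1 from Complex.I_sq]
    norm_num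

theorem integral_sub_mul_corrA (h : RootPair C a b) :
    Integrable (fun ζ : ℝ => ((2 * Real.pi * ζ : ℝ) - Complex.I * a) *
      (corrA a b (2 * Real.pi * ζ) / symProd a b (2 * Real.pi * ζ))) ∧
    ∫ ζ : ℝ, ((2 * Real.pi * ζ : ℝ) - Complex.I * a) *
      (corrA a b (2 * Real.pi * ζ) / symProd a b (2 * Real.pi * ζ)) = 0 := by
  have i2 : (-(Complex.I * a)).im < 0 := by simpa using h.re_a
  simp_rw [h.sub_mul_corrA_div_symProd]
  constructor
  · have := ((integrable_inv_sub_mul_pow i2.ne i2.ne 2).comp_mul_left'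
      (by positivity : 2 * Real.pi ≠ 0)).const_mul (-(16 * Complex.I * a ^ 4))
    refine this.congr (Eventually.of_forall fun ζ => ?_)
    ring
  · rw [integral_const_mul, integral_comp_two_pi (fun z : ℝ =>
      (((z : ℂ) - -(Complex.I * a))⁻¹) ^ (2 + 2)), integral_inv_sub_pow i2.ne, mul_zero, mul_zero]

theorem integral_sub_mul_corrB (h : RootPair C a b) :
    Integrable (fun ζ : ℝ => ((2 * Real.pi * ζ : ℝ) - Complex.I * a) *
      (corrB a b (2 * Real.pi * ζ) / symProd a b (2 * Real.pi * ζ))) ∧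
    ∫ ζ : ℝ, ((2 * Real.pi * ζ : ℝ) - Complex.I * a) *
      (corrB a b (2 * Real.pi * ζ) / symProd a b (2 * Real.pi * ζ)) = 1 := by
  have hb : b ≠ 0 := norm_pos_iff.1 h.norm_b_pos
  have i1 : 0 < (Complex.I * b).im := by simpa using h.re_b
  have i2 : (-(Complex.I * b)).im < 0 := by simpa using h.re_b
  have hpi : (Real.pi : ℂ) ≠ 0 := by exact_mod_cast Real.pi_ne_zero
  simp_rw [h.sub_mul_corrB_div_symProd]
  constructor
  · exact ((integrable_inv_sub_mul_pow i1.ne' i2.ne 2).comp_mul_left'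
      (by positivity : 2 * Real.pi ≠ 0)).const_mul _
  · rw [integral_const_mul, integral_comp_two_pi (fun z : ℝ => ((z : ℂ) - Complex.I * b)⁻¹ *
      (((z : ℂ) - -(Complex.I * b))⁻¹) ^ (2 + 1)), integral_inv_sub_mul_pow i1 i2]
    have : (Complex.I * b - -(Complex.I * b)) ^ (2 + 1) = -(8 * Complex.I * b ^ 3) := by
      rw [show Complex.I * b - -(Complex.I * b) = 2 * Complex.I * b by ring, mul_pow, mul_pow,
        Complex.I_pow_three]
      ring
    rw [this]
    have hI := Complex.I_ne_zero
    field_simp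

theorem norm_corrB_div_le (h : RootPair C a b) (z : ℝ) : ‖corrB a b z / symProd a b z‖ ≤
    8 * 6 * 28 ^ 2 / ‖a‖ * (‖b‖ / (z ^ 2 + ‖b‖ ^ 2)) := by
  have ha := h.norm_a_pos
  have hb := h.norm_b_pos
  have h1 := norm_inv_sub_sq_le h.re_a h.im_a z
  have h2 := norm_inv_sub_sq_le h.re_b h.im_b z
  have h3 := norm_inv_add_sq_le h.re_b h.im_b z
  rw [h.corrB_div_symProd]
  simp only [norm_mul, norm_neg, norm_pow, Complex.norm_ofNat]
  generalize ‖((z : ℂ) - Complex.I * a)⁻¹‖ = x1 at *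
  have x2n := norm_nonneg ((z : ℂ) - Complex.I * b)⁻¹
  have x3n := norm_nonneg ((z : ℂ) + Complex.I * b)⁻¹
  generalize ‖((z : ℂ) - Complex.I * b)⁻¹‖ = x2 at *
  generalize ‖((z : ℂ) + Complex.I * b)⁻¹‖ = x3 at *
  set Na := z ^ 2 + ‖a‖ ^ 2 with hNa
  set Nb := z ^ 2 + ‖b‖ ^ 2 with hNb
  have pa : 0 < Na := by positivity
  have pb : 0 < Nb := by positivity
  have e1 : x1 ≤ 6 / ‖a‖ := by
    refine le_of_sq_le_sq ?_ (by positivity)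
    refine h1.trans ?_
    rw [div_pow, ← div_eq_mul_inv, div_le_div_iff₀ pa (by positivity), hNa]
    nlinarith [sq_nonneg z, sq_nonneg ‖a‖]
  have e2 : x2 * x3 ≤ 28 * Nb⁻¹ := by nlinarith [sq_nonneg (x2 - x3)]
  have e3 : x3 ^ 2 ≤ 28 * (‖b‖ ^ 2)⁻¹ := by
    refine h3.trans ?_
    gcongr
    rw [hNb]; nlinarith [sq_nonneg z]
  calc 8 * ‖b‖ ^ 3 * (x1 * (x2 * x3 ^ 3))
      = 8 * ‖b‖ ^ 3 * (x1 * ((x2 * x3) * x3 ^ 2)) := by ring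
    _ ≤ 8 * ‖b‖ ^ 3 * (6 / ‖a‖ * ((28 * Nb⁻¹) * (28 * (‖b‖ ^ 2)⁻¹))) := by gcongr
    _ = _ := by field_simp

theorem continuous_corrB_div (h : RootPair C a b) :
    Continuous fun z : ℝ => corrB a b z / symProd a b z := by
  simp_rw [h.corrB_div_symProd]
  refine continuous_const.mul ((Continuous.inv₀ (by fun_prop) (zfreq_sub_ne_zero h.re_a)).mul
    ((Continuous.inv₀ (by fun_prop) (zfreq_sub_ne_zero h.re_b)).mul
      ((Continuous.inv₀ (by fun_prop) (zfreq_add_ne_zero h.re_b)).pow 3)))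

theorem integrable_corrB_div (h : RootPair C a b) : Integrable fun ζ : ℝ =>
    corrB a b (2 * Real.pi * ζ) / symProd a b (2 * Real.pi * ζ) :=
  ((integral_div_add_sq h.norm_b_pos).1.const_mul (8 * 6 * 28 ^ 2 / ‖a‖)).mono'
    (h.continuous_corrB_div.comp (by fun_prop : Continuous fun ζ : ℝ =>
      2 * Real.pi * ζ)).aestronglyMeasurable
    (Eventually.of_forall fun _ => h.norm_corrB_div_le _)

theorem norm_integral_corrB_div_le (h : RootPair C a b) :
    ‖∫ ζ : ℝ, corrB a b (2 * Real.pi * ζ) / symProd a b (2 * Real.pi * ζ)‖ ≤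
      8 * 6 * 28 ^ 2 / ‖a‖ := by
  obtain ⟨h1, h2⟩ := integral_div_add_sq h.norm_b_pos
  refine (norm_integral_le_of_norm_le (h1.const_mul (8 * 6 * 28 ^ 2 / ‖a‖))
    (Eventually.of_forall fun _ => h.norm_corrB_div_le _)).trans ?_
  rw [integral_const_mul, h2]
  have := h.norm_a_pos
  have : 0 ≤ 8 * 6 * 28 ^ 2 / ‖a‖ := by positivity
  linarith

/-- The corrector `corrA` is a combination of powers of `1 / (z + ia)`, hence anticausal. -/
theorem integral_corrA_mul_fourierInv (h : RootPair C a b) {ψ : ℝ → ℂ} (hψ : IsHalfLineTest ψ) :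
    Integrable (fun ζ : ℝ => corrA a b (2 * Real.pi * ζ) * 𝓕⁻ ψ ζ) ∧
      ∫ ζ : ℝ, corrA a b (2 * Real.pi * ζ) * 𝓕⁻ ψ ζ = 0 := by
  have i2 : (-(Complex.I * a)).im < 0 := by simpa using h.re_a
  have hj := fun j => integral_inv_pow_mul_fourierInv i2 j hψ
  have e : ∀ ζ : ℝ, corrA a b (2 * Real.pi * ζ) * 𝓕⁻ ψ ζ = -(16 * Complex.I * a ^ 4) *
      ((𝓕⁻ ψ ζ * ((2 * Real.pi * ζ - -(Complex.I * a))⁻¹) ^ 1 +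
        (-(2 * Complex.I * a)) * (𝓕⁻ ψ ζ * ((2 * Real.pi * ζ - -(Complex.I * a))⁻¹) ^ 2)) +
        (b ^ 2 - a ^ 2) * (𝓕⁻ ψ ζ * ((2 * Real.pi * ζ - -(Complex.I * a))⁻¹) ^ 3)) := by
    intro ζ
    have h2 := zfreq_add_ne_zero h.re_a (2 * Real.pi * ζ)
    rw [corrA]
    push_cast at h2 ⊢
    rw [sub_neg_eq_add]
    field_simp
    linear_combination (-(a ^ 6) * 𝓕⁻ ψ ζ) * Complex.I_sq
  simp_rw [e]
  have k1 : Integrable fun ζ : ℝ => 𝓕⁻ ψ ζ * ((2 * Real.pi * ζ - -(Complex.I * a))⁻¹) ^ 1 +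
      (-(2 * Complex.I * a)) * (𝓕⁻ ψ ζ * ((2 * Real.pi * ζ - -(Complex.I * a))⁻¹) ^ 2) :=
    (hj 1).1.add ((hj 2).1.const_mul (-(2 * Complex.I * a)))
  have k2 := (hj 3).1.const_mul (b ^ 2 - a ^ 2)
  refine ⟨(k1.add k2).const_mul _, ?_⟩
  rw [integral_const_mul, integral_add k1 k2, integral_add (hj 1).1 ((hj 2).1.const_mul _),
    integral_const_mul, integral_const_mul, (hj 1).2, (hj 2).2, (hj 3).2]
  simp

/-- The corrector `corrB` is a combination of powers of `1 / (z + ib)`, hence anticausal. -/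
theorem integral_corrB_mul_fourierInv (h : RootPair C a b) {ψ : ℝ → ℂ} (hψ : IsHalfLineTest ψ) :
    Integrable (fun ζ : ℝ => corrB a b (2 * Real.pi * ζ) * 𝓕⁻ ψ ζ) ∧
      ∫ ζ : ℝ, corrB a b (2 * Real.pi * ζ) * 𝓕⁻ ψ ζ = 0 := by
  have i2 : (-(Complex.I * b)).im < 0 := by simpa using h.re_b
  have hj := fun j => integral_inv_pow_mul_fourierInv i2 j hψ
  have e : ∀ ζ : ℝ, corrB a b (2 * Real.pi * ζ) * 𝓕⁻ ψ ζ = -(8 * b ^ 3) *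
      (𝓕⁻ ψ ζ * ((2 * Real.pi * ζ - -(Complex.I * b))⁻¹) ^ 1 +
        (Complex.I * (a - b)) * (𝓕⁻ ψ ζ * ((2 * Real.pi * ζ - -(Complex.I * b))⁻¹) ^ 2)) := by
    intro ζ
    have h2 := zfreq_add_ne_zero h.re_b (2 * Real.pi * ζ)
    rw [corrB]
    push_cast at h2 ⊢
    rw [sub_neg_eq_add]
    field_simp
    ring
  simp_rw [e]
  have k2 := (hj 2).1.const_mul (Complex.I * (a - b))
  refine ⟨((hj 1).1.add k2).const_mul _, ?_⟩
  rw [integral_const_mul, integral_add (hj 1).1 k2, integral_const_mul, (hj 1).2, (hj 2).2]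
  simp

end RootPair

/-! ### Sufficiency of the trace condition -/

namespace RootPair

variable {C : ℝ} {a b : ℂ}

theorem continuous_inv_symProd (h : RootPair C a b) :
    Continuous fun ζ : ℝ => (symProd a b (2 * Real.pi * ζ))⁻¹ := by
  refine Continuous.inv₀ ?_ fun ζ => h.symProd_ne_zero _
  unfold symProd
  fun_prop

theorem memLp_inv_symProd (h : RootPair C a b) :
    MemLp (fun ζ : ℝ => (symProd a b (2 * Real.pi * ζ))⁻¹) 2 := by
  have ha := h.norm_a_pos
  have hb := h.norm_b_pos
  refine (memLp_of_le_div (M := 28 ^ 4 / (‖b‖ ^ 4 * ‖a‖ ^ 3))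
    h.continuous_inv_symProd.aestronglyMeasurable ha fun ζ => ?_).1
  have := h.sq_norm_inv_symProd_le (2 * Real.pi * ζ)
  rw [div_mul_eq_mul_div, le_div_iff₀ (by positivity), mul_comm]
  exact this

theorem memLp_sub_div_symProd (h : RootPair C a b) :
    MemLp (fun ζ : ℝ => ((2 * Real.pi * ζ : ℝ) - Complex.I * a) *
      (symProd a b (2 * Real.pi * ζ))⁻¹) 2 := by
  have ha := h.norm_a_pos
  have hb := h.norm_b_pos
  refine (memLp_of_le_div (M := 28 ^ 3 / (‖a‖ ^ 2 * ‖b‖ ^ 3)) ?_ hb fun ζ => ?_).1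
  · exact ((by fun_prop : Continuous fun ζ : ℝ => ((2 * Real.pi * ζ : ℝ) - Complex.I * a : ℂ)).mul
      h.continuous_inv_symProd).aestronglyMeasurable
  · rw [← div_eq_mul_inv]
    refine (h.sq_norm_sub_div_symProd_le _).trans ?_
    set z := 2 * Real.pi * ζ
    set Na := z ^ 2 + ‖a‖ ^ 2 with hNa
    set Nb := z ^ 2 + ‖b‖ ^ 2 with hNb
    have pa : 0 < Na := by positivity
    have pb : 0 < Nb := by positivity
    have t1 : Na⁻¹ ≤ (‖a‖ ^ 2)⁻¹ := inv_anti₀ (by positivity) (by rw [hNa]; nlinarith [sq_nonneg z])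
    have t2 : Nb⁻¹ ≤ (‖b‖ ^ 2)⁻¹ := inv_anti₀ (by positivity) (by rw [hNb]; nlinarith [sq_nonneg z])
    calc 28 ^ 3 * (Na⁻¹ * (Nb⁻¹ * Nb⁻¹))
        ≤ 28 ^ 3 * ((‖a‖ ^ 2)⁻¹ * ((‖b‖ ^ 2)⁻¹ * Nb⁻¹)) := by gcongr
      _ = _ := by field_simp

theorem memLp_zfreq_mul_sub_div_symProd (h : RootPair C a b) :
    MemLp (fun ζ : ℝ => ((2 * Real.pi * ζ : ℝ) : ℂ) * (((2 * Real.pi * ζ : ℝ) - Complex.I * a) *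
      (symProd a b (2 * Real.pi * ζ))⁻¹)) 2 := by
  have hb := h.norm_b_pos
  refine (memLp_of_le_div (M := 28 ^ 3 / ‖b‖ ^ 3) ?_ hb fun ζ => ?_).1
  · exact ((by fun_prop : Continuous fun ζ : ℝ => ((2 * Real.pi * ζ : ℝ) : ℂ)).mul
      ((by fun_prop : Continuous fun ζ : ℝ => ((2 * Real.pi * ζ : ℝ) - Complex.I * a : ℂ)).mul
      h.continuous_inv_symProd)).aestronglyMeasurable
  · have := h.sq_norm_zfreq_mul_le (2 * Real.pi * ζ)
    rw [div_mul_eq_mul_div, le_div_iff₀ (by positivity), mul_comm, ← div_eq_mul_inv]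
    exact this

end RootPair

section Kernels

variable (T : ℝ) {d : ℕ}

/-- `1 / D` as a kernel. -/
def kerD (k : ℤ) (η : Space (d + 1)) : ℂ :=
  (symProd (freqA T k (tang η)) (freqB T k (tang η)) (zfreq η))⁻¹

/-- `(z - ia) / D` as a kernel. -/
def kerS (k : ℤ) (η : Space (d + 1)) : ℂ :=
  (zfreq η - Complex.I * freqA T k (tang η)) * kerD T k η

@[fun_prop] theorem measurable_kerD (k : ℤ) : Measurable (kerD T k : Space (d + 1) → ℂ) := by
  unfold kerD symProd
  fun_prop

@[fun_prop] theorem measurable_kerS (k : ℤ) : Measurable (kerS T k : Space (d + 1) → ℂ) := by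
  unfold kerS
  fun_prop

theorem aestronglyMeasurable_integral_glue {f : Space (d + 1) → ℂ}
    (hf : AEStronglyMeasurable f) :
    AEStronglyMeasurable (fun ξ : Space d => ∫ ζ : ℝ, f (glue ξ ζ)) :=
  (aestronglyMeasurable_glue hf).integral_prod_right'

/-- The integral of `corrB / D` over the normal frequency. -/
def corrMean (k : ℤ) (ξ : Space d) : ℂ :=
  ∫ ζ : ℝ, corrB (freqA T k ξ) (freqB T k ξ) (2 * Real.pi * ζ) /
    symProd (freqA T k ξ) (freqB T k ξ) (2 * Real.pi * ζ)

theorem aestronglyMeasurable_corrMean (k : ℤ) :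
    AEStronglyMeasurable (corrMean T k : Space d → ℂ) := by
  have h := aestronglyMeasurable_integral_glue (d := d) (f := fun η =>
    corrB (freqA T k (tang η)) (freqB T k (tang η)) (zfreq η) * kerD T k η)
    (Measurable.aestronglyMeasurable (by unfold corrB; fun_prop))
  refine h.congr (Eventually.of_forall fun ξ => ?_)
  simp only [corrMean, kerD, tang_glue, zfreq_glue, ← div_eq_mul_inv]

end Kernels

section Sufficiency

variable {T : ℝ} [hT : Fact (0 < T)] {d : ℕ}

variable (T d) in
theorem exists_rootPair : ∃ C : ℝ, ∀ k : ℤ, k ≠ 0 → ∀ ξ : Space d,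
    RootPair C (freqA T k ξ) (freqB T k ξ) := by
  obtain ⟨C, hC1, hC⟩ := exists_freq_bounds T d
  exact ⟨C, fun k hk ξ => ⟨hC1, (freqA_spec T hk ξ).1, (freqA_spec T hk ξ).2,
    (freqB_spec T hk ξ).1, (freqB_spec T hk ξ).2, (hC k hk ξ).2.2.2.1⟩⟩

theorem symD_eq_symProd {k : ℤ} (hk : k ≠ 0) (η : Space (d + 1)) :
    symD T k η = symProd (freqA T k (tang η)) (freqB T k (tang η)) (zfreq η) :=
  symD_eq_prod hk η

theorem memLp_kerD {k : ℤ} (hk : k ≠ 0) (ξ : Space d) :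
    MemLp (fun ζ : ℝ => kerD T k (glue ξ ζ)) 2 := by
  obtain ⟨C, hC⟩ := exists_rootPair T d
  simpa only [kerD, tang_glue, zfreq_glue] using (hC k hk ξ).memLp_inv_symProd

theorem memLp_kerS {k : ℤ} (hk : k ≠ 0) (ξ : Space d) :
    MemLp (fun ζ : ℝ => kerS T k (glue ξ ζ)) 2 := by
  obtain ⟨C, hC⟩ := exists_rootPair T d
  simpa only [kerS, kerD, tang_glue, zfreq_glue] using (hC k hk ξ).memLp_sub_div_symProd

theorem memLp_zfreq_mul_kerS {k : ℤ} (hk : k ≠ 0) (ξ : Space d) :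
    MemLp (fun ζ : ℝ => (zfreq (glue ξ ζ) : ℂ) * kerS T k (glue ξ ζ)) 2 := by
  obtain ⟨C, hC⟩ := exists_rootPair T d
  simpa only [kerS, kerD, tang_glue, zfreq_glue] using
    (hC k hk ξ).memLp_zfreq_mul_sub_div_symProd

/-- The coefficient of `corrB`, chosen so that `∫ (z - ia) Û = 0` for the corrected `Û`; the
corrector `corrA` does not contribute to this moment. -/
def coefB (F : L2 T (d + 1)) (k : ℤ) (ξ : Space d) : ℂ :=
  -∫ ζ : ℝ, kerS T k (glue ξ ζ) * fourierG F k (glue ξ ζ)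

/-- The coefficient of `corrA`, chosen so that `∫ Û = 0` for the corrected `Û`. -/
def coefA (F : L2 T (d + 1)) (k : ℤ) (ξ : Space d) : ℂ :=
  -(∫ ζ : ℝ, kerD T k (glue ξ ζ) * fourierG F k (glue ξ ζ)) - corrMean T k ξ * coefB F k ξ

theorem aestronglyMeasurable_coefB (F : L2 T (d + 1)) (k : ℤ) :
    AEStronglyMeasurable (coefB F k) :=
  (aestronglyMeasurable_integral_glue (f := fun η => kerS T k η * fourierG F k η)
    ((measurable_kerS T k).aestronglyMeasurable.mul (Lp.memLp _).1)).neg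

theorem aestronglyMeasurable_coefA (F : L2 T (d + 1)) (k : ℤ) :
    AEStronglyMeasurable (coefA F k) :=
  (aestronglyMeasurable_integral_glue (f := fun η => kerD T k η * fourierG F k η)
    ((measurable_kerD T k).aestronglyMeasurable.mul (Lp.memLp _).1)).neg.sub
    ((aestronglyMeasurable_corrMean T k).mul (aestronglyMeasurable_coefB F k))

theorem coef_zero {F : L2 T (d + 1)} (hF : F ∈ L2perp T (d + 1)) :
    ∀ᵐ ξ : Space d, coefB F 0 ξ = 0 ∧ coefA F 0 ξ = 0 := by
  filter_upwards [ae_ae_glue (fourierG_ae_zero hF)] with ξ h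
  have h1 : ∀ r : Space (d + 1) → ℂ, ∫ ζ : ℝ, r (glue ξ ζ) * fourierG F 0 (glue ξ ζ) = 0 := by
    intro r
    refine integral_eq_zero_of_ae ?_
    filter_upwards [h] with ζ hζ
    simp [hζ]
  simp [coefA, coefB, h1]

/-- The size `|b|^{3/2}` of the roots is controlled by the weights of the trace space. -/
theorem exists_norm_freqB_le : ∃ C : ℝ, ∀ k : ℤ, k ≠ 0 → ∀ ξ : Space d,
    ‖freqB T k ξ‖ * Real.sqrt ‖freqB T k ξ‖ ≤
      C * (weight (3 / 4) 0 (tfreq T k) (xfreq ξ) + weight 0 (3 / 2) (tfreq T k) (xfreq ξ)) := by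
  obtain ⟨C, hC1, hC⟩ := exists_freq_bounds T d
  refine ⟨(2 * C) ^ (3 / 4 : ℝ), fun k hk ξ => ?_⟩
  have h1 := (hC k hk ξ).2.2.1
  set β := ‖freqB T k ξ‖
  have hβ : 0 ≤ β := norm_nonneg _
  have e : β * Real.sqrt β = (β ^ 2) ^ (3 / 4 : ℝ) := by
    rw [Real.sqrt_eq_rpow, ← Real.rpow_natCast, ← Real.rpow_mul hβ]
    rcases hβ.eq_or_lt with h0 | h0
    · rw [← h0, Real.zero_rpow (by norm_num), zero_mul]
      rw [Real.zero_rpow (by norm_num)]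
    · conv_lhs => rw [← Real.rpow_one β]
      rw [← Real.rpow_mul hβ, ← Real.rpow_add h0]
      norm_num
  rw [e, weight, weight, zero_div, Real.rpow_zero, Real.rpow_zero, mul_one, one_mul]
  set τ := tfreq T k
  set X := ‖xfreq ξ‖ ^ 2 with hX
  have hX0 : 0 ≤ X := by positivity
  have hw1 : 0 ≤ (1 + τ ^ 2) ^ ((3 / 4 : ℝ) / 2) := by positivity
  have hw2 : 0 ≤ (1 + X) ^ ((3 / 2 : ℝ) / 2) := by positivity
  have hC2 : 0 ≤ (2 * C) ^ (3 / 4 : ℝ) := by positivity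
  rcases le_total |τ| X with h | h
  · have h2 : β ^ 2 ≤ 2 * C * (1 + X) := by nlinarith [abs_nonneg τ]
    have h3 := Real.rpow_le_rpow (by positivity) h2 (by norm_num : (0 : ℝ) ≤ 3 / 4)
    rw [Real.mul_rpow (by positivity) (by positivity)] at h3
    refine h3.trans (mul_le_mul_of_nonneg_left ?_ hC2)
    norm_num at hw1 ⊢
    exact hw1
  · have hs := abs_le_sqrt_one_add_sq τ
    have hs0 : 0 ≤ (1 + τ ^ 2) ^ (1 / 2 : ℝ) := by positivity
    have h2 : β ^ 2 ≤ 2 * C * (1 + τ ^ 2) ^ (1 / 2 : ℝ) := by nlinarith [abs_nonneg τ]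
    have h3 := Real.rpow_le_rpow (by positivity) h2 (by norm_num : (0 : ℝ) ≤ 3 / 4)
    rw [Real.mul_rpow (by positivity) (by positivity), ← Real.rpow_mul (by positivity)] at h3
    refine h3.trans (mul_le_mul_of_nonneg_left ?_ hC2)
    norm_num at hw2 ⊢
    exact hw2

theorem sqSummable_norm_freqB_mul {G : L2 T d} (hG : G ∈ traceSpace T d) :
    SqSummable volume fun k (ξ : Space d) =>
      ((‖freqB T k ξ‖ * Real.sqrt ‖freqB T k ξ‖ : ℝ) : ℂ) * fourierG G k ξ := by
  obtain ⟨C, hC⟩ := exists_norm_freqB_le (T := T) (d := d)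
  obtain ⟨hperp, h1⟩ := mem_Hperp_iff.1 hG.1
  have h2 := (mem_Hperp_iff.1 hG.2).2
  refine (h1.add h2).mono (fun k => ?_) C fun k => ?_
  · refine AEStronglyMeasurable.mul (Measurable.aestronglyMeasurable ?_) (Lp.memLp _).1
    have := (measurable_freqB (d := d) T k).norm
    have := this.sqrt
    fun_prop
  · by_cases hk : k = 0
    · subst hk
      filter_upwards [fourierG_ae_zero hperp] with ξ hξ
      simp [hξ]
    · refine Eventually.of_forall fun ξ => ?_
      rw [← add_mul, norm_mul, norm_mul, ← mul_assoc, ← Complex.ofReal_add, Complex.norm_real,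
        Complex.norm_real, Real.norm_of_nonneg (by positivity), Real.norm_of_nonneg (by
          unfold weight; positivity)]
      exact mul_le_mul_of_nonneg_right (hC k hk ξ) (norm_nonneg _)

/-- The trace of `op[D⁻]⁻¹₊ f` in terms of the coefficient of `corrB`, from
`1 / D⁻ = (z - ib) (z - ia) / D`. -/
theorem trace_eq_coefB {F V : L2 T (d + 1)} (hV : IsOp invDminus F V) {k : ℤ} (hk : k ≠ 0) :
    ∀ᵐ ξ : Space d, ∫ ζ : ℝ, fourierG V k (glue ξ ζ) =
      (∫ ζ : ℝ, ((zfreq (glue ξ ζ) : ℂ) * kerS T k (glue ξ ζ)) * fourierG F k (glue ξ ζ)) +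
        Complex.I * freqB T k ξ * coefB F k ξ := by
  obtain ⟨C, hC⟩ := exists_rootPair T d
  filter_upwards [ae_ae_glue (hV k), ae_integrable_kernel_mul (Lp.memLp (fourierG F k))
    (r := kerS T k) (memLp_kerS hk), ae_integrable_kernel_mul (Lp.memLp (fourierG F k))
    (r := fun η => (zfreq η : ℂ) * kerS T k η) (memLp_zfreq_mul_kerS hk)] with ξ h1 i1 i2
  have e : ∀ᵐ ζ : ℝ, fourierG V k (glue ξ ζ) =
      ((zfreq (glue ξ ζ) : ℂ) * kerS T k (glue ξ ζ)) * fourierG F k (glue ξ ζ) -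
        (Complex.I * freqB T k ξ) * (kerS T k (glue ξ ζ) * fourierG F k (glue ξ ζ)) := by
    filter_upwards [h1] with ζ hζ
    rw [hζ, invDminus_eq hk, kerS, kerD, symProd]
    simp only [tang_glue, zfreq_glue]
    have h := hC k hk ξ
    have h1 := zfreq_sub_ne_zero h.re_a (2 * Real.pi * ζ)
    have h2 := zfreq_add_ne_zero h.re_a (2 * Real.pi * ζ)
    have h3 := zfreq_sub_ne_zero h.re_b (2 * Real.pi * ζ)
    have h4 := zfreq_add_ne_zero h.re_b (2 * Real.pi * ζ)
    have e5 : Complex.I * freqB T k ξ = ((2 * Real.pi * ζ : ℝ) : ℂ) -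
      (((2 * Real.pi * ζ : ℝ) : ℂ) - Complex.I * freqB T k ξ) := by ring
    conv_rhs => rw [show ∀ x y z : ℂ, x * y * z = x * (y * z) from fun x y z => mul_assoc x y z,
      ← sub_mul]
    generalize ((2 * Real.pi * ζ : ℝ) : ℂ) - Complex.I * freqA T k ξ = x1 at *
    generalize ((2 * Real.pi * ζ : ℝ) : ℂ) + Complex.I * freqA T k ξ = x2 at *
    generalize ((2 * Real.pi * ζ : ℝ) : ℂ) + Complex.I * freqB T k ξ = x4 at *
    generalize ((2 * Real.pi * ζ : ℝ) : ℂ) - Complex.I * freqB T k ξ = x3 at *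
    field_simp
  rw [integral_congr_ae e, integral_sub i2 (i1.const_mul _), integral_const_mul, coefB]
  ring

/-- The estimate that needs the regularity of the trace: `F ∈ L²` alone gives only `|b|² |a|^{1/2}
coefB ∈ L²`, which is weaker where `|b|` exceeds `|a|`. However, `ib coefB` differs from the trace
of `op[D⁻]⁻¹₊ f` by a term that stays in `L²` after multiplication with `|b|^{3/2}`. -/
theorem sqSummable_coefB {F V : L2 T (d + 1)} {G : L2 T d} (hF : F ∈ L2perp T (d + 1))
    (hV : IsOp invDminus F V)
    (hG : ∀ k, fourierG G k =ᵐ[volume] fun ξ => ∫ ζ : ℝ, fourierG V k (glue ξ ζ))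
    (hGt : G ∈ traceSpace T d) :
    SqSummable volume fun k (ξ : Space d) =>
      ((‖freqB T k ξ‖ ^ 2 * Real.sqrt ‖freqB T k ξ‖ : ℝ) : ℂ) * coefB F k ξ := by
  obtain ⟨C, hC⟩ := exists_rootPair T d
  have hm : ∀ k, Measurable fun ξ : Space d => Real.sqrt ‖freqB T k ξ‖ := fun k =>
    (measurable_freqB (d := d) T k).norm.sqrt
  have hglue : ∀ ξ : Space d, Measurable fun ζ : ℝ => glue ξ ζ := fun ξ =>
    (continuous_glue.comp (continuous_const.prodMk continuous_id)).measurable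
  have hrm : ∀ k, Measurable fun η : Space (d + 1) => ((‖freqB T k (tang η)‖ *
      Real.sqrt ‖freqB T k (tang η)‖ : ℝ) : ℂ) * ((zfreq η : ℂ) * kerS T k η) := by
    intro k
    have := (hm k).comp measurable_tang
    simp only [Function.comp_def] at this
    fun_prop
  have h1 := (sqSummable_fourierG F).integral_mul (r := fun k η =>
    ((‖freqB T k (tang η)‖ * Real.sqrt ‖freqB T k (tang η)‖ : ℝ) : ℂ) *
      ((zfreq η : ℂ) * kerS T k η)) (fun k => (hrm k).aestronglyMeasurable) (28 ^ 3) (fun k => by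
      by_cases hk : k = 0
      · left; subst hk; exact fourierG_ae_zero hF
      · right
        intro ξ
        have h := hC k hk ξ
        refine (memLp_of_le_div ((hrm k).comp (hglue ξ)).aestronglyMeasurable h.norm_b_pos
          fun ζ => ?_).2
        have := h.sq_norm_zfreq_mul_le (2 * Real.pi * ζ)
        simp only [Function.comp, tang_glue, zfreq_glue, kerS, kerD]
        rw [← div_eq_mul_inv, norm_mul, mul_pow, Complex.norm_real, Real.norm_eq_abs, sq_abs,
          mul_pow, Real.sq_sqrt (norm_nonneg _), ← pow_succ]
        exact this)
  refine ((sqSummable_norm_freqB_mul hGt).add (h1.const_mul (-1))).mono (fun k => ?_) 1 fun k => ?_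
  · refine AEStronglyMeasurable.mul (Measurable.aestronglyMeasurable ?_)
      (aestronglyMeasurable_coefB F k)
    have := hm k
    fun_prop
  · by_cases hk : k = 0
    · subst hk
      filter_upwards [coef_zero hF] with ξ hξ
      rw [hξ.1]; simp only [mul_zero, norm_zero, one_mul]; positivity
    · filter_upwards [hG k, trace_eq_coefB hV hk] with ξ h2 h3
      rw [one_mul, h2, h3]
      simp only [tang_glue, mul_assoc]
      rw [integral_const_mul]
      rw [show ∀ x y z : ℂ, x * (y + z) + -1 * (x * y) = x * z from fun x y z => by ring]
      apply le_of_eq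
      simp only [norm_mul, Complex.norm_real, Complex.norm_I, norm_norm, norm_pow,
        Complex.ofReal_mul, Complex.ofReal_pow]
      ring

/-- Once `coefB` is controlled, `coefA` is too, because the integral of `corrB / D` is of size `1 /
|a|`. -/
theorem sqSummable_coefA {F V : L2 T (d + 1)} {G : L2 T d} (hF : F ∈ L2perp T (d + 1))
    (hV : IsOp invDminus F V)
    (hG : ∀ k, fourierG G k =ᵐ[volume] fun ξ => ∫ ζ : ℝ, fourierG V k (glue ξ ζ))
    (hGt : G ∈ traceSpace T d) :
    SqSummable volume fun k (ξ : Space d) =>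
      ((‖freqB T k ξ‖ ^ 2 * (‖freqA T k ξ‖ * Real.sqrt ‖freqA T k ξ‖) : ℝ) : ℂ) * coefA F k ξ := by
  obtain ⟨C, hC⟩ := exists_rootPair T d
  have hm : ∀ k, Measurable fun ξ : Space d => Real.sqrt ‖freqA T k ξ‖ := fun k =>
    (measurable_freqA (d := d) T k).norm.sqrt
  have hglue : ∀ ξ : Space d, Measurable fun ζ : ℝ => glue ξ ζ := fun ξ =>
    (continuous_glue.comp (continuous_const.prodMk continuous_id)).measurable
  have hrm : ∀ k, Measurable fun η : Space (d + 1) => ((‖freqB T k (tang η)‖ ^ 2 *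
      (‖freqA T k (tang η)‖ * Real.sqrt ‖freqA T k (tang η)‖) : ℝ) : ℂ) * kerD T k η := by
    intro k
    have := (hm k).comp measurable_tang
    simp only [Function.comp_def] at this
    fun_prop
  have h1 := (sqSummable_fourierG F).integral_mul (r := fun k η =>
    ((‖freqB T k (tang η)‖ ^ 2 * (‖freqA T k (tang η)‖ * Real.sqrt ‖freqA T k (tang η)‖) : ℝ) : ℂ) *
      kerD T k η) (fun k => (hrm k).aestronglyMeasurable) (28 ^ 4) (fun k => by
      by_cases hk : k = 0
      · left; subst hk; exact fourierG_ae_zero hF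
      · right
        intro ξ
        have h := hC k hk ξ
        refine (memLp_of_le_div ((hrm k).comp (hglue ξ)).aestronglyMeasurable h.norm_a_pos
          fun ζ => ?_).2
        have := h.sq_norm_inv_symProd_le (2 * Real.pi * ζ)
        simp only [Function.comp, tang_glue, zfreq_glue, kerD]
        rw [norm_mul, mul_pow, Complex.norm_real, Real.norm_eq_abs, sq_abs, mul_pow, mul_pow,
          Real.sq_sqrt (norm_nonneg _), ← pow_succ, ← pow_mul]
        exact this)
  have h2 : SqSummable volume fun k (ξ : Space d) =>
      ((‖freqB T k ξ‖ ^ 2 * (‖freqA T k ξ‖ * Real.sqrt ‖freqA T k ξ‖) : ℝ) : ℂ) *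
        (corrMean T k ξ * coefB F k ξ) := by
    refine (sqSummable_coefB hF hV hG hGt).mono (fun k => ?_) (8 * 6 * 28 ^ 2 * C) fun k => ?_
    · refine AEStronglyMeasurable.mul (Measurable.aestronglyMeasurable ?_)
        ((aestronglyMeasurable_corrMean T k).mul (aestronglyMeasurable_coefB F k))
      have := hm k
      fun_prop
    · by_cases hk : k = 0
      · subst hk
        filter_upwards [coef_zero hF] with ξ hξ
        rw [hξ.1]; simp
      · refine Eventually.of_forall fun ξ => ?_
        have h := hC k hk ξ
        have ht : ‖corrMean T k ξ‖ ≤ 8 * 6 * 28 ^ 2 / ‖freqA T k ξ‖ :=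
          h.norm_integral_corrB_div_le
        have ha := h.norm_a_pos
        have hb := h.norm_b_pos
        have hC1 := h.one_le
        have hs : Real.sqrt ‖freqA T k ξ‖ ≤ C * Real.sqrt ‖freqB T k ξ‖ := by
          have h3 : ‖freqA T k ξ‖ ≤ C * ‖freqB T k ξ‖ := by
            refine le_of_sq_le_sq ?_ (by positivity)
            have := h.a_le_b
            nlinarith [mul_nonneg (mul_nonneg (by linarith : 0 ≤ C) (sub_nonneg.2 hC1))
              (sq_nonneg ‖freqB T k ξ‖)]
          calc Real.sqrt ‖freqA T k ξ‖ ≤ Real.sqrt (C * ‖freqB T k ξ‖) := Real.sqrt_le_sqrt h3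
            _ = Real.sqrt C * Real.sqrt ‖freqB T k ξ‖ := Real.sqrt_mul (by linarith) _
            _ ≤ C * Real.sqrt ‖freqB T k ξ‖ := by
              gcongr
              rw [Real.sqrt_le_left (by linarith)]
              nlinarith
        rw [norm_mul, norm_mul, norm_mul, Complex.norm_real, Complex.norm_real,
          Real.norm_of_nonneg (by positivity), Real.norm_of_nonneg (by positivity)]
        calc ‖freqB T k ξ‖ ^ 2 * (‖freqA T k ξ‖ * Real.sqrt ‖freqA T k ξ‖) *
              (‖corrMean T k ξ‖ * ‖coefB F k ξ‖)
            ≤ ‖freqB T k ξ‖ ^ 2 * (‖freqA T k ξ‖ * (C * Real.sqrt ‖freqB T k ξ‖)) *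
              (8 * 6 * 28 ^ 2 / ‖freqA T k ξ‖ * ‖coefB F k ξ‖) := by gcongr
          _ = _ := by field_simp
  refine ((h1.const_mul (-1)).add (h2.const_mul (-1))).mono (fun k => ?_) 1 fun k =>
    Eventually.of_forall fun ξ => ?_
  · refine AEStronglyMeasurable.mul (Measurable.aestronglyMeasurable ?_)
      (aestronglyMeasurable_coefA F k)
    have := hm k
    fun_prop
  · rw [one_mul, coefA]
    apply le_of_eq
    simp only [tang_glue, mul_assoc]
    rw [integral_const_mul]
    congr 1
    ring

/-- Multiplication of a function of the tangential frequencies with a kernel that is uniformly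
bounded in `L²` with respect to the normal frequency. -/
theorem SqSummable.mul_tang {c : ℤ → Space d → ℂ} (hc : SqSummable volume c)
    {r : ℤ → Space (d + 1) → ℂ}
    (hcr : ∀ k, AEStronglyMeasurable fun η : Space (d + 1) => r k η * c k (tang η)) (M : ℝ)
    (hle : ∀ k, c k =ᵐ[volume] 0 ∨
      ∀ ξ : Space d, ∫⁻ ζ : ℝ, ‖r k (glue ξ ζ)‖ₑ ^ 2 ≤ ENNReal.ofReal M) :
    SqSummable volume fun k (η : Space (d + 1)) => r k η * c k (tang η) := by
  refine ⟨hcr, (ENNReal.tsum_le_tsum (g := fun k => ENNReal.ofReal M * ∫⁻ ξ, ‖c k ξ‖ₑ ^ 2)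
    fun k => ?_).trans_lt ?_⟩
  · rw [lintegral_glue ((hcr k).enorm.pow_const 2),
      ← lintegral_const_mul' _ _ ENNReal.ofReal_ne_top]
    rcases hle k with h | h
    · refine lintegral_mono_ae ?_
      filter_upwards [h] with ξ hξ
      simp [hξ]
    · refine lintegral_mono fun ξ => ?_
      simp only [tang_glue, enorm_mul, mul_pow]
      rw [lintegral_mul_const' _ _ (by simp)]
      exact mul_le_mul_left (h ξ) _
  · rw [ENNReal.tsum_mul_left]
    exact ENNReal.mul_lt_top ENNReal.ofReal_lt_top hc.2

end Sufficiency

/-! ### Construction of the solution -/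

theorem quasiMeasurePreserving_tang (d : ℕ) :
    Measure.QuasiMeasurePreserving (tang : Space (d + 1) → Space d) :=
  Measure.quasiMeasurePreserving_fst.comp
    (measurePreserving_glue d).symm.quasiMeasurePreserving

/-- The combination of the two correctors that is added to `F̂`. It is anticausal, so that it does
not change the right-hand side on the half cylinder. -/
def corrector {T : ℝ} [Fact (0 < T)] {d : ℕ} (F : L2 T (d + 1)) (k : ℤ) (η : Space (d + 1)) : ℂ :=
  corrA (freqA T k (tang η)) (freqB T k (tang η)) (zfreq η) * coefA F k (tang η) +
    corrB (freqA T k (tang η)) (freqB T k (tang η)) (zfreq η) * coefB F k (tang η)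

section Solution

variable {T : ℝ} [hT : Fact (0 < T)] {d : ℕ}

variable (T d) in
/-- `D` is elliptic with respect to the weights of the solution space, uniformly in `τ ≠ 0`. -/
theorem exists_weight_le_symD : ∃ C : ℝ, ∀ k : ℤ, k ≠ 0 → ∀ η : Space (d + 1),
    1 ≤ C * ‖symD T k η‖ ∧
    weight 0 4 (tfreq T k) (xfreq η) ≤ C * ‖symD T k η‖ ∧
      weight 1 2 (tfreq T k) (xfreq η) ≤ C * ‖symD T k η‖ := by
  have hT0 := hT.out
  set τ₀ := 2 * Real.pi / T with hτ₀
  have hτ : 0 < τ₀ := by positivity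
  refine ⟨2 / τ₀ + 2, fun k hk η => ?_⟩
  have h0 : τ₀ ≤ |tfreq T k| := le_abs_tfreq hk
  have hD := symD_eq k η (T := T)
  rw [weight_zero_four, weight_one_two]
  set τ := tfreq T k
  set r := ‖xfreq η‖ ^ 2 with hr
  have hr0 : 0 ≤ r := by positivity
  have h1 : |τ| * (1 + r) ≤ ‖symD T k η‖ := by
    have : (symD T k η).im = τ * (1 + r) := by
      rw [hD]; simp only [Complex.add_im, Complex.mul_im, Complex.I_re, Complex.I_im,
        Complex.ofReal_re, Complex.ofReal_im, Complex.add_re, Complex.mul_re]; ring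
    rw [← abs_of_nonneg (by positivity : 0 ≤ 1 + r), ← abs_mul, ← this]
    exact Complex.abs_im_le_norm _
  have h2 : r ^ 2 ≤ ‖symD T k η‖ := by
    have : (symD T k η).re = r ^ 2 := by
      rw [hD]; simp only [Complex.add_im, Complex.mul_im, Complex.I_re, Complex.I_im,
        Complex.ofReal_re, Complex.ofReal_im, Complex.add_re, Complex.mul_re]; ring
    rw [← this]
    exact Complex.re_le_norm _
  have h3 : 1 ≤ |τ| / τ₀ := (one_le_div hτ).2 h0
  have h4 : 1 + r ≤ ‖symD T k η‖ / τ₀ := by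
    rw [le_div_iff₀ hτ]
    nlinarith
  have h5 : (1 + τ ^ 2) ^ (1 / 2 : ℝ) ≤ 1 + |τ| := by
    rw [← Real.sqrt_eq_rpow]
    refine Real.sqrt_le_iff.2 ⟨by positivity, ?_⟩
    nlinarith [sq_abs τ, abs_nonneg τ]
  have e : (2 / τ₀ + 2) * ‖symD T k η‖ = 2 * (‖symD T k η‖ / τ₀) + 2 * ‖symD T k η‖ := by ring
  have hn := norm_nonneg (symD T k η)
  rw [e]
  refine ⟨by nlinarith, by nlinarith, ?_⟩
  calc (1 + τ ^ 2) ^ (1 / 2 : ℝ) * (1 + r) ≤ (1 + |τ|) * (1 + r) := by gcongr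
    _ ≤ _ := by nlinarith

theorem corrector_zero {F : L2 T (d + 1)} (hF : F ∈ L2perp T (d + 1)) :
    corrector F 0 =ᵐ[volume] 0 := by
  filter_upwards [(quasiMeasurePreserving_tang d).ae (coef_zero hF)] with η h
  simp [corrector, h.1, h.2]

/-- Multiplication with a kernel `r` such that `|r|² ≤ M w² A / (z² + A²)` maps functions `c` of the
tangential frequencies with `w c ∈ L²` to `L²`. -/
theorem SqSummable.mul_tang_of_sq_norm_le {w : ℤ → Space d → ℝ} {c : ℤ → Space d → ℂ}
    (hwc : SqSummable volume fun k ξ => (w k ξ : ℂ) * c k ξ)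
    (hw : ∀ k, Measurable (w k)) (hw0 : ∀ k, k ≠ 0 → ∀ ξ, 0 < w k ξ)
    (hc : ∀ k, AEStronglyMeasurable (c k)) (hc0 : c 0 =ᵐ[volume] 0)
    {r : ℤ → Space (d + 1) → ℂ} (hr : ∀ k, Measurable (r k)) (A : ℤ → Space d → ℝ) (M : ℝ)
    (hA : ∀ k, k ≠ 0 → ∀ ξ, 0 < A k ξ)
    (hle : ∀ k, k ≠ 0 → ∀ ξ (ζ : ℝ), ‖r k (glue ξ ζ)‖ ^ 2 ≤
      w k ξ ^ 2 * (M * (A k ξ / ((2 * Real.pi * ζ) ^ 2 + A k ξ ^ 2)))) :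
    SqSummable volume fun k (η : Space (d + 1)) => r k η * c k (tang η) := by
  have hct : ∀ k, AEStronglyMeasurable fun η : Space (d + 1) => c k (tang η) := fun k =>
    (hc k).comp_quasiMeasurePreserving (quasiMeasurePreserving_tang d)
  have hwt : ∀ k, Measurable fun η : Space (d + 1) => w k (tang η) := fun k =>
    (hw k).comp measurable_tang
  have hrm : ∀ k, Measurable fun η : Space (d + 1) => r k η / (w k (tang η) : ℂ) := fun k => by
    have := hwt k
    have := hr k
    fun_prop
  have h := hwc.mul_tang (r := fun k η => r k η / (w k (tang η) : ℂ)) (fun k => by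
    refine (hrm k).aestronglyMeasurable.mul (AEStronglyMeasurable.mul ?_ (hct k))
    have := hwt k
    exact Measurable.aestronglyMeasurable (by fun_prop)) M (fun k => by
    by_cases hk : k = 0
    · left
      subst hk
      filter_upwards [hc0] with ξ hξ
      simp [hξ]
    · right
      intro ξ
      refine (memLp_of_le_div ((hrm k).comp (continuous_glue.comp
        (continuous_const.prodMk continuous_id)).measurable).aestronglyMeasurable
        (hA k hk ξ) fun ζ => ?_).2
      have hwp := hw0 k hk ξ
      simp only [Function.comp, tang_glue, id]
      rw [norm_div, div_pow, Complex.norm_real, Real.norm_of_nonneg hwp.le,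
        div_le_iff₀ (by positivity), mul_comm _ (w k ξ ^ 2)]
      exact hle k hk ξ ζ)
  refine h.mono (fun k => (hr k).aestronglyMeasurable.mul (hct k)) 1 fun k => ?_
  by_cases hk : k = 0
  · subst hk
    filter_upwards [(quasiMeasurePreserving_tang d).ae hc0] with η hη
    simp [hη]
  · refine Eventually.of_forall fun η => ?_
    have hwp : (w k (tang η) : ℂ) ≠ 0 := by exact_mod_cast (hw0 k hk _).ne'
    rw [one_mul, ← mul_assoc, div_mul_cancel₀ _ hwp]

theorem sqSummable_corrector {F V : L2 T (d + 1)} {G : L2 T d} (hF : F ∈ L2perp T (d + 1))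
    (hV : IsOp invDminus F V)
    (hG : ∀ k, fourierG G k =ᵐ[volume] fun ξ => ∫ ζ : ℝ, fourierG V k (glue ξ ζ))
    (hGt : G ∈ traceSpace T d) : SqSummable volume (corrector F) := by
  obtain ⟨C, hC⟩ := exists_rootPair T d
  have hma : ∀ k, Measurable fun ξ : Space d => Real.sqrt ‖freqA T k ξ‖ := fun k =>
    (measurable_freqA (d := d) T k).norm.sqrt
  have hmb : ∀ k, Measurable fun ξ : Space d => Real.sqrt ‖freqB T k ξ‖ := fun k =>
    (measurable_freqB (d := d) T k).norm.sqrt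
  refine ((sqSummable_coefA hF hV hG hGt).mul_tang_of_sq_norm_le (fun k => ?_) (fun k hk ξ => ?_)
    (aestronglyMeasurable_coefA F) ?_
    (r := fun k η => corrA (freqA T k (tang η)) (freqB T k (tang η)) (zfreq η)) (fun k => ?_)
    (fun k ξ => ‖freqA T k ξ‖) (256 * 28 ^ 3 * 4 * C ^ 2) (fun k hk ξ => (hC k hk ξ).norm_a_pos)
    (fun k hk ξ ζ => ?_)).add
    ((sqSummable_coefB hF hV hG hGt).mul_tang_of_sq_norm_le (fun k => ?_) (fun k hk ξ => ?_)
    (aestronglyMeasurable_coefB F) ?_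
    (r := fun k η => corrB (freqA T k (tang η)) (freqB T k (tang η)) (zfreq η)) (fun k => ?_)
    (fun k ξ => ‖freqB T k ξ‖) (128 * 28 ^ 2 * C) (fun k hk ξ => (hC k hk ξ).norm_b_pos)
    (fun k hk ξ ζ => ?_))
  · have := hma k
    fun_prop
  · have := (hC k hk ξ).norm_a_pos
    have := (hC k hk ξ).norm_b_pos
    positivity
  · filter_upwards [coef_zero hF] with ξ h using h.2
  · unfold corrA
    fun_prop
  · have := (hC k hk ξ).sq_norm_corrA_le (2 * Real.pi * ζ)
    simp only [tang_glue, zfreq_glue]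
    refine this.trans (le_of_eq ?_)
    rw [mul_pow (‖freqB T k ξ‖ ^ 2), mul_pow ‖freqA T k ξ‖, Real.sq_sqrt (norm_nonneg _)]
    ring
  · have := hmb k
    fun_prop
  · have := (hC k hk ξ).norm_b_pos
    positivity
  · filter_upwards [coef_zero hF] with ξ h using h.1
  · unfold corrB
    fun_prop
  · have := (hC k hk ξ).sq_norm_corrB_le (2 * Real.pi * ζ)
    simp only [tang_glue, zfreq_glue]
    refine this.trans (le_of_eq ?_)
    rw [mul_pow (‖freqB T k ξ‖ ^ 2), Real.sq_sqrt (norm_nonneg _)]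
    ring

theorem anticausal_corrector (F : L2 T (d + 1)) {k : ℤ} (hk : k ≠ 0) :
    Anticausal (corrector F k) := by
  obtain ⟨C, hC⟩ := exists_rootPair T d
  refine fun ψ hψ => Eventually.of_forall fun ξ => ?_
  obtain ⟨iA, hA⟩ := (hC k hk ξ).integral_corrA_mul_fourierInv hψ
  obtain ⟨iB, hB⟩ := (hC k hk ξ).integral_corrB_mul_fourierInv hψ
  simp only [corrector, tang_glue, zfreq_glue]
  calc ∫ ζ : ℝ, _ = ∫ ζ : ℝ, (coefA F k ξ * (corrA (freqA T k ξ) (freqB T k ξ) (2 * Real.pi * ζ) *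
          𝓕⁻ ψ ζ) + coefB F k ξ * (corrB (freqA T k ξ) (freqB T k ξ) (2 * Real.pi * ζ) *
          𝓕⁻ ψ ζ)) := integral_congr_ae (Eventually.of_forall fun ζ => by ring)
    _ = 0 := by
      rw [integral_add (iA.const_mul _) (iB.const_mul _), integral_const_mul, integral_const_mul,
        hA, hB, mul_zero, mul_zero, add_zero]

theorem integral_add_mul_add_mul {α : Type*} [MeasurableSpace α] {μ : Measure α} {f g h : α → ℂ}
    (hf : Integrable f μ) (hg : Integrable g μ) (hh : Integrable h μ) (p q : ℂ) :
    Integrable (fun x => f x + (p * g x + q * h x)) μ ∧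
      ∫ x, f x + (p * g x + q * h x) ∂μ =
        ∫ x, f x ∂μ + (p * ∫ x, g x ∂μ + q * ∫ x, h x ∂μ) := by
  have h1 := hg.const_mul p
  have h2 := hh.const_mul q
  have h3 : Integrable (fun x => p * g x + q * h x) μ := h1.add h2
  refine ⟨hf.add h3, ?_⟩
  rw [integral_add hf h3, integral_add h1 h2, integral_const_mul, integral_const_mul]

/-- The coefficients of the correctors are such that both moments of the solution vanish. -/
theorem integral_corrected {F U : L2 T (d + 1)} {k : ℤ} (hk : k ≠ 0)
    (hU : ∀ᵐ η : Space (d + 1), fourierG U k η =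
      (symD T k η)⁻¹ * (fourierG F k η + corrector F k η)) :
    ∀ᵐ ξ : Space d, ∫ ζ : ℝ, fourierG U k (glue ξ ζ) = 0 ∧
      ∫ ζ : ℝ, (zfreq (glue ξ ζ) : ℂ) * fourierG U k (glue ξ ζ) = 0 := by
  obtain ⟨C, hC⟩ := exists_rootPair T d
  filter_upwards [ae_ae_glue hU, ae_integrable_kernel_mul (Lp.memLp (fourierG F k))
    (r := kerD T k) (memLp_kerD hk), ae_integrable_kernel_mul (Lp.memLp (fourierG F k))
    (r := kerS T k) (memLp_kerS hk)] with ξ h1 iD iS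
  have h := hC k hk ξ
  obtain ⟨iA0, mA0⟩ := h.integral_corrA
  obtain ⟨iA1, mA1⟩ := h.integral_sub_mul_corrA
  obtain ⟨iB1, mB1⟩ := h.integral_sub_mul_corrB
  have iB0 := h.integrable_corrB_div
  set a := freqA T k ξ with ha
  set b := freqB T k ξ with hb
  have e0 : ∀ᵐ ζ : ℝ, fourierG U k (glue ξ ζ) = kerD T k (glue ξ ζ) * fourierG F k (glue ξ ζ) +
      (coefA F k ξ * (corrA a b (2 * Real.pi * ζ) / symProd a b (2 * Real.pi * ζ)) +
        coefB F k ξ * (corrB a b (2 * Real.pi * ζ) / symProd a b (2 * Real.pi * ζ))) := by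
    filter_upwards [h1] with ζ hζ
    rw [hζ, symD_eq_symProd hk, kerD, corrector]
    simp only [tang_glue, zfreq_glue, ← ha, ← hb]
    ring
  have e1 : ∀ᵐ ζ : ℝ, ((2 * Real.pi * ζ : ℝ) - Complex.I * a) * fourierG U k (glue ξ ζ) =
      kerS T k (glue ξ ζ) * fourierG F k (glue ξ ζ) +
      (coefA F k ξ * (((2 * Real.pi * ζ : ℝ) - Complex.I * a) *
          (corrA a b (2 * Real.pi * ζ) / symProd a b (2 * Real.pi * ζ))) +
        coefB F k ξ * (((2 * Real.pi * ζ : ℝ) - Complex.I * a) *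
          (corrB a b (2 * Real.pi * ζ) / symProd a b (2 * Real.pi * ζ)))) := by
    filter_upwards [e0] with ζ hζ
    rw [hζ, kerS]
    simp only [tang_glue, zfreq_glue, ← ha]
    ring
  obtain ⟨i0, m0⟩ := integral_add_mul_add_mul iD iA0 iB0 (coefA F k ξ) (coefB F k ξ)
  obtain ⟨i1, m1⟩ := integral_add_mul_add_mul iS iA1 iB1 (coefA F k ξ) (coefB F k ξ)
  have hm0 : ∫ ζ : ℝ, fourierG U k (glue ξ ζ) = 0 := by
    rw [integral_congr_ae e0, m0, mA0, coefA, corrMean]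
    ring
  have hm1 : ∫ ζ : ℝ, ((2 * Real.pi * ζ : ℝ) - Complex.I * a) * fourierG U k (glue ξ ζ) = 0 := by
    rw [integral_congr_ae e1, m1, mA1, mB1, coefB]
    ring
  refine ⟨hm0, ?_⟩
  have j0 : Integrable fun ζ : ℝ => fourierG U k (glue ξ ζ) :=
    i0.congr (e0.mono fun ζ hζ => hζ.symm)
  have j1 : Integrable fun ζ : ℝ =>
      ((2 * Real.pi * ζ : ℝ) - Complex.I * a) * fourierG U k (glue ξ ζ) :=
    i1.congr (e1.mono fun ζ hζ => hζ.symm)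
  calc ∫ ζ : ℝ, (zfreq (glue ξ ζ) : ℂ) * fourierG U k (glue ξ ζ)
      = ∫ ζ : ℝ, (((2 * Real.pi * ζ : ℝ) - Complex.I * a) * fourierG U k (glue ξ ζ) +
          (Complex.I * a) * fourierG U k (glue ξ ζ)) := by
        refine integral_congr_ae (Eventually.of_forall fun ζ => ?_)
        simp only [zfreq_glue]
        ring
    _ = 0 := by
      rw [integral_add j1 (j0.const_mul _), integral_const_mul, hm0, hm1, mul_zero, add_zero]

/-- If the trace of `op[D⁻]⁻¹₊ f` is regular enough, then the Dirichlet problem is solvable: the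
right-hand side is extended in such a way that `op[1/D]` of the extension has vanishing traces. -/
theorem exists_solvesDirichlet {F V : L2 T (d + 1)} {G : L2 T d} (hF : F ∈ L2perp T (d + 1))
    (hV : IsOp invDminus F V)
    (hG : ∀ k, fourierG G k =ᵐ[volume] fun ξ => ∫ ζ : ℝ, fourierG V k (glue ξ ζ))
    (hGt : G ∈ traceSpace T d) :
    ∃ u ∈ solSpace T d, SolvesDirichlet u (restr F) := by
  obtain ⟨C, hC⟩ := exists_weight_le_symD T d
  have hN := sqSummable_corrector hF hV hG hGt
  have hFN := (sqSummable_fourierG F).add hN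
  obtain ⟨F₁, hF₁⟩ := hFN.exists_fourierG T
  have hzero : ∀ᵐ η : Space (d + 1), fourierG F 0 η + corrector F 0 η = 0 := by
    filter_upwards [fourierG_ae_zero hF, corrector_zero hF] with η h1 h2
    rw [h1, h2]; simp
  have hne : ∀ k : ℤ, k ≠ 0 → ∀ η : Space (d + 1), symD T k η ≠ 0 := fun k hk η h0 => by
    have := (hC k hk η).1
    rw [h0, norm_zero, mul_zero] at this
    linarith
  have hbound : ∀ w : ℤ → Space (d + 1) → ℝ, (∀ k, Measurable (w k)) → (∀ k η, 0 ≤ w k η) →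
      (∀ k, k ≠ 0 → ∀ η, w k η ≤ C * ‖symD T k η‖) → SqSummable volume fun k η =>
        (w k η : ℂ) * ((symD T k η)⁻¹ * (fourierG F k η + corrector F k η)) := by
    intro w hwm hw0 hw
    refine hFN.mono (fun k => ?_) C fun k => ?_
    · have h1 := hwm k
      have h2 := (continuous_symD (d := d) T k).measurable
      exact AEStronglyMeasurable.mul (Measurable.aestronglyMeasurable (by fun_prop))
        (AEStronglyMeasurable.mul (Measurable.aestronglyMeasurable (by fun_prop)) (hFN.1 k))
    · by_cases hk : k = 0
      · subst hk
        filter_upwards [hzero] with η h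
        simp [h]
      · refine Eventually.of_forall fun η => ?_
        rw [norm_mul, norm_mul, norm_inv, Complex.norm_real, Real.norm_of_nonneg (hw0 k η),
          ← mul_assoc, ← div_eq_mul_inv]
        refine mul_le_mul_of_nonneg_right ?_ (norm_nonneg _)
        rw [div_le_iff₀ (norm_pos_iff.2 (hne k hk η))]
        exact hw k hk η
  have h1 := hbound (fun _ _ => 1) (fun _ => measurable_const) (fun _ _ => zero_le_one)
    fun k hk η => (hC k hk η).1
  obtain ⟨U, hU⟩ := h1.exists_fourierG T
  have hU' : ∀ k, ∀ᵐ η : Space (d + 1), fourierG U k η =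
      (symD T k η)⁻¹ * (fourierG F k η + corrector F k η) := fun k => by
    filter_upwards [hU k] with η h
    rw [h]; simp
  have hU0 : fourierG U 0 =ᵐ[volume] 0 := by
    filter_upwards [hU' 0, hzero] with η h h'
    rw [h, h']; simp
  have hUperp : U ∈ L2perp T (d + 1) := by
    rw [mem_L2perp_iff]
    exact (Lp.eq_zero_iff_ae_eq_zero).2 hU0
  have hmem : ∀ s r : ℝ, (∀ k, k ≠ 0 → ∀ η : Space (d + 1),
      weight s r (tfreq T k) (xfreq η) ≤ C * ‖symD T k η‖) → U ∈ Hperp T (d + 1) s r := by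
    intro s r hw
    have hwm : ∀ k, Measurable fun η : Space (d + 1) => weight s r (tfreq T k) (xfreq η) := by
      intro k
      have := (continuous_xfreq (n := d + 1)).measurable
      unfold weight
      fun_prop
    refine mem_Hperp_iff.2 ⟨hUperp, (hbound _ hwm (fun k η => by unfold weight; positivity)
      hw).mono (fun k => ?_) 1 fun k => ?_⟩
    · have := hwm k
      exact AEStronglyMeasurable.mul (Measurable.aestronglyMeasurable (by fun_prop))
        (Lp.memLp _).1
    · filter_upwards [hU' k] with η h
      rw [h, one_mul]
  have hU12 := hmem 1 2 fun k hk η => (hC k hk η).2.2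
  have hU04 := hmem 0 4 fun k hk η => (hC k hk η).2.1
  have hz1 : SqSummable volume fun k (η : Space (d + 1)) => (zfreq η : ℂ) * fourierG U k η := by
    simpa only [pow_one] using sqSummable_zfreq_pow hU04 (j := 1) (by norm_num)
  obtain ⟨W, hW, hWd⟩ := exists_normalDeriv hz1
  have hmom : ∀ k, ∀ᵐ ξ : Space d, ∫ ζ : ℝ, fourierG U k (glue ξ ζ) = 0 ∧
      ∫ ζ : ℝ, (zfreq (glue ξ ζ) : ℂ) * fourierG U k (glue ξ ζ) = 0 := by
    intro k
    by_cases hk : k = 0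
    · subst hk
      filter_upwards [ae_ae_glue hU0] with ξ h
      exact ⟨integral_eq_zero_of_ae h, integral_eq_zero_of_ae (by
        filter_upwards [h] with ζ hζ
        rw [hζ]; simp)⟩
    · exact integral_corrected hk (hU' k)
  have hG0 : ∀ k, fourierG (0 : L2 T d) k =ᵐ[volume] 0 := fun k => by
    rw [fourierG_zero]
    exact Lp.coeFn_zero _ _ _
  -- the corrected right-hand side `F₁` is another extension of `f`
  have hrestr : restr F₁ = restr F := by
    rw [← sub_eq_zero, ← restr_sub, restr_eq_zero_iff_anticausal]
    intro k
    have e : corrector F k =ᵐ[volume] fourierG (F₁ - F) k := by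
      rw [fourierG_sub]
      filter_upwards [hF₁ k, Lp.coeFn_sub (fourierG F₁ k) (fourierG F k)] with η h h'
      rw [h', Pi.sub_apply, h, add_sub_cancel_left]
    by_cases hk : k = 0
    · subst hk
      exact anticausal_of_ae_zero (e.symm.trans (corrector_zero hF))
    · exact (anticausal_corrector F hk).congr e
  refine ⟨restr U, ⟨⟨U, hU12, rfl⟩, ⟨U, hU04, rfl⟩⟩, ?_, ?_, restr W, hWd, ?_⟩
  · rw [← hrestr]
    refine weakEq_of_symbol fun k => ?_
    by_cases hk : k = 0
    · subst hk
      filter_upwards [hF₁ 0, hU0, hzero] with η h h' h''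
      rw [h, h', h'']; simp
    · filter_upwards [hF₁ k, hU' k] with η h h'
      rw [h, h', mul_inv_cancel_left₀ (hne k hk η)]
  · refine hasTrace_restr hz1.last_mul fun k => ?_
    filter_upwards [hG0 k, hmom k] with ξ h h'
    rw [h, h'.1]; rfl
  · have hz2 : SqSummable volume fun k (η : Space (d + 1)) => (zfreq η : ℂ) * fourierG W k η := by
      refine (sqSummable_zfreq_pow hU04 (j := 2) (by norm_num)).mono (fun k =>
        (Measurable.aestronglyMeasurable (by fun_prop)).mul (Lp.memLp _).1) 1 fun k => ?_
      filter_upwards [hW k] with η h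
      rw [h, one_mul]
      refine le_of_eq ?_
      simp only [norm_mul, Complex.norm_I, norm_pow]
      ring
    refine hasTrace_restr hz2.last_mul fun k => ?_
    filter_upwards [hG0 k, hmom k, ae_ae_glue (hW k)] with ξ h h' h''
    rw [h, integral_congr_ae h'', integral_const_mul, h'.2, mul_zero]; rfl

end Solution

/-! ### A right-hand side without solution -/

section Indicator

variable {α : Type*} [MeasurableSpace α] {μ : Measure α}

theorem tsum_lintegral_indicator {S : Set α} (hS : MeasurableSet S) (c : ℤ → ℂ) :
    ∑' k, ∫⁻ x, ‖S.indicator (fun _ => c k) x‖ₑ ^ 2 ∂μ = (∑' k, ‖c k‖ₑ ^ 2) * μ S := by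
  rw [← ENNReal.tsum_mul_right]
  refine tsum_congr fun k => ?_
  rw [← setLIntegral_const, ← lintegral_indicator hS]
  refine lintegral_congr fun x => ?_
  by_cases hx : x ∈ S <;> simp [hx]

theorem summable_sq_iff_tsum_enorm (c : ℤ → ℂ) :
    (Summable fun k => ‖c k‖ ^ 2) ↔ ∑' k, ‖c k‖ₑ ^ 2 < ⊤ := by
  have e : ∀ k, ‖c k‖ₑ ^ 2 = ((‖c k‖₊ ^ 2 : NNReal) : ENNReal) := fun k => by
    rw [enorm_eq_nnnorm, ENNReal.coe_pow]
  simp_rw [e]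
  rw [lt_top_iff_ne_top, ENNReal.tsum_coe_ne_top_iff_summable, ← NNReal.summable_coe]
  simp

theorem sqSummable_indicator {S : Set α} (hS : MeasurableSet S) (hS1 : μ S < ⊤) {c : ℤ → ℂ}
    (hc : Summable fun k => ‖c k‖ ^ 2) : SqSummable μ fun k => S.indicator fun _ => c k := by
  refine ⟨fun k => (measurable_const.indicator hS).aestronglyMeasurable, ?_⟩
  rw [tsum_lintegral_indicator hS]
  exact ENNReal.mul_lt_top ((summable_sq_iff_tsum_enorm c).1 hc) hS1

theorem SqSummable.summable_of_indicator {S : Set α} (hS : MeasurableSet S) (hS0 : μ S ≠ 0)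
    {c : ℤ → ℂ} (hc : SqSummable μ fun k => S.indicator fun _ => c k) :
    Summable fun k => ‖c k‖ ^ 2 := by
  rw [summable_sq_iff_tsum_enorm]
  have h := hc.2
  rw [tsum_lintegral_indicator hS] at h
  exact ENNReal.lt_top_of_mul_ne_top_left h.ne hS0

end Indicator

section Counterexample

/-- The frequencies `(ξ', z)` with `|ξ'| < 2π` and `0 ≤ z ≤ 2π`. -/
def lowFreq (d : ℕ) : Set (Space (d + 1)) :=
  {η | tang η ∈ Metric.ball (0 : Space d) 1 ∧ η (Fin.last d) ∈ Set.Icc (0 : ℝ) 1}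

theorem measurableSet_lowFreq (d : ℕ) : MeasurableSet (lowFreq d) :=
  (measurable_tang measurableSet_ball).inter
    ((by fun_prop : Measurable fun η : Space (d + 1) => η (Fin.last d)) measurableSet_Icc)

theorem volume_lowFreq_lt_top (d : ℕ) : volume (lowFreq d) < ⊤ := by
  refine (Metric.isBounded_closedBall (x := (0 : Space (d + 1))) (r := 2)).subset
    (fun η hη => ?_) |>.measure_lt_top
  obtain ⟨h1, h2, h3⟩ := hη
  rw [mem_ball_zero_iff] at h1
  rw [mem_closedBall_zero_iff]
  have := norm_tang_sq η
  nlinarith [norm_nonneg η, norm_nonneg (tang η)]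

theorem integral_indicator_lowFreq {d : ℕ} (c : ℂ) (ξ : Space d) :
    ∫ ζ : ℝ, (lowFreq d).indicator (fun _ => c) (glue ξ ζ) =
      (Metric.ball (0 : Space d) 1).indicator (fun _ => c) ξ := by
  by_cases hξ : ξ ∈ Metric.ball (0 : Space d) 1
  · have e : (fun ζ : ℝ => (lowFreq d).indicator (fun _ => c) (glue ξ ζ)) =
        (Set.Icc (0 : ℝ) 1).indicator fun _ => c := by
      funext ζ
      have : glue ξ ζ ∈ lowFreq d ↔ ζ ∈ Set.Icc (0 : ℝ) 1 := by
        simp only [lowFreq, Set.mem_ofPred_eq, tang_glue, glue_last, hξ, true_and]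
      by_cases hζ : ζ ∈ Set.Icc (0 : ℝ) 1
      · rw [Set.indicator_of_mem hζ, Set.indicator_of_mem (this.2 hζ)]
      · rw [Set.indicator_of_notMem hζ, Set.indicator_of_notMem (mt this.1 hζ)]
    rw [e, integral_indicator measurableSet_Icc, Set.indicator_of_mem hξ]
    simp
  · rw [Set.indicator_of_notMem hξ]
    refine integral_eq_zero_of_ae (Eventually.of_forall fun ζ => ?_)
    refine Set.indicator_of_notMem (fun h => hξ ?_) _
    simpa only [tang_glue] using h.1

variable {T : ℝ} [hT : Fact (0 < T)] {d : ℕ}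

theorem abs_tfreq (k : ℤ) : |tfreq T k| = 2 * Real.pi / T * |(k : ℝ)| := by
  have := hT.out
  rw [tfreq, abs_div, abs_mul, abs_of_pos this, abs_of_pos (by positivity : 0 < 2 * Real.pi)]
  ring

variable (T d) in
/-- On bounded space frequencies `D⁻` grows like `|τ|^{1/2}`, since only one of its two roots is
unbounded. -/
theorem exists_norm_Dminus_le : ∃ K : ℝ, 0 ≤ K ∧ ∀ k : ℤ, k ≠ 0 → ∀ η ∈ lowFreq d,
    invDminus (tfreq T k) (xfreq η) ≠ 0 ∧
      ‖(invDminus (tfreq T k) (xfreq η))⁻¹‖ ≤ K * |(k : ℝ)| ^ (1 / 2 : ℝ) := by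
  obtain ⟨C, hC1, hC⟩ := exists_freq_bounds T d
  have hT0 := hT.out
  set P := (2 * Real.pi) ^ 2 with hP
  have hP0 : 0 ≤ P := by positivity
  set K₂ := (2 * (P + C * (1 + P))) * (2 * (P + C * (2 * Real.pi / T + P))) with hK
  have hτ0 : 0 ≤ 2 * Real.pi / T := by positivity
  have hK0 : 0 ≤ K₂ := by positivity
  refine ⟨Real.sqrt K₂, Real.sqrt_nonneg _, fun k hk η hη => ?_⟩
  obtain ⟨h1, h2, h3⟩ := hη
  rw [mem_ball_zero_iff] at h1
  obtain ⟨-, -, b1, -, b3⟩ := hC k hk (tang η)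
  have hk1 : (1 : ℝ) ≤ |(k : ℝ)| := by exact_mod_cast Int.one_le_abs hk
  have hx : ‖xfreq (tang η)‖ ^ 2 ≤ P := by
    rw [xfreq, norm_smul, Real.norm_of_nonneg (by positivity), mul_pow]
    exact mul_le_of_le_one_right hP0 (pow_le_one₀ (norm_nonneg _) h1.le)
  have hz : zfreq η ^ 2 ≤ P := by
    rw [zfreq, mul_pow]
    exact mul_le_of_le_one_right hP0 (pow_le_one₀ h2 h3)
  have e1 : ‖(zfreq η : ℂ) + Complex.I * freqA T k (tang η)‖ ^ 2 ≤ 2 * (P + C * (1 + P)) :=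
    (norm_add_I_mul_le _ _).trans (by nlinarith)
  have e2 : ‖(zfreq η : ℂ) + Complex.I * freqB T k (tang η)‖ ^ 2 ≤
      2 * (P + C * (2 * Real.pi / T + P)) * |(k : ℝ)| := by
    refine (norm_add_I_mul_le _ _).trans ?_
    rw [abs_tfreq] at b1
    have : ‖freqB T k (tang η)‖ ^ 2 ≤ C * (2 * Real.pi / T + P) * |(k : ℝ)| := by
      refine b1.trans ?_
      rw [mul_assoc]
      refine mul_le_mul_of_nonneg_left ?_ (by linarith)
      nlinarith
    nlinarith
  rw [invDminus_eq hk]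
  refine ⟨mul_ne_zero (inv_ne_zero (zfreq_add_ne_zero (freqA_spec T hk _).1 _))
    (inv_ne_zero (zfreq_add_ne_zero (freqB_spec T hk _).1 _)), ?_⟩
  rw [mul_inv, inv_inv, inv_inv, norm_mul, ← Real.sqrt_eq_rpow, ← Real.sqrt_mul hK0]
  refine Real.le_sqrt_of_sq_le ?_
  rw [mul_pow, hK, mul_assoc]
  exact mul_le_mul e1 e2 (by positivity) (by positivity)

variable (T d) in
/-- There is `f` whose trace of `op[D⁻]⁻¹₊ f` is concentrated on bounded frequencies `ξ'`, with
Fourier coefficients `|k|^{-5/4}` in time. These are not square summable with the weight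
`|k|^{3/4}`, whereas those of `f` are of size `|k|^{-3/4}` only. -/
theorem exists_trace_eq_rpow : ∃ F V : L2 T (d + 1), F ∈ L2perp T (d + 1) ∧ IsOp invDminus F V ∧
    ∀ k, ∀ᵐ ξ : Space d, ∫ ζ : ℝ, fourierG V k (glue ξ ζ) =
      (Metric.ball (0 : Space d) 1).indicator
        (fun _ => ((|(k : ℝ)| ^ (-(5 / 4) : ℝ) : ℝ) : ℂ)) ξ := by
  obtain ⟨K, hK0, hK⟩ := exists_norm_Dminus_le T d
  have hs : SqSummable volume fun k : ℤ =>
      (lowFreq d).indicator fun _ => ((|(k : ℝ)| ^ (-(3 / 4) : ℝ) : ℝ) : ℂ) := by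
    refine sqSummable_indicator (measurableSet_lowFreq d) (volume_lowFreq_lt_top d) ?_
    refine (Real.summable_abs_int_rpow (b := 3 / 2) (by norm_num)).congr fun k => ?_
    rw [Complex.norm_real, Real.norm_of_nonneg (by positivity), ← Real.rpow_natCast,
      ← Real.rpow_mul (abs_nonneg _)]
    norm_num
  -- `F̂ = D⁻ |k|^{-5/4}` on the bounded frequencies; `0 ^ (-5/4) = 0` for real powers, so that the
  -- coefficients at `k = 0` vanish
  have hmono := hs.mono (g := fun k η => (invDminus (tfreq T k) (xfreq η))⁻¹ *
    (lowFreq d).indicator (fun _ => ((|(k : ℝ)| ^ (-(5 / 4) : ℝ) : ℝ) : ℂ)) η) (fun k => by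
      by_cases hk : k = 0
      · subst hk
        have : (fun η : Space (d + 1) => (invDminus (tfreq T 0) (xfreq η))⁻¹ *
            (lowFreq d).indicator (fun _ => (((|((0 : ℤ) : ℝ)| ^ (-(5 / 4) : ℝ) : ℝ)) : ℂ)) η) =
            fun _ => 0 := by
          funext η
          rw [Int.cast_zero, abs_zero, Real.zero_rpow (by norm_num)]
          simp
        rw [this]
        exact aestronglyMeasurable_const
      · exact ((measurable_invDminus k hk).inv.mul
          (measurable_const.indicator (measurableSet_lowFreq d))).aestronglyMeasurable) K
    (fun k => Eventually.of_forall fun η => by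
      by_cases hη : η ∈ lowFreq d
      · rw [Set.indicator_of_mem hη, Set.indicator_of_mem hη]
        by_cases hk : k = 0
        · subst hk
          rw [Int.cast_zero, abs_zero, Real.zero_rpow (by norm_num), Real.zero_rpow (by norm_num)]
          simp
        · have hk0 : 0 < |(k : ℝ)| := by positivity
          rw [norm_mul, Complex.norm_real, Complex.norm_real, Real.norm_of_nonneg (by positivity),
            Real.norm_of_nonneg (by positivity)]
          calc _ ≤ K * |(k : ℝ)| ^ (1 / 2 : ℝ) * |(k : ℝ)| ^ (-(5 / 4) : ℝ) := by
                gcongr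
                exact (hK k hk η hη).2
            _ = _ := by
              rw [mul_assoc, ← Real.rpow_add hk0]
              norm_num
      · rw [Set.indicator_of_notMem hη, Set.indicator_of_notMem hη]
        simp)
  obtain ⟨F, hF⟩ := hmono.exists_fourierG T
  have hperp : F ∈ L2perp T (d + 1) := by
    rw [mem_L2perp_iff, Lp.eq_zero_iff_ae_eq_zero]
    filter_upwards [hF 0] with η h
    rw [h, Int.cast_zero, abs_zero, Real.zero_rpow (by norm_num)]
    simp
  obtain ⟨V, hV⟩ := exists_isOp_invDminus hperp
  refine ⟨F, V, hperp, hV, fun k => ?_⟩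
  have hVk : ∀ᵐ η : Space (d + 1), fourierG V k η =
      (lowFreq d).indicator (fun _ => ((|(k : ℝ)| ^ (-(5 / 4) : ℝ) : ℝ) : ℂ)) η := by
    filter_upwards [hV k, hF k] with η h1 h2
    rw [h1, h2]
    by_cases hk : k = 0
    · subst hk
      rw [Int.cast_zero, abs_zero, Real.zero_rpow (by norm_num)]
      simp
    · by_cases hη : η ∈ lowFreq d
      · rw [mul_inv_cancel_left₀ (hK k hk η hη).1]
      · rw [Set.indicator_of_notMem hη]
        simp
  filter_upwards [ae_ae_glue hVk] with ξ h
  rw [integral_congr_ae h, integral_indicator_lowFreq]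

/-- With the weight `|k|^{3/4}` the coefficients `|k|^{-5/4}` become `|k|^{-1/2}`, and the harmonic
series diverges. -/
theorem not_mem_traceSpace_of_eq_rpow {G : L2 T d}
    (hG : ∀ k, fourierG G k =ᵐ[volume] (Metric.ball (0 : Space d) 1).indicator
        (fun _ => ((|(k : ℝ)| ^ (-(5 / 4) : ℝ) : ℝ) : ℂ))) : G ∉ traceSpace T d := by
  intro hmem
  have hT0 := hT.out
  have h1 := (mem_Hperp_iff.1 hmem.1).2
  have hτ : 0 < 2 * Real.pi / T := by positivity
  have h2 : SqSummable volume fun k : ℤ => (Metric.ball (0 : Space d) 1).indicator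
      fun _ => ((|(k : ℝ)| ^ (-(1 / 2) : ℝ) : ℝ) : ℂ) := by
    refine h1.mono (fun k => (measurable_const.indicator measurableSet_ball).aestronglyMeasurable)
      ((2 * Real.pi / T) ^ (-(3 / 4) : ℝ)) fun k => ?_
    filter_upwards [hG k] with ξ h
    rw [h]
    by_cases hξ : ξ ∈ Metric.ball (0 : Space d) 1
    · rw [Set.indicator_of_mem hξ, Set.indicator_of_mem hξ]
      by_cases hk : k = 0
      · subst hk
        rw [Int.cast_zero, abs_zero, Real.zero_rpow (by norm_num)]
        simp only [Complex.ofReal_zero, norm_zero]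
        positivity
      · have hk0 : 0 < |(k : ℝ)| := by positivity
        have hw : weight (3 / 4) 0 (tfreq T k) (xfreq ξ) =
            (1 + tfreq T k ^ 2) ^ ((3 / 4 : ℝ) / 2) := by
          rw [weight, zero_div, Real.rpow_zero, mul_one]
        have hle : (2 * Real.pi / T * |(k : ℝ)|) ^ (3 / 4 : ℝ) ≤
            (1 + tfreq T k ^ 2) ^ ((3 / 4 : ℝ) / 2) := by
          rw [← abs_tfreq]
          calc |tfreq T k| ^ (3 / 4 : ℝ) = (|tfreq T k| ^ 2) ^ ((3 / 4 : ℝ) / 2) := by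
                rw [← Real.rpow_natCast, ← Real.rpow_mul (abs_nonneg _)]
                norm_num
            _ ≤ _ := by
              rw [sq_abs]
              exact Real.rpow_le_rpow (by positivity) (by linarith) (by norm_num)
        rw [hw, norm_mul, Complex.norm_real, Complex.norm_real, Complex.norm_real,
          Real.norm_of_nonneg (by positivity), Real.norm_of_nonneg (by positivity),
          Real.norm_of_nonneg (by positivity)]
        calc |(k : ℝ)| ^ (-(1 / 2) : ℝ) = (2 * Real.pi / T) ^ (-(3 / 4) : ℝ) *
              ((2 * Real.pi / T * |(k : ℝ)|) ^ (3 / 4 : ℝ) * |(k : ℝ)| ^ (-(5 / 4) : ℝ)) := by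
              rw [Real.mul_rpow hτ.le hk0.le, mul_assoc, ← Real.rpow_add hk0, ← mul_assoc,
                ← Real.rpow_add hτ]
              norm_num
          _ ≤ _ := by gcongr
    · rw [Set.indicator_of_notMem hξ, Set.indicator_of_notMem hξ]
      simp
  have h3 := h2.summable_of_indicator measurableSet_ball
    (Metric.measure_ball_pos volume (0 : Space d) one_pos).ne'
  refine Real.not_summable_natCast_inv
    ((h3.comp_injective Nat.cast_injective).congr fun n => ?_)
  simp only [Function.comp]
  rw [Complex.norm_real, Real.norm_of_nonneg (by positivity), ← Real.rpow_natCast,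
    ← Real.rpow_mul (abs_nonneg _), Int.cast_natCast, abs_of_nonneg (Nat.cast_nonneg n),
    ← Real.rpow_neg_one]
  norm_num

end Counterexample

end CHG

end

theorem theorem1p2 (T : ℝ) [hT : Fact (0 < T)] (d : ℕ) :
    (∀ f ∈ CHG.L2perpPlus T d,
      ∃ (v : CHG.L2plus T d) (g : CHG.L2 T d),
        (∀ w : CHG.L2plus T d, CHG.IsOpPlus CHG.invDminus f w ↔ w = v) ∧
        (∀ h : CHG.L2 T d, CHG.HasTrace v h ↔ h = g) ∧
        ((∃ u ∈ CHG.solSpace T d, CHG.SolvesDirichlet u f) ↔ g ∈ CHG.traceSpace T d)) ∧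
    (∃ f ∈ CHG.L2perpPlus T d, ¬ ∃ u ∈ CHG.solSpace T d, CHG.SolvesDirichlet u f) ∧
    CHG.LopatinskiiShapiro (d := d) CHG.dirichletSymbol := by
  refine ⟨?_, ?_, CHG.lopatinskiiShapiro_dirichletSymbol⟩
  · rintro f ⟨F, hF, rfl⟩
    obtain ⟨V, hV⟩ := CHG.exists_isOp_invDminus hF
    obtain ⟨G, hG, hVG⟩ := CHG.exists_trace_transform hF hV
    refine ⟨CHG.restr V, G, fun w => ⟨?_, ?_⟩, fun h => ⟨fun hh => hh.unique hVG, ?_⟩, ?_, ?_⟩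
    · rintro ⟨F', V', hF', hFF', hV', rfl⟩
      exact CHG.restr_eq_of_isOp hF hF' hV hV' hFF'
    · rintro rfl
      exact ⟨F, V, hF, rfl, hV, rfl⟩
    · rintro rfl
      exact hVG
    · rintro ⟨u, hu, hs⟩
      exact CHG.mem_traceSpace_of_solvesDirichlet hF hV hG hu hs
    · exact CHG.exists_solvesDirichlet hF hV hG
  · obtain ⟨F, V, hF, hV, htr⟩ := CHG.exists_trace_eq_rpow T d
    obtain ⟨G, hG, -⟩ := CHG.exists_trace_transform hF hV
    refine ⟨CHG.restr F, ⟨F, hF, rfl⟩, ?_⟩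
    rintro ⟨u, hu, hs⟩
    exact CHG.not_mem_traceSpace_of_eq_rpow (fun k => (hG k).trans (htr k))
      (CHG.mem_traceSpace_of_solvesDirichlet hF hV hG hu hs)
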